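/- Let $M>1$ be an integer and let $\Omega_M$ be the hierarchical group of order $M$: the sequences $x=(x_1,x_2,\dots)$ with $x_i\in\{0,\dots,M-1\}$ and only finitely many nonzero entries, with componentwise addition mod $M$ and the distance $|x-y|=\max\{i:x_i\ne y_i\}$ ($0$ if $x=y$). For $0<c<M$ the $c$-random walk is the continuous time random walk on $\Omega_M$ with jump rate $1$ whose jumps have length $j\ge1$ with probability $r_j=(1-\frac cM)(\frac cM)^{j-1}$ and, given the length $j$, lead to a uniformly chosen point at distance $j$ from the current position. Put $$a=\frac cM,\qquad b=\frac{M^2-c}{M(M-1)},\qquad \gamma=\frac{\log c}{\log(M/c)} .$$ For $H\in(\frac12,1)$, oscillatory sub-fractional Brownian motion (osfBm) with parameter $H$ is the continuous centered Gaussian process $\zeta^H=(\zeta^H_t)_{t\ge0}$ with covariance $$E\zeta^H_s\zeta^H_t=s^{2H}h_s+t^{2H}h_t-\tfrac12\left[(s+t)^{2H}h_{s+t}+|s-t|^{2H}h_{|s-t|}\right],$$ $$h_t=\sum_{j\in\mathbb Z}(ba^jt)^{-2H}\left(e^{-ba^jt}-1+ba^jt\right)\ \ (t>0),\qquad h_0=0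 .$$ Consider a Poisson system of $c$-random walks with critical binary branching at rate $V>0$: at time $0$ the numbers of particles at the points of $\Omega_M$ are independent Poisson variables with parameter $\lambda>0$; all particles move and branch independently of each other and of the initial configuration; a particle moves as a $c$-random walk during an exponentially distributed lifetime with parameter $V$, and at its death it is replaced, at the place of its death, by $0$ or $2$ particles with probability $\frac12$ each. Let $N_t(A)$ be the number of particles in $A\subset\Omega_M$ at time $t$, and for $\varphi:\Omega_M\to\mathbb R$ with bounded support let $\langle N_t,\varphi\rangle=\sum_x\varphi(x)N_t(\{x\})$ and $$\langle X_T(t),\varphi\rangle=\frac1{F_T}\int_0^{Tt}\left(\langle N_r,\varphi\rangle-E\langle N_r,\varphi\rangle\right)dr,\qquad t\ge0 .$$ Theorem. Assume $1<c<\sqrt M$, so that $0<\gamma<1$, and let $F_T=T^{(2-\gamma)/2}$, $T_n=a^{-n}$ and $H=\frac{2-\gamma}2\in(\frac12,1)$. Then osfBm with parameter $H$ exists, the variables and integrals in the definition of $X_T$ are well defined (for every $t\ge 0$, almost surely $N_t(\{x\})<\infty$ for all $x$; $\langle N_t,\varphi\rangle$ is integrable for every $t\ge0$; almost surely $r\mapsto\langle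 N_r,\varphi\rangle$ is integrable on bounded intervals), and for every $\varphi:\Omega_M\to\mathbb R$ with bounded support and every $\tau>0$, the processes $\langle X_{T_n},\varphi\rangle$ converge weakly in $C([0,\tau])$, as $n\to\infty$, to $$K\,\zeta^H\sum_{x\in\Omega_M}\varphi(x),\qquad K=\left(\frac{\lambda V(M-1)}{M\,b^{1+\gamma}}\right)^{1/2}>0 .$$ -/

import Mathlib

open MeasureTheory ProbabilityTheory Filter Topology
open scoped NNReal ENNReal

noncomputable section

namespace HierBranching

/-! ### The hierarchical group and the `c`-random walk -/

/-- The hierarchical group `Ω_M`: finitely supported sequences with entries in `ℤ/M`, added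
componentwise. The coordinate `x i` of the Lean object is the coordinate `x_{i+1}` of the usual
notation `x = (x₁, x₂, …)`. -/
abbrev HierGroup (M : ℕ) : Type := ℕ →₀ ZMod M

/-- The group is countable and discrete: every subset is measurable. -/
instance instMeasurableSpaceHierGroup (M : ℕ) : MeasurableSpace (HierGroup M) := ⊤

/-- The hierarchical distance `|x - y| = max {i ≥ 1 : x_i ≠ y_i}`, and `0` if `x = y`
(coordinates are numbered from `1` here, hence the shift). -/
def hdist {M : ℕ} (x y : HierGroup M) : ℕ := (x - y).support.sup (fun i => i + 1)

/-- `φ` belongs to `B_b`: it has bounded support. -/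
def HasBoundedSupport {M : ℕ} (φ : HierGroup M → ℝ) : Prop :=
  ∃ R : ℕ, ∀ x, φ x ≠ 0 → hdist x 0 ≤ R

/-- `r_j = (1 - c/M) (c/M)^(j-1)`, `j ≥ 1`: the probability that a jump has length `j`. -/
def jumpLengthProb (M : ℕ) (c : ℝ) (j : ℕ) : ℝ :=
  if j = 0 then 0 else (1 - c / M) * (c / M) ^ (j - 1)

/-- One-step transition probability from `0` to `y`: choose a distance `j` with probability `r_j`,
then a point uniformly among those at distance `j`. -/
def stepProb (M : ℕ) (c : ℝ) (y : HierGroup M) : ℝ :=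
  jumpLengthProb M c (hdist 0 y) / ({z : HierGroup M | hdist 0 z = hdist 0 y}.ncard : ℝ)

/-- The `n`-step transition probability `p^(n)(0, y)` of the discrete time walk. -/
def nStepProb (M : ℕ) (c : ℝ) : ℕ → HierGroup M → ℝ
  | 0, y => if y = 0 then 1 else 0
  | n + 1, y => ∑' z : HierGroup M, nStepProb M c n z * stepProb M c (y - z)

/-- `p_t(0, y) = e^{-t} ∑ₙ tⁿ/n! p^(n)(0, y)`: transition probability of the continuous time
`c`-random walk with jump rate `1`. -/
def transProb (M : ℕ) (c : ℝ) (t : ℝ) (y : HierGroup M) : ℝ :=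
  Real.exp (-t) * ∑' n : ℕ, t ^ n / (n.factorial : ℝ) * nStepProb M c n y

/-- `Z` is a (continuous time) `c`-random walk started at `0`: its paths are right-continuous with
left limits in the discrete space `Ω_M`, its increments are independent, and
`P(Z_t - Z_s = y) = p_{t-s}(0, y)`. -/
structure IsCRandomWalk (M : ℕ) (c : ℝ) {Ω : Type*} [MeasurableSpace Ω]
    (Z : ℝ≥0 → Ω → HierGroup M) (P : Measure Ω) : Prop where
  measurable_eval : ∀ t, Measurable (Z t)
  start : ∀ ω, Z 0 ω = 0
  right_cont : ∀ ω t, ∀ᶠ s in 𝓝[>] t, Z s ω = Z t ω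
  left_lim : ∀ ω t, ∃ x, ∀ᶠ s in 𝓝[<] t, Z s ω = x
  indep_incr : HasIndepIncrements Z P
  law_incr : ∀ s t : ℝ≥0, s ≤ t → ∀ y : HierGroup M,
    P.real {ω | Z t ω - Z s ω = y} = transProb M c ((t : ℝ) - s) y

/-! ### The branching system -/

/-- Labels of particles. `(x, i, u)` is the descendant with address `u` of the `i`-th initial
particle at the site `x`. The root has the empty address, and the two possible children of `u` are
`false :: u` and `true :: u`. -/
abbrev Particle (M : ℕ) : Type := HierGroup M × ℕ × List Bool

/-- The independent sources of randomness: the number of initial particles at each site and, for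
each particle label, a lifetime, a branching decision and a motion. -/
inductive Source (M : ℕ) : Type
  | init (x : HierGroup M)
  | life (p : Particle M)
  | split (p : Particle M)
  | walk (p : Particle M)

/-- The `σ`-algebra generated by each source of randomness. -/
@[reducible] def sourceSigma {M : ℕ} {Ω : Type*} (theta : HierGroup M → Ω → ℕ) (life : Particle M → Ω → ℝ)
    (split : Particle M → Ω → Bool) (walk : Particle M → ℝ≥0 → Ω → HierGroup M) :
    Source M → MeasurableSpace Ω
  | .init x => MeasurableSpace.comap (theta x) inferInstance
  | .life p => MeasurableSpace.comap (life p) inferInstance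
  | .split p => MeasurableSpace.comap (split p) inferInstance
  | .walk p => ⨆ t : ℝ≥0, MeasurableSpace.comap (walk p t) inferInstance

/-- A Poisson system of `c`-random walks with critical binary branching at rate `V`, realized on
the probability space `(Ω, P)`: `theta x` is the Poisson (parameter `lam`) number of initial
particles at `x`. Each particle lives for an exponential time with parameter `V`, moves
during its life as a `c`-random walk, and at its death is replaced by two particles
(`split = true`) or by none (`split = false`), with probability `1/2` each. All these random
elements are independent. -/
structure PoissonBranchingSystem (M : ℕ) (c V : ℝ) (lam : ℝ≥0) {Ω : Type*} [MeasurableSpace Ω]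
    (P : Measure Ω) where
  theta : HierGroup M → Ω → ℕ
  life : Particle M → Ω → ℝ
  split : Particle M → Ω → Bool
  walk : Particle M → ℝ≥0 → Ω → HierGroup M
  measurable_theta : ∀ x, Measurable (theta x)
  measurable_life : ∀ p, Measurable (life p)
  measurable_split : ∀ p, Measurable (split p)
  theta_law : ∀ x, P.map (theta x) = poissonMeasure lam
  life_law : ∀ p, P.map (life p) = expMeasure V
  split_law : ∀ p, P {ω | split p ω = true} = 1 / 2
  walk_law : ∀ p, IsCRandomWalk M c (walk p) P
  indep : iIndep (sourceSigma theta life split walk) P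

namespace PoissonBranchingSystem

variable {M : ℕ} {c V : ℝ} {lam : ℝ≥0} {Ω : Type*} [MeasurableSpace Ω] {P : Measure Ω}

/-- The particle `(x, i, u)` is born at some time: its root is one of the `theta x` initial
particles at `x`, and all its strict ancestors split. -/
def Exists (S : PoissonBranchingSystem M c V lam P) (ω : Ω) (x : HierGroup M) (i : ℕ) :
    List Bool → Prop
  | [] => i < S.theta x ω
  | _ :: u => S.Exists ω x i u ∧ S.split (x, i, u) ω = true

/-- Birth time: the sum of the lifetimes of the strict ancestors. -/
def birthTime (S : PoissonBranchingSystem M c V lam P) (ω : Ω) (x : HierGroup M) (i : ℕ) :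
    List Bool → ℝ
  | [] => 0
  | _ :: u => S.birthTime ω x i u + S.life (x, i, u) ω

/-- Birth place: the site where the parent died (the initial site for a root). -/
def birthPlace (S : PoissonBranchingSystem M c V lam P) (ω : Ω) (x : HierGroup M) (i : ℕ) :
    List Bool → HierGroup M
  | [] => x
  | _ :: u => S.birthPlace ω x i u + S.walk (x, i, u) (S.life (x, i, u) ω).toNNReal ω

/-- The particle `p` is alive at time `t`. -/
def Alive (S : PoissonBranchingSystem M c V lam P) (ω : Ω) (t : ℝ) (p : Particle M) : Prop :=
  S.Exists ω p.1 p.2.1 p.2.2 ∧ S.birthTime ω p.1 p.2.1 p.2.2 ≤ t ∧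
    t < S.birthTime ω p.1 p.2.1 p.2.2 + S.life p ω

/-- The position at time `t` of a particle which is alive at time `t`. -/
def position (S : PoissonBranchingSystem M c V lam P) (ω : Ω) (t : ℝ) (p : Particle M) :
    HierGroup M :=
  S.birthPlace ω p.1 p.2.1 p.2.2 +
    S.walk p (t - S.birthTime ω p.1 p.2.1 p.2.2).toNNReal ω

/-- The empirical measure: `N_t(A)` is the number of particles in the set `A` at time `t`. -/
def N (S : PoissonBranchingSystem M c V lam P) (t : ℝ) (ω : Ω) (A : Set (HierGroup M)) : ℕ∞ :=
  {p : Particle M | S.Alive ω t p ∧ S.position ω t p ∈ A}.encard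

/-- `⟨N_t, φ⟩ = ∑ₓ φ(x) N_t({x})`. -/
def pairing (S : PoissonBranchingSystem M c V lam P) (φ : HierGroup M → ℝ) (t : ℝ) (ω : Ω) : ℝ :=
  ∑' x : HierGroup M, φ x * ((S.N t ω {x}).toNat : ℝ)

/-- The occupation time fluctuation `⟨X_T(t), φ⟩ = F⁻¹ ∫₀^{Tt} (⟨N_r, φ⟩ - E⟨N_r, φ⟩) dr` with
norming `F`. -/
def fluctuation (S : PoissonBranchingSystem M c V lam P) (F T : ℝ) (φ : HierGroup M → ℝ)
    (t : ℝ) (ω : Ω) : ℝ :=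
  (1 / F) * ∫ r in (0 : ℝ)..(T * t), (S.pairing φ r ω - ∫ ω', S.pairing φ r ω' ∂P)

end PoissonBranchingSystem

/-! ### Oscillatory sub-fractional Brownian motion -/

/-- The degree `γ = log c / log (M / c)` of the `c`-random walk. -/
def degree (M : ℕ) (c : ℝ) : ℝ := Real.log c / Real.log (M / c)

/-- `a = c / M`. -/
def aConst (M : ℕ) (c : ℝ) : ℝ := c / M

/-- `b = (M² - c) / (M (M - 1))`. -/
def bConst (M : ℕ) (c : ℝ) : ℝ := ((M : ℝ) ^ 2 - c) / (M * (M - 1))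

/-- The parameter `H = (2 - γ) / 2`. -/
def hurst (M : ℕ) (c : ℝ) : ℝ := (2 - degree M c) / 2

/-- The times `T_n = a^{-n}`. -/
def timeSeq (M : ℕ) (c : ℝ) (n : ℕ) : ℝ := (aConst M c ^ n)⁻¹

/-- The norming `F_T = T^{(2 - γ) / 2}`. -/
def norming (M : ℕ) (c T : ℝ) : ℝ := T ^ ((2 - degree M c) / 2)

/-- `h_t = ∑_{j ∈ ℤ} (b a^j t)^{-2H} (e^{-b a^j t} - 1 + b a^j t)` for `t > 0`, and `h_0 = 0`. -/
def hOsc (a b H t : ℝ) : ℝ :=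
  if 0 < t then
    ∑' j : ℤ, (b * a ^ j * t) ^ (-(2 * H)) *
      (Real.exp (-(b * a ^ j * t)) - 1 + b * a ^ j * t)
  else 0

/-- The covariance function of oscillatory sub-fractional Brownian motion. -/
def osfBmCov (a b H s t : ℝ) : ℝ :=
  s ^ (2 * H) * hOsc a b H s + t ^ (2 * H) * hOsc a b H t -
    (1 / 2) * ((s + t) ^ (2 * H) * hOsc a b H (s + t) +
      |s - t| ^ (2 * H) * hOsc a b H |s - t|)

/-- `ζ` is an oscillatory sub-fractional Brownian motion with parameter `H` (and constants
`a`, `b`): a centered Gaussian family indexed by `[0, ∞)` with covariance `osfBmCov`. -/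
structure IsOsfBm (a b H : ℝ) {Ω : Type*} [MeasurableSpace Ω] (ζ : ℝ≥0 → Ω → ℝ)
    (P : Measure Ω) : Prop where
  gaussian : IsGaussianProcess ζ P
  centered : ∀ t, ∫ ω, ζ t ω ∂P = 0
  covariance : ∀ s t : ℝ≥0, cov[ζ s, ζ t; P] = osfBmCov a b H s t

/-! ### The space `C([0, τ])` -/

/-- `C([0, τ])` has the topology of uniform convergence and carries its Borel `σ`-algebra. -/
instance instMeasurableSpacePath (τ : ℝ) : MeasurableSpace C(Set.Icc (0 : ℝ) τ, ℝ) := borel _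

instance instBorelSpacePath (τ : ℝ) : BorelSpace C(Set.Icc (0 : ℝ) τ, ℝ) := ⟨rfl⟩

/-- The restriction to `[0, τ]` of a continuous function on `[0, ∞)`. -/
def restrictPath (f : ℝ≥0 → ℝ) (hf : Continuous f) (τ : ℝ) : C(Set.Icc (0 : ℝ) τ, ℝ) where
  toFun t := f ⟨(t : ℝ), t.2.1⟩
  continuous_toFun := hf.comp (continuous_subtype_val.subtype_mk _)

/-- The constant `K = (lam V (M - 1) / (M b^{1+γ}))^{1/2}`. -/
def KConst (M : ℕ) (c V : ℝ) (lam : ℝ≥0) : ℝ :=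
  Real.sqrt (lam * V * (M - 1) / (M * bConst M c ^ (1 + degree M c)))

end HierBranching

end

set_option linter.unusedSectionVars false

noncomputable section

namespace HierBranching

open scoped Complex Real
open Complex (I)
open ENNReal (add_ne_top coe_ne_top mul_ne_top ne_top_of_tsum_ne_top ofReal ofReal_add
  ofReal_le_ofReal ofReal_mul ofReal_ne_top ofReal_of_nonpos ofReal_one ofReal_pos ofReal_pow
  ofReal_tsum_of_nonneg one_le_ofReal one_ne_top sum_le_tsum sum_ne_top summable toReal_add
  toReal_mono toReal_mul toReal_nonneg toReal_ofReal toReal_ofReal' toReal_pow toReal_sum tsum_add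
  tsum_comm tsum_le_tsum tsum_prod' zero_ne_top)
open Set (Icc Ici Iic Iio Ioc Ioi Ioo disjoint_left indicator indicator_of_mem inter_comm mem_Iic
  mem_Ioi mem_iUnion)
open Finset (induction_on le_sup mem_range mul_sum prod_insert range range_one sum_add_distrib
  sum_coe_sort sum_congr sum_const sum_div sum_insert sum_le_sum sum_mul sum_mul_sum sum_nonneg
  sum_singleton sum_sub_distrib univ)
open Real (add_one_le_exp coe_toNNReal exp_add exp_le_one_iff exp_pos exp_zero log mul_rpow
  norm_of_nonneg rpow_add rpow_mul rpow_natCast rpow_neg rpow_one rpow_sub rpow_two sin sqrt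
  toNNReal)
open Complex (exp_bound exp_sum norm_exp norm_exp_I_mul_ofReal norm_real ofReal_neg ofReal_re)
open Nat (floor_le le_succ)
open NNReal (coe_le_coe)

/-! ### Spectral decomposition of the walk on the hierarchical group -/

section Walk

variable {M : ℕ}

/-! The system is a Poisson cloud of independent families, so the centered occupation time is a sum
of many small independent contributions. The theorem is a central limit theorem whose variance can
be computed exactly, together with a tightness estimate.

Moments of one family. Let G be the potential operator of the space-time walk (`pot`) and R its
resolvent at rate V, so that G f = R f + V R G f (`pot_eq`). Test the family of a particle against a
space-time function Φ ≥ 0. Conditioning on the first branching event gives a renewal equation for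
each moment. By criticality the mean is GΦ (`lintegral_fam`). The second moment is V G((GΦ)²),
created by pairs of relatives, up to a term involving the occupation of a single particle during its
own life (`le_lintegral_fam_sq`, `lintegral_fam_sq_le`). The third moment is bounded in the same way
(`lintegral_fam_cube_le`). Signed test functions are differences Φ₁ - Φ₂, and (x - y)² = 2x² + 2y² -
(x + y)² reduces their variances to nonnegative functionals.

Central limit theorem. The Poisson number of families at each site and the independence of sites
turn the expansion of the characteristic function of one family into a Gaussian characteristic
function, with an explicit error (`norm_charFun_centered_sub_le`). The variance is λV ∫ Σ_y (GΦ)², a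
quadratic form in the kernel `bil`. The errors vanish because a single particle's contribution is of
order 1/F and T/F² → 0, which is where c² < M enters.

Variance. Differences of uniform laws on consecutive balls are eigenfunctions of the step law with
eigenvalues 1 - b a^j (`specKernel_conv`). Hence p_t(0) is the sum over j ≥ 0 of (1 - 1/M) M^{-j}
e^{-b a^j t}, and the form of two time intervals (0,s], (0,t] is the sum of (1 - 1/M) M^{-j}
β_j^{-3} ψ(β_j s, β_j t) with β_j = b a^j (`bil_zero`, `decay_box_zero`). Multiplying time by T_n =
a^{-n} replaces β_j by β_{j-n}. As a^{1+γ} = 1/M, the weights are rescaled by exactly F²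
(`kap_shift`). The normalized variance is therefore one fixed series over ℤ restricted to indices ≥
-n, and it converges to the full series, which is K² times the osfBm covariance
(`KConst_sq_mul_osfBmCov`). This discrete scale invariance explains both the sequence a^{-n} and the
oscillation of the limit. Two sites z apart see the same kernel except at the finitely many levels
below |z|, which contribute only O(T_n) = o(F²). So all sites are asymptotically identical and only
Σφ survives (`tendsto_bil`).

Tightness and existence. The same series bounds second moments of increments by a multiple of
(t-s)^{1+ε}, ε = (1-γ)/2, on bounded time intervals. Because this exponent exceeds 1, Kolmogorov's
criterion works with second moments alone. Tightness and convergence of finite-dimensional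
characteristic functions give weak convergence on C([0,∞)), which is then restricted to [0,τ].
Existence of osfBm needs no separate proof of positive definiteness: a cluster point of the
fluctuations at a single site, divided by K, is osfBm (`exists_isOsfBm`). -/

lemma hdist_zero_left (z : HierGroup M) : hdist 0 z = z.support.sup (fun i => i + 1) := by
  simp [hdist, Finsupp.support_neg]

lemma hdist_zero_right (z : HierGroup M) : hdist z 0 = hdist 0 z := by
  simp [hdist, Finsupp.support_neg]

lemma hdist_zero_le_iff {z : HierGroup M} {j : ℕ} : hdist 0 z ≤ j ↔ ∀ i, j ≤ i → z i = 0 := by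
  rw [hdist_zero_left, Finset.sup_le_iff]
  constructor
  · intro h i hi
    by_contra hz
    have := h i (by simpa using hz)
    omega
  · intro h i hi
    by_contra hj
    exact (Finsupp.mem_support_iff.1 hi) (h i (by omega))

lemma hdist_zero_neg (z : HierGroup M) : hdist 0 (-z) = hdist 0 z := by
  simp [hdist_zero_left, Finsupp.support_neg]

lemma hdist_zero_sub_le {y z : HierGroup M} {j : ℕ} (hz : hdist 0 z ≤ j) :
    hdist 0 (y - z) ≤ j ↔ hdist 0 y ≤ j := by
  rw [hdist_zero_le_iff] at *
  rw [hdist_zero_le_iff]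
  refine forall₂_congr fun i hi => ?_
  simp [hz i hi]

/-- Ultrametric isosceles property: moving by less than the distance of y from the origin leaves
that distance unchanged. It makes the step law constant on small balls away from the origin. -/
lemma hdist_zero_sub_eq {y z : HierGroup M} {j : ℕ} (hz : hdist 0 z ≤ j) (hy : j < hdist 0 y) :
    hdist 0 (y - z) = hdist 0 y := by
  apply le_antisymm
  · exact (hdist_zero_sub_le (hz.trans hy.le)).2 le_rfl
  · by_contra h
    push Not at h
    have h1 : hdist 0 (y - z) ≤ max (hdist 0 (y-z)) j := le_max_left _ _
    have h2 := (hdist_zero_sub_le (y := y) (hz.trans (le_max_right (hdist 0 (y-z)) j))).1 h1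
    omega

lemma hdist_zero_eq_zero {z : HierGroup M} : hdist 0 z = 0 ↔ z = 0 := by
  constructor
  · intro h
    ext i
    simpa using hdist_zero_le_iff.1 h.le i (Nat.zero_le i)
  · rintro rfl; simp [hdist]

/-- Elements of the ball of radius `j` are functions on the first `j` coordinates. -/
def ballEquiv (M j : ℕ) : {z : HierGroup M // hdist 0 z ≤ j} ≃ (Fin j → ZMod M) where
  toFun z i := z.1 i
  invFun f := ⟨Finsupp.onFinset (range j) (fun i => if h : i < j then f ⟨i, h⟩ else 0)
    (by intro i hi; by_contra hc; simp at hc; simp [hc.not_gt] at hi), by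
    rw [hdist_zero_le_iff]; intro i hi; simp [hi.not_gt]⟩
  left_inv z := by
    ext i
    simp only [Finsupp.onFinset_apply]
    split_ifs with h
    · rfl
    · exact (hdist_zero_le_iff.1 z.2 i (by omega)).symm
  right_inv f := by
    ext i; simp

variable [NeZero M]

lemma finite_ball (M : ℕ) [NeZero M] (j : ℕ) : {z : HierGroup M | hdist 0 z ≤ j}.Finite := by
  have : Finite {z : HierGroup M // hdist 0 z ≤ j} := Finite.of_equiv _ (ballEquiv M j).symm
  exact @Set.toFinite _ _ this

/-- The ball of radius `j` around `0`. -/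
def hball (M : ℕ) [NeZero M] (j : ℕ) : Finset (HierGroup M) := (finite_ball M j).toFinset

@[simp] lemma mem_hball {j : ℕ} {z : HierGroup M} : z ∈ hball M j ↔ hdist 0 z ≤ j := by
  simp [hball]

lemma card_hball (j : ℕ) : (hball M j).card = M ^ j := by
  have h1 : (hball M j).card = Nat.card {z : HierGroup M // hdist 0 z ≤ j} := by
    rw [hball, ← Set.ncard_eq_toFinset_card _ (finite_ball M j)]; rfl
  rw [h1, Nat.card_congr (ballEquiv M j)]
  simp

lemma hball_mono {j k : ℕ} (h : j ≤ k) : hball M j ⊆ hball M k := fun z hz => by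
  rw [mem_hball] at *; omega

lemma ncard_sphere (j : ℕ) :
    ({z : HierGroup M | hdist 0 z = j + 1}.ncard : ℝ) = (M : ℝ) ^ (j + 1) - (M : ℝ) ^ j := by
  have : {z : HierGroup M | hdist 0 z = j + 1} = ↑(hball M (j+1) \ hball M j) := by
    ext z; simp; omega
  rw [this, Set.ncard_coe_finset, Finset.card_sdiff_of_subset (hball_mono (le_succ j)),
    card_hball, card_hball,
    Nat.cast_sub (Nat.pow_le_pow_right (NeZero.pos M) (le_succ j))]
  simp

variable {c : ℝ}

lemma sum_sphere (hM : 1 < M) (j : ℕ) :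
    ∑ z ∈ hball M (j+1) \ hball M j, stepProb M c z = (1 - c / M) * (c / M) ^ j := by
  have h1 : ∀ z ∈ hball M (j+1) \ hball M j,
      stepProb M c z = (1 - c / M) * (c / M) ^ j / ((M : ℝ) ^ (j + 1) - (M : ℝ) ^ j) := by
    intro z hz
    have hz' : hdist 0 z = j + 1 := by simp at hz; omega
    rw [stepProb, hz', ncard_sphere, jumpLengthProb]
    simp
  rw [sum_congr rfl h1, sum_const, Finset.card_sdiff_of_subset (hball_mono (le_succ j)),
    card_hball, card_hball, nsmul_eq_mul,
    Nat.cast_sub (Nat.pow_le_pow_right (NeZero.pos M) (le_succ j))]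
  have : ((M:ℝ) ^ (j + 1) - (M : ℝ) ^ j) ≠ 0 := by
    have h2 : (1:ℝ) < M := by exact_mod_cast hM
    have h3 : (0:ℝ) < (M:ℝ)^j := by positivity
    rw [pow_succ]; nlinarith
  push_cast
  field_simp

/-- Sphere masses form a geometric series. The mass a^j left outside the ball is the source of the
eigenvalues. -/
lemma sum_hball_stepProb (hM : 1 < M) (j : ℕ) :
    ∑ z ∈ hball M j, stepProb M c z = 1 - (c / M) ^ j := by
  induction j with
  | zero =>
    have : hball M 0 = {0} := by ext z; simp [hdist_zero_eq_zero]
    rw [this]; simp [stepProb, jumpLengthProb, hdist]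
  | succ j ih =>
    rw [← Finset.sum_sdiff (hball_mono (le_succ j)), ih, sum_sphere hM]
    ring

lemma stepProb_nonneg (hc : 0 ≤ c) (hcM : c ≤ M) (z : HierGroup M) : 0 ≤ stepProb M c z := by
  unfold stepProb jumpLengthProb
  have : c / M ≤ 1 := div_le_one_of_le₀ hcM (by positivity)
  positivity

lemma summable_stepProb (hM : 1 < M) (hc : 0 ≤ c) (hcM : c ≤ M) :
    Summable (fun z : HierGroup M => stepProb M c z) := by
  refine summable_of_sum_le (c := 1) (fun z => stepProb_nonneg hc hcM z) fun u => ?_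
  have h1 : u ⊆ hball M (u.sup (fun z => hdist 0 z)) := fun z hz => by
    rw [mem_hball]; exact le_sup (f := fun z => hdist 0 z) hz
  calc _ ≤ ∑ z ∈ hball M (u.sup (fun z => hdist 0 z)), stepProb M c z :=
        Finset.sum_le_sum_of_subset_of_nonneg h1 fun z _ _ => stepProb_nonneg hc hcM z
    _ ≤ 1 := by
      rw [sum_hball_stepProb hM]
      have : 0 ≤ (c / M) ^ (u.sup (fun z => hdist 0 z)) := by positivity
      linarith

/-- The uniform distribution on the ball of radius `j`. -/
def unifBall (M : ℕ) (j : ℕ) (y : HierGroup M) : ℝ := if hdist 0 y ≤ j then ((M : ℝ) ^ j)⁻¹ else 0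

/-- The kernel of the spectral projection of the walk with index `j`. -/
def specKernel (M : ℕ) (j : ℕ) (y : HierGroup M) : ℝ := unifBall M j y - unifBall M (j + 1) y

/-- Balls around the origin are subgroups. Translating a ball by one of its points permutes it,
while for y outside the ball the step law is constant along y - z. -/
lemma tsum_unifBall_mul (hM : 1 < M) (j : ℕ) (y : HierGroup M) :
    ∑ z ∈ hball M j, ((M:ℝ)^j)⁻¹ * stepProb M c (y - z) =
      if hdist 0 y ≤ j then ((M:ℝ)^j)⁻¹ * (1 - (c / M) ^ j) else stepProb M c y := by
  rw [← mul_sum]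
  split_ifs with h
  · congr 1
    rw [← sum_hball_stepProb hM]
    refine Finset.sum_nbij' (fun z => y - z) (fun z => y - z) ?_ ?_ ?_ ?_ ?_
    · intro z hz; rw [mem_hball] at *; exact (hdist_zero_sub_le hz).2 h
    · intro z hz; rw [mem_hball] at *; exact (hdist_zero_sub_le hz).2 h
    · intro z _; simp
    · intro z _; simp
    · intro z _; rfl
  · have : ∀ z ∈ hball M j, stepProb M c (y - z) = stepProb M c y := by
      intro z hz
      rw [mem_hball] at hz
      have := hdist_zero_sub_eq hz (not_le.1 h)
      rw [stepProb, stepProb, this]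
    rw [sum_congr rfl this, sum_const, card_hball, nsmul_eq_mul]
    push_cast
    field_simp

lemma unifBall_eq_zero {j : ℕ} {z : HierGroup M} (h : z ∉ hball M j) : unifBall M j z = 0 := by
  simp at h; simp [unifBall, h.not_ge]

lemma unifBall_mul_hasSum (hM : 1 < M) (j : ℕ) (y : HierGroup M) :
    HasSum (fun z => unifBall M j z * stepProb M c (y - z))
      (if hdist 0 y ≤ j then ((M:ℝ)^j)⁻¹ * (1 - (c / M) ^ j) else stepProb M c y) := by
  rw [← tsum_unifBall_mul hM]
  have : ∑ z ∈ hball M j, ((M:ℝ)^j)⁻¹ * stepProb M c (y - z) =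
      ∑ z ∈ hball M j, unifBall M j z * stepProb M c (y - z) :=
    sum_congr rfl fun z hz => by rw [mem_hball] at hz; simp [unifBall, hz]
  rw [this]
  exact hasSum_sum_of_ne_finset_zero fun z hz => by rw [unifBall_eq_zero hz, zero_mul]

/-- The spectral kernels are eigenfunctions of the step distribution. -/
lemma specKernel_conv (hM : 1 < M) (j : ℕ) (y : HierGroup M) :
    HasSum (fun z => specKernel M j z * stepProb M c (y - z))
      ((1 - bConst M c * aConst M c ^ j) * specKernel M j y) := by
  have h := (unifBall_mul_hasSum (c := c) hM j y).sub (unifBall_mul_hasSum (c := c) hM (j+1) y)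
  have hf : (fun z => specKernel M j z * stepProb M c (y - z)) = fun z =>
      unifBall M j z * stepProb M c (y - z) - unifBall M (j + 1) z * stepProb M c (y - z) := by
    ext z; rw [specKernel]; ring
  suffices hv : (1 - bConst M c * aConst M c ^ j) * specKernel M j y =
      (if hdist 0 y ≤ j then ((M:ℝ)^j)⁻¹ * (1 - (c / M) ^ j) else stepProb M c y) -
      (if hdist 0 y ≤ j + 1 then ((M:ℝ)^(j+1))⁻¹ * (1 - (c / M) ^ (j + 1)) else stepProb M c y) by
    rw [hf, hv]; exact h
  · have hM1 : (1:ℝ) < M := by exact_mod_cast hM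
    have hM2 : (M:ℝ) - 1 ≠ 0 := by linarith
    have hM0 : (M:ℝ) ≠ 0 := by linarith
    have hMj : (M:ℝ)^j ≠ 0 := by positivity
    simp only [specKernel, unifBall, bConst, aConst]
    -- Three regions: the ball of radius j, the sphere of radius j+1, and the outside, where both
    -- convolutions equal the step law at y and cancel. The eigenvalue is the same on the first two
    -- only for this value of b.
    by_cases h1 : hdist 0 y ≤ j
    · have h2 : hdist 0 y ≤ j + 1 := by omega
      simp only [h1, h2, if_true]
      rw [pow_succ (c / (M:ℝ)), pow_succ]
      generalize (c / (M:ℝ))^j = w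
      field_simp
      ring
    · by_cases h2 : hdist 0 y ≤ j + 1
      · have h3 : hdist 0 y = j + 1 := by omega
        simp only [h1, h2, if_true, if_false]
        rw [stepProb, h3, ncard_sphere, jumpLengthProb]
        have : ((M:ℝ) ^ (j + 1) - (M : ℝ) ^ j) = (M:ℝ)^j * (M - 1) := by ring
        rw [this]
        simp only [Nat.add_eq_zero_iff, one_ne_zero, and_false, if_false, Nat.add_sub_cancel]
        rw [pow_succ (c/(M:ℝ)), pow_succ]
        generalize (c / (M:ℝ))^j = w
        field_simp
        ring
      · simp only [h1, h2, if_false]; ring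

lemma abs_specKernel_le (hM : 1 < M) (j : ℕ) (y : HierGroup M) :
    |specKernel M j y| ≤ ((M:ℝ)⁻¹) ^ j := by
  have hM1 : (1:ℝ) < M := by exact_mod_cast hM
  have h0 : (0:ℝ) < ((M:ℝ)^j)⁻¹ := by positivity
  have h1 : ((M:ℝ)^(j+1))⁻¹ ≤ ((M:ℝ)^j)⁻¹ := by
    apply inv_anti₀ (by positivity); rw [pow_succ]
    exact le_mul_of_one_le_right (by positivity) hM1.le
  have h2 : (0:ℝ) < ((M:ℝ)^(j+1))⁻¹ := by positivity
  rw [inv_pow]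
  simp only [specKernel, unifBall]
  split_ifs <;> rw [abs_le] <;> constructor <;> linarith

lemma specKernel_le_zero (hM : 1 < M) (j : ℕ) (y : HierGroup M) :
    specKernel M j y ≤ specKernel M j 0 := by
  have hM1 : (1:ℝ) < M := by exact_mod_cast hM
  have h0 : (0:ℝ) < ((M:ℝ)^j)⁻¹ := by positivity
  have h1 : ((M:ℝ)^(j+1))⁻¹ ≤ ((M:ℝ)^j)⁻¹ := by
    apply inv_anti₀ (by positivity); rw [pow_succ]
    exact le_mul_of_one_le_right (by positivity) hM1.le
  have h2 : (0:ℝ) < ((M:ℝ)^(j+1))⁻¹ := by positivity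
  have h3 : hdist (0 : HierGroup M) 0 = 0 := by simp [hdist]
  simp only [specKernel, unifBall, h3, Nat.zero_le, if_true]
  split_ifs with h4 h5 h5
  · linarith
  · omega
  · linarith
  · linarith

lemma specKernel_zero (j : ℕ) : specKernel M j 0 = (1 - (M:ℝ)⁻¹) * ((M:ℝ)⁻¹) ^ j := by
  have h3 : hdist (0 : HierGroup M) 0 = 0 := by simp [hdist]
  simp only [specKernel, unifBall, h3, Nat.zero_le, if_true]
  rw [inv_pow, pow_succ, mul_inv]; ring

lemma specKernel_neg (j : ℕ) (y : HierGroup M) : specKernel M j (-y) = specKernel M j y := by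
  simp [specKernel, unifBall, hdist_zero_neg]

/-- Levels j ≥ |y| cannot tell y from the origin, so diagonal and off-diagonal kernels differ in
finitely many terms. -/
lemma specKernel_eq_of_le {j : ℕ} {y : HierGroup M} (h : hdist 0 y ≤ j) :
    specKernel M j y = specKernel M j 0 := by
  have h3 : hdist (0 : HierGroup M) 0 = 0 := by simp [hdist]
  simp [specKernel, unifBall, h, h3, h.trans (le_succ j)]

lemma summable_inv_pow (hM : 1 < M) : Summable (fun j : ℕ => ((M:ℝ)⁻¹) ^ j) :=
  summable_geometric_of_lt_one (by positivity) (inv_lt_one_of_one_lt₀ (by exact_mod_cast hM))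

/-- The sum telescopes to the uniform law on the ball of radius 0, a point mass, since uniform
weights on large balls tend to zero. -/
lemma hasSum_specKernel (hM : 1 < M) (y : HierGroup M) :
    HasSum (fun j => specKernel M j y) (if y = 0 then 1 else 0) := by
  have hs : Summable (fun j => specKernel M j y) :=
    Summable.of_norm_bounded (summable_inv_pow hM) (fun j => abs_specKernel_le hM j y)
  have h1 : ∀ n, ∑ j ∈ range n, specKernel M j y = unifBall M 0 y - unifBall M n y := by
    intro n
    rw [← Finset.sum_range_sub' (fun j => unifBall M j y)]; rfl
  have h2 : Tendsto (fun n => unifBall M n y) atTop (𝓝 0) := by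
    refine squeeze_zero (fun n => ?_) (fun n => ?_) ((summable_inv_pow hM).tendsto_atTop_zero)
    · unfold unifBall; split_ifs <;> positivity
    · unfold unifBall; split_ifs
      · rw [inv_pow]
      · positivity
  have h3 := hs.hasSum.tendsto_sum_nat
  simp_rw [h1] at h3
  have h4 := tendsto_nhds_unique h3 (h2.const_sub (unifBall M 0 y))
  have h5 : unifBall M 0 y = if y = 0 then 1 else 0 := by
    simp only [unifBall, Nat.le_zero, hdist_zero_eq_zero, pow_zero, inv_one]
  rw [sub_zero, h5] at h4
  rw [← h4]; exact hs.hasSum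

lemma aConst_pos (hc : 0 < c) : 0 < aConst M c := by
  have := NeZero.pos M
  unfold aConst; positivity

lemma aConst_lt_one (hcM : c < M) : aConst M c < 1 := by
  have := NeZero.pos M
  unfold aConst; rw [div_lt_one (by positivity)]; exact hcM

lemma bConst_pos (hM : 1 < M) (hcM : c < M) : 0 < bConst M c := by
  have hM1 : (1:ℝ) < M := by exact_mod_cast hM
  unfold bConst
  apply div_pos <;> nlinarith

/-- Since c < M, the constant b exceeds 1 and the eigenvalue at level 0 is negative. The bound b ≤
2, valid for M ≥ 2, still keeps all eigenvalues in [-1, 1]. -/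
lemma abs_eigen_le (hM : 1 < M) (hc : 1 ≤ c) (hcM : c < M) (j : ℕ) :
    |1 - bConst M c * aConst M c ^ j| ≤ 1 := by
  have hM1 : (2:ℝ) ≤ M := by exact_mod_cast hM
  have ha := aConst_pos (M := M) (c := c) (by linarith)
  have ha1 := aConst_lt_one (M := M) hcM
  have hb := bConst_pos hM hcM
  have hb2 : bConst M c ≤ 2 := by
    unfold bConst
    rw [div_le_iff₀ (by nlinarith)]
    nlinarith
  have h1 : aConst M c ^ j ≤ 1 := pow_le_one₀ ha.le ha1.le
  have h2 : 0 < aConst M c ^ j := by positivity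
  rw [abs_le]; constructor
  · nlinarith
  · nlinarith

/-- Expand the point mass at the origin in eigenfunctions and apply the step law n times. The
products M^{-j} · `stepProb` dominate and justify the exchange of sums. -/
lemma nStepProb_eq (hM : 1 < M) (hc : 1 ≤ c) (hcM : c < M) (n : ℕ) (y : HierGroup M) :
    nStepProb M c n y = ∑' j, (1 - bConst M c * aConst M c ^ j) ^ n * specKernel M j y := by
  induction n generalizing y with
  | zero => simp [nStepProb, (hasSum_specKernel hM y).tsum_eq]
  | succ n ih =>
    rw [nStepProb]
    simp_rw [ih, ← tsum_mul_right]
    have hle : ∀ (j : ℕ) (z : HierGroup M), ‖(1 - bConst M c * aConst M c ^ j) ^ n * specKernel M j z *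
        stepProb M c (y - z)‖ ≤ ((M:ℝ)⁻¹) ^ j * stepProb M c (y - z) := by
      intro j z
      have h0 := stepProb_nonneg (M := M) (c := c) (by linarith) hcM.le (y - z)
      rw [norm_mul, norm_mul, norm_pow, norm_of_nonneg h0]
      gcongr
      calc _ ≤ 1 * ((M:ℝ)⁻¹) ^ j := by
            gcongr
            · exact pow_le_one₀ (abs_nonneg _) (abs_eigen_le hM hc hcM j)
            · exact abs_specKernel_le hM j z
        _ = _ := one_mul _
    have hsum : Summable (fun z => stepProb M c (y - z)) :=
      (summable_stepProb (M := M) (c := c) hM (by linarith) hcM.le).comp_injective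
        (i := fun z => y - z) (fun z w h => sub_right_injective h)
    have hs2 : Summable (Function.uncurry fun (z : HierGroup M) (j : ℕ) =>
        (1 - bConst M c * aConst M c ^ j) ^ n * specKernel M j z * stepProb M c (y - z)) := by
      refine Summable.of_norm_bounded (g := fun p : HierGroup M × ℕ =>
        stepProb M c (y - p.1) * ((M:ℝ)⁻¹) ^ p.2) ?_ ?_
      · exact Summable.mul_of_nonneg (f := fun z => stepProb M c (y - z))
          (g := fun j : ℕ => ((M:ℝ)⁻¹) ^ j) hsum (summable_inv_pow hM)
          (fun z => stepProb_nonneg (by linarith) hcM.le _)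
          (fun j => pow_nonneg (inv_nonneg.2 (Nat.cast_nonneg M)) j)
      · rintro ⟨z, j⟩; rw [mul_comm (stepProb _ _ _)]; exact hle j z
    rw [← Summable.tsum_comm hs2]
    refine tsum_congr fun j => ?_
    simp_rw [mul_assoc]
    rw [tsum_mul_left, (specKernel_conv hM j y).tsum_eq]
    ring

/-- Spectral representation of the transition probabilities. -/
lemma transProb_eq (hM : 1 < M) (hc : 1 ≤ c) (hcM : c < M) (t : ℝ) (y : HierGroup M) :
    transProb M c t y = ∑' j, rexp (-(bConst M c * aConst M c ^ j * t)) * specKernel M j y := by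
  unfold transProb
  simp_rw [nStepProb_eq hM hc hcM, ← tsum_mul_left]
  have hs2 : Summable (Function.uncurry fun (n : ℕ) (j : ℕ) => rexp (-t) *
      (t ^ n / n.factorial * ((1 - bConst M c * aConst M c ^ j) ^ n * specKernel M j y))) := by
    apply Summable.mul_left
    refine Summable.of_norm_bounded (g := fun p : ℕ × ℕ =>
        (|t| ^ p.1 / p.1.factorial) * ((M:ℝ)⁻¹) ^ p.2) ?_ ?_
    · exact Summable.mul_of_nonneg (Real.summable_pow_div_factorial |t|) (summable_inv_pow hM)
          (fun z => by positivity) (fun j => by positivity)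
    · rintro ⟨n, j⟩
      simp only [norm_mul, norm_div, norm_pow, Real.norm_eq_abs, Nat.abs_cast]
      gcongr
      calc _ ≤ 1 * ((M:ℝ)⁻¹) ^ j := by
            gcongr
            · exact pow_le_one₀ (abs_nonneg _) (abs_eigen_le hM hc hcM j)
            · exact abs_specKernel_le hM j y
        _ = _ := one_mul _
  rw [← Summable.tsum_comm hs2]
  refine tsum_congr fun j => ?_
  have : ∀ n : ℕ, rexp (-t) *
      (t ^ n / n.factorial * ((1 - bConst M c * aConst M c ^ j) ^ n * specKernel M j y)) =
      (rexp (-t) * specKernel M j y) *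
        ((t * (1 - bConst M c * aConst M c ^ j)) ^ n / n.factorial) := by
    intro n; rw [mul_pow]; ring
  simp_rw [this, tsum_mul_left]
  have he : ∀ x : ℝ, ∑' n : ℕ, x ^ n / (n.factorial:ℝ) = rexp x := fun x => by
    rw [Real.exp_eq_exp_ℝ, NormedSpace.exp_eq_tsum_div]
  rw [he, mul_right_comm, ← exp_add]
  congr 2; ring

lemma transProb_neg (hM : 1 < M) (hc : 1 ≤ c) (hcM : c < M) (t : ℝ) (y : HierGroup M) :
    transProb M c t (-y) = transProb M c t y := by
  simp_rw [transProb_eq hM hc hcM, specKernel_neg]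

lemma summable_exp_specKernel (hM : 1 < M) (hc : 1 ≤ c) (hcM : c < M) {t : ℝ} (ht : 0 ≤ t)
    (y : HierGroup M) :
    Summable fun j => rexp (-(bConst M c * aConst M c ^ j * t)) * specKernel M j y := by
  refine Summable.of_norm_bounded (summable_inv_pow hM) fun j => ?_
  have ha := aConst_pos (M := M) (c := c) (by linarith)
  have hb := bConst_pos hM hcM
  rw [norm_mul, norm_of_nonneg (exp_pos _).le]
  calc _ ≤ 1 * ((M:ℝ)⁻¹) ^ j := by
        gcongr
        · rw [exp_le_one_iff]; rw [neg_nonpos]; positivity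
        · exact abs_specKernel_le hM j y
    _ = _ := one_mul _

lemma transProb_le_zero (hM : 1 < M) (hc : 1 ≤ c) (hcM : c < M) {t : ℝ} (ht : 0 ≤ t)
    (y : HierGroup M) : transProb M c t y ≤ transProb M c t 0 := by
  rw [transProb_eq hM hc hcM, transProb_eq hM hc hcM]
  refine Summable.tsum_le_tsum (fun j => ?_) (summable_exp_specKernel hM hc hcM ht y)
    (summable_exp_specKernel hM hc hcM ht 0)
  gcongr
  exact specKernel_le_zero hM j y

lemma transProb_zero_eq (hM : 1 < M) (hc : 1 ≤ c) (hcM : c < M) (t : ℝ) : transProb M c t 0 =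
      (1 - (M:ℝ)⁻¹) * ∑' j, rexp (-(bConst M c * aConst M c ^ j * t)) * ((M:ℝ)⁻¹) ^ j := by
  rw [transProb_eq hM hc hcM, ← tsum_mul_left]
  refine tsum_congr fun j => ?_
  rw [specKernel_zero]; ring

/-- Off-diagonal transition probabilities differ from the diagonal one by finitely many
exponentially decaying terms. -/
lemma transProb_zero_sub_le (hM : 1 < M) (hc : 1 ≤ c) (hcM : c < M) {t : ℝ} (ht : 0 ≤ t)
    (y : HierGroup M) : transProb M c t 0 ≤ transProb M c t y +
      ∑ j ∈ range (hdist 0 y), 2 * rexp (-(bConst M c * aConst M c ^ j * t)) := by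
  rw [← sub_le_iff_le_add', transProb_eq hM hc hcM, transProb_eq hM hc hcM,
    ← (summable_exp_specKernel hM hc hcM ht 0).tsum_sub (summable_exp_specKernel hM hc hcM ht y)]
  rw [tsum_eq_sum (s := range (hdist 0 y))]
  · refine sum_le_sum fun j _ => ?_
    rw [← mul_sub, mul_comm]
    gcongr
    have h1 := abs_le.1 (abs_specKernel_le hM j y)
    have h2 := abs_le.1 (abs_specKernel_le hM j (0 : HierGroup M))
    have h3 : ((M:ℝ)⁻¹) ^ j ≤ 1 := pow_le_one₀ (by positivity)
      (inv_le_one_of_one_le₀ (by exact_mod_cast hM.le))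
    linarith
  · intro j hj
    simp at hj
    rw [specKernel_eq_of_le hj, sub_self]

lemma measurable_transProb (hM : 1 < M) (hc : 1 ≤ c) (hcM : c < M) (y : HierGroup M) :
    Measurable fun t => transProb M c t y := by
  simp_rw [transProb_eq hM hc hcM]
  refine Measurable.tsum fun j => ?_
  fun_prop

end Walk

/-! ### Potential theory of a symmetric convolution semigroup -/

section Semigroup

variable {H : Type*} [AddCommGroup H] [Countable H]

/-- A symmetric convolution semigroup of probability weights on a countable group, largest at the
origin. -/
structure SymmSemigroup (k : ℝ → H → ℝ≥0∞) : Prop where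
  measurable : ∀ z, Measurable fun r => k r z
  tsum_eq_one : ∀ r, 0 ≤ r → ∑' z, k r z = 1
  conv : ∀ r s, 0 ≤ r → 0 ≤ s → ∀ y, ∑' z, k r z * k s (y - z) = k (r + s) y
  neg : ∀ r z, k r (-z) = k r z
  le_zero : ∀ r, 0 ≤ r → ∀ z, k r z ≤ k r 0

/-- The action of a convolution semigroup on functions. -/
def avg (k : ℝ → H → ℝ≥0∞) (r : ℝ) (f : H → ℝ≥0∞) (y : H) : ℝ≥0∞ := ∑' z, k r z * f (y + z)

variable {k : ℝ → H → ℝ≥0∞}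

lemma avg_mono {f g : H → ℝ≥0∞} (h : ∀ y, f y ≤ g y) (r : ℝ) (y : H) :
    avg k r f y ≤ avg k r g y := by
  unfold avg; gcongr; exact h _

lemma avg_add (r : ℝ) (f g : H → ℝ≥0∞) (y : H) :
    avg k r (fun y => f y + g y) y = avg k r f y + avg k r g y := by
  simp only [avg, mul_add, tsum_add]

lemma avg_const_mul (r : ℝ) (C : ℝ≥0∞) (f : H → ℝ≥0∞) (y : H) :
    avg k r (fun y => C * f y) y = C * avg k r f y := by
  simp only [avg, mul_left_comm _ C, ENNReal.tsum_mul_left]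

lemma avg_const (hk : SymmSemigroup k) {r : ℝ} (hr : 0 ≤ r) (C : ℝ≥0∞) (y : H) :
    avg k r (fun _ => C) y = C := by
  simp only [avg, ENNReal.tsum_mul_right, hk.tsum_eq_one r hr, one_mul]

lemma avg_avg (hk : SymmSemigroup k) {r s : ℝ} (hr : 0 ≤ r) (hs : 0 ≤ s) (f : H → ℝ≥0∞) (y : H) :
    avg k r (avg k s f) y = avg k (r + s) f y := by
  simp only [avg, ← ENNReal.tsum_mul_left]
  have h1 : ∀ z, ∑' w, k r z * (k s w * f (y + z + w)) = ∑' v, k r z * k s (v - z) * f (y + v) := by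
    intro z
    rw [← (Equiv.subRight z).tsum_eq]
    refine tsum_congr fun v => ?_
    simp only [Equiv.subRight_apply]
    rw [mul_assoc]; congr 3; abel
  simp_rw [h1]
  rw [tsum_comm]
  refine tsum_congr fun v => ?_
  rw [ENNReal.tsum_mul_right, hk.conv r s hr hs]

/-- Symmetry of the kernel makes the semigroup self-adjoint for counting measure; taking one
function constant gives invariance of counting measure. -/
lemma tsum_mul_avg (hk : SymmSemigroup k) (r : ℝ) (f g : H → ℝ≥0∞) :
    ∑' y, f y * avg k r g y = ∑' y, g y * avg k r f y := by
  simp only [avg, ← ENNReal.tsum_mul_left]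
  have h1 : ∀ (f g : H → ℝ≥0∞) y, ∑' z, f y * (k r z * g (y + z)) =
      ∑' v, f y * g v * k r (v - y) := by
    intro f g y
    rw [← (Equiv.subRight y).tsum_eq]
    refine tsum_congr fun v => ?_
    simp only [Equiv.subRight_apply, add_sub_cancel]
    ring
  simp_rw [h1]
  rw [tsum_comm]
  refine tsum_congr fun v => tsum_congr fun y => ?_
  rw [← hk.neg, neg_sub, mul_comm (f y)]

lemma tsum_avg (hk : SymmSemigroup k) {r : ℝ} (hr : 0 ≤ r) (f : H → ℝ≥0∞) :
    ∑' y, avg k r f y = ∑' y, f y := by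
  have := tsum_mul_avg hk r (fun _ => 1) f
  simpa [avg_const hk hr] using this

lemma avg_le_const (hk : SymmSemigroup k) {r : ℝ} (hr : 0 ≤ r) {f : H → ℝ≥0∞} {C : ℝ≥0∞}
    (h : ∀ y, f y ≤ C) (y : H) : avg k r f y ≤ C :=
  (avg_mono h r y).trans_eq (avg_const hk hr C y)

lemma avg_lintegral {α : Type*} [MeasurableSpace α] {μ : Measure α} (r : ℝ) {F : α → H → ℝ≥0∞}
    (hF : ∀ y, Measurable fun u => F u y) (y : H) :
    avg k r (fun y => ∫⁻ u, F u y ∂μ) y = ∫⁻ u, avg k r (F u) y ∂μ := by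
  unfold avg
  rw [lintegral_tsum (fun z => ((hF _).const_mul _).aemeasurable)]
  exact tsum_congr fun z => (lintegral_const_mul _ (hF _)).symm

lemma measurable_avg (hk : SymmSemigroup k) {α : Type*} [MeasurableSpace α] {F : α → H → ℝ≥0∞}
    (hF : ∀ y, Measurable fun u => F u y) {g : α → ℝ} (hg : Measurable g) (y : H) :
    Measurable fun u => avg k (g u) (F u) y := by
  unfold avg
  exact Measurable.tsum fun z => ((hk.measurable z).comp hg).mul (hF _)

/-- Time integral of the semigroup with weight `w`, acting on space-time functions. -/
def resW (k : ℝ → H → ℝ≥0∞) (w : ℝ → ℝ≥0∞) (f : ℝ → H → ℝ≥0∞) (s : ℝ) (y : H) : ℝ≥0∞ :=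
  ∫⁻ r in Ioi (0:ℝ), w r * avg k r (f (s + r)) y

/-- The potential operator of the space-time process. -/
def pot (k : ℝ → H → ℝ≥0∞) (f : ℝ → H → ℝ≥0∞) : ℝ → H → ℝ≥0∞ := resW k (fun _ => 1) f

/-- The exponential weight `exp (-V r)`. -/
def expW (V : ℝ) (r : ℝ) : ℝ≥0∞ := ofReal (rexp (-(V * r)))

@[fun_prop]
lemma measurable_expW (V : ℝ) : Measurable (expW V) := by unfold expW; fun_prop

variable {w : ℝ → ℝ≥0∞} {f g : ℝ → H → ℝ≥0∞}

lemma measurable_resW_aux (hk : SymmSemigroup k) (hf : ∀ y, Measurable fun s => f s y) (y : H)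
    (s : ℝ) : Measurable fun r => avg k r (f (s + r)) y :=
  measurable_avg hk (F := fun r => f (s + r)) (fun y => (hf y).comp (measurable_const_add s))
    measurable_id y

lemma measurable_resW_integrand (hk : SymmSemigroup k) (hw : Measurable w)
    (hf : ∀ y, Measurable fun s => f s y) (y : H) (s : ℝ) :
    Measurable fun r => w r * avg k r (f (s + r)) y := hw.mul (measurable_resW_aux hk hf y s)

lemma measurable_resW (hk : SymmSemigroup k) (hw : Measurable w)
    (hf : ∀ y, Measurable fun s => f s y) (y : H) : Measurable fun s => resW k w f s y := by
  unfold resW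
  apply Measurable.lintegral_prod_right' (f := fun p : ℝ × ℝ => w p.2 * avg k p.2 (f (p.1 + p.2)) y)
  refine (hw.comp measurable_snd).mul ?_
  exact measurable_avg hk (F := fun p : ℝ × ℝ => f (p.1 + p.2))
    (fun y => (hf y).comp (measurable_fst.add measurable_snd)) measurable_snd y

lemma resW_mono {w' : ℝ → ℝ≥0∞} (hw : ∀ r, 0 < r → w r ≤ w' r)
    (h : ∀ s y, f s y ≤ g s y) (s : ℝ) (y : H) : resW k w f s y ≤ resW k w' g s y := by
  unfold resW
  refine setLIntegral_mono' measurableSet_Ioi fun r hr => ?_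
  gcongr
  · exact hw r hr
  · exact avg_mono (h _) r y

lemma resW_add (hk : SymmSemigroup k) (hw : Measurable w) (hf : ∀ y, Measurable fun s => f s y)
    (s : ℝ) (y : H) :
    resW k w (fun s y => f s y + g s y) s y = resW k w f s y + resW k w g s y := by
  unfold resW
  rw [← lintegral_add_left (measurable_resW_integrand hk hw hf y s)]
  simp only [avg_add, mul_add]

lemma resW_const_mul (hk : SymmSemigroup k) (hw : Measurable w)
    (hf : ∀ y, Measurable fun s => f s y) (C : ℝ≥0∞) (s : ℝ) (y : H) :
    resW k w (fun s y => C * f s y) s y = C * resW k w f s y := by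
  unfold resW
  rw [← lintegral_const_mul _ (measurable_resW_integrand hk hw hf y s)]
  simp only [avg_const_mul, mul_left_comm]

lemma resW_le_const (hk : SymmSemigroup k) (hw : Measurable w) {C : ℝ≥0∞}
    (h : ∀ s y, f s y ≤ C) (s : ℝ) (y : H) :
    resW k w f s y ≤ (∫⁻ r in Ioi (0:ℝ), w r) * C := by
  unfold resW
  rw [← lintegral_mul_const _ hw]
  refine setLIntegral_mono' measurableSet_Ioi fun r hr => ?_
  gcongr
  exact avg_le_const hk (le_of_lt hr) (h _) y

lemma avg_resW (hk : SymmSemigroup k) (hw : Measurable w) (hf : ∀ y, Measurable fun s => f s y)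
    {v : ℝ} (hv : 0 ≤ v) (s : ℝ) (y : H) :
    avg k v (resW k w f s) y = ∫⁻ r in Ioi (0:ℝ), w r * avg k (v + r) (f (s + r)) y := by
  have : avg k v (resW k w f s) y =
      ∫⁻ r in Ioi (0:ℝ), avg k v (fun y => w r * avg k r (f (s + r)) y) y :=
    avg_lintegral (F := fun r y => w r * avg k r (f (s + r)) y) v
      (fun y => hw.mul (measurable_resW_aux hk hf y s)) y
  rw [this]
  refine setLIntegral_congr_fun measurableSet_Ioi fun r hr => ?_
  simp only [avg_const_mul]
  rw [avg_avg hk hv (le_of_lt hr)]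

/-- Time integrals of the semigroup commute. -/
lemma resW_comm (hk : SymmSemigroup k) {w' : ℝ → ℝ≥0∞} (hw : Measurable w) (hw' : Measurable w')
    (hf : ∀ y, Measurable fun s => f s y) (s : ℝ) (y : H) :
    resW k w (resW k w' f) s y = resW k w' (resW k w f) s y := by
  have h : ∀ {w w' : ℝ → ℝ≥0∞}, Measurable w → Measurable w' → resW k w (resW k w' f) s y =
      ∫⁻ r in Ioi (0:ℝ), ∫⁻ u in Ioi (0:ℝ), w r * w' u * avg k (r + u) (f (s + (r + u))) y := by
    intro w w' hw hw'
    rw [resW]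
    refine setLIntegral_congr_fun measurableSet_Ioi fun r hr => ?_
    rw [avg_resW hk hw' hf (le_of_lt hr), ← lintegral_const_mul]
    · simp only [mul_assoc, add_assoc]
    · refine hw'.mul (measurable_avg hk (F := fun u => f (s + r + u)) (fun y => ?_) ?_ y)
      · exact (hf y).comp (measurable_const_add _)
      · exact measurable_const_add _
  rw [h hw hw', h hw' hw, lintegral_lintegral_swap]
  · refine lintegral_congr fun r => lintegral_congr fun u => ?_
    rw [mul_comm (w u), add_comm u]
  · apply Measurable.aemeasurable
    refine ((hw.comp measurable_fst).mul (hw'.comp measurable_snd)).mul ?_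
    exact measurable_avg hk (F := fun p : ℝ × ℝ => f (s + (p.1 + p.2)))
      (fun y => (hf y).comp ((measurable_fst.add measurable_snd).const_add s))
      (measurable_fst.add measurable_snd) y

lemma lintegral_Ioi_shift (h : ℝ → ℝ≥0∞) (r : ℝ) :
    ∫⁻ u in Ioi (0:ℝ), h (r + u) = ∫⁻ v in Ioi r, h v := by
  rw [← lintegral_indicator measurableSet_Ioi, ← lintegral_indicator measurableSet_Ioi,
    ← lintegral_add_left_eq_self (fun v => (Ioi r).indicator h v) r]
  refine lintegral_congr fun u => ?_
  simp [indicator]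

/-- Substitute v = r + u. In the resolvent equation the inner integral becomes an exponential
distribution function. -/
lemma lintegral_triangle {g h : ℝ → ℝ≥0∞} (hg : Measurable g) (hh : Measurable h) :
    ∫⁻ r in Ioi (0:ℝ), ∫⁻ u in Ioi (0:ℝ), g r * h (r + u) =
      ∫⁻ v in Ioi (0:ℝ), (∫⁻ r in Ioo 0 v, g r) * h v := by
  have h1 : ∀ r ∈ Ioi (0:ℝ), ∫⁻ u in Ioi (0:ℝ), g r * h (r + u) =
      ∫⁻ v in Ioi (0:ℝ), (Iio v).indicator g r * h v := by
    intro r hr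
    rw [lintegral_Ioi_shift (fun v => g r * h v), ← lintegral_indicator measurableSet_Ioi,
      ← lintegral_indicator measurableSet_Ioi]
    refine lintegral_congr fun v => ?_
    by_cases hv : r < v
    · simp [indicator, hv, lt_trans hr hv]
    · simp [indicator, hv]
  rw [setLIntegral_congr_fun measurableSet_Ioi h1, lintegral_lintegral_swap]
  · refine setLIntegral_congr_fun measurableSet_Ioi fun v hv => ?_
    rw [lintegral_mul_const _ (hg.indicator measurableSet_Iio),
      lintegral_indicator measurableSet_Iio, Measure.restrict_restrict measurableSet_Iio,
      inter_comm, Set.Ioi_inter_Iio]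
  · apply Measurable.aemeasurable
    refine Measurable.mul ?_ (hh.comp measurable_snd)
    have : (Function.uncurry fun (x y : ℝ) => (Iio y).indicator g x) =
        {p : ℝ × ℝ | p.1 < p.2}.indicator (fun p => g p.1) := by
      ext p; simp [indicator, Function.uncurry]
    have h2 : Measurable (Function.uncurry fun (x y : ℝ) => (Iio y).indicator g x) := by
      rw [this]
      exact (hg.comp measurable_fst).indicator (measurableSet_lt measurable_fst measurable_snd)
    exact h2

lemma lintegral_expW_Ioo {V : ℝ} (hV : 0 < V) {v : ℝ} (hv : 0 ≤ v) :
    ofReal V * ∫⁻ r in Ioo 0 v, expW V r = ofReal (1 - rexp (-(V * v))) := by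
  rw [← lintegral_const_mul _ (measurable_expW V)]
  have h1 : ∀ r, ofReal V * expW V r = ofReal (V * rexp (-(V * r))) := by
    intro r; rw [expW, ofReal_mul hV.le]
  simp_rw [h1]
  rw [← ofReal_integral_eq_lintegral_ofReal]
  · congr 1
    rw [← integral_Ioc_eq_integral_Ioo, ← intervalIntegral.integral_of_le hv]
    rw [intervalIntegral.integral_eq_sub_of_hasDerivAt (f := fun r => -rexp (-(V * r)))]
    · simp; ring
    · intro x _
      have : HasDerivAt (fun r : ℝ => -(V * r)) (-(V * 1)) x := ((hasDerivAt_id x).const_mul V).neg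
      convert! this.exp.neg using 1; ring
    · apply Continuous.intervalIntegrable; fun_prop
  · have : Continuous fun r => V * rexp (-(V * r)) := by fun_prop
    exact (this.integrableOn_Icc (a := 0) (b := v)).mono_set Set.Ioo_subset_Icc_self
  · filter_upwards with r; positivity

lemma lintegral_expW {V : ℝ} (hV : 0 < V) : ofReal V * ∫⁻ r in Ioi (0:ℝ), expW V r = 1 := by
  unfold expW
  rw [← ofReal_integral_eq_lintegral_ofReal]
  · have := integral_exp_mul_Ioi (a := -V) (by linarith) 0
    simp only [neg_mul] at this
    rw [this]
    rw [← ofReal_mul hV.le]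
    simp [hV.ne']
  · have := exp_neg_integrableOn_Ioi 0 hV
    simpa [IntegrableOn] using this
  · filter_upwards with r; positivity

/-- Resolvent equation. -/
lemma pot_eq (hk : SymmSemigroup k) (hf : ∀ y, Measurable fun s => f s y) {V : ℝ} (hV : 0 < V)
    (s : ℝ) (y : H) :
    pot k f s y = resW k (expW V) f s y + ofReal V * resW k (expW V) (pot k f) s y := by
  have h1 : resW k (expW V) (pot k f) s y =
      ∫⁻ v in Ioi (0:ℝ), (∫⁻ r in Ioo 0 v, expW V r) * avg k v (f (s + v)) y := by
    rw [← lintegral_triangle (measurable_expW V) (measurable_resW_aux hk hf y s), resW]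
    refine setLIntegral_congr_fun measurableSet_Ioi fun r hr => ?_
    rw [pot, avg_resW hk measurable_const hf (le_of_lt hr), ← lintegral_const_mul]
    · simp only [one_mul, add_assoc]
    · refine measurable_const.mul (measurable_avg hk (F := fun u => f (s + r + u)) (fun y => ?_) ?_ y)
      · exact (hf y).comp (measurable_const_add _)
      · exact measurable_const_add _
  have hm : Measurable fun v => ofReal V * ((∫⁻ r in Ioo 0 v, expW V r) * avg k v (f (s + v)) y) := by
    refine measurable_const.mul (Measurable.mul ?_ (measurable_resW_aux hk hf y s))
    have : Monotone fun v : ℝ => ∫⁻ r in Ioo 0 v, expW V r := fun a b hab =>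
      lintegral_mono_set (Set.Ioo_subset_Ioo_right hab)
    exact this.measurable
  rw [h1, ← lintegral_const_mul' _ _ ofReal_ne_top, resW, ← lintegral_add_right _ hm, pot, resW]
  refine setLIntegral_congr_fun measurableSet_Ioi fun v hv => ?_
  -- Survival and death probabilities at age v add up: e^{-Vv} + (1 - e^{-Vv}) = 1, the weight of G.
  rw [← mul_assoc, lintegral_expW_Ioo hV (le_of_lt hv), expW, ← add_mul,
    ← ofReal_add (by positivity)]
  · simp
  · rw [sub_nonneg, exp_le_one_iff]
    have : 0 < V * v := mul_pos hV hv
    linarith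

lemma tsum_resW (hk : SymmSemigroup k) (hw : Measurable w) (hf : ∀ y, Measurable fun s => f s y)
    (s : ℝ) : ∑' y, resW k w f s y = ∫⁻ r in Ioi (0:ℝ), w r * ∑' y, f (s + r) y := by
  unfold resW
  rw [← lintegral_tsum fun y => (measurable_resW_integrand hk hw hf y s).aemeasurable]
  refine setLIntegral_congr_fun measurableSet_Ioi fun r hr => ?_
  rw [ENNReal.tsum_mul_left, tsum_avg hk (le_of_lt hr)]

lemma lintegral_tsum_resW_le (hk : SymmSemigroup k) (hw : Measurable w)
    (hf : ∀ y, Measurable fun s => f s y) :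
    ∫⁻ s in Ioi (0:ℝ), ∑' y, resW k w f s y ≤
      (∫⁻ r in Ioi (0:ℝ), w r) * ∫⁻ s in Ioi (0:ℝ), ∑' y, f s y := by
  have hm : Measurable fun s => ∑' y, f s y := Measurable.tsum hf
  simp_rw [tsum_resW hk hw hf]
  rw [lintegral_lintegral_swap, ← lintegral_mul_const _ hw]
  · refine setLIntegral_mono' measurableSet_Ioi fun r hr => ?_
    rw [lintegral_const_mul (f := fun s => ∑' y, f (s + r) y) _ (hm.comp (measurable_add_const r))]
    refine mul_le_mul' le_rfl ?_
    simp_rw [add_comm _ r]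
    rw [lintegral_Ioi_shift (fun v => ∑' y, f v y)]
    exact lintegral_mono_set (Set.Ioi_subset_Ioi (le_of_lt hr))
  · apply Measurable.aemeasurable
    exact (hw.comp measurable_snd).mul (hm.comp (measurable_fst.add measurable_snd))

/-- Iterating the renewal inequality `u (n+1) ≥ R f + V R (u n)` exhausts the potential of `f`. -/
lemma pot_le_iterate (hk : SymmSemigroup k) (hf : ∀ y, Measurable fun s => f s y) {V : ℝ}
    (hV : 0 < V) {C : ℝ≥0∞} {T : ℝ}
    (hC : ∀ s y, pot k f s y ≤ C * ofReal (rexp (V * (T - s)))) {ι : Type*}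
    {u : ℕ → ι → ℝ → H → ℝ≥0∞} {ch : Bool → ι → ι}
    (hu : ∀ n i s y, resW k (expW V) f s y + ofReal V *
      resW k (expW V) (fun s y => 2⁻¹ * (u n (ch false i) s y + u n (ch true i) s y)) s y ≤ u (n+1) i s y)
    (n : ℕ) (i : ι) (s : ℝ) (y : H) :
    pot k f s y ≤ u n i s y + C * 2⁻¹ ^ n * ofReal (rexp (V * (T - s))) := by
  -- The operator V R has mass one, so it does not contract constants. It does halve e^{V(T-s)},
  -- because V ∫ e^{-2Vr} dr = 1/2, and this weight makes the iteration error geometric.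
  have hres : ∀ s y, ofReal V * resW k (expW V)
      (fun s _ => ofReal (rexp (V * (T - s)))) s y =
      2⁻¹ * ofReal (rexp (V * (T - s))) := by
    intro s y
    have : ∀ r ∈ Ioi (0:ℝ), expW V r * avg k r (fun _ => ofReal (rexp (V * (T - (s+r))))) y =
        expW (2 * V) r * ofReal (rexp (V * (T - s))) := by
      intro r hr
      rw [avg_const hk (le_of_lt hr), expW, expW, ← ofReal_mul (by positivity),
        ← ofReal_mul (by positivity), ← exp_add, ← exp_add]
      congr 2; ring
    rw [resW, setLIntegral_congr_fun measurableSet_Ioi this, lintegral_mul_const _ (measurable_expW _),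
      ← mul_assoc]
    congr 1
    have h2 := lintegral_expW (V := 2 * V) (by positivity)
    rw [ofReal_mul (by norm_num), mul_assoc] at h2
    simp only [ENNReal.ofReal_ofNat] at h2
    rw [ENNReal.eq_inv_of_mul_eq_one_left (a := ofReal V * ∫⁻ r in Ioi (0:ℝ), expW (2 * V) r)]
    rw [mul_comm]; exact h2
  induction n generalizing i s y with
  | zero => simpa using (hC s y).trans le_add_self
  | succ n ih =>
    rw [pot_eq hk hf hV]
    refine le_trans ?_ (add_le_add_left (hu n i s y) _)
    rw [add_assoc]
    gcongr
    have hexpm : ∀ y : H, Measurable fun s : ℝ => ofReal (rexp (V * (T - s))) := by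
      intro y; fun_prop
    have h2 : C * 2⁻¹ ^ (n+1) * ofReal (rexp (V * (T - s))) = ofReal V * resW k (expW V)
        (fun s _ => C * 2⁻¹ ^ n * ofReal (rexp (V * (T - s)))) s y := by
      rw [resW_const_mul hk (measurable_expW V) hexpm, mul_left_comm, hres, pow_succ]; ring
    rw [h2, ← mul_add]
    gcongr
    rw [add_comm, ← resW_add hk (measurable_expW V) (fun y => (hexpm y).const_mul _)]
    refine resW_mono (fun _ _ => le_rfl) (fun s y => ?_) s y
    have ha := ih (ch false i) s y
    have hb := ih (ch true i) s y
    calc pot k f s y = 2⁻¹ * (pot k f s y + pot k f s y) := by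
          rw [← two_mul, ← mul_assoc, ENNReal.inv_mul_cancel (by norm_num) (by norm_num), one_mul]
      _ ≤ 2⁻¹ * ((u n (ch false i) s y + C * 2⁻¹ ^ n * ofReal (rexp (V * (T - s)))) +
          (u n (ch true i) s y + C * 2⁻¹ ^ n * ofReal (rexp (V * (T - s))))) := by
          gcongr
      _ = _ := by
          have h3 : ∀ a b e : ℝ≥0∞, 2⁻¹ * ((a + e) + (b + e)) = e + 2⁻¹ * (a + b) := by
            intro a b e
            have : (a + e) + (b + e) = (a + b) + 2 * e := by ring
            rw [this, mul_add, ← mul_assoc 2⁻¹ 2 e, ENNReal.inv_mul_cancel (by norm_num) (by norm_num),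
              one_mul, add_comm]
          rw [h3]

end Semigroup

/-! ### Freezing an independent random variable -/

section Substitution

variable {Ω α β : Type*} [mΩ : MeasurableSpace Ω] [MeasurableSpace α] [MeasurableSpace β]
  {P : Measure Ω} [IsProbabilityMeasure P]

lemma lintegral_subst_of_indepFun {X : Ω → α} {Y : Ω → β} (hX : Measurable X) (hY : Measurable Y)
    (h : IndepFun X Y P) {f : α → β → ℝ≥0∞} (hf : Measurable (Function.uncurry f)) :
    ∫⁻ ω, f (X ω) (Y ω) ∂P = ∫⁻ ω, ∫⁻ ω', f (X ω) (Y ω') ∂P ∂P := by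
  have h1 := (indepFun_iff_map_prod_eq_prod_map_map hX.aemeasurable hY.aemeasurable).1 h
  have h2 : ∫⁻ ω, f (X ω) (Y ω) ∂P = ∫⁻ z, Function.uncurry f z ∂(P.map fun ω => (X ω, Y ω)) := by
    rw [lintegral_map hf (hX.prodMk hY)]; rfl
  rw [h2, h1, lintegral_prod _ hf.aemeasurable, lintegral_map hf.lintegral_prod_right' hX]
  refine lintegral_congr fun ω => ?_
  exact lintegral_map (f := fun y => Function.uncurry f (X ω, y)) (hf.comp measurable_prodMk_left) hY

/-- Integration with a frozen value: if `X` is independent of the random field `f`, it may be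
substituted after integrating the field. -/
lemma lintegral_subst_of_indep {m1 m2 : MeasurableSpace Ω} (h1 : m1 ≤ mΩ) (h2 : m2 ≤ mΩ)
    (h : Indep m1 m2 P) {X : Ω → α} (hX : Measurable[m1] X) {f : α → Ω → ℝ≥0∞}
    (hf : @Measurable (α × Ω) ℝ≥0∞ (@Prod.instMeasurableSpace α Ω _ m2) _ (Function.uncurry f)) :
    ∫⁻ ω, f (X ω) ω ∂P = ∫⁻ ω, ∫⁻ ω', f (X ω) ω' ∂P ∂P := by
  refine @lintegral_subst_of_indepFun Ω α Ω mΩ _ m2 P _ X id (hX.mono h1 le_rfl)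
    (measurable_id.mono h2 le_rfl) ?_ f hf
  rw [IndepFun_iff_Indep]
  rw [MeasurableSpace.comap_id]
  exact indep_of_indep_of_le_left h hX.comap_le

end Substitution

/-! ### The transition kernel of the walk as a convolution semigroup -/

section WalkLaw

variable {M : ℕ} {c : ℝ} {Ω : Type*} [MeasurableSpace Ω] {P : Measure Ω} [IsProbabilityMeasure P]
  {Z : ℝ≥0 → Ω → HierGroup M}

/-- The transition probabilities of the `c`-random walk as an extended nonnegative kernel. -/
def tkernel (M : ℕ) (c : ℝ) (r : ℝ) (z : HierGroup M) : ℝ≥0∞ := ofReal (transProb M c r z)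

lemma IsCRandomWalk.measure_sub_eq (h : IsCRandomWalk M c Z P) {s t : ℝ≥0} (hst : s ≤ t)
    (y : HierGroup M) : P {ω | Z t ω - Z s ω = y} = tkernel M c ((t:ℝ) - s) y := by
  rw [tkernel, ← h.law_incr s t hst y, ofReal_measureReal]

lemma IsCRandomWalk.measure_eq (h : IsCRandomWalk M c Z P) (t : ℝ≥0) (y : HierGroup M) :
    P {ω | Z t ω = y} = tkernel M c t y := by
  have := h.measure_sub_eq (zero_le (a := t)) y
  simpa [h.start] using this


lemma lintegral_comp_countable {H : Type*} [Countable H] [MeasurableSpace H]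
    [DiscreteMeasurableSpace H] {X : Ω → H} (hX : Measurable X) (f : H → ℝ≥0∞) :
    ∫⁻ ω, f (X ω) ∂P = ∑' y, P {ω | X ω = y} * f y := by
  rw [← lintegral_map (measurable_of_countable f) hX, lintegral_countable']
  refine tsum_congr fun y => ?_
  rw [Measure.map_apply hX (measurableSet_singleton y), mul_comm]; rfl

lemma lintegral_ite_eq {H : Type*} [MeasurableSpace H] [MeasurableSingletonClass H] [DecidableEq H]
    {X : Ω → H} (hX : Measurable X) (y : H) :
    ∫⁻ ω, (if X ω = y then (1:ℝ≥0∞) else 0) ∂P = P {ω | X ω = y} := by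
  have h : MeasurableSet {ω | X ω = y} := hX (measurableSet_singleton y)
  rw [← lintegral_indicator_one h]
  refine lintegral_congr fun ω => ?_
  simp [indicator]

/-- Total mass and Chapman–Kolmogorov are read off from the given process through its independent
increments. Symmetry and the maximum at the origin come from the spectral formula. -/
lemma tkernel_symmSemigroup [NeZero M] (hM : 1 < M) (hc : 1 ≤ c) (hcM : c < M)
    (h : IsCRandomWalk M c Z P) : SymmSemigroup (tkernel M c) where
  measurable z := (measurable_transProb hM hc hcM z).ennreal_ofReal
  tsum_eq_one r hr := by
    lift r to ℝ≥0 using hr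
    have h1 := lintegral_comp_countable (P := P) (h.measurable_eval r) (fun _ => 1)
    simp only [lintegral_const, measure_univ, mul_one, h.measure_eq] at h1
    exact h1.symm
  conv r s hr hs y := by
    lift r to ℝ≥0 using hr
    lift s to ℝ≥0 using hs
    have hi := h.indep_incr.indepFun_eval_sub (r := 0) (s := r) (t := (r + s))
      zero_le le_self_add
      (Filter.Eventually.of_forall h.start)
    have hle : r ≤ r + s := le_self_add
    have hX := h.measurable_eval r
    have hY : Measurable (Z (r + s) - Z r) :=
      (measurable_of_countable (fun p : HierGroup M × HierGroup M => p.1 - p.2)).comp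
        ((h.measurable_eval (r + s)).prodMk hX)
    have h1 := lintegral_subst_of_indepFun hX hY hi
      (f := fun x x' => if x + x' = y then (1:ℝ≥0∞) else 0) (measurable_of_countable _)
    have h2 : ∀ x : HierGroup M, ∫⁻ ω', (if x + (Z (r + s) - Z r) ω' = y
        then (1:ℝ≥0∞) else 0) ∂P = tkernel M c s (y - x) := by
      intro x
      have h3 := h.measure_sub_eq hle (y - x)
      have h4 : (((r + s : ℝ≥0) : ℝ) : ℝ) - (r : ℝ≥0) = s := by simp
      rw [h4] at h3
      have h6 := lintegral_ite_eq (P := P) hY (y - x)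
      simp only [Pi.sub_apply] at h6
      rw [← h3, ← h6]
      refine lintegral_congr fun ω => ?_
      simp only [Pi.sub_apply, eq_sub_iff_add_eq, add_comm x]
    simp_rw [h2] at h1
    rw [lintegral_comp_countable hX (fun x => tkernel M c s (y - x))] at h1
    simp_rw [h.measure_eq] at h1
    rw [← h1]
    have h5 := h.measure_eq (r + s) y
    rw [NNReal.coe_add] at h5
    rw [← h5, ← lintegral_ite_eq (h.measurable_eval _)]
    refine lintegral_congr fun ω => ?_
    simp
  neg r z := by rw [tkernel, tkernel, transProb_neg hM hc hcM]
  le_zero r hr z := ofReal_le_ofReal (transProb_le_zero hM hc hcM hr z)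

end WalkLaw

/-! ### Joint measurability of random space-time fields -/

section Fields

variable {H : Type*} [AddCommGroup H] [Countable H] [MeasurableSpace H] [DiscreteMeasurableSpace H]

lemma measurable_add_countable {α : Type*} [MeasurableSpace α] {f g : α → H} (hf : Measurable f)
    (hg : Measurable g) : Measurable fun x => f x + g x :=
  (measurable_of_countable (fun p : H × H => p.1 + p.2)).comp (hf.prodMk hg)

/-- A right-continuous process in a countable discrete space is jointly measurable. -/
lemma measurable_uncurry_of_right_cont {Ω : Type*} [MeasurableSpace Ω] {w : ℝ≥0 → Ω → H}
    (hm : ∀ t, Measurable (w t)) (hrc : ∀ ω t, ∀ᶠ s in 𝓝[>] t, w s ω = w t ω) :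
    Measurable fun p : ℝ≥0 × Ω => w p.1 p.2 := by
  -- Dyadic approximations from the right. The `+ 1` keeps them strictly above t, as required by
  -- convergence in the punctured right neighbourhood.
  let q : ℕ → ℝ≥0 → ℝ≥0 := fun k t => ((⌊t * 2 ^ k⌋₊ : ℝ≥0) + 1) / 2 ^ k
  have hq1 : ∀ k t, t < q k t := fun k t => by
    rw [lt_div_iff₀ (by positivity)]; exact Nat.lt_floor_add_one _
  have hq2 : ∀ k t, q k t ≤ t + (2⁻¹) ^ k := fun k t => by
    rw [div_le_iff₀ (by positivity), add_mul, inv_pow, inv_mul_cancel₀ (by positivity)]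
    gcongr
    exact floor_le (by positivity)
  have hq3 : ∀ t, Tendsto (fun k => q k t) atTop (𝓝[>] t) := fun t => by
    rw [tendsto_nhdsWithin_iff]
    refine ⟨?_, Eventually.of_forall fun k => hq1 k t⟩
    refine tendsto_of_tendsto_of_tendsto_of_le_of_le tendsto_const_nhds ?_ (fun k => (hq1 k t).le)
      (fun k => hq2 k t)
    have : Tendsto (fun k : ℕ => (2⁻¹ : ℝ≥0) ^ k) atTop (𝓝 0) :=
      NNReal.tendsto_pow_atTop_nhds_zero_of_lt_one (by rw [← NNReal.coe_lt_coe]; norm_num)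
    simpa using this.const_add t
  have hwc : ∀ a : ℝ≥0, Measurable fun p : ℝ≥0 × Ω => w (((⌊p.1 * a⌋₊ : ℝ≥0) + 1) / a) p.2 := by
    intro a
    have h1 : Measurable fun p : ℕ × Ω => w (((p.1 : ℝ≥0) + 1) / a) p.2 :=
      measurable_from_prod_countable_right fun n => hm (((n : ℝ≥0) + 1) / a)
    have h2 : Measurable fun p : ℝ≥0 × Ω => (⌊p.1 * a⌋₊, p.2) :=
      (Nat.measurable_floor.comp (measurable_fst.mul_const a)).prodMk measurable_snd
    have h3 := h1.comp h2
    simp only [Function.comp_def] at h3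
    exact h3
  have hwq : ∀ k, Measurable fun p : ℝ≥0 × Ω => w (q k p.1) p.2 := fun k => hwc (2 ^ k)
  refine measurable_to_countable' fun y => ?_
  have : (fun p : ℝ≥0 × Ω => w p.1 p.2) ⁻¹' {y} =
      ⋃ K, ⋂ k ≥ K, (fun p : ℝ≥0 × Ω => w (q k p.1) p.2) ⁻¹' {y} := by
    ext ⟨t, ω⟩
    have hev : ∀ᶠ k in atTop, w (q k t) ω = w t ω := (hq3 t).eventually (hrc ω t)
    simp only [Set.mem_preimage, Set.mem_singleton_iff, mem_iUnion, Set.mem_iInter]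
    obtain ⟨K, hK⟩ := eventually_atTop.1 hev
    constructor
    · intro h; exact ⟨K, fun k hk => (hK k hk).trans h⟩
    · rintro ⟨K', hK'⟩
      rw [← hK (max K K') (le_max_left _ _)]
      exact hK' _ (le_max_right _ _)
  rw [this]
  exact MeasurableSet.iUnion fun K => MeasurableSet.iInter fun k => MeasurableSet.iInter fun _ =>
    hwq k (measurableSet_singleton y)

/-- Joint measurability of a random space-time field with respect to a `σ`-algebra on the
probability space. -/
def FieldMeas {Ω : Type*} (m : MeasurableSpace Ω) (X : ℝ → H → Ω → ℝ≥0∞) : Prop :=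
  @Measurable ((ℝ × H) × Ω) ℝ≥0∞ (@Prod.instMeasurableSpace (ℝ × H) Ω _ m) _
    (fun q => X q.1.1 q.1.2 q.2)

variable {Ω : Type*}

lemma FieldMeas.mono {m m' : MeasurableSpace Ω} {X : ℝ → H → Ω → ℝ≥0∞} (h : FieldMeas m X)
    (hm : m ≤ m') : FieldMeas m' X := by
  unfold FieldMeas at *
  refine Measurable.mono h ?_ le_rfl
  exact sup_le_sup le_rfl (MeasurableSpace.comap_mono hm)

lemma FieldMeas.mul {m : MeasurableSpace Ω} {X Y : ℝ → H → Ω → ℝ≥0∞} (h : FieldMeas m X)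
    (h' : FieldMeas m Y) : FieldMeas m fun s y ω => X s y ω * Y s y ω := by
  unfold FieldMeas at *
  exact Measurable.mul h h'

lemma FieldMeas.add {m : MeasurableSpace Ω} {X Y : ℝ → H → Ω → ℝ≥0∞} (h : FieldMeas m X)
    (h' : FieldMeas m Y) : FieldMeas m fun s y ω => X s y ω + Y s y ω := by
  unfold FieldMeas at *
  exact Measurable.add h h'

lemma FieldMeas.pow {m : MeasurableSpace Ω} {X : ℝ → H → Ω → ℝ≥0∞} (h : FieldMeas m X) (n : ℕ) :
    FieldMeas m fun s y ω => X s y ω ^ n := by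
  unfold FieldMeas at *
  exact Measurable.pow_const h n

lemma FieldMeas.eval {m : MeasurableSpace Ω} {X : ℝ → H → Ω → ℝ≥0∞} (h : FieldMeas m X) (s : ℝ)
    (y : H) : Measurable[m] (X s y) :=
  Measurable.comp (f := fun ω => ((s, y), ω)) h measurable_prodMk_left

lemma FieldMeas.lintegral {m : MeasurableSpace Ω} {X : ℝ → H → Ω → ℝ≥0∞} (h : FieldMeas m X)
    (μ : Measure Ω) [SFinite μ] (y : H) : Measurable fun s => ∫⁻ ω, X s y ω ∂μ := by
  have h1 : Measurable fun q : (ℝ × H) × Ω => X q.1.1 q.1.2 q.2 := h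
  exact (h1.lintegral_prod_right' (ν := μ)).comp (measurable_id.prodMk measurable_const)

/-- Occupation functional of a single particle started at time `s` at `y`. -/
def occ (Φ : ℝ → H → ℝ≥0∞) (life : Ω → ℝ) (walk : ℝ≥0 → Ω → H) (s : ℝ) (y : H) (ω : Ω) : ℝ≥0∞ :=
  ∫⁻ r in Ioi (0:ℝ), if r < life ω then Φ (s + r) (y + walk r.toNNReal ω) else 0

/-- One branching step: occupation of the particle, then the fields of its two children if it
splits. -/
def branchStep (Φ : ℝ → H → ℝ≥0∞) (life : Ω → ℝ) (split : Ω → Bool) (walk : ℝ≥0 → Ω → H)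
    (X₀ X₁ : ℝ → H → Ω → ℝ≥0∞) (s : ℝ) (y : H) (ω : Ω) : ℝ≥0∞ :=
  occ Φ life walk s y ω + if split ω then
    X₀ (s + life ω) (y + walk (life ω).toNNReal ω) ω +
    X₁ (s + life ω) (y + walk (life ω).toNNReal ω) ω else 0

lemma measurable_uncurry_field {Φ : ℝ → H → ℝ≥0∞} (hΦ : ∀ y, Measurable fun s => Φ s y) :
    Measurable fun p : ℝ × H => Φ p.1 p.2 :=
  measurable_from_prod_countable_left fun y => hΦ y

lemma measurable_occ_integrand [m : MeasurableSpace Ω] {Φ : ℝ → H → ℝ≥0∞}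
    (hΦ : ∀ y, Measurable fun s => Φ s y) {life : Ω → ℝ} {walk : ℝ≥0 → Ω → H}
    (hl : Measurable life) (hw : Measurable fun p : ℝ≥0 × Ω => walk p.1 p.2) :
    Measurable fun q : ((ℝ × H) × Ω) × ℝ => if q.2 < life q.1.2 then
      Φ (q.1.1.1 + q.2) (q.1.1.2 + walk q.2.toNNReal q.1.2) else 0 := by
  refine Measurable.ite (measurableSet_lt measurable_snd (by fun_prop)) ?_ measurable_const
  refine (measurable_uncurry_field hΦ).comp (Measurable.prodMk (by fun_prop) ?_)
  refine measurable_add_countable (by fun_prop) ?_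
  exact hw.comp (Measurable.prodMk (by fun_prop) (by fun_prop))

lemma fieldMeas_occ [m : MeasurableSpace Ω] {Φ : ℝ → H → ℝ≥0∞}
    (hΦ : ∀ y, Measurable fun s => Φ s y) {life : Ω → ℝ} {walk : ℝ≥0 → Ω → H}
    (hl : Measurable life) (hw : Measurable fun p : ℝ≥0 × Ω => walk p.1 p.2) :
    FieldMeas m (occ Φ life walk) := by
  unfold FieldMeas occ
  exact Measurable.lintegral_prod_right' (measurable_occ_integrand hΦ hl hw)

lemma FieldMeas.end [m : MeasurableSpace Ω] {life : Ω → ℝ} {walk : ℝ≥0 → Ω → H}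
    {X : ℝ → H → Ω → ℝ≥0∞} (hX : FieldMeas m X)
    (hl : Measurable life) (hw : Measurable fun p : ℝ≥0 × Ω => walk p.1 p.2) :
    FieldMeas m fun s y ω => X (s + life ω) (y + walk (life ω).toNNReal ω) ω := by
  unfold FieldMeas at *
  refine Measurable.comp (g := fun q : (ℝ × H) × Ω => X q.1.1 q.1.2 q.2)
    (f := fun q : (ℝ × H) × Ω => ((q.1.1 + life q.2, q.1.2 + walk (life q.2).toNNReal q.2), q.2)) hX ?_
  refine Measurable.prodMk (Measurable.prodMk (by fun_prop) ?_) measurable_snd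
  refine measurable_add_countable (by fun_prop) ?_
  exact hw.comp (Measurable.prodMk (by fun_prop) (by fun_prop))

lemma FieldMeas.ite_split [m : MeasurableSpace Ω] {split : Ω → Bool} {X : ℝ → H → Ω → ℝ≥0∞}
    (hX : FieldMeas m X) (hs : Measurable split) :
    FieldMeas m fun s y ω => if split ω then X s y ω else 0 := by
  unfold FieldMeas at *
  refine Measurable.ite ?_ hX measurable_const
  exact (hs.comp measurable_snd) (measurableSet_singleton true)

lemma fieldMeas_branchStep [m : MeasurableSpace Ω] {Φ : ℝ → H → ℝ≥0∞}
    (hΦ : ∀ y, Measurable fun s => Φ s y) {life : Ω → ℝ} {split : Ω → Bool} {walk : ℝ≥0 → Ω → H}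
    (hl : Measurable life) (hs : Measurable split)
    (hw : Measurable fun p : ℝ≥0 × Ω => walk p.1 p.2) {X₀ X₁ : ℝ → H → Ω → ℝ≥0∞}
    (h₀ : FieldMeas m X₀) (h₁ : FieldMeas m X₁) :
    FieldMeas m (branchStep Φ life split walk X₀ X₁) :=
  (fieldMeas_occ hΦ hl hw).add (((h₀.add h₁).end hl hw).ite_split hs)

end Fields

/-! ### Exponential lifetimes -/

section Exponential

lemma lintegral_expMeasure (V : ℝ) {ψ : ℝ → ℝ≥0∞} (hψ : Measurable ψ) : ∫⁻ l, ψ l ∂(expMeasure V) =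
      ∫⁻ r in Ioi (0:ℝ), ofReal (V * rexp (-(V * r))) * ψ r := by
  have h1 : expMeasure V = volume.withDensity (exponentialPDF V) := rfl
  have hm : Measurable (exponentialPDF V) := (measurable_exponentialPDFReal V).ennreal_ofReal
  rw [h1, lintegral_withDensity_eq_lintegral_mul _ hm hψ, ← lintegral_indicator measurableSet_Ioi]
  have h0 : ∀ᵐ r : ℝ, r ≠ 0 := by
    simp [ae_iff]
  refine lintegral_congr_ae ?_
  filter_upwards [h0] with r hr
  simp only [Pi.mul_apply, indicator, mem_Ioi]
  split_ifs with h
  · rw [exponentialPDF_of_nonneg h.le]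
  · rw [exponentialPDF_of_neg (lt_of_le_of_ne (not_lt.1 h) hr), zero_mul]

/-- `E[ψ(L); L > r]` for an exponential variable `L`. -/
def tailW (V : ℝ) (ψ : ℝ → ℝ≥0∞) (r : ℝ) : ℝ≥0∞ :=
  ∫⁻ l, (if r < l then ψ l else 0) ∂(expMeasure V)

lemma measurable_tailW {V : ℝ} (hV : 0 < V) {ψ : ℝ → ℝ≥0∞} (hψ : Measurable ψ) :
    Measurable (tailW V ψ) := by
  have := isProbabilityMeasure_expMeasure hV
  unfold tailW
  refine Measurable.lintegral_prod_right' (f := fun p : ℝ × ℝ => if p.1 < p.2 then ψ p.2 else 0) ?_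
  exact Measurable.ite (measurableSet_lt measurable_fst measurable_snd) (hψ.comp measurable_snd)
    measurable_const

lemma ofReal_mul_lintegral_expW_Ioi {V : ℝ} (hV : 0 < V) (r : ℝ) :
    ofReal V * ∫⁻ v in Ioi r, expW V v = expW V r := by
  rw [← lintegral_Ioi_shift]
  have : ∀ u, expW V (r + u) = expW V r * expW V u := by
    intro u
    rw [expW, expW, expW, ← ofReal_mul (exp_pos _).le, ← exp_add]
    congr 2; ring
  simp_rw [this]
  rw [lintegral_const_mul _ (measurable_expW V), mul_left_comm, lintegral_expW hV, mul_one]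

lemma tailW_one {V : ℝ} (hV : 0 < V) {r : ℝ} (hr : 0 < r) : tailW V (fun _ => 1) r = expW V r := by
  rw [tailW, lintegral_expMeasure V (Measurable.ite measurableSet_Ioi measurable_const measurable_const),
    ← ofReal_mul_lintegral_expW_Ioi hV, ← lintegral_const_mul _ (measurable_expW V),
    ← lintegral_indicator measurableSet_Ioi, ← lintegral_indicator measurableSet_Ioi]
  refine lintegral_congr fun l => ?_
  by_cases h : r < l
  · simp [indicator, h, hr.trans h, expW, ofReal_mul hV.le]
  · simp [indicator, h]

end Exponential

section FieldAux

variable {H : Type*} [AddCommGroup H] [Countable H] [MeasurableSpace H] [DiscreteMeasurableSpace H]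
  {Ω : Type*} {m : MeasurableSpace Ω} {life : Ω → ℝ} {split : Ω → Bool} {walk : ℝ≥0 → Ω → H}

lemma measurable_uncurry_walk {h : ℝ → H → ℝ≥0∞} (hh : ∀ y, Measurable fun s => h s y)
    (hw : Measurable fun p : ℝ≥0 × Ω => walk p.1 p.2) (s : ℝ) (y : H) :
    Measurable (Function.uncurry fun (l : ℝ) ω => h (s + l) (y + walk l.toNNReal ω)) := by
  refine (measurable_uncurry_field hh).comp (Measurable.prodMk (by fun_prop) ?_)
  refine measurable_add_countable (by fun_prop) ?_
  exact Measurable.comp hw (Measurable.prodMk (by fun_prop) measurable_snd)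

lemma measurable_time_place (hl : Measurable life)
    (hw : Measurable fun p : ℝ≥0 × Ω => walk p.1 p.2) (s : ℝ) (y : H) :
    Measurable fun ω => (s + life ω, y + walk (life ω).toNNReal ω) := by
  refine Measurable.prodMk (by fun_prop) (measurable_add_countable (by fun_prop) ?_)
  exact Measurable.comp hw (Measurable.prodMk (by fun_prop) measurable_id)

lemma measurable_uncurry_split {X : ℝ → H → Ω → ℝ≥0∞} (hX : FieldMeas m X)
    (hs : Measurable split) :
    Measurable (Function.uncurry fun (x : ℝ≥0∞ × (ℝ × H)) ω =>
      x.1 * (if split ω then X x.2.1 x.2.2 ω else 0)) := by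
  have h3 := hX.ite_split hs
  have h4 : Measurable fun q : (ℝ≥0∞ × (ℝ × H)) × Ω =>
      (if split q.2 then X q.1.2.1 q.1.2.2 q.2 else 0) :=
    Measurable.comp (f := fun q : (ℝ≥0∞ × (ℝ × H)) × Ω => (q.1.2, q.2)) h3
      (Measurable.prodMk (by fun_prop) measurable_snd)
  exact Measurable.mul (by fun_prop) h4

end FieldAux

/-! ### One branching event: independence and factorization -/

section Forest

variable {H : Type*} [AddCommGroup H] [Countable H] [MeasurableSpace H] [DiscreteMeasurableSpace H]
  {ι Ω : Type*} [mΩ : MeasurableSpace Ω]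

/-- The `σ`-algebra of the motion and the lifetime of a particle. -/
@[reducible] def motionSigma (life : Ω → ℝ) (walk : ℝ≥0 → Ω → H) : MeasurableSpace Ω :=
  MeasurableSpace.comap life inferInstance ⊔ ⨆ t, MeasurableSpace.comap (walk t) inferInstance

/-- Independence structure and laws of a forest of particles with critical binary branching, where
`F p` is a `σ`-algebra carrying the randomness of `p` and all its descendants. -/
structure IsBranching (k : ℝ → H → ℝ≥0∞) (V : ℝ) (P : Measure Ω) (ch : Bool → ι → ι)
    (life : ι → Ω → ℝ) (split : ι → Ω → Bool) (walk : ι → ℝ≥0 → Ω → H)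
    (F : ι → MeasurableSpace Ω) : Prop where
  semigroup : SymmSemigroup k
  V_pos : 0 < V
  le : ∀ p, F p ≤ mΩ
  child_le : ∀ b p, F (ch b p) ≤ F p
  life_meas : ∀ p, Measurable[F p] (life p)
  split_meas : ∀ p, Measurable[F p] (split p)
  walk_meas : ∀ p t, Measurable[F p] (walk p t)
  right_cont : ∀ p ω t, ∀ᶠ s in 𝓝[>] t, walk p s ω = walk p t ω
  indep_motion : ∀ p, Indep (motionSigma (life p) (walk p))
    (MeasurableSpace.comap (split p) inferInstance ⊔ (F (ch false p) ⊔ F (ch true p))) P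
  indep_split : ∀ p, Indep (MeasurableSpace.comap (split p) inferInstance)
    (F (ch false p) ⊔ F (ch true p)) P
  indep_children : ∀ p, Indep (F (ch false p)) (F (ch true p)) P
  indep_life : ∀ p, Indep (MeasurableSpace.comap (life p) inferInstance)
    (⨆ t, MeasurableSpace.comap (walk p t) inferInstance) P
  life_law : ∀ p, P.map (life p) = expMeasure V
  split_law : ∀ p, P {ω | split p ω = true} = 2⁻¹
  walk_law : ∀ p (t : ℝ≥0) y, P {ω | walk p t ω = y} = k t y

namespace IsBranching

variable {k : ℝ → H → ℝ≥0∞} {V : ℝ} {P : Measure Ω} [IsProbabilityMeasure P] {ch : Bool → ι → ι}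
  {life : ι → Ω → ℝ} {split : ι → Ω → Bool} {walk : ι → ℝ≥0 → Ω → H} {F : ι → MeasurableSpace Ω}
  {Φ : ℝ → H → ℝ≥0∞}

/-- Stated for every σ-algebra containing the path, because the factorizations need measurability
relative to the particle's own σ-algebra and not only to the ambient one. -/
lemma measurable_walk_joint (hB : IsBranching k V P ch life split walk F) (p : ι) :
    ∀ m : MeasurableSpace Ω, (⨆ t, MeasurableSpace.comap (walk p t) inferInstance) ≤ m →
    @Measurable (ℝ≥0 × Ω) H (@Prod.instMeasurableSpace ℝ≥0 Ω _ m) _ (fun q => walk p q.1 q.2) := by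
  have hrc := hB.right_cont p
  intro m hm
  exact measurable_uncurry_of_right_cont (fun t => (@measurable_iff_comap_le Ω H m _ (walk p t)).2
    ((le_iSup (fun t => MeasurableSpace.comap (walk p t) inferInstance) t).trans hm)) hrc

lemma walk_le (hB : IsBranching k V P ch life split walk F) (p : ι) :
    (⨆ t, MeasurableSpace.comap (walk p t) inferInstance) ≤ F p :=
  iSup_le fun t => (hB.walk_meas p t).comap_le

lemma motion_le (hB : IsBranching k V P ch life split walk F) (p : ι) :
    motionSigma (life p) (walk p) ≤ F p :=
  sup_le (hB.life_meas p).comap_le (hB.walk_le p)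

lemma measurable_life (hB : IsBranching k V P ch life split walk F) (p : ι) :
    Measurable (life p) := (hB.life_meas p).mono (hB.le p) le_rfl

lemma measurable_split (hB : IsBranching k V P ch life split walk F) (p : ι) :
    Measurable (split p) := (hB.split_meas p).mono (hB.le p) le_rfl

lemma measurable_walk (hB : IsBranching k V P ch life split walk F) (p : ι) (t : ℝ≥0) :
    Measurable (walk p t) := (hB.walk_meas p t).mono (hB.le p) le_rfl

lemma lintegral_walk (hB : IsBranching k V P ch life split walk F) (p : ι) (t : ℝ≥0) (f : H → ℝ≥0∞)
    (y : H) : ∫⁻ ω, f (y + walk p t ω) ∂P = avg k t f y := by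
  rw [lintegral_comp_countable (f := fun z => f (y + z)) (hB.measurable_walk p t), avg]
  simp_rw [hB.walk_law]

lemma lintegral_life (hB : IsBranching k V P ch life split walk F) (p : ι) {ψ : ℝ → ℝ≥0∞}
    (hψ : Measurable ψ) : ∫⁻ ω, ψ (life p ω) ∂P = ∫⁻ l, ψ l ∂(expMeasure V) := by
  rw [← hB.life_law p, lintegral_map hψ (hB.measurable_life p)]

/-- Expectation of a function of the time and place of death. -/
lemma lintegral_end (hB : IsBranching k V P ch life split walk F) (p : ι) {h : ℝ → H → ℝ≥0∞}
    (hh : ∀ y, Measurable fun s => h s y) (s : ℝ) (y : H) :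
    ∫⁻ ω, h (s + life p ω) (y + walk p (life p ω).toNNReal ω) ∂P =
      ofReal V * resW k (expW V) h s y := by
  have h1 := lintegral_subst_of_indep (P := P) (hB.measurable_life p).comap_le
    ((hB.walk_le p).trans (hB.le p)) (hB.indep_life p) (X := life p)
    (comap_measurable (life p))
    (f := fun l ω => h (s + l) (y + walk p l.toNNReal ω))
    (@measurable_uncurry_walk H _ _ _ _ Ω _ (walk p) h hh (hB.measurable_walk_joint p _ le_rfl) s y)
  rw [h1]
  simp_rw [hB.lintegral_walk p]
  have hm : Measurable fun l => avg k (l.toNNReal) (h (s + l)) y :=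
    measurable_avg hB.semigroup (F := fun l => h (s + l)) (fun y => (hh y).comp (measurable_const_add s))
      (by fun_prop) y
  rw [hB.lintegral_life p hm, lintegral_expMeasure V hm, resW,
    ← lintegral_const_mul _ (measurable_resW_integrand hB.semigroup (measurable_expW V) hh y s)]
  refine setLIntegral_congr_fun measurableSet_Ioi fun r hr => ?_
  simp only [expW]
  rw [ofReal_mul hB.V_pos.le, mul_assoc, coe_toNNReal r (le_of_lt hr)]

/-- By Tonelli the particle is inspected age by age; survival to age r depends on the lifetime only
and is independent of the position at that age. The weight ψ allows powers of the lifetime. -/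
lemma lintegral_occ (hB : IsBranching k V P ch life split walk F) (p : ι)
    (hΦ : ∀ y, Measurable fun s => Φ s y) {ψ : ℝ → ℝ≥0∞} (hψ : Measurable ψ) (s : ℝ) (y : H) :
    ∫⁻ ω, ψ (life p ω) * occ Φ (life p) (walk p) s y ω ∂P = resW k (tailW V ψ) Φ s y := by
  have hw := hB.measurable_walk_joint p _ ((hB.walk_le p).trans (hB.le p))
  have hl := hB.measurable_life p
  have hint : Measurable fun q : Ω × ℝ => if q.2 < life p q.1 then
      Φ (s + q.2) (y + walk p q.2.toNNReal q.1) else 0 :=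
    Measurable.comp (f := fun q : Ω × ℝ => (((s, y), q.1), q.2))
      (measurable_occ_integrand (m := mΩ) hΦ hl hw)
      (Measurable.prodMk (Measurable.prodMk measurable_const measurable_fst) measurable_snd)
  unfold occ resW
  have h1 : ∀ ω, ψ (life p ω) * ∫⁻ r in Ioi (0:ℝ), (if r < life p ω then
      Φ (s + r) (y + walk p r.toNNReal ω) else 0) =
      ∫⁻ r in Ioi (0:ℝ), ψ (life p ω) * (if r < life p ω then
      Φ (s + r) (y + walk p r.toNNReal ω) else 0) := fun ω =>
    (lintegral_const_mul (f := fun r : ℝ => if r < life p ω then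
      Φ (s + r) (y + walk p r.toNNReal ω) else 0) _ (hint.comp measurable_prodMk_left)).symm
  simp_rw [h1]
  rw [lintegral_lintegral_swap]
  · refine setLIntegral_congr_fun measurableSet_Ioi fun r hr => ?_
    have h2 : ∀ ω, ψ (life p ω) * (if r < life p ω then
        Φ (s + r) (y + walk p r.toNNReal ω) else 0) =
        (if r < life p ω then ψ (life p ω) else 0) * Φ (s + r) (y + walk p r.toNNReal ω) := by
      intro ω; split_ifs <;> simp
    simp_rw [h2]
    have hm1 : Measurable fun l => if r < l then ψ l else 0 :=
      Measurable.ite measurableSet_Ioi hψ measurable_const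
    rw [lintegral_mul_eq_lintegral_mul_lintegral_of_independent_measurableSpace hl.comap_le
      ((hB.walk_le p).trans (hB.le p)) (hB.indep_life p)
      (f := fun ω => if r < life p ω then ψ (life p ω) else 0)
      (g := fun ω => Φ (s + r) (y + walk p r.toNNReal ω))
      (hm1.comp (comap_measurable (life p)))
      ((measurable_of_countable fun z => Φ (s + r) (y + z)).comp ((@measurable_iff_comap_le Ω H _ _ _).2 (le_iSup
      (fun t => MeasurableSpace.comap (walk p t) inferInstance) r.toNNReal)))]
    rw [hB.lintegral_walk p r.toNNReal (Φ (s + r)), hB.lintegral_life p hm1,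
      coe_toNNReal r (le_of_lt hr)]
    rfl
  · apply Measurable.aemeasurable
    exact ((hψ.comp hl).comp measurable_fst).mul hint

lemma lintegral_occ_one (hB : IsBranching k V P ch life split walk F) (p : ι)
    (hΦ : ∀ y, Measurable fun s => Φ s y) (s : ℝ) (y : H) :
    ∫⁻ ω, occ Φ (life p) (walk p) s y ω ∂P = resW k (expW V) Φ s y := by
  have := hB.lintegral_occ p hΦ (ψ := fun _ => 1) measurable_const s y
  simp only [one_mul] at this
  rw [this, resW, resW]
  refine setLIntegral_congr_fun measurableSet_Ioi fun r hr => ?_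
  simp only [tailW_one hB.V_pos hr]

lemma measurable_end (hB : IsBranching k V P ch life split walk F) (p : ι) (s : ℝ) (y : H) :
    Measurable[motionSigma (life p) (walk p)]
      fun ω => (s + life p ω, y + walk p (life p ω).toNNReal ω) :=
  @measurable_time_place H _ _ _ _ Ω (motionSigma (life p) (walk p)) (life p) (walk p)
    ((@measurable_iff_comap_le Ω ℝ _ _ _).2 le_sup_left)
    (hB.measurable_walk_joint p _ le_sup_right) s y

/-- Factorization at a branching event. -/
lemma lintegral_split (hB : IsBranching k V P ch life split walk F) (p : ι) {g : Ω → ℝ≥0∞}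
    (hg : Measurable[motionSigma (life p) (walk p)] g) {X₀ X₁ : ℝ → H → Ω → ℝ≥0∞}
    (h₀ : FieldMeas (F (ch false p)) X₀) (h₁ : FieldMeas (F (ch true p)) X₁) (s : ℝ) (y : H) :
    ∫⁻ ω, g ω * (if split p ω then
        X₀ (s + life p ω) (y + walk p (life p ω).toNNReal ω) ω *
        X₁ (s + life p ω) (y + walk p (life p ω).toNNReal ω) ω else 0) ∂P =
      2⁻¹ * ∫⁻ ω, g ω * ((∫⁻ ω', X₀ (s + life p ω) (y + walk p (life p ω).toNNReal ω) ω' ∂P) *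
        (∫⁻ ω', X₁ (s + life p ω) (y + walk p (life p ω).toNNReal ω) ω' ∂P)) ∂P := by
  -- The time and place of death depend on the motion of p alone. They can be frozen while the split
  -- and the subtrees of the children are integrated.
  have h1 := lintegral_subst_of_indep (P := P) ((hB.motion_le p).trans (hB.le p))
    (sup_le (hB.measurable_split p).comap_le (sup_le (hB.le _) (hB.le _))) (hB.indep_motion p)
    (X := fun ω => (g ω, (s + life p ω, y + walk p (life p ω).toNNReal ω)))
    (Measurable.prodMk hg (hB.measurable_end p s y))
    (f := fun x ω => x.1 * (if split p ω then X₀ x.2.1 x.2.2 ω * X₁ x.2.1 x.2.2 ω else 0))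
    (@measurable_uncurry_split H _ _ _ _ Ω _ (split p) _
      ((h₀.mono (le_sup_left.trans le_sup_right)).mul (h₁.mono (le_sup_right.trans le_sup_right)))
      ((@measurable_iff_comap_le Ω Bool _ _ _).2 le_sup_left))
  rw [h1, ← lintegral_const_mul' _ _ (by simp)]
  refine lintegral_congr fun ω => ?_
  have hX : ∀ s y, ∫⁻ ω', (if split p ω' then X₀ s y ω' * X₁ s y ω' else 0) ∂P =
      2⁻¹ * ((∫⁻ ω', X₀ s y ω' ∂P) * ∫⁻ ω', X₁ s y ω' ∂P) := by
    intro s y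
    have e1 : ∀ ω', (if split p ω' then X₀ s y ω' * X₁ s y ω' else 0) =
        (if split p ω' then (1:ℝ≥0∞) else 0) * (X₀ s y ω' * X₁ s y ω') := by
      intro ω'; split_ifs <;> simp
    simp_rw [e1]
    rw [lintegral_mul_eq_lintegral_mul_lintegral_of_independent_measurableSpace
      (hB.measurable_split p).comap_le (sup_le (hB.le _) (hB.le _)) (hB.indep_split p)
      (f := fun ω' => if split p ω' then (1:ℝ≥0∞) else 0)
      (g := fun ω' => X₀ s y ω' * X₁ s y ω')
      ((measurable_of_countable fun b : Bool => if b then (1:ℝ≥0∞) else 0).comp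
        (comap_measurable (split p)))
      (((h₀.mono le_sup_left).mul (h₁.mono le_sup_right)).eval s y),
      lintegral_mul_eq_lintegral_mul_lintegral_of_independent_measurableSpace
      (hB.le _) (hB.le _) (hB.indep_children p) (h₀.eval s y) (h₁.eval s y)]
    congr 1
    have e2 := lintegral_ite_eq (P := P) (hB.measurable_split p) true
    rw [hB.split_law] at e2
    rw [← e2]
  have hm : Measurable fun ω' => (if split p ω' then
      X₀ (s + life p ω) (y + walk p (life p ω).toNNReal ω) ω' *
      X₁ (s + life p ω) (y + walk p (life p ω).toNNReal ω) ω' else 0) := by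
    refine Measurable.ite (hB.measurable_split p (measurableSet_singleton true)) ?_ measurable_const
    exact ((h₀.mono (hB.le _)).mul (h₁.mono (hB.le _))).eval _ _
  rw [lintegral_const_mul _ hm, hX]
  ring

end IsBranching

end Forest

/-! ### Occupation functionals of families and their moment recursions -/

section FamilyDef

variable {H : Type*} [AddCommGroup H] {ι Ω : Type*}

/-- Occupation functional of a particle and of its descendants up to generation `n`. -/
def famN (Φ : ℝ → H → ℝ≥0∞) (ch : Bool → ι → ι) (life : ι → Ω → ℝ) (split : ι → Ω → Bool)
    (walk : ι → ℝ≥0 → Ω → H) : ℕ → ι → ℝ → H → Ω → ℝ≥0∞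
  | 0, _, _, _, _ => 0
  | n + 1, p, s, y, ω => branchStep Φ (life p) (split p) (walk p)
      (famN Φ ch life split walk n (ch false p)) (famN Φ ch life split walk n (ch true p)) s y ω

/-- Occupation functional of a particle and all its descendants. -/
def fam (Φ : ℝ → H → ℝ≥0∞) (ch : Bool → ι → ι) (life : ι → Ω → ℝ) (split : ι → Ω → Bool)
    (walk : ι → ℝ≥0 → Ω → H) (p : ι) (s : ℝ) (y : H) (ω : Ω) : ℝ≥0∞ :=
  ⨆ n, famN Φ ch life split walk n p s y ω

end FamilyDef

section Supersolution

variable {H : Type*} [AddCommGroup H] [Countable H] {k : ℝ → H → ℝ≥0∞} {f : ℝ → H → ℝ≥0∞}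

/-- `f + V G f`, the solution of `u = f + V R u`. -/
def renewal (k : ℝ → H → ℝ≥0∞) (V : ℝ) (f : ℝ → H → ℝ≥0∞) (s : ℝ) (y : H) : ℝ≥0∞ :=
  f s y + ofReal V * pot k f s y

lemma measurable_pot (hk : SymmSemigroup k) (hf : ∀ y, Measurable fun s => f s y) (y : H) :
    Measurable fun s => pot k f s y := measurable_resW hk measurable_const hf y

lemma measurable_renewal (hk : SymmSemigroup k) (V : ℝ) (hf : ∀ y, Measurable fun s => f s y)
    (y : H) : Measurable fun s => renewal k V f s y :=
  (hf y).add ((measurable_pot hk hf y).const_mul _)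

/-- The kernel `E[(1 + L)² A]` bounding the occupation `A` of a single particle with lifetime `L`. -/
def lifeOcc (k : ℝ → H → ℝ≥0∞) (V : ℝ) (Φ : ℝ → H → ℝ≥0∞) : ℝ → H → ℝ≥0∞ :=
  resW k (tailW V fun l => ofReal (1 + l) ^ 2) Φ

/-- Applying R to f + V G f gives G f by the resolvent equation `pot_eq`. -/
lemma renewal_eq (hk : SymmSemigroup k) (hf : ∀ y, Measurable fun s => f s y) {V : ℝ} (hV : 0 < V)
    (s : ℝ) (y : H) : renewal k V f s y =
      f s y + ofReal V * resW k (expW V) (renewal k V f) s y := by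
  have h1 : resW k (expW V) (renewal k V f) s y =
      resW k (expW V) f s y + ofReal V * resW k (expW V) (pot k f) s y := by
    unfold renewal
    rw [resW_add hk (measurable_expW V) hf, resW_const_mul hk (measurable_expW V)
      (fun y => measurable_pot hk hf y)]
  rw [h1, ← pot_eq hk hf hV]; rfl

end Supersolution

section Life

variable {H ι Ω : Type*} [AddCommGroup H] {Φ : ℝ → H → ℝ≥0∞} {life : ι → Ω → ℝ}
  {walk : ι → ℝ≥0 → Ω → H}

lemma occ_of_life_nonpos {p : ι} {s : ℝ} {y : H} {ω : Ω} (h : life p ω ≤ 0) :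
    occ Φ (life p) (walk p) s y ω = 0 := by
  rw [occ]
  rw [setLIntegral_congr_fun (g := fun _ => 0) measurableSet_Ioi, lintegral_zero]
  intro r hr
  have : ¬ r < life p ω := not_lt.2 (h.trans (le_of_lt hr))
  simp [this]

/-- A nonpositive lifetime produces no occupation, so the factor can be inserted without any sign
assumption. -/
lemma one_le_life {p : ι} {s : ℝ} {y : H} {ω : Ω} (n : ℕ) : occ Φ (life p) (walk p) s y ω ≤
      ofReal (1 + life p ω) ^ n * occ Φ (life p) (walk p) s y ω := by
  rcases le_or_gt (life p ω) 0 with h | h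
  · rw [occ_of_life_nonpos h]; exact zero_le
  · have : 1 ≤ ofReal (1 + life p ω) := by
      rw [one_le_ofReal]; linarith
    exact le_mul_of_one_le_left' (one_le_pow₀ this)

lemma life_mul_occ_le {p : ι} {s : ℝ} {y : H} {ω : Ω} :
    ofReal (1 + life p ω) * occ Φ (life p) (walk p) s y ω ≤
      ofReal (1 + life p ω) ^ 2 * occ Φ (life p) (walk p) s y ω := by
  rw [sq, mul_assoc]
  gcongr
  simpa using one_le_life (Φ := Φ) (life := life) (walk := walk) (p := p) (s := s) (y := y) (ω := ω) 1

end Life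

section Forest

variable {H : Type*} [AddCommGroup H] [Countable H] [MeasurableSpace H] [DiscreteMeasurableSpace H]
  {ι Ω : Type*} [mΩ : MeasurableSpace Ω]

namespace IsBranching

variable {k : ℝ → H → ℝ≥0∞} {V : ℝ} {P : Measure Ω} [IsProbabilityMeasure P] {ch : Bool → ι → ι}
  {life : ι → Ω → ℝ} {split : ι → Ω → Bool} {walk : ι → ℝ≥0 → Ω → H} {F : ι → MeasurableSpace Ω}
  {Φ : ℝ → H → ℝ≥0∞}

lemma fieldMeas_step (hB : IsBranching k V P ch life split walk F)
    (hΦ : ∀ y, Measurable fun s => Φ s y) (p : ι) {X₀ X₁ : ℝ → H → Ω → ℝ≥0∞}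
    (h₀ : FieldMeas (F (ch false p)) X₀) (h₁ : FieldMeas (F (ch true p)) X₁) :
    FieldMeas (F p) (branchStep Φ (life p) (split p) (walk p) X₀ X₁) :=
  fieldMeas_branchStep (m := F p) hΦ (hB.life_meas p) (hB.split_meas p)
    (hB.measurable_walk_joint p _ (hB.walk_le p)) (h₀.mono (hB.child_le _ _))
    (h₁.mono (hB.child_le _ _))

lemma fieldMeas_famN (hB : IsBranching k V P ch life split walk F)
    (hΦ : ∀ y, Measurable fun s => Φ s y) (n : ℕ) (p : ι) :
    FieldMeas (F p) (famN Φ ch life split walk n p) := by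
  induction n generalizing p with
  | zero => exact measurable_const
  | succ n ih => exact hB.fieldMeas_step hΦ p (ih _) (ih _)

lemma fieldMeas_fam (hB : IsBranching k V P ch life split walk F)
    (hΦ : ∀ y, Measurable fun s => Φ s y) (p : ι) :
    FieldMeas (F p) (fam Φ ch life split walk p) :=
  Measurable.iSup fun n => hB.fieldMeas_famN hΦ n p

lemma famN_mono (n : ℕ) (p : ι) (s : ℝ) (y : H) (ω : Ω) :
    famN Φ ch life split walk n p s y ω ≤ famN Φ ch life split walk (n + 1) p s y ω := by
  induction n generalizing p s y with
  | zero => exact zero_le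
  | succ n ih =>
    rw [famN, famN, branchStep, branchStep]
    gcongr
    split_ifs
    · exact add_le_add (ih _ _ _) (ih _ _ _)
    · exact le_rfl

lemma monotone_famN (p : ι) (s : ℝ) (y : H) (ω : Ω) :
    Monotone fun n => famN Φ ch life split walk n p s y ω :=
  monotone_nat_of_le_succ fun n => famN_mono n p s y ω

/-- The truncations increase with the generation, so the supremum passes through the sum of the two
children. -/
lemma fam_eq (p : ι) (s : ℝ) (y : H) (ω : Ω) :
    fam Φ ch life split walk p s y ω = branchStep Φ (life p) (split p) (walk p)
      (fam Φ ch life split walk (ch false p)) (fam Φ ch life split walk (ch true p)) s y ω := by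
  rw [fam, ← (monotone_famN p s y ω).iSup_nat_add 1]
  simp only [famN, branchStep]
  by_cases h : split p ω = true
  · simp only [h, if_true]
    rw [fam, fam, ENNReal.iSup_add_iSup_of_monotone (monotone_famN _ _ _ _) (monotone_famN _ _ _ _),
      ENNReal.add_iSup]
  · simp [h]

lemma lintegral_fam_pow (hB : IsBranching k V P ch life split walk F)
    (hΦ : ∀ y, Measurable fun s => Φ s y) (j : ℕ) (hj : j ≠ 0) (p : ι) (s : ℝ) (y : H) :
    ∫⁻ ω, fam Φ ch life split walk p s y ω ^ j ∂P =
      ⨆ n, ∫⁻ ω, famN Φ ch life split walk n p s y ω ^ j ∂P := by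
  rw [← lintegral_iSup]
  · refine lintegral_congr fun ω => ?_
    rw [fam, (show Monotone (fun x : ℝ≥0∞ => x ^ j) from fun a b h => pow_le_pow_left' h j).map_iSup_of_continuousAt (ENNReal.continuous_pow j).continuousAt]
    simp [hj]
  · exact fun n => (((hB.fieldMeas_famN hΦ n p).mono (hB.le p)).pow j).eval s y
  · exact fun a b hab ω => by
      dsimp only
      gcongr
      exact monotone_famN p s y ω hab

section Step

variable {X₀ X₁ : ℝ → H → Ω → ℝ≥0∞}

/-- A term in the expansion of a power of a branching step. -/
def stepTerm (Φ : ℝ → H → ℝ≥0∞) (life : Ω → ℝ) (split : Ω → Bool) (walk : ℝ≥0 → Ω → H)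
    (X₀ X₁ : ℝ → H → Ω → ℝ≥0∞) (s : ℝ) (y : H) (l i j : ℕ) (ω : Ω) : ℝ≥0∞ :=
  occ Φ life walk s y ω ^ l * (if split ω then
    X₀ (s + life ω) (y + walk (life ω).toNNReal ω) ω ^ i *
    X₁ (s + life ω) (y + walk (life ω).toNNReal ω) ω ^ j else 0)

lemma measurable_occ (hB : IsBranching k V P ch life split walk F)
    (hΦ : ∀ y, Measurable fun s => Φ s y) (p : ι) (s : ℝ) (y : H) :
    Measurable[motionSigma (life p) (walk p)] (occ Φ (life p) (walk p) s y) :=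
  FieldMeas.eval (@fieldMeas_occ H _ _ _ _ Ω (motionSigma (life p) (walk p)) Φ hΦ (life p) (walk p)
    ((@measurable_iff_comap_le Ω ℝ _ _ _).2 le_sup_left)
    (hB.measurable_walk_joint p _ le_sup_right)) s y

/-- Factorization at a branching event, for powers of the fields of the children. -/
lemma lintegral_split_pow (hB : IsBranching k V P ch life split walk F)
    (hΦ : ∀ y, Measurable fun s => Φ s y) (p : ι)
    (h₀ : FieldMeas (F (ch false p)) X₀) (h₁ : FieldMeas (F (ch true p)) X₁) (l i j : ℕ) (s : ℝ)
    (y : H) :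
    ∫⁻ ω, stepTerm Φ (life p) (split p) (walk p) X₀ X₁ s y l i j ω ∂P =
      2⁻¹ * ∫⁻ ω, occ Φ (life p) (walk p) s y ω ^ l * (
        (∫⁻ ω', X₀ (s + life p ω) (y + walk p (life p ω).toNNReal ω) ω' ^ i ∂P) *
        (∫⁻ ω', X₁ (s + life p ω) (y + walk p (life p ω).toNNReal ω) ω' ^ j ∂P)) ∂P :=
  hB.lintegral_split p ((hB.measurable_occ hΦ p s y).pow_const l) (h₀.pow i) (h₁.pow j) s y

lemma measurable_step (hB : IsBranching k V P ch life split walk F)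
    (hΦ : ∀ y, Measurable fun s => Φ s y) (p : ι)
    (h₀ : FieldMeas (F (ch false p)) X₀) (h₁ : FieldMeas (F (ch true p)) X₁) (l i j : ℕ) (s : ℝ)
    (y : H) : Measurable (stepTerm Φ (life p) (split p) (walk p) X₀ X₁ s y l i j) := by
  refine Measurable.mul ?_ ?_
  · exact ((hB.measurable_occ hΦ p s y).mono ((hB.motion_le p).trans (hB.le p)) le_rfl).pow_const l
  · have hw := hB.measurable_walk_joint p _ ((hB.walk_le p).trans (hB.le p))
    exact ((FieldMeas.ite_split (((h₀.mono (hB.le _)).pow i).mul ((h₁.mono (hB.le _)).pow j))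
      (hB.measurable_split p)).end (hB.measurable_life p) hw |> fun h => by
        exact FieldMeas.eval (FieldMeas.ite_split (((((h₀.mono (hB.le _)).pow i).mul
          ((h₁.mono (hB.le _)).pow j))).end (hB.measurable_life p) hw) (hB.measurable_split p)) s y)

/-- First moment of a branching step. -/
lemma lintegral_branchStep (hB : IsBranching k V P ch life split walk F)
    (hΦ : ∀ y, Measurable fun s => Φ s y) (p : ι)
    (h₀ : FieldMeas (F (ch false p)) X₀) (h₁ : FieldMeas (F (ch true p)) X₁) (s : ℝ) (y : H) :
    ∫⁻ ω, branchStep Φ (life p) (split p) (walk p) X₀ X₁ s y ω ∂P =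
      resW k (expW V) Φ s y + ofReal V * resW k (expW V)
        (fun s y => 2⁻¹ * ((∫⁻ ω, X₀ s y ω ∂P) + ∫⁻ ω, X₁ s y ω ∂P)) s y := by
  have e : ∀ ω, branchStep Φ (life p) (split p) (walk p) X₀ X₁ s y ω =
      occ Φ (life p) (walk p) s y ω +
      (stepTerm Φ (life p) (split p) (walk p) X₀ X₁ s y 0 1 0 ω +
        stepTerm Φ (life p) (split p) (walk p) X₀ X₁ s y 0 0 1 ω) := by
    intro ω; rw [branchStep, stepTerm, stepTerm]; split_ifs <;> simp
  have hm0 : ∀ y, Measurable fun s => ∫⁻ ω, X₀ s y ω ∂P := (h₀.mono (hB.le _)).lintegral P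
  have hm1 : ∀ y, Measurable fun s => ∫⁻ ω, X₁ s y ω ∂P := (h₁.mono (hB.le _)).lintegral P
  simp_rw [e]
  rw [lintegral_add_left ((hB.measurable_occ hΦ p s y).mono ((hB.motion_le p).trans (hB.le p)) le_rfl),
    lintegral_add_left (hB.measurable_step hΦ p h₀ h₁ 0 1 0 s y),
    hB.lintegral_split_pow hΦ p h₀ h₁, hB.lintegral_split_pow hΦ p h₀ h₁, hB.lintegral_occ_one p hΦ,
    ← mul_add]
  congr 1
  simp only [pow_zero, pow_one, lintegral_one, measure_univ, one_mul, mul_one]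
  rw [hB.lintegral_end p hm0, hB.lintegral_end p hm1,
    resW_const_mul hB.semigroup (measurable_expW V)
      (f := fun s y => (∫⁻ ω, X₀ s y ω ∂P) + ∫⁻ ω, X₁ s y ω ∂P) (fun y => (hm0 y).add (hm1 y)),
    resW_add hB.semigroup (measurable_expW V) hm0]
  ring

lemma lintegral_mul_occ_le (hB : IsBranching k V P ch life split walk F)
    (hΦ : ∀ y, Measurable fun s => Φ s y) (p : ι) (s : ℝ) (y : H) {g : Ω → ℝ≥0∞} {C : ℝ≥0∞}
    (hg : ∀ ω, g ω * occ Φ (life p) (walk p) s y ω ≤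
      C * (ofReal (1 + life p ω) ^ 2 * occ Φ (life p) (walk p) s y ω)) :
    ∫⁻ ω, g ω * occ Φ (life p) (walk p) s y ω ∂P ≤ C * lifeOcc k V Φ s y := by
  refine (lintegral_mono hg).trans ?_
  rw [lintegral_const_mul]
  · rw [hB.lintegral_occ p hΦ (ψ := fun l => ofReal (1 + l) ^ 2) (by fun_prop)]
    rfl
  · have := hB.measurable_life p
    have := ((hB.measurable_occ hΦ p s y).mono ((hB.motion_le p).trans (hB.le p)) le_rfl)
    fun_prop

lemma lintegral_occ_le (hB : IsBranching k V P ch life split walk F)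
    (hΦ : ∀ y, Measurable fun s => Φ s y) (p : ι) (s : ℝ) (y : H) :
    ∫⁻ ω, occ Φ (life p) (walk p) s y ω ∂P ≤ lifeOcc k V Φ s y := by
  have := hB.lintegral_mul_occ_le hΦ p s y (g := fun _ => 1) (C := 1)
    (fun ω => by
      rw [one_mul, one_mul]
      exact one_le_life (Φ := Φ) (life := life) (walk := walk) (p := p) (s := s) (y := y) (ω := ω) 2)
  simpa using this

variable {a : ℝ≥0∞}

lemma lintegral_occ_sq_le (hB : IsBranching k V P ch life split walk F)
    (hΦ : ∀ y, Measurable fun s => Φ s y) (p : ι)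
    (hA : ∀ s y ω, occ Φ (life p) (walk p) s y ω ≤ a * ofReal (1 + life p ω)) (s : ℝ) (y : H) :
    ∫⁻ ω, occ Φ (life p) (walk p) s y ω ^ 2 ∂P ≤ a * lifeOcc k V Φ s y := by
  simp_rw [sq]
  refine hB.lintegral_mul_occ_le hΦ p s y (C := a) fun ω => ?_
  calc _ ≤ a * ofReal (1 + life p ω) * occ Φ (life p) (walk p) s y ω := by
        gcongr; exact hA s y ω
    _ ≤ _ := by rw [mul_assoc]; exact mul_le_mul' le_rfl life_mul_occ_le

/-- Second moment of a branching step, upper bound. -/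
lemma lintegral_branchStep_sq_le (hB : IsBranching k V P ch life split walk F)
    (hΦ : ∀ y, Measurable fun s => Φ s y) {m₁ m₂ : ℝ → H → ℝ≥0∞} (p : ι)
    (hA : ∀ s y ω, occ Φ (life p) (walk p) s y ω ≤ a * ofReal (1 + life p ω))
    (hm₁ : ∀ y, Measurable fun s => m₁ s y) (hm₂ : ∀ y, Measurable fun s => m₂ s y)
    (hm₁a : ∀ s y, m₁ s y ≤ a)
    (h₀ : FieldMeas (F (ch false p)) X₀) (h₁ : FieldMeas (F (ch true p)) X₁)
    (h01 : ∀ s y, ∫⁻ ω, X₀ s y ω ^ 1 ∂P ≤ m₁ s y) (h11 : ∀ s y, ∫⁻ ω, X₁ s y ω ^ 1 ∂P ≤ m₁ s y)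
    (h02 : ∀ s y, ∫⁻ ω, X₀ s y ω ^ 2 ∂P ≤ m₂ s y) (h12 : ∀ s y, ∫⁻ ω, X₁ s y ω ^ 2 ∂P ≤ m₂ s y)
    (s : ℝ) (y : H) :
    ∫⁻ ω, branchStep Φ (life p) (split p) (walk p) X₀ X₁ s y ω ^ 2 ∂P ≤ 3 * a * lifeOcc k V Φ s y +
        ofReal V * resW k (expW V) (fun s y => m₁ s y ^ 2) s y +
        ofReal V * resW k (expW V) m₂ s y := by
  set A := occ Φ (life p) (walk p) s y with hAdef
  set T := stepTerm Φ (life p) (split p) (walk p) X₀ X₁ s y with hT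
  -- Expansion of (A + X₀ + X₁)², where A is the particle's own occupation. Of the terms without A,
  -- only X₀X₁ is a source in the renewal equation; its factor 2 cancels the splitting probability.
  -- Every term containing A will carry the small factor a.
  have e : ∀ ω, branchStep Φ (life p) (split p) (walk p) X₀ X₁ s y ω ^ 2 =
      A ω ^ 2 + (2 * T 1 1 0 ω + (2 * T 1 0 1 ω + (T 0 2 0 ω + (T 0 0 2 ω + 2 * T 0 1 1 ω)))) := by
    intro ω; simp only [hT, stepTerm]; rw [branchStep]; split_ifs
    · rw [← hAdef]; ring
    · simp [hAdef]
  have hTm := fun l i j => hB.measurable_step hΦ p h₀ h₁ l i j s y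
  have hAm : Measurable A := (hB.measurable_occ hΦ p s y).mono ((hB.motion_le p).trans (hB.le p)) le_rfl
  have hTe := fun l i j => hB.lintegral_split_pow hΦ p h₀ h₁ l i j s y
  have hAA := hB.lintegral_occ_le hΦ p s y
  have hAA2 := hB.lintegral_occ_sq_le hΦ p hA s y
  have hT1 : ∀ i j, (∀ s y, (∫⁻ ω', X₀ s y ω' ^ i ∂P) * (∫⁻ ω', X₁ s y ω' ^ j ∂P) ≤ a) →
      ∫⁻ ω, T 1 i j ω ∂P ≤ 2⁻¹ * (a * lifeOcc k V Φ s y) := by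
    intro i j h
    rw [hTe]
    gcongr
    calc _ ≤ ∫⁻ ω, a * A ω ∂P := by
          refine lintegral_mono fun ω => ?_
          rw [pow_one, mul_comm a]; gcongr; exact h _ _
      _ ≤ _ := by rw [lintegral_const_mul _ hAm]; gcongr
  have hT0 : ∀ i j (h : ℝ → H → ℝ≥0∞), (∀ y, Measurable fun s => h s y) →
      (∀ s y, (∫⁻ ω', X₀ s y ω' ^ i ∂P) * (∫⁻ ω', X₁ s y ω' ^ j ∂P) ≤ h s y) →
      ∫⁻ ω, T 0 i j ω ∂P ≤ 2⁻¹ * (ofReal V * resW k (expW V) h s y) := by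
    intro i j h hh hle
    rw [hTe, ← hB.lintegral_end p hh]
    refine mul_le_mul' le_rfl (lintegral_mono fun ω => ?_)
    rw [pow_zero, one_mul]; exact hle _ _
  simp_rw [e]
  rw [lintegral_add_left (hAm.pow_const 2), lintegral_add_left ((hTm 1 1 0).const_mul 2),
    lintegral_add_left ((hTm 1 0 1).const_mul 2), lintegral_add_left (hTm 0 2 0),
    lintegral_add_left (hTm 0 0 2), lintegral_const_mul _ (hTm 1 1 0),
    lintegral_const_mul _ (hTm 1 0 1), lintegral_const_mul _ (hTm 0 1 1)]
  have b1 := hT1 1 0 (fun s y => by simpa using (h01 s y).trans (hm₁a s y))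
  have b2 := hT1 0 1 (fun s y => by simpa using (h11 s y).trans (hm₁a s y))
  have b3 := hT0 2 0 m₂ hm₂ (fun s y => by simpa using h02 s y)
  have b4 := hT0 0 2 m₂ hm₂ (fun s y => by simpa using h12 s y)
  have b5 := hT0 1 1 (fun s y => m₁ s y ^ 2) (fun y => (hm₁ y).pow_const 2)
    (fun s y => by rw [sq]; exact mul_le_mul' (h01 s y) (h11 s y))
  have h2 : (2:ℝ≥0∞) * 2⁻¹ = 1 := ENNReal.mul_inv_cancel (by norm_num) (by norm_num)
  calc _ ≤ a * lifeOcc k V Φ s y + (2 * (2⁻¹ * (a * lifeOcc k V Φ s y)) +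
        (2 * (2⁻¹ * (a * lifeOcc k V Φ s y)) +
        (2⁻¹ * (ofReal V * resW k (expW V) m₂ s y) +
        (2⁻¹ * (ofReal V * resW k (expW V) m₂ s y) +
        2 * (2⁻¹ * (ofReal V * resW k (expW V) (fun s y => m₁ s y ^ 2) s y)))))) := by
        gcongr
    _ = a * lifeOcc k V Φ s y + ((2 * 2⁻¹) * (a * lifeOcc k V Φ s y) +
        ((2 * 2⁻¹) * (a * lifeOcc k V Φ s y) +
        ((2 * 2⁻¹) * (ofReal V * resW k (expW V) m₂ s y) +
        (2 * 2⁻¹) * (ofReal V * resW k (expW V) (fun s y => m₁ s y ^ 2) s y)))) := by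
        ring
    _ = _ := by rw [h2]; ring

/-- Second moment of a branching step, lower bound. -/
lemma le_lintegral_branchStep_sq (hB : IsBranching k V P ch life split walk F)
    (hΦ : ∀ y, Measurable fun s => Φ s y) (p : ι)
    (h₀ : FieldMeas (F (ch false p)) X₀) (h₁ : FieldMeas (F (ch true p)) X₁) (s : ℝ) (y : H) :
    ofReal V * resW k (expW V)
        (fun s y => (∫⁻ ω, X₀ s y ω ∂P) * ∫⁻ ω, X₁ s y ω ∂P) s y +
      ofReal V * resW k (expW V)
        (fun s y => 2⁻¹ * ((∫⁻ ω, X₀ s y ω ^ 2 ∂P) + ∫⁻ ω, X₁ s y ω ^ 2 ∂P)) s y ≤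
    ∫⁻ ω, branchStep Φ (life p) (split p) (walk p) X₀ X₁ s y ω ^ 2 ∂P := by
  set A := occ Φ (life p) (walk p) s y with hAdef
  set T := stepTerm Φ (life p) (split p) (walk p) X₀ X₁ s y with hT
  -- For the lower bound all terms containing A are dropped; what remains is already the renewal
  -- equation with source V (GΦ)².
  have e : ∀ ω, T 0 2 0 ω + (T 0 0 2 ω + 2 * T 0 1 1 ω) ≤
      branchStep Φ (life p) (split p) (walk p) X₀ X₁ s y ω ^ 2 := by
    intro ω; simp only [hT, stepTerm]; rw [branchStep]; split_ifs
    · rw [← hAdef]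
      refine le_of_eq_of_le ?_ (pow_le_pow_left' (le_add_self (b := A ω)) 2)
      ring
    · simp
  have hTm := fun l i j => hB.measurable_step hΦ p h₀ h₁ l i j s y
  have hTe := fun l i j => hB.lintegral_split_pow hΦ p h₀ h₁ l i j s y
  refine le_trans (le_of_eq ?_) (lintegral_mono e)
  have hp : ∀ (j : ℕ) y, Measurable fun s => ∫⁻ ω, X₀ s y ω ^ j ∂P :=
    fun j => ((h₀.mono (hB.le _)).pow j).lintegral P
  have hp' : ∀ (j : ℕ) y, Measurable fun s => ∫⁻ ω, X₁ s y ω ^ j ∂P :=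
    fun j => ((h₁.mono (hB.le _)).pow j).lintegral P
  have hT0 : ∀ i j, ∫⁻ ω, T 0 i j ω ∂P = 2⁻¹ * (ofReal V * resW k (expW V)
      (fun s y => (∫⁻ ω', X₀ s y ω' ^ i ∂P) * (∫⁻ ω', X₁ s y ω' ^ j ∂P)) s y) := by
    intro i j
    rw [hTe, ← hB.lintegral_end p
      (h := fun s y => (∫⁻ ω', X₀ s y ω' ^ i ∂P) * (∫⁻ ω', X₁ s y ω' ^ j ∂P))
      (fun y => (hp i y).mul (hp' j y))]
    simp only [pow_zero, one_mul]
  rw [lintegral_add_left (hTm 0 2 0), lintegral_add_left (hTm 0 0 2),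
    lintegral_const_mul _ (hTm 0 1 1), hT0, hT0, hT0,
    resW_const_mul hB.semigroup (measurable_expW V)
      (f := fun s y => (∫⁻ ω, X₀ s y ω ^ 2 ∂P) + ∫⁻ ω, X₁ s y ω ^ 2 ∂P)
      (fun y => (hp 2 y).add (hp' 2 y)),
    resW_add hB.semigroup (measurable_expW V) (hp 2), ← mul_assoc 2 2⁻¹,
    ENNReal.mul_inv_cancel (by norm_num) (by norm_num)]
  simp only [pow_zero, pow_one, lintegral_one, measure_univ, mul_one, one_mul]
  ring

/-- The bounds used for the third moment hold from times s ≥ 0 only; a positive lifetime keeps the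
birth times of the children in that range. -/
lemma life_pos (hB : IsBranching k V P ch life split walk F) (p : ι) : ∀ᵐ ω ∂P, 0 < life p ω := by
  have h : ∀ᵐ l ∂(P.map (life p)), 0 < l := by
    rw [hB.life_law, ae_iff]
    have h1 := lintegral_expMeasure V (ψ := (Iic (0:ℝ)).indicator fun _ => 1)
      (measurable_const.indicator measurableSet_Iic)
    rw [lintegral_indicator_const measurableSet_Iic, one_mul] at h1
    simp only [not_lt]
    change expMeasure V (Iic 0) = 0
    rw [h1, setLIntegral_congr_fun (g := fun _ => 0) measurableSet_Ioi, lintegral_zero]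
    intro r hr
    have hr' : r ∉ Iic (0:ℝ) := not_le.2 (mem_Ioi.1 hr)
    simp only [Set.indicator_of_notMem hr', mul_zero]
  exact ae_of_ae_map (hB.measurable_life p).aemeasurable h

/-- Third moment of a branching step, upper bound. -/
lemma lintegral_branchStep_cube_le (hB : IsBranching k V P ch life split walk F)
    (hΦ : ∀ y, Measurable fun s => Φ s y) {m₁ m₂ m₃ : ℝ → H → ℝ≥0∞} (p : ι)
    (hA : ∀ s y ω, occ Φ (life p) (walk p) s y ω ≤ a * ofReal (1 + life p ω))
    (hm₁ : ∀ y, Measurable fun s => m₁ s y) (hm₂ : ∀ y, Measurable fun s => m₂ s y)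
    (hm₃ : ∀ y, Measurable fun s => m₃ s y)
    (hm₁a : ∀ s y, m₁ s y ≤ a) {c₂ : ℝ≥0∞} (hm₂c : ∀ s y, 0 ≤ s → m₂ s y ≤ c₂)
    (h₀ : FieldMeas (F (ch false p)) X₀) (h₁ : FieldMeas (F (ch true p)) X₁)
    (h01 : ∀ s y, ∫⁻ ω, X₀ s y ω ^ 1 ∂P ≤ m₁ s y) (h11 : ∀ s y, ∫⁻ ω, X₁ s y ω ^ 1 ∂P ≤ m₁ s y)
    (h02 : ∀ s y, ∫⁻ ω, X₀ s y ω ^ 2 ∂P ≤ m₂ s y) (h12 : ∀ s y, ∫⁻ ω, X₁ s y ω ^ 2 ∂P ≤ m₂ s y)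
    (h03 : ∀ s y, 0 ≤ s → ∫⁻ ω, X₀ s y ω ^ 3 ∂P ≤ m₃ s y)
    (h13 : ∀ s y, 0 ≤ s → ∫⁻ ω, X₁ s y ω ^ 3 ∂P ≤ m₃ s y)
    (s : ℝ) (hs : 0 ≤ s) (y : H) :
    ∫⁻ ω, branchStep Φ (life p) (split p) (walk p) X₀ X₁ s y ω ^ 3 ∂P ≤
      (7 * a ^ 2 + 3 * c₂) * lifeOcc k V Φ s y +
        3 * (ofReal V * resW k (expW V) (fun s y => m₁ s y * m₂ s y) s y) +
        ofReal V * resW k (expW V) m₃ s y := by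
  set A := occ Φ (life p) (walk p) s y with hAdef
  set T := stepTerm Φ (life p) (split p) (walk p) X₀ X₁ s y with hT
  have e : ∀ ω, branchStep Φ (life p) (split p) (walk p) X₀ X₁ s y ω ^ 3 =
      A ω ^ 3 + (3 * T 2 1 0 ω + (3 * T 2 0 1 ω + (3 * T 1 2 0 ω + (3 * T 1 0 2 ω +
      (6 * T 1 1 1 ω + (T 0 3 0 ω + (T 0 0 3 ω + (3 * T 0 2 1 ω + 3 * T 0 1 2 ω)))))))) := by
    intro ω; simp only [hT, stepTerm]; rw [branchStep]; split_ifs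
    · rw [← hAdef]; ring
    · simp [hAdef]
  have hTm := fun l i j => hB.measurable_step hΦ p h₀ h₁ l i j s y
  have hAm : Measurable A := (hB.measurable_occ hΦ p s y).mono ((hB.motion_le p).trans (hB.le p)) le_rfl
  have hTe := fun l i j => hB.lintegral_split_pow hΦ p h₀ h₁ l i j s y
  have hAA : ∫⁻ ω, A ω ^ 1 ∂P ≤ lifeOcc k V Φ s y := by simpa using hB.lintegral_occ_le hΦ p s y
  have hAA2 := hB.lintegral_occ_sq_le hΦ p hA s y
  have hAA3 : ∫⁻ ω, A ω ^ 3 ∂P ≤ a ^ 2 * lifeOcc k V Φ s y := by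
    have e3 : ∀ ω, A ω ^ 3 = A ω ^ 2 * A ω := fun ω => by ring
    simp_rw [e3]
    refine hB.lintegral_mul_occ_le hΦ p s y (g := fun ω => A ω ^ 2) (C := a ^ 2) fun ω => ?_
    calc _ ≤ (a * ofReal (1 + life p ω)) ^ 2 * A ω := by gcongr; exact hA s y ω
      _ = _ := by rw [mul_pow, mul_assoc]
  have hTl : ∀ l i j (C : ℝ≥0∞), (∀ s y, 0 ≤ s → (∫⁻ ω', X₀ s y ω' ^ i ∂P) * (∫⁻ ω', X₁ s y ω' ^ j ∂P) ≤ C) →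
      ∫⁻ ω, T l i j ω ∂P ≤ 2⁻¹ * (C * ∫⁻ ω, A ω ^ l ∂P) := by
    intro l i j C h
    rw [hTe, ← lintegral_const_mul _ (hAm.pow_const l)]
    refine mul_le_mul' le_rfl (lintegral_mono_ae ?_)
    filter_upwards [hB.life_pos p] with ω hω
    rw [mul_comm C]
    exact mul_le_mul' le_rfl (h _ _ (by positivity))
  have hT0 : ∀ i j (h : ℝ → H → ℝ≥0∞), (∀ y, Measurable fun s => h s y) →
      (∀ s y, 0 ≤ s → (∫⁻ ω', X₀ s y ω' ^ i ∂P) * (∫⁻ ω', X₁ s y ω' ^ j ∂P) ≤ h s y) →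
      ∫⁻ ω, T 0 i j ω ∂P ≤ 2⁻¹ * (ofReal V * resW k (expW V) h s y) := by
    intro i j h hh hle
    rw [hTe, ← hB.lintegral_end p hh]
    refine mul_le_mul' le_rfl (lintegral_mono_ae ?_)
    filter_upwards [hB.life_pos p] with ω hω
    rw [pow_zero, one_mul]; exact hle _ _ (by positivity)
  simp_rw [e]
  rw [lintegral_add_left (hAm.pow_const 3), lintegral_add_left ((hTm 2 1 0).const_mul 3),
    lintegral_add_left ((hTm 2 0 1).const_mul 3), lintegral_add_left ((hTm 1 2 0).const_mul 3),
    lintegral_add_left ((hTm 1 0 2).const_mul 3), lintegral_add_left ((hTm 1 1 1).const_mul 6),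
    lintegral_add_left (hTm 0 3 0), lintegral_add_left (hTm 0 0 3),
    lintegral_add_left ((hTm 0 2 1).const_mul 3),
    lintegral_const_mul _ (hTm 2 1 0), lintegral_const_mul _ (hTm 2 0 1),
    lintegral_const_mul _ (hTm 1 2 0), lintegral_const_mul _ (hTm 1 0 2),
    lintegral_const_mul _ (hTm 1 1 1), lintegral_const_mul _ (hTm 0 2 1),
    lintegral_const_mul _ (hTm 0 1 2)]
  have b1 := hTl 2 1 0 a (fun s y _ => by simpa using (h01 s y).trans (hm₁a s y))
  have b2 := hTl 2 0 1 a (fun s y _ => by simpa using (h11 s y).trans (hm₁a s y))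
  have b3 := hTl 1 2 0 c₂ (fun s y hs => by simpa using (h02 s y).trans (hm₂c s y hs))
  have b4 := hTl 1 0 2 c₂ (fun s y hs => by simpa using (h12 s y).trans (hm₂c s y hs))
  have b5 := hTl 1 1 1 (a ^ 2) (fun s y _ => by
    rw [sq]; exact mul_le_mul' ((h01 s y).trans (hm₁a s y)) ((h11 s y).trans (hm₁a s y)))
  have b6 := hT0 3 0 m₃ hm₃ (fun s y hs => by simpa using h03 s y hs)
  have b7 := hT0 0 3 m₃ hm₃ (fun s y hs => by simpa using h13 s y hs)
  have b8 := hT0 2 1 (fun s y => m₁ s y * m₂ s y) (fun y => (hm₁ y).mul (hm₂ y))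
    (fun s y _ => by rw [mul_comm]; exact mul_le_mul' (h11 s y) (h02 s y))
  have b9 := hT0 1 2 (fun s y => m₁ s y * m₂ s y) (fun y => (hm₁ y).mul (hm₂ y))
    (fun s y _ => mul_le_mul' (h01 s y) (h12 s y))
  have h2 : (2:ℝ≥0∞) * 2⁻¹ = 1 := ENNReal.mul_inv_cancel (by norm_num) (by norm_num)
  set L := lifeOcc k V Φ s y
  calc _ ≤ a ^ 2 * L + (3 * (2⁻¹ * (a * (a * L))) + (3 * (2⁻¹ * (a * (a * L))) +
        (3 * (2⁻¹ * (c₂ * L)) + (3 * (2⁻¹ * (c₂ * L)) + (6 * (2⁻¹ * (a ^ 2 * L)) +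
        (2⁻¹ * (ofReal V * resW k (expW V) m₃ s y) +
        (2⁻¹ * (ofReal V * resW k (expW V) m₃ s y) +
        (3 * (2⁻¹ * (ofReal V * resW k (expW V) (fun s y => m₁ s y * m₂ s y) s y)) +
        3 * (2⁻¹ * (ofReal V * resW k (expW V) (fun s y => m₁ s y * m₂ s y) s y)))))))))) := by
        refine add_le_add hAA3 (add_le_add (mul_le_mul' le_rfl (b1.trans (by gcongr)))
          (add_le_add (mul_le_mul' le_rfl (b2.trans (by gcongr)))
          (add_le_add (mul_le_mul' le_rfl (b3.trans (by gcongr)))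
          (add_le_add (mul_le_mul' le_rfl (b4.trans (by gcongr)))
          (add_le_add (mul_le_mul' le_rfl (b5.trans (by gcongr))) (add_le_add b6 (add_le_add b7
          (add_le_add (mul_le_mul' le_rfl b8) (mul_le_mul' le_rfl b9)))))))))
    -- Coefficient count, splits having probability 1/2: 7 = 1 + 3 + 3 from A³, the two terms 3A²X
    -- and 6AX₀X₁, while the two terms 3AX² give 3c₂.
    _ = a ^ 2 * L + (2 * 2⁻¹) * (6 * a ^ 2 * L + 3 * c₂ * L + ofReal V * resW k (expW V) m₃ s y +
        3 * (ofReal V * resW k (expW V) (fun s y => m₁ s y * m₂ s y) s y)) := by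
        ring
    _ = _ := by rw [h2]; ring

end Step

end IsBranching

end Forest

/-! ### A priori bounds for potentials -/

section PotBounds

variable {H : Type*} [AddCommGroup H] [Countable H] {k : ℝ → H → ℝ≥0∞} {f : ℝ → H → ℝ≥0∞}

lemma pot_le_of_bounded (hk : SymmSemigroup k) {C : ℝ≥0∞} {T : ℝ} (hC : ∀ s y, f s y ≤ C)
    (hT : ∀ s y, T < s → f s y = 0) (s : ℝ) (y : H) :
    pot k f s y ≤ C * ofReal (T - s) := by
  have h1 : pot k f s y ≤ ∫⁻ r in Ioi (0:ℝ), (Iic (T - s)).indicator (fun _ => C) r := by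
    unfold pot resW
    refine setLIntegral_mono' measurableSet_Ioi fun r hr => ?_
    rw [one_mul]
    by_cases h : r ≤ T - s
    · rw [indicator_of_mem (mem_Iic.2 h)]
      exact avg_le_const hk (le_of_lt hr) (fun y => hC _ y) y
    · have : ∀ z, f (s + r) z = 0 := fun z => hT _ _ (by linarith)
      simp [avg, this]
  refine h1.trans ?_
  rw [lintegral_indicator measurableSet_Iic, setLIntegral_const,
    Measure.restrict_apply measurableSet_Iic, inter_comm, Set.Ioi_inter_Iic, Real.volume_Ioc, sub_zero]

/-- The linear bound T - s is weakened to an exponential, the shape in which `pot_le_iterate` gains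
a factor 1/2 per generation. -/
lemma pot_le_exp (hk : SymmSemigroup k) {C : ℝ≥0∞} {T V : ℝ} (hV : 0 < V) (hC : ∀ s y, f s y ≤ C)
    (hT : ∀ s y, T < s → f s y = 0) (s : ℝ) (y : H) :
    pot k f s y ≤ C * (ofReal V)⁻¹ * ofReal (rexp (V * (T - s))) := by
  refine (pot_le_of_bounded hk hC hT s y).trans ?_
  rw [mul_assoc]
  gcongr
  rw [← ENNReal.div_eq_inv_mul, ENNReal.le_div_iff_mul_le (by simp [hV]) (by simp), mul_comm,
    ← ofReal_mul hV.le]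
  gcongr
  linarith [add_one_le_exp (V * (T - s))]

lemma pot_eq_zero {T : ℝ} (hT : ∀ s y, T < s → f s y = 0) {s : ℝ} (hs : T ≤ s) (y : H) :
    pot k f s y = 0 := by
  unfold pot resW
  rw [setLIntegral_congr_fun (g := fun _ => 0) measurableSet_Ioi, lintegral_zero]
  intro r hr
  have hr' : 0 < r := hr
  have : ∀ z, f (s + r) z = 0 := fun z => hT _ _ (by linarith)
  simp [avg, this]

/-- A renewal part plus a potential part is an exact fixed point of the moment recursion with source
A h + B V R g. Bounds of this shape therefore pass through the induction over generations without
loss. -/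
lemma renewal_affine_eq (hk : SymmSemigroup k) {g h : ℝ → H → ℝ≥0∞}
    (hh : ∀ y, Measurable fun s => h s y) (hg : ∀ y, Measurable fun s => g s y) {V : ℝ} (hV : 0 < V)
    (A B : ℝ≥0∞) (s : ℝ) (y : H) :
    A * renewal k V h s y + B * (ofReal V * pot k g s y) =
      A * h s y + B * (ofReal V * resW k (expW V) g s y) + ofReal V *
        resW k (expW V) (fun s y => A * renewal k V h s y + B * (ofReal V * pot k g s y)) s y := by
  have hr := fun y => measurable_renewal hk V hh y
  have hp := fun y => measurable_pot hk hg y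
  rw [resW_add hk (measurable_expW V) (fun y => (hr y).const_mul A),
    resW_const_mul hk (measurable_expW V) hr, resW_const_mul hk (measurable_expW V)
      (fun y => (hp y).const_mul _), resW_const_mul hk (measurable_expW V) hp]
  conv_lhs => rw [renewal_eq hk hh hV, pot_eq hk hg hV]
  ring

lemma tsum_pot_zero (hk : SymmSemigroup k) (hf : ∀ y, Measurable fun s => f s y) :
    ∑' y, pot k f 0 y = ∫⁻ s in Ioi (0:ℝ), ∑' y, f s y := by
  rw [pot, tsum_resW hk measurable_const hf]
  simp

/-- Duality between a space-time function and a potential. -/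
lemma lintegral_mul_pot_le (hk : SymmSemigroup k) {m g : ℝ → H → ℝ≥0∞}
    (hg : ∀ y, Measurable fun s => g s y) {T : ℝ}
    (hT : ∀ s y, T < s → g s y = 0) {b : ℝ → ℝ≥0∞} (hbm : Measurable b)
    (hb : ∀ s r y, 0 ≤ s → 0 ≤ r → avg k r (m s) y ≤ b r) :
    ∫⁻ s in Ioi (0:ℝ), ∑' y, m s y * pot k g s y ≤
      (∫⁻ r in Ioc 0 T, b r) * ∫⁻ s in Ioi (0:ℝ), ∑' y, g s y := by
  have hgm : Measurable fun s => ∑' y, g s y := Measurable.tsum hg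
  have hb' : Measurable ((Iic T).indicator b) := hbm.indicator measurableSet_Iic
  have h1 : ∀ s, 0 < s → ∑' y, m s y * pot k g s y ≤
      ∫⁻ r in Ioi (0:ℝ), (Iic T).indicator b r * ∑' y, g (s + r) y := by
    intro s hs
    have e : ∀ y, m s y * pot k g s y = ∫⁻ r in Ioi (0:ℝ), m s y * avg k r (g (s + r)) y := by
      intro y
      rw [pot, resW, ← lintegral_const_mul _ (measurable_resW_integrand hk measurable_const hg y s)]
      simp
    simp_rw [e]
    rw [← lintegral_tsum fun y => ((measurable_resW_aux hk hg y s).const_mul _).aemeasurable]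
    refine setLIntegral_mono' measurableSet_Ioi fun r hr => ?_
    -- Self-adjointness moves the semigroup from g to m, where it is controlled by b.
    rw [tsum_mul_avg hk]
    by_cases hrT : r ≤ T
    · rw [indicator_of_mem (mem_Iic.2 hrT), mul_comm, ← ENNReal.tsum_mul_right]
      exact tsum_le_tsum fun y => mul_le_mul' le_rfl (hb s r y hs.le (le_of_lt hr))
    · have : ∀ z, g (s + r) z = 0 := fun z => hT _ _ (by linarith)
      simp [this]
  refine (setLIntegral_mono' measurableSet_Ioi h1).trans ?_
  rw [lintegral_lintegral_swap]
  · rw [show Ioc 0 T = Iic T ∩ Ioi 0 by rw [inter_comm, Set.Ioi_inter_Iic],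
      ← Measure.restrict_restrict measurableSet_Iic, ← lintegral_indicator measurableSet_Iic,
      ← lintegral_mul_const _ hb']
    refine setLIntegral_mono' measurableSet_Ioi fun r hr => ?_
    rw [lintegral_const_mul (f := fun s => ∑' y, g (s + r) y) _ (hgm.comp (measurable_add_const r))]
    refine mul_le_mul' le_rfl ?_
    simp_rw [add_comm _ r]
    rw [lintegral_Ioi_shift (fun v => ∑' y, g v y)]
    exact lintegral_mono_set (Set.Ioi_subset_Ioi (le_of_lt hr))
  · apply Measurable.aemeasurable
    exact (hb'.comp measurable_snd).mul (hgm.comp (measurable_fst.add measurable_snd))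

lemma two_mul_mul_avg_le (hk : SymmSemigroup k) {r : ℝ} (hr : 0 ≤ r) (x : ℝ≥0∞) (f : H → ℝ≥0∞)
    (y : H) : 2 * (x * avg k r f y) ≤ x ^ 2 + avg k r (fun z => f z ^ 2) y := by
  have h2 : ∀ u v : ℝ≥0∞, 2 * (u * v) ≤ u ^ 2 + v ^ 2 := by
    intro u v
    rcases le_total u v with h | h
    · obtain ⟨d, rfl⟩ := le_iff_exists_add.1 h
      calc 2 * (u * (u + d)) ≤ 2 * (u * (u + d)) + d ^ 2 := le_self_add
        _ = _ := by ring
    · obtain ⟨d, rfl⟩ := le_iff_exists_add.1 h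
      calc 2 * ((v + d) * v) ≤ 2 * ((v + d) * v) + d ^ 2 := le_self_add
        _ = _ := by ring
  calc 2 * (x * avg k r f y) = avg k r (fun z => 2 * (x * f z)) y := by
        rw [avg_const_mul, avg_const_mul]
    _ ≤ avg k r (fun z => x ^ 2 + f z ^ 2) y := avg_mono (fun z => h2 _ _) r y
    _ = _ := by rw [avg_add, avg_const hk hr]

/-- Young's inequality for a weighted time average: 2uv ≤ u² + v² inside the average, then
invariance of counting measure and a time shift bound each square by the mass of w times the L²
norm. -/
lemma lintegral_mul_resW_le (hk : SymmSemigroup k) {w : ℝ → ℝ≥0∞} (hw : Measurable w)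
    {m : ℝ → H → ℝ≥0∞} (hm : ∀ y, Measurable fun s => m s y) :
    ∫⁻ s in Ioi (0:ℝ), ∑' y, m s y * resW k w m s y ≤
      (∫⁻ r in Ioi (0:ℝ), w r) * ∫⁻ s in Ioi (0:ℝ), ∑' y, m s y ^ 2 := by
  have hm2 : ∀ y, Measurable fun s => m s y ^ 2 := fun y => (hm y).pow_const 2
  have h1 : ∀ s y, 2 * (m s y * resW k w m s y) ≤
      (∫⁻ r in Ioi (0:ℝ), w r) * m s y ^ 2 + resW k w (fun s y => m s y ^ 2) s y := by
    intro s y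
    rw [resW, resW, ← lintegral_mul_const _ hw, ← lintegral_add_left (hw.mul_const _),
      ← lintegral_const_mul _ (measurable_resW_integrand hk hw hm y s),
      ← lintegral_const_mul _ ((measurable_resW_integrand hk hw hm y s).const_mul _)]
    refine setLIntegral_mono' measurableSet_Ioi fun r hr => ?_
    calc 2 * (m s y * (w r * avg k r (m (s + r)) y)) = w r * (2 * (m s y * avg k r (m (s + r)) y)) := by
          ring
      _ ≤ w r * (m s y ^ 2 + avg k r (fun z => m (s + r) z ^ 2) y) := by
          gcongr; exact two_mul_mul_avg_le hk (le_of_lt hr) _ _ _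
      _ = _ := by rw [mul_add]
  have h2 : 2 * ∫⁻ s in Ioi (0:ℝ), ∑' y, m s y * resW k w m s y ≤
      2 * ((∫⁻ r in Ioi (0:ℝ), w r) * ∫⁻ s in Ioi (0:ℝ), ∑' y, m s y ^ 2) := by
    calc _ = ∫⁻ s in Ioi (0:ℝ), ∑' y, 2 * (m s y * resW k w m s y) := by
          simp_rw [ENNReal.tsum_mul_left]
          rw [lintegral_const_mul]
          exact Measurable.tsum fun y => (hm y).mul (measurable_resW hk hw hm y)
      _ ≤ ∫⁻ s in Ioi (0:ℝ), (((∫⁻ r in Ioi (0:ℝ), w r) * ∑' y, m s y ^ 2) +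
            ∑' y, resW k w (fun s y => m s y ^ 2) s y) := by
          refine lintegral_mono fun s => ?_
          rw [← ENNReal.tsum_mul_left, ← tsum_add]
          exact tsum_le_tsum fun y => h1 s y
      _ = (∫⁻ r in Ioi (0:ℝ), w r) * (∫⁻ s in Ioi (0:ℝ), ∑' y, m s y ^ 2) +
            ∫⁻ s in Ioi (0:ℝ), ∑' y, resW k w (fun s y => m s y ^ 2) s y := by
          rw [lintegral_add_left, lintegral_const_mul]
          · exact Measurable.tsum hm2
          · exact (Measurable.tsum hm2).const_mul _
      _ ≤ _ := by
          rw [two_mul]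
          gcongr
          exact lintegral_tsum_resW_le hk hw hm2
  exact (ENNReal.mul_le_mul_iff_right (by norm_num) (by norm_num)).1 h2

end PotBounds

section LifeConst

/-- `E(1 + L)³` for an exponential lifetime `L`. -/
def lifeConst (V : ℝ) : ℝ≥0∞ := ∫⁻ l, ofReal (1 + l) ^ 3 ∂(expMeasure V)

lemma lifeConst_ne_top {V : ℝ} (hV : 0 < V) : lifeConst V ≠ ⊤ := by
  -- With this choice (1+r)³ ≤ e⁻³ exp(Vr/2), so half of the exponential rate survives; e ≤ 1 is
  -- used at r = 0.
  set e := min 1 (V / 6) with he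
  have he0 : 0 < e := by positivity
  have he1 : e ≤ 1 := min_le_left _ _
  have he2 : e ≤ V / 6 := min_le_right _ _
  have hle : lifeConst V ≤ ofReal (2 * e⁻¹ ^ 3) *
      (ofReal (V / 2) * ∫⁻ r in Ioi (0:ℝ), expW (V / 2) r) := by
    rw [lifeConst, lintegral_expMeasure V (by fun_prop), ← lintegral_const_mul _ (measurable_expW _),
      ← lintegral_const_mul _ ((measurable_expW _).const_mul _)]
    refine setLIntegral_mono' measurableSet_Ioi fun r hr => ?_
    have hr0 : 0 < r := hr
    rw [expW, ← ofReal_pow (by positivity), ← ofReal_mul (by positivity),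
      ← ofReal_mul (by positivity), ← ofReal_mul (by positivity)]
    apply ofReal_le_ofReal
    have h1 : 1 + r ≤ e⁻¹ * rexp (V / 6 * r) := by
      have h2 := add_one_le_exp (e * r)
      have h3 : rexp (e * r) ≤ rexp (V / 6 * r) := by gcongr
      have h4 : 1 + r ≤ e⁻¹ * (e * r + 1) := by
        rw [mul_add, inv_mul_cancel_left₀ he0.ne', mul_one]
        linarith [(one_le_inv₀ he0).2 he1]
      exact h4.trans (by gcongr; linarith)
    calc V * rexp (-(V * r)) * (1 + r) ^ 3 ≤ V * rexp (-(V * r)) *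
          (e⁻¹ * rexp (V / 6 * r)) ^ 3 := by gcongr
      _ = V * e⁻¹ ^ 3 * (rexp (-(V * r)) * rexp (V / 6 * r) ^ 3) := by ring
      _ = 2 * e⁻¹ ^ 3 * (V / 2 * rexp (-(V / 2 * r))) := by
          rw [← Real.exp_nat_mul, ← exp_add]; push_cast
          rw [show -(V * r) + 3 * (V / 6 * r) = -(V / 2 * r) by ring]; ring
  rw [lintegral_expW (by positivity), mul_one] at hle
  exact ne_top_of_le_ne_top ofReal_ne_top hle

lemma tailW_le_lifeConst (V : ℝ) {r : ℝ} (hr : 0 < r) :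
    tailW V (fun l => ofReal (1 + l) ^ 2) r ≤ lifeConst V := by
  unfold tailW lifeConst
  refine lintegral_mono fun l => ?_
  dsimp only
  split_ifs with h
  · exact pow_le_pow_right₀ (by rw [one_le_ofReal]; linarith) (by norm_num)
  · exact zero_le

/-- By Fubini, integrating the indicator of r < l over r > 0 gives l for positive l. This raises the
square of 1 + l to the cube defining `lifeConst`. -/
lemma lintegral_tailW_le {V : ℝ} (hV : 0 < V) :
    ∫⁻ r in Ioi (0:ℝ), tailW V (fun l => ofReal (1 + l) ^ 2) r ≤ lifeConst V := by
  have := isProbabilityMeasure_expMeasure hV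
  unfold tailW
  rw [lintegral_lintegral_swap]
  · unfold lifeConst
    refine lintegral_mono fun l => ?_
    have h1 : ∀ r : ℝ, (if r < l then ofReal (1 + l) ^ 2 else 0) =
        (Iio l).indicator (fun _ => ofReal (1 + l) ^ 2) r := by
      intro r; simp [indicator]
    simp_rw [h1]
    rw [lintegral_indicator measurableSet_Iio, setLIntegral_const,
      Measure.restrict_apply measurableSet_Iio, inter_comm, Set.Ioi_inter_Iio, Real.volume_Ioo,
      pow_succ (n := 2)]
    gcongr
    linarith
  · apply Measurable.aemeasurable
    exact Measurable.ite (measurableSet_lt measurable_fst measurable_snd) (by fun_prop)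
      measurable_const

variable {H : Type*} [AddCommGroup H] [Countable H] {k : ℝ → H → ℝ≥0∞} {V : ℝ} {Φ : ℝ → H → ℝ≥0∞}

lemma measurable_lifeOcc (hk : SymmSemigroup k) (hV : 0 < V) (hΦ : ∀ y, Measurable fun s => Φ s y)
    (y : H) : Measurable fun s => lifeOcc k V Φ s y :=
  measurable_resW hk (measurable_tailW hV (by fun_prop)) hΦ y

lemma lifeOcc_le (hk : SymmSemigroup k) (hΦ : ∀ y, Measurable fun s => Φ s y) (s : ℝ) (y : H) :
    lifeOcc k V Φ s y ≤ lifeConst V * pot k Φ s y := by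
  unfold lifeOcc pot resW
  rw [← lintegral_const_mul _ (measurable_resW_integrand hk measurable_const hΦ y s)]
  refine setLIntegral_mono' measurableSet_Ioi fun r hr => ?_
  rw [one_mul]
  exact mul_le_mul' (tailW_le_lifeConst V hr) le_rfl

lemma pot_lifeOcc (hk : SymmSemigroup k) (hV : 0 < V) (hΦ : ∀ y, Measurable fun s => Φ s y) (s : ℝ)
    (y : H) : pot k (lifeOcc k V Φ) s y =
      resW k (tailW V fun l => ofReal (1 + l) ^ 2) (pot k Φ) s y :=
  resW_comm hk measurable_const (measurable_tailW hV (by fun_prop)) hΦ s y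

/-- G commutes with the lifetime average, so everything reduces to the bound on GΦ and the third
lifetime moment. -/
lemma renewal_lifeOcc_le (hk : SymmSemigroup k) (hV : 0 < V) (hΦ : ∀ y, Measurable fun s => Φ s y)
    {a : ℝ≥0∞} (ha : ∀ s y, pot k Φ s y ≤ a) (s : ℝ) (y : H) :
    renewal k V (lifeOcc k V Φ) s y ≤ lifeConst V * (1 + ofReal V) * a := by
  rw [renewal, pot_lifeOcc hk hV hΦ]
  calc _ ≤ lifeConst V * a + ofReal V * (lifeConst V * a) := by
        refine add_le_add ((lifeOcc_le hk hΦ s y).trans (mul_le_mul' le_rfl (ha s y)))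
          (mul_le_mul' le_rfl ?_)
        exact (resW_le_const hk (measurable_tailW hV (by fun_prop)) ha s y).trans
          (mul_le_mul' (lintegral_tailW_le hV) le_rfl)
    _ = _ := by ring

lemma lintegral_tsum_lifeOcc_le (hk : SymmSemigroup k) (hV : 0 < V)
    (hΦ : ∀ y, Measurable fun s => Φ s y) :
    ∫⁻ s in Ioi (0:ℝ), ∑' y, lifeOcc k V Φ s y ≤ lifeConst V * ∫⁻ s in Ioi (0:ℝ), ∑' y, Φ s y :=
  (lintegral_tsum_resW_le hk (measurable_tailW hV (by fun_prop)) hΦ).trans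
    (mul_le_mul' (lintegral_tailW_le hV) le_rfl)

lemma tsum_renewal_lifeOcc_le (hk : SymmSemigroup k) (hV : 0 < V)
    (hΦ : ∀ y, Measurable fun s => Φ s y) :
    ∑' y, renewal k V (lifeOcc k V Φ) 0 y ≤
      lifeConst V * (1 + ofReal V) * ∫⁻ s in Ioi (0:ℝ), ∑' y, Φ s y := by
  unfold renewal
  rw [tsum_add, ENNReal.tsum_mul_left, tsum_pot_zero hk (measurable_lifeOcc hk hV hΦ)]
  calc _ ≤ lifeConst V * (∫⁻ s in Ioi (0:ℝ), ∑' y, Φ s y) +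
        ofReal V * (lifeConst V * ∫⁻ s in Ioi (0:ℝ), ∑' y, Φ s y) := by
        refine add_le_add ?_ (mul_le_mul' le_rfl (lintegral_tsum_lifeOcc_le hk hV hΦ))
        rw [← tsum_pot_zero hk hΦ, ← ENNReal.tsum_mul_left]
        exact tsum_le_tsum fun y => lifeOcc_le hk hΦ 0 y
    _ = _ := by ring

end LifeConst

section Bounds

variable {H : Type*} [AddCommGroup H] [Countable H] {k : ℝ → H → ℝ≥0∞} {V : ℝ} {Φ : ℝ → H → ℝ≥0∞}

/-- Upper bound for the second moment of the occupation functional of a family. -/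
def secondBd (k : ℝ → H → ℝ≥0∞) (V : ℝ) (Φ : ℝ → H → ℝ≥0∞) (a : ℝ≥0∞) (s : ℝ) (y : H) : ℝ≥0∞ :=
  3 * a * renewal k V (lifeOcc k V Φ) s y + 1 * (ofReal V * pot k (fun s y => pot k Φ s y ^ 2) s y)

/-- Upper bound for the third moment of the occupation functional of a family. -/
def thirdBd (k : ℝ → H → ℝ≥0∞) (V : ℝ) (Φ : ℝ → H → ℝ≥0∞) (a c₂ : ℝ≥0∞) (s : ℝ) (y : H) : ℝ≥0∞ :=
  (7 * a ^ 2 + 3 * c₂) * renewal k V (lifeOcc k V Φ) s y +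
    3 * (ofReal V * pot k (fun s y => pot k Φ s y * secondBd k V Φ a s y) s y)

lemma measurable_secondBd (hk : SymmSemigroup k) (hV : 0 < V) (hΦ : ∀ y, Measurable fun s => Φ s y)
    (a : ℝ≥0∞) (y : H) : Measurable fun s => secondBd k V Φ a s y :=
  ((measurable_renewal hk V (measurable_lifeOcc hk hV hΦ) y).const_mul _).add
    (((measurable_pot hk (fun y => (measurable_pot hk hΦ y).pow_const 2) y).const_mul _).const_mul _)

lemma measurable_thirdBd (hk : SymmSemigroup k) (hV : 0 < V) (hΦ : ∀ y, Measurable fun s => Φ s y)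
    (a c₂ : ℝ≥0∞) (y : H) : Measurable fun s => thirdBd k V Φ a c₂ s y :=
  ((measurable_renewal hk V (measurable_lifeOcc hk hV hΦ) y).const_mul _).add
    (((measurable_pot hk (fun y => (measurable_pot hk hΦ y).mul
      (measurable_secondBd hk hV hΦ a y)) y).const_mul _).const_mul _)

lemma tsum_secondBd_le (hk : SymmSemigroup k) (hV : 0 < V) (hΦ : ∀ y, Measurable fun s => Φ s y)
    (a : ℝ≥0∞) : ∑' y, secondBd k V Φ a 0 y ≤
      3 * a * (lifeConst V * (1 + ofReal V)) * (∫⁻ s in Ioi (0:ℝ), ∑' y, Φ s y) +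
      ofReal V * ∫⁻ s in Ioi (0:ℝ), ∑' y, pot k Φ s y ^ 2 := by
  unfold secondBd
  rw [tsum_add, ENNReal.tsum_mul_left, ENNReal.tsum_mul_left, one_mul,
    ENNReal.tsum_mul_left, tsum_pot_zero hk fun y => (measurable_pot hk hΦ y).pow_const 2, mul_assoc (3 * a)]
  exact add_le_add (mul_le_mul' le_rfl (tsum_renewal_lifeOcc_le hk hV hΦ)) le_rfl

/-- Use (GΦ)² ≤ a GΦ; then G(GΦ) is a time integral of semigroup averages of GΦ, each at most b r.
The integral stops at T because GΦ vanishes from time T on and s ≥ 0. -/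
lemma secondBd_le (hk : SymmSemigroup k) (hV : 0 < V) (hΦ : ∀ y, Measurable fun s => Φ s y) {T : ℝ}
    (hT : ∀ s y, T < s → Φ s y = 0) {a : ℝ≥0∞} (ha : ∀ s y, pot k Φ s y ≤ a) {b : ℝ → ℝ≥0∞}
    (hb : ∀ s r y, 0 ≤ s → 0 ≤ r → avg k r (pot k Φ s) y ≤ b r) (s : ℝ) (y : H) (hs : 0 ≤ s) :
    secondBd k V Φ a s y ≤ 3 * a ^ 2 * (lifeConst V * (1 + ofReal V)) +
      a * (ofReal V * ∫⁻ r in Ioc 0 T, b r) := by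
  unfold secondBd
  rw [one_mul]
  refine add_le_add ?_ ?_
  · refine (mul_le_mul' le_rfl (renewal_lifeOcc_le hk hV hΦ ha s y)).trans_eq ?_
    ring
  · rw [mul_left_comm]
    refine mul_le_mul' le_rfl ?_
    have h1 : pot k (fun s y => pot k Φ s y ^ 2) s y ≤ a * pot k (pot k Φ) s y := by
      have h3 := resW_const_mul hk (w := fun _ => 1) measurable_const (measurable_pot hk hΦ) a s y
      refine le_of_le_of_eq ?_ h3
      exact resW_mono (fun _ _ => le_rfl) (fun s y => by rw [sq]; exact mul_le_mul' (ha s y) le_rfl) s y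
    refine h1.trans (mul_le_mul' le_rfl ?_)
    rw [show Ioc 0 T = Iic T ∩ Ioi 0 by rw [inter_comm, Set.Ioi_inter_Iic],
      ← Measure.restrict_restrict measurableSet_Iic, ← lintegral_indicator measurableSet_Iic]
    unfold pot
    rw [resW]
    refine setLIntegral_mono' measurableSet_Ioi fun r hr => ?_
    have hr' : 0 < r := hr
    rw [one_mul]
    by_cases hrT : r ≤ T
    · rw [indicator_of_mem (mem_Iic.2 hrT), show resW k (fun _ => 1) Φ = pot k Φ from rfl]
      have h2 : avg k r (pot k Φ (s + r)) y ≤ b r := hb _ _ _ (by linarith) hr'.le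
      exact h2
    · have : ∀ z, resW k (fun _ => 1) Φ (s + r) z = 0 := fun z => pot_eq_zero hT (by linarith) z
      simp [avg, this]

/-- Summing over starting sites turns the outer potential into a space-time integral of GΦ times the
second moment bound. The single-particle part is handled by the bound on GΦ and by Young's
inequality, the main part by the duality `lintegral_mul_pot_le`. -/
lemma tsum_thirdBd_le (hk : SymmSemigroup k) (hV : 0 < V) (hΦ : ∀ y, Measurable fun s => Φ s y)
    {T : ℝ} (hT : ∀ s y, T < s → Φ s y = 0) {a : ℝ≥0∞} (ha : ∀ s y, pot k Φ s y ≤ a) (c₂ : ℝ≥0∞)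
    {b : ℝ → ℝ≥0∞} (hbm : Measurable b)
    (hb : ∀ s r y, 0 ≤ s → 0 ≤ r → avg k r (pot k Φ s) y ≤ b r) :
    ∑' y, thirdBd k V Φ a c₂ 0 y ≤ (7 * a ^ 2 + 3 * c₂) * (lifeConst V * (1 + ofReal V) *
        ∫⁻ s in Ioi (0:ℝ), ∑' y, Φ s y) +
      3 * (ofReal V * (3 * a * (a * (lifeConst V * ∫⁻ s in Ioi (0:ℝ), ∑' y, Φ s y) +
        ofReal V * (lifeConst V * ∫⁻ s in Ioi (0:ℝ), ∑' y, pot k Φ s y ^ 2)) +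
        ofReal V * ((∫⁻ r in Ioc 0 T, b r) * ∫⁻ s in Ioi (0:ℝ), ∑' y, pot k Φ s y ^ 2))) := by
  have hp := measurable_pot hk hΦ
  have hp2 : ∀ y, Measurable fun s => pot k Φ s y ^ 2 := fun y => (hp y).pow_const 2
  have hl := measurable_lifeOcc hk hV hΦ
  have hsm := measurable_secondBd hk hV hΦ a
  unfold thirdBd
  rw [tsum_add, ENNReal.tsum_mul_left, ENNReal.tsum_mul_left, ENNReal.tsum_mul_left,
    tsum_pot_zero hk (f := fun s y => pot k Φ s y * secondBd k V Φ a s y)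
      fun y => (hp y).mul (hsm y)]
  refine add_le_add (mul_le_mul' le_rfl (tsum_renewal_lifeOcc_le hk hV hΦ))
    (mul_le_mul' le_rfl (mul_le_mul' le_rfl ?_))
  have e : ∀ s, ∑' y, pot k Φ s y * secondBd k V Φ a s y =
      3 * a * (∑' y, pot k Φ s y * lifeOcc k V Φ s y +
        ofReal V * ∑' y, pot k Φ s y * pot k (lifeOcc k V Φ) s y) +
      ofReal V * ∑' y, pot k Φ s y * pot k (fun s y => pot k Φ s y ^ 2) s y := by
    intro s
    simp only [← ENNReal.tsum_mul_left, ← tsum_add]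
    refine tsum_congr fun y => ?_
    rw [secondBd, renewal]; ring
  simp_rw [e]
  have m1 : Measurable fun s => ∑' y, pot k Φ s y * lifeOcc k V Φ s y :=
    Measurable.tsum fun y => (hp y).mul (hl y)
  have m2 : Measurable fun s => ∑' y, pot k Φ s y * pot k (lifeOcc k V Φ) s y :=
    Measurable.tsum fun y => (hp y).mul (measurable_pot hk hl y)
  have m3 : Measurable fun s => ∑' y, pot k Φ s y * pot k (fun s y => pot k Φ s y ^ 2) s y :=
    Measurable.tsum fun y => (hp y).mul (measurable_pot hk hp2 y)
  rw [lintegral_add_right _ (m3.const_mul _), lintegral_const_mul (3 * a)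
      (show Measurable fun s => ∑' y, pot k Φ s y * lifeOcc k V Φ s y + ofReal V *
        ∑' y, pot k Φ s y * pot k (lifeOcc k V Φ) s y from m1.add (m2.const_mul _)),
    lintegral_const_mul _ m3, lintegral_add_right _ (m2.const_mul _), lintegral_const_mul _ m2]
  refine add_le_add (mul_le_mul' le_rfl (add_le_add ?_ (mul_le_mul' le_rfl ?_)))
    (mul_le_mul' le_rfl ?_)
  · refine le_trans ?_ (mul_le_mul' le_rfl (lintegral_tsum_lifeOcc_le hk hV hΦ))
    rw [← lintegral_const_mul _ (Measurable.tsum hl)]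
    refine lintegral_mono fun s => ?_
    rw [← ENNReal.tsum_mul_left]
    exact tsum_le_tsum fun y => mul_le_mul' (ha s y) le_rfl
  · simp_rw [pot_lifeOcc hk hV hΦ]
    exact (lintegral_mul_resW_le hk (measurable_tailW hV (by fun_prop)) hp).trans
      (mul_le_mul' (lintegral_tailW_le hV) le_rfl)
  · refine lintegral_mul_pot_le hk hp2 (T := T) (fun s y hs => ?_) hbm hb
    rw [pot_eq_zero hT hs.le]; simp

end Bounds

/-! ### Moments of whole families -/

section Forest

variable {H : Type*} [AddCommGroup H] [Countable H] [MeasurableSpace H] [DiscreteMeasurableSpace H]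
  {ι Ω : Type*} [mΩ : MeasurableSpace Ω]

namespace IsBranching

variable {k : ℝ → H → ℝ≥0∞} {V : ℝ} {P : Measure Ω} [IsProbabilityMeasure P] {ch : Bool → ι → ι}
  {life : ι → Ω → ℝ} {split : ι → Ω → Bool} {walk : ι → ℝ≥0 → Ω → H} {F : ι → MeasurableSpace Ω}
  {Φ : ℝ → H → ℝ≥0∞}

lemma two_inv_mul_add_self (x : ℝ≥0∞) : 2⁻¹ * (x + x) = x := by
  rw [← two_mul, ← mul_assoc, ENNReal.inv_mul_cancel (by norm_num) (by norm_num), one_mul]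

lemma lintegral_famN_le (hB : IsBranching k V P ch life split walk F)
    (hΦ : ∀ y, Measurable fun s => Φ s y) (n : ℕ) (p : ι) (s : ℝ) (y : H) :
    ∫⁻ ω, famN Φ ch life split walk n p s y ω ^ 1 ∂P ≤ pot k Φ s y := by
  induction n generalizing p s y with
  | zero => simp [famN]
  | succ n ih =>
    simp only [pow_one] at ih ⊢
    unfold famN
    rw [hB.lintegral_branchStep hΦ p (hB.fieldMeas_famN hΦ n _) (hB.fieldMeas_famN hΦ n _),
      pot_eq hB.semigroup hΦ hB.V_pos]
    gcongr
    refine resW_mono (fun _ _ => le_rfl) (fun s y => ?_) s y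
    calc _ ≤ 2⁻¹ * (pot k Φ s y + pot k Φ s y) := by gcongr <;> exact ih _ _ _
      _ = _ := two_inv_mul_add_self _

/-- The first moment of the occupation functional of a family is the potential of `Φ`. -/
lemma lintegral_fam (hB : IsBranching k V P ch life split walk F)
    (hΦ : ∀ y, Measurable fun s => Φ s y) {T : ℝ} (hT : ∀ s y, T < s → Φ s y = 0) {κ : ℝ≥0∞}
    (hκ : κ ≠ ⊤) (hΦκ : ∀ s y, Φ s y ≤ κ) (p : ι) (s : ℝ) (y : H) :
    ∫⁻ ω, fam Φ ch life split walk p s y ω ∂P = pot k Φ s y := by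
  have h1 := hB.lintegral_fam_pow hΦ 1 one_ne_zero p s y
  simp only [pow_one] at h1
  have hup : ∀ n, ∫⁻ ω, famN Φ ch life split walk n p s y ω ∂P ≤ pot k Φ s y := fun n => by
    simpa using hB.lintegral_famN_le hΦ n p s y
  refine le_antisymm (by rw [h1]; exact iSup_le hup) ?_
  -- The truncated means satisfy the renewal recursion, so GΦ exceeds them by a geometrically small
  -- amount. No uniqueness theorem for the limiting equation is needed.
  have h2 := pot_le_iterate hB.semigroup hΦ hB.V_pos (pot_le_exp hB.semigroup hB.V_pos hΦκ hT)
    (u := fun n p s y => ∫⁻ ω, famN Φ ch life split walk n p s y ω ∂P) (ch := ch)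
    (fun n p s y => by
      conv_rhs => unfold famN
      rw [hB.lintegral_branchStep hΦ p (hB.fieldMeas_famN hΦ n _) (hB.fieldMeas_famN hΦ n _)])
  have h3 : Tendsto (fun n : ℕ => (∫⁻ ω, fam Φ ch life split walk p s y ω ∂P) +
      κ * (ofReal V)⁻¹ * 2⁻¹ ^ n * ofReal (rexp (V * (T - s)))) atTop
      (𝓝 ((∫⁻ ω, fam Φ ch life split walk p s y ω ∂P) +
      κ * (ofReal V)⁻¹ * 0 * ofReal (rexp (V * (T - s))))) := by
    refine Tendsto.const_add _ (ENNReal.Tendsto.mul_const (ENNReal.Tendsto.const_mul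
      (ENNReal.tendsto_pow_atTop_nhds_zero_of_lt_one (by norm_num)) (Or.inr ?_)) (Or.inr (by simp)))
    exact mul_ne_top hκ (by simp [hB.V_pos])
  rw [mul_zero, zero_mul, add_zero] at h3
  refine ge_of_tendsto' h3 fun n => (h2 n p s y).trans (add_le_add ?_ le_rfl)
  rw [h1]
  exact le_iSup (fun n => ∫⁻ ω, famN Φ ch life split walk n p s y ω ∂P) n

lemma lintegral_famN_sq_le (hB : IsBranching k V P ch life split walk F)
    (hΦ : ∀ y, Measurable fun s => Φ s y) {a : ℝ≥0∞}
    (hA : ∀ p s y ω, occ Φ (life p) (walk p) s y ω ≤ a * ofReal (1 + life p ω))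
    (ha : ∀ s y, pot k Φ s y ≤ a) (n : ℕ) (p : ι) (s : ℝ) (y : H) :
    ∫⁻ ω, famN Φ ch life split walk n p s y ω ^ 2 ∂P ≤ secondBd k V Φ a s y := by
  induction n generalizing p s y with
  | zero => simp [famN]
  | succ n ih =>
    have h1 := hB.lintegral_famN_le hΦ n
    have := hB.lintegral_branchStep_sq_le hΦ p (hA p) (measurable_pot hB.semigroup hΦ)
      (measurable_secondBd hB.semigroup hB.V_pos hΦ a) ha (hB.fieldMeas_famN hΦ n (ch false p))
      (hB.fieldMeas_famN hΦ n (ch true p)) (h1 _) (h1 _) (ih _) (ih _) s y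
    unfold famN
    refine this.trans_eq ?_
    have h2 := renewal_affine_eq hB.semigroup (measurable_lifeOcc hB.semigroup hB.V_pos hΦ)
      (fun y => (measurable_pot hB.semigroup hΦ y).pow_const 2) hB.V_pos (3 * a) 1 s y
    rw [one_mul (ofReal V * resW k (expW V) _ s y)] at h2
    exact h2.symm

lemma lintegral_fam_sq_le (hB : IsBranching k V P ch life split walk F)
    (hΦ : ∀ y, Measurable fun s => Φ s y) {a : ℝ≥0∞}
    (hA : ∀ p s y ω, occ Φ (life p) (walk p) s y ω ≤ a * ofReal (1 + life p ω))
    (ha : ∀ s y, pot k Φ s y ≤ a) (p : ι) (s : ℝ) (y : H) :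
    ∫⁻ ω, fam Φ ch life split walk p s y ω ^ 2 ∂P ≤ secondBd k V Φ a s y := by
  rw [hB.lintegral_fam_pow hΦ 2 two_ne_zero]
  exact iSup_le fun n => hB.lintegral_famN_sq_le hΦ hA ha n p s y

lemma lintegral_fam_cube_le (hB : IsBranching k V P ch life split walk F)
    (hΦ : ∀ y, Measurable fun s => Φ s y) {a c₂ : ℝ≥0∞}
    (hA : ∀ p s y ω, occ Φ (life p) (walk p) s y ω ≤ a * ofReal (1 + life p ω))
    (ha : ∀ s y, pot k Φ s y ≤ a) (hc : ∀ s y, 0 ≤ s → secondBd k V Φ a s y ≤ c₂)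
    (p : ι) (s : ℝ) (hs : 0 ≤ s) (y : H) :
    ∫⁻ ω, fam Φ ch life split walk p s y ω ^ 3 ∂P ≤ thirdBd k V Φ a c₂ s y := by
  rw [hB.lintegral_fam_pow hΦ 3 three_ne_zero]
  refine iSup_le fun n => ?_
  induction n generalizing p s y with
  | zero => simp [famN]
  | succ n ih =>
    have h1 := hB.lintegral_famN_le hΦ n
    have h2 := hB.lintegral_famN_sq_le hΦ hA ha n
    have := hB.lintegral_branchStep_cube_le hΦ p (hA p) (measurable_pot hB.semigroup hΦ)
      (measurable_secondBd hB.semigroup hB.V_pos hΦ a)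
      (measurable_thirdBd hB.semigroup hB.V_pos hΦ a c₂) ha hc (hB.fieldMeas_famN hΦ n (ch false p))
      (hB.fieldMeas_famN hΦ n (ch true p)) (h1 _) (h1 _) (h2 _) (h2 _) (fun s y hs => ih _ s hs y)
      (fun s y hs => ih _ s hs y) s hs y
    unfold famN
    refine this.trans_eq ?_
    exact (renewal_affine_eq hB.semigroup (measurable_lifeOcc hB.semigroup hB.V_pos hΦ)
      (fun y => (measurable_pot hB.semigroup hΦ y).mul
        (measurable_secondBd hB.semigroup hB.V_pos hΦ a y)) hB.V_pos (7 * a ^ 2 + 3 * c₂) 3 s y).symm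

/-- The second moment is at least `V G ((G Φ)²)`. -/
lemma le_lintegral_fam_sq (hB : IsBranching k V P ch life split walk F)
    (hΦ : ∀ y, Measurable fun s => Φ s y) {T : ℝ} (hT : ∀ s y, T < s → Φ s y = 0) {κ a : ℝ≥0∞}
    (hκ : κ ≠ ⊤) (hΦκ : ∀ s y, Φ s y ≤ κ) (hat : a ≠ ⊤) (ha : ∀ s y, pot k Φ s y ≤ a) (p : ι)
    (s : ℝ) (y : H) :
    ofReal V * pot k (fun s y => pot k Φ s y ^ 2) s y ≤
      ∫⁻ ω, fam Φ ch life split walk p s y ω ^ 2 ∂P := by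
  have hp2 : ∀ y, Measurable fun s => pot k Φ s y ^ 2 :=
    fun y => (measurable_pot hB.semigroup hΦ y).pow_const 2
  have hb : ∀ s y, ofReal V * pot k Φ s y ^ 2 ≤ ofReal V * a ^ 2 := by
    intro s y; gcongr; exact ha s y
  have hbT : ∀ s y, T < s → ofReal V * pot k Φ s y ^ 2 = 0 := by
    intro s y hs; rw [pot_eq_zero hT hs.le]; simp
  rw [pot, ← resW_const_mul hB.semigroup measurable_const hp2]
  -- The iteration is applied to the constant sequence: the full second moment is itself a
  -- supersolution of the recursion with source V (GΦ)².
  have h2 := pot_le_iterate hB.semigroup (f := fun s y => ofReal V * pot k Φ s y ^ 2)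
    (fun y => (hp2 y).const_mul _) hB.V_pos
    (pot_le_exp hB.semigroup hB.V_pos hb hbT)
    (u := fun n p s y => ∫⁻ ω, fam Φ ch life split walk p s y ω ^ 2 ∂P) (ch := ch)
    (fun n p s y => by
      have h3 := hB.le_lintegral_branchStep_sq hΦ p (hB.fieldMeas_fam hΦ (ch false p))
        (hB.fieldMeas_fam hΦ (ch true p)) s y
      simp_rw [hB.lintegral_fam hΦ hT hκ hΦκ, ← sq, ← fam_eq] at h3
      rw [resW_const_mul hB.semigroup (measurable_expW V) hp2]
      exact h3)
  have h3 : Tendsto (fun n : ℕ => (∫⁻ ω, fam Φ ch life split walk p s y ω ^ 2 ∂P) +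
      ofReal V * a ^ 2 * (ofReal V)⁻¹ * 2⁻¹ ^ n * ofReal (rexp (V * (T - s)))) atTop
      (𝓝 ((∫⁻ ω, fam Φ ch life split walk p s y ω ^ 2 ∂P) +
      ofReal V * a ^ 2 * (ofReal V)⁻¹ * 0 * ofReal (rexp (V * (T - s))))) := by
    refine Tendsto.const_add _ (ENNReal.Tendsto.mul_const (ENNReal.Tendsto.const_mul
      (ENNReal.tendsto_pow_atTop_nhds_zero_of_lt_one (by norm_num)) (Or.inr ?_)) (Or.inr (by simp)))
    exact mul_ne_top (mul_ne_top (by simp) (ENNReal.pow_ne_top hat))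
      (by simp [hB.V_pos])
  rw [mul_zero, zero_mul, add_zero] at h3
  exact ge_of_tendsto' h3 fun n => h2 n p s y

end IsBranching

end Forest

/-! ### Independence structure of the concrete particle system -/

namespace PoissonBranchingSystem

variable {M : ℕ} {c V : ℝ} {lam : ℝ≥0} {Ω : Type*} [mΩ : MeasurableSpace Ω] {P : Measure Ω}
  (S : PoissonBranchingSystem M c V lam P)

/-- The `σ`-algebras of the sources of randomness of the system. -/
abbrev sigma : Source M → MeasurableSpace Ω := sourceSigma S.theta S.life S.split S.walk

lemma sigma_le (s : Source M) : S.sigma s ≤ mΩ := by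
  cases s with
  | init x => exact (S.measurable_theta x).comap_le
  | life p => exact (S.measurable_life p).comap_le
  | split p => exact (S.measurable_split p).comap_le
  | walk p => exact iSup_le fun t => ((S.walk_law p).measurable_eval t).comap_le

/-- The `σ`-algebra generated by a set of sources. -/
@[reducible] def sigmaOf (A : Set (Source M)) : MeasurableSpace Ω := ⨆ s ∈ A, S.sigma s

lemma sigmaOf_le (A : Set (Source M)) : S.sigmaOf A ≤ mΩ := iSup₂_le fun s _ => S.sigma_le s

lemma sigmaOf_mono {A B : Set (Source M)} (h : A ⊆ B) : S.sigmaOf A ≤ S.sigmaOf B :=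
  biSup_mono h

lemma sigma_le_sigmaOf {A : Set (Source M)} {s : Source M} (h : s ∈ A) : S.sigma s ≤ S.sigmaOf A :=
  le_biSup _ h

lemma indep_sigmaOf {A B : Set (Source M)} (h : Disjoint A B) :
    Indep (S.sigmaOf A) (S.sigmaOf B) P :=
  indep_iSup_of_disjoint S.sigma_le S.indep h

/-- The two possible children of a particle. -/
def child (b : Bool) (p : Particle M) : Particle M := (p.1, p.2.1, b :: p.2.2)

/-- The sources of randomness of a particle and of all its possible descendants. -/
def subtree (p : Particle M) : Set (Source M) :=
  {s | ∃ v, s = .life (p.1, p.2.1, v ++ p.2.2) ∨ s = .split (p.1, p.2.1, v ++ p.2.2) ∨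
    s = .walk (p.1, p.2.1, v ++ p.2.2)}

lemma subtree_child_subset (b : Bool) (p : Particle M) : subtree (child b p) ⊆ subtree p := by
  rintro s ⟨v, hv⟩
  refine ⟨v ++ [b], ?_⟩
  simpa [child] using hv

lemma life_mem_subtree (p : Particle M) : Source.life p ∈ subtree p := ⟨[], by simp⟩
lemma split_mem_subtree (p : Particle M) : Source.split p ∈ subtree p := ⟨[], by simp⟩
lemma walk_mem_subtree (p : Particle M) : Source.walk p ∈ subtree p := ⟨[], by simp⟩

lemma notMem_subtree_child (b : Bool) (p : Particle M) (v : List Bool) :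
    p ≠ (p.1, p.2.1, v ++ (child b p).2.2) := by
  intro h
  have h1 := congrArg (fun q : Particle M => q.2.2.length) h
  simp [child] at h1
  omega

/-- Descendants prepend letters to an address, so a common descendant of the two children would give
its parent's address two different suffixes of the same length. -/
lemma disjoint_subtree_child (p : Particle M) :
    Disjoint (subtree (child false p)) (subtree (child true p)) := by
  rw [disjoint_left]
  rintro s ⟨v, hv⟩ ⟨w, hw⟩
  have : v ++ (false :: p.2.2) = w ++ (true :: p.2.2) := by
    rcases hv with rfl | rfl | rfl <;> simpa [child] using hw
  have := List.append_inj_right' this (by simp)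
  simp at this

/-- The independence assertions about subtrees are instances of disjointness of sets of sources. -/
lemma isBranching (hM : 1 < M) (hc : 1 ≤ c) (hcM : c < M) (hV : 0 < V) [IsProbabilityMeasure P] :
    IsBranching (tkernel M c) V P child S.life S.split S.walk fun p => S.sigmaOf (subtree p) where
  semigroup := by
    have : NeZero M := ⟨by omega⟩
    exact tkernel_symmSemigroup hM hc hcM (S.walk_law (0, 0, []))
  V_pos := hV
  le p := S.sigmaOf_le _
  child_le b p := S.sigmaOf_mono (subtree_child_subset b p)
  life_meas p := (@measurable_iff_comap_le Ω ℝ _ _ _).2 (S.sigma_le_sigmaOf (life_mem_subtree p))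
  split_meas p := (@measurable_iff_comap_le Ω Bool _ _ _).2 (S.sigma_le_sigmaOf (split_mem_subtree p))
  walk_meas p t := (@measurable_iff_comap_le Ω (HierGroup M) _ _ _).2
    ((le_iSup (fun t => MeasurableSpace.comap (S.walk p t) inferInstance) t).trans
      (S.sigma_le_sigmaOf (walk_mem_subtree p)))
  right_cont p := (S.walk_law p).right_cont
  indep_motion p := by
    have hd : Disjoint ({.life p, .walk p} : Set (Source M))
        ({.split p} ∪ (subtree (child false p) ∪ subtree (child true p))) := by
      rw [disjoint_left]
      rintro s (rfl | rfl) (h | ⟨v, h⟩ | ⟨v, h⟩) <;> simp at h <;>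
      exact notMem_subtree_child _ p v h
    refine indep_of_indep_of_le_left (indep_of_indep_of_le_right (S.indep_sigmaOf hd) ?_) ?_
    · exact sup_le (S.sigma_le_sigmaOf (s := .split p) (by simp)) (sup_le
        (S.sigmaOf_mono fun x hx => Or.inr (Or.inl hx)) (S.sigmaOf_mono fun x hx => Or.inr (Or.inr hx)))
    · exact sup_le (S.sigma_le_sigmaOf (s := .life p) (by simp))
        (S.sigma_le_sigmaOf (s := .walk p) (by simp))
  indep_split p := by
    have hd : Disjoint ({.split p} : Set (Source M))
        (subtree (child false p) ∪ subtree (child true p)) := by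
      rw [disjoint_left]
      rintro s rfl (⟨v, h⟩ | ⟨v, h⟩) <;> simp at h <;>
      exact notMem_subtree_child _ p v h
    refine indep_of_indep_of_le_left (indep_of_indep_of_le_right (S.indep_sigmaOf hd) ?_) ?_
    · exact sup_le (S.sigmaOf_mono Set.subset_union_left) (S.sigmaOf_mono Set.subset_union_right)
    · exact S.sigma_le_sigmaOf (s := .split p) (by simp)
  indep_children p := S.indep_sigmaOf (disjoint_subtree_child p)
  indep_life p := by
    have hd : Disjoint ({.life p} : Set (Source M)) {.walk p} := by simp
    exact indep_of_indep_of_le_left (indep_of_indep_of_le_right (S.indep_sigmaOf hd)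
      (S.sigma_le_sigmaOf (s := .walk p) (by simp))) (S.sigma_le_sigmaOf (s := .life p) (by simp))
  life_law := S.life_law
  split_law p := by rw [S.split_law]; simp
  walk_law p t y := (S.walk_law p).measure_eq t y

end PoissonBranchingSystem

/-! ### The recursive functional as a sum over particles -/

section PathExpansion

variable {H : Type*} [AddCommGroup H] {ι Ω : Type*}

/-- Contribution of the descendant reached from `p` along the path `w`. -/
def pathOcc (Φ : ℝ → H → ℝ≥0∞) (ch : Bool → ι → ι) (life : ι → Ω → ℝ) (split : ι → Ω → Bool)
    (walk : ι → ℝ≥0 → Ω → H) (ω : Ω) : List Bool → ι → ℝ → H → ℝ≥0∞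
  | [], p, s, y => occ Φ (life p) (walk p) s y ω
  | b :: w, p, s, y => if split p ω then
      pathOcc Φ ch life split walk ω w (ch b p) (s + life p ω) (y + walk p (life p ω).toNNReal ω) else 0

variable {Φ : ℝ → H → ℝ≥0∞} {ch : Bool → ι → ι} {life : ι → Ω → ℝ} {split : ι → Ω → Bool}
  {walk : ι → ℝ≥0 → Ω → H} {ω : Ω}

lemma tsum_list_bool (f : List Bool → ℝ≥0∞) :
    ∑' w, f w = f [] + (∑' w, f (false :: w) + ∑' w, f (true :: w)) := by
  let e : Unit ⊕ (Bool × List Bool) ≃ List Bool :=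
    { toFun := Sum.elim (fun _ => []) fun q => q.1 :: q.2
      invFun := fun l => match l with
        | [] => .inl ()
        | b :: w => .inr (b, w)
      left_inv := by rintro (_ | ⟨b, w⟩) <;> rfl
      right_inv := by rintro (_ | ⟨b, w⟩) <;> rfl }
  rw [← e.tsum_eq, Summable.tsum_sum summable summable, tsum_prod', tsum_bool]
  simp [e]

lemma famN_eq_tsum (n : ℕ) (p : ι) (s : ℝ) (y : H) : famN Φ ch life split walk n p s y ω =
      ∑' w : List Bool, if w.length < n then pathOcc Φ ch life split walk ω w p s y else 0 := by
  induction n generalizing p s y with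
  | zero => simp [famN]
  | succ n ih =>
    rw [tsum_list_bool, famN, branchStep, ih, ih]
    by_cases h : split p ω = true
    · simp [pathOcc, h]
    · simp [pathOcc, h]

lemma fam_eq_tsum (p : ι) (s : ℝ) (y : H) :
    fam Φ ch life split walk p s y ω = ∑' w : List Bool, pathOcc Φ ch life split walk ω w p s y := by
  refine le_antisymm (iSup_le fun n => ?_) ?_
  · rw [famN_eq_tsum]
    exact tsum_le_tsum fun w => by split_ifs <;> simp
  · rw [ENNReal.tsum_eq_iSup_sum]
    refine iSup_le fun A => ?_
    refine le_trans ?_ (le_iSup (fun n => famN Φ ch life split walk n p s y ω) (A.sup List.length + 1))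
    rw [famN_eq_tsum]
    refine le_trans (le_of_eq ?_) (sum_le_tsum A)
    refine sum_congr rfl fun w hw => ?_
    rw [if_pos (Nat.lt_succ_of_le (le_sup (f := List.length) hw))]

end PathExpansion

namespace PoissonBranchingSystem

variable {M : ℕ} {c V : ℝ} {lam : ℝ≥0} {Ω : Type*} [mΩ : MeasurableSpace Ω] {P : Measure Ω}
  (S : PoissonBranchingSystem M c V lam P)

/-- The occupation functional of the family of the `i`-th initial particle at `x`. -/
def famAt (Φ : ℝ → HierGroup M → ℝ≥0∞) (q : HierGroup M × ℕ) (ω : Ω) : ℝ≥0∞ :=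
  fam Φ child S.life S.split S.walk (q.1, q.2, []) 0 q.1 ω

/-- The total occupation functional. -/
def total (Φ : ℝ → HierGroup M → ℝ≥0∞) (ω : Ω) : ℝ≥0∞ :=
  ∑' q : HierGroup M × ℕ, if q.2 < S.theta q.1 ω then S.famAt Φ q ω else 0

lemma exists_of_append {ω : Ω} {x : HierGroup M} {i : ℕ} (v u : List Bool)
    (h : S.Exists ω x i (v ++ u)) : S.Exists ω x i u := by
  induction v with
  | nil => exact h
  | cons b v ih => exact ih h.1

open Classical in
-- A path is read from the ancestor downwards, whereas addresses list the youngest generation first;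
-- hence the reversal.
lemma pathOcc_eq (Φ : ℝ → HierGroup M → ℝ≥0∞) {ω : Ω} (x : HierGroup M) (i : ℕ) (w u : List Bool)
    (hu : S.Exists ω x i u) :
    pathOcc Φ child S.life S.split S.walk ω w (x, i, u) (S.birthTime ω x i u) (S.birthPlace ω x i u) =
      if S.Exists ω x i (w.reverse ++ u) then
        occ Φ (S.life (x, i, w.reverse ++ u)) (S.walk (x, i, w.reverse ++ u))
          (S.birthTime ω x i (w.reverse ++ u)) (S.birthPlace ω x i (w.reverse ++ u)) ω else 0 := by
  induction w generalizing u with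
  | nil => simp [pathOcc, hu]
  | cons b w ih =>
    rw [pathOcc]
    by_cases h : S.split (x, i, u) ω = true
    · have := ih (b :: u) ⟨hu, h⟩
      simp only [birthTime, birthPlace, List.reverse_cons, List.append_assoc, List.singleton_append]
        at this ⊢
      rw [if_pos h, ← this]
      rfl
    · rw [if_neg h, if_neg]
      intro hx
      simp only [List.reverse_cons, List.append_assoc, List.singleton_append] at hx
      exact h (S.exists_of_append _ _ hx).2

lemma lt_theta_of_exists {ω : Ω} {x : HierGroup M} {i : ℕ} {u : List Bool} (h : S.Exists ω x i u) :
    i < S.theta x ω := by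
  induction u with
  | nil => exact h
  | cons b u ih => exact ih h.1

open Classical in
lemma total_eq_tsum (Φ : ℝ → HierGroup M → ℝ≥0∞) (ω : Ω) :
    S.total Φ ω = ∑' p : Particle M, if S.Exists ω p.1 p.2.1 p.2.2 then
      occ Φ (S.life p) (S.walk p) (S.birthTime ω p.1 p.2.1 p.2.2)
        (S.birthPlace ω p.1 p.2.1 p.2.2) ω else 0 := by
  rw [total, tsum_prod', tsum_prod']
  refine tsum_congr fun x => ?_
  rw [tsum_prod']
  refine tsum_congr fun i => ?_
  by_cases h : i < S.theta x ω
  · dsimp only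
    rw [if_pos h, famAt, fam_eq_tsum, ← (List.reverse_involutive.toPerm _).tsum_eq]
    refine tsum_congr fun u => ?_
    have := S.pathOcc_eq Φ (ω := ω) x i u.reverse [] h
    simpa [birthTime, birthPlace] using this
  · have h2 : ∀ u, ¬ S.Exists ω x i u := fun u hu => h (S.lt_theta_of_exists hu)
    simp [h, h2]

end PoissonBranchingSystem

/-! ### Mean of the total occupation -/

section PoissonMean

lemma lintegral_poissonMeasure (r : ℝ≥0) (f : ℕ → ℝ≥0∞) : ∫⁻ n, f n ∂(poissonMeasure r) =
      ∑' n, f n * ofReal (rexp (-r) * r ^ n / (n.factorial : ℝ)) := by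
  rw [lintegral_countable']
  simp_rw [poissonMeasure_singleton]

lemma lintegral_id_poissonMeasure (r : ℝ≥0) : ∫⁻ n, (n : ℝ≥0∞) ∂(poissonMeasure r) = r := by
  rw [lintegral_poissonMeasure, tsum_eq_zero_add' summable]
  have h : ∀ n : ℕ, ((n + 1 : ℕ) : ℝ≥0∞) *
      ofReal (rexp (-r) * r ^ (n + 1) / ((n + 1).factorial : ℝ)) =
      r * (1 * ofReal (rexp (-r) * r ^ n / (n.factorial : ℝ))) := by
    intro n
    rw [one_mul, ← ENNReal.ofReal_natCast, ← ENNReal.ofReal_coe_nnreal,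
      ← ofReal_mul (by positivity), ← ofReal_mul (by positivity)]
    congr 1
    rw [Nat.factorial_succ]
    push_cast
    rw [pow_succ]
    field_simp
  simp_rw [h]
  rw [ENNReal.tsum_mul_left, ← lintegral_poissonMeasure r (fun _ => 1)]
  simp

lemma tsum_ite_lt (n : ℕ) : ∑' i : ℕ, (if i < n then (1 : ℝ≥0∞) else 0) = n := by
  rw [tsum_eq_sum (s := range n) (by intro i hi; simpa using hi)]
  rw [sum_congr rfl (g := fun _ => 1) (fun i hi => by simp [mem_range.1 hi])]
  simp

end PoissonMean

namespace PoissonBranchingSystem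

variable {M : ℕ} [NeZero M] {c V : ℝ} {lam : ℝ≥0} {Ω : Type*} [mΩ : MeasurableSpace Ω] {P : Measure Ω}
  (S : PoissonBranchingSystem M c V lam P)

/-- The layer-cake sum Σ P(i < θ) = E θ. -/
lemma tsum_measure_theta (x : HierGroup M) :
    ∑' i : ℕ, ∫⁻ ω, (if i < S.theta x ω then 1 else 0) ∂P = (lam : ℝ≥0∞) := by
  have hm := S.measurable_theta x
  rw [← lintegral_tsum fun i => (Measurable.ite (measurableSet_lt measurable_const hm)
    measurable_const measurable_const).aemeasurable]
  simp_rw [tsum_ite_lt]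
  rw [← lintegral_id_poissonMeasure, ← S.theta_law x, lintegral_map (measurable_of_countable _) hm]

lemma measurable_walk_joint (p : Particle M) : Measurable fun q : ℝ≥0 × Ω => S.walk p q.1 q.2 :=
  measurable_uncurry_of_right_cont (S.walk_law p).measurable_eval (S.walk_law p).right_cont

lemma measurableSet_exists (x : HierGroup M) (i : ℕ) (u : List Bool) :
    MeasurableSet {ω | S.Exists ω x i u} := by
  induction u with
  | nil => exact S.measurable_theta x measurableSet_Ioi
  | cons b u ih => exact ih.inter (S.measurable_split _ (measurableSet_singleton true))

lemma measurable_birthTime (x : HierGroup M) (i : ℕ) (u : List Bool) :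
    Measurable fun ω => S.birthTime ω x i u := by
  induction u with
  | nil => exact measurable_const
  | cons b u ih => exact ih.add (S.measurable_life _)

lemma measurable_birthPlace (x : HierGroup M) (i : ℕ) (u : List Bool) :
    Measurable fun ω => S.birthPlace ω x i u := by
  induction u with
  | nil => exact measurable_const
  | cons b u ih =>
    refine measurable_add_countable ih ?_
    exact (S.measurable_walk_joint _).comp
      ((S.measurable_life _).real_toNNReal.prodMk measurable_id)

lemma measurableSet_alive (p : Particle M) : MeasurableSet {q : ℝ × Ω | S.Alive q.2 q.1 p} := by
  have h2 : Measurable fun q : ℝ × Ω => S.birthTime q.2 p.1 p.2.1 p.2.2 :=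
    (S.measurable_birthTime p.1 p.2.1 p.2.2).comp measurable_snd
  refine MeasurableSet.inter (measurable_snd (S.measurableSet_exists _ _ _)) (MeasurableSet.inter ?_ ?_)
  · exact measurableSet_le h2 measurable_fst
  · exact measurableSet_lt measurable_fst (h2.add ((S.measurable_life p).comp measurable_snd))

lemma measurable_position (p : Particle M) : Measurable fun q : ℝ × Ω => S.position q.2 q.1 p := by
  refine measurable_add_countable ((S.measurable_birthPlace _ _ _).comp measurable_snd) ?_
  exact (S.measurable_walk_joint p).comp (((measurable_fst.sub
    ((S.measurable_birthTime _ _ _).comp measurable_snd)).real_toNNReal).prodMk measurable_snd)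

open Classical in
/-- The number of particles at `z` at time `t`, as an extended real number. -/
def count (t : ℝ) (z : HierGroup M) (ω : Ω) : ℝ≥0∞ :=
  ∑' p : Particle M, if S.Alive ω t p ∧ S.position ω t p = z then 1 else 0

lemma count_eq (t : ℝ) (z : HierGroup M) (ω : Ω) : S.count t z ω = (S.N t ω {z} : ℝ≥0∞) := by
  classical
  rw [N, ← ENNReal.tsum_set_one, count, tsum_subtype _ fun _ => (1 : ℝ≥0∞)]
  refine tsum_congr fun p => ?_
  simp [indicator]

lemma measurable_count (z : HierGroup M) : Measurable fun q : ℝ × Ω => S.count q.1 z q.2 := by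
  classical
  refine Measurable.tsum fun p => Measurable.ite ?_ measurable_const measurable_const
  exact (S.measurableSet_alive p).inter (S.measurable_position p (measurableSet_singleton z))

lemma measurable_count_left (z : HierGroup M) (ω : Ω) : Measurable fun t => S.count t z ω :=
  (S.measurable_count z).comp measurable_prodMk_right

lemma measurable_count_right (z : HierGroup M) (t : ℝ) : Measurable fun ω => S.count t z ω :=
  (S.measurable_count z).comp measurable_prodMk_left

lemma birthTime_nonneg {ω : Ω} (h : ∀ p, 0 ≤ S.life p ω) (x : HierGroup M) (i : ℕ) (u : List Bool) :
    0 ≤ S.birthTime ω x i u := by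
  induction u with
  | nil => exact le_rfl
  | cons b u ih => exact add_nonneg ih (h _)

lemma occ_eq {H : Type*} [AddCommGroup H] {Ψ : ℝ → H → ℝ≥0∞}
    {life : Ω → ℝ} {walk : ℝ≥0 → Ω → H} {s : ℝ} (hs : 0 ≤ s) (y : H) (ω : Ω) :
    occ Ψ life walk s y ω = ∫⁻ t in Ioi (0:ℝ), if s ≤ t ∧ t < s + life ω then
      Ψ t (y + walk (t - s).toNNReal ω) else 0 := by
  have h1 := lintegral_Ioi_shift (fun t => if t < s + life ω then
    Ψ t (y + walk (t - s).toNNReal ω) else 0) s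
  simp only [add_lt_add_iff_left, add_sub_cancel_left] at h1
  rw [occ, h1, ← lintegral_indicator measurableSet_Ioi, ← lintegral_indicator measurableSet_Ioi]
  -- A particle counts as alive at its birth time, while `occ` uses ages r > 0 only. The two
  -- conventions differ on a null set of times.
  have h0 : ∀ᵐ t : ℝ, t ≠ s := by simp [ae_iff]
  refine lintegral_congr_ae ?_
  filter_upwards [h0] with t ht
  by_cases h2 : s < t
  · simp [indicator, h2, h2.le, hs.trans_lt h2]
  · have : ¬ s ≤ t := fun h => h2 (lt_of_le_of_ne h ht.symm)
    simp [indicator, h2, this]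

/-- Bridge between the recursion, for which moments are computed, and the particle counts appearing
in the theorem. -/
lemma total_eq_lintegral {Φ : ℝ → HierGroup M → ℝ≥0∞} (hΦ : ∀ y, Measurable fun s => Φ s y) {ω : Ω}
    (h : ∀ p, 0 ≤ S.life p ω) :
    S.total Φ ω = ∫⁻ t in Ioi (0:ℝ), ∑' z, Φ t z * S.count t z ω := by
  classical
  rw [total_eq_tsum]
  have e1 : ∀ p : Particle M, (if S.Exists ω p.1 p.2.1 p.2.2 then
      occ Φ (S.life p) (S.walk p) (S.birthTime ω p.1 p.2.1 p.2.2)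
        (S.birthPlace ω p.1 p.2.1 p.2.2) ω else 0) =
      ∫⁻ t in Ioi (0:ℝ), if S.Alive ω t p then Φ t (S.position ω t p) else 0 := by
    intro p
    split_ifs with hp
    · rw [occ_eq (S.birthTime_nonneg h _ _ _)]
      refine lintegral_congr fun t => ?_
      simp only [Alive, hp, true_and, position]
    · simp [Alive, hp]
  simp_rw [e1]
  have hm : ∀ p, Measurable fun t => if S.Alive ω t p then Φ t (S.position ω t p) else 0 := by
    intro p
    refine Measurable.ite ?_ ?_ measurable_const
    · exact (S.measurableSet_alive p).preimage (measurable_prodMk_right (y := ω))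
    · exact (measurable_uncurry_field hΦ).comp (measurable_id.prodMk
        ((S.measurable_position p).comp measurable_prodMk_right))
  rw [← lintegral_tsum fun p => (hm p).aemeasurable]
  refine lintegral_congr fun t => ?_
  simp_rw [count, ← ENNReal.tsum_mul_left]
  rw [tsum_comm]
  refine tsum_congr fun p => ?_
  by_cases hp : S.Alive ω t p
  · simp only [hp, true_and, if_true, mul_ite, mul_one, mul_zero]
    rw [tsum_eq_single (S.position ω t p)]
    · simp
    · intro z hz; simp [hz.symm]
  · simp [hp]

section Prob

variable [IsProbabilityMeasure P]

lemma ae_life_nonneg (hM : 1 < M) (hc : 1 ≤ c) (hcM : c < M) (hV : 0 < V) :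
    ∀ᵐ ω ∂P, ∀ p, 0 ≤ S.life p ω :=
  ae_all_iff.2 fun p => ((S.isBranching hM hc hcM hV).life_pos p).mono fun _ h => h.le

lemma measurable_famAt (hM : 1 < M) (hc : 1 ≤ c) (hcM : c < M) (hV : 0 < V)
    {Φ : ℝ → HierGroup M → ℝ≥0∞} (hΦ : ∀ y, Measurable fun s => Φ s y) (q : HierGroup M × ℕ) :
    Measurable[S.sigmaOf (subtree (q.1, q.2, []))] (S.famAt Φ q) :=
  ((S.isBranching hM hc hcM hV).fieldMeas_fam hΦ (q.1, q.2, [])).eval 0 q.1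

lemma measurable_famAt' (hM : 1 < M) (hc : 1 ≤ c) (hcM : c < M) (hV : 0 < V)
    {Φ : ℝ → HierGroup M → ℝ≥0∞} (hΦ : ∀ y, Measurable fun s => Φ s y) (q : HierGroup M × ℕ) :
    Measurable (S.famAt Φ q) := (S.measurable_famAt hM hc hcM hV hΦ q).mono (S.sigmaOf_le _) le_rfl

lemma measurable_total (hM : 1 < M) (hc : 1 ≤ c) (hcM : c < M) (hV : 0 < V)
    {Φ : ℝ → HierGroup M → ℝ≥0∞} (hΦ : ∀ y, Measurable fun s => Φ s y) :
    Measurable (S.total Φ) :=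
  Measurable.tsum fun q => Measurable.ite (measurableSet_lt measurable_const (S.measurable_theta _))
    (S.measurable_famAt' hM hc hcM hV hΦ q) measurable_const

/-- Mean of the total occupation. -/
lemma lintegral_total (hM : 1 < M) (hc : 1 ≤ c) (hcM : c < M) (hV : 0 < V)
    {Φ : ℝ → HierGroup M → ℝ≥0∞} (hΦ : ∀ y, Measurable fun s => Φ s y) {T : ℝ}
    (hT : ∀ s y, T < s → Φ s y = 0) {κ : ℝ≥0∞} (hκ : κ ≠ ⊤) (hΦκ : ∀ s y, Φ s y ≤ κ) :
    ∫⁻ ω, S.total Φ ω ∂P = lam * ∫⁻ t in Ioi (0:ℝ), ∑' z, Φ t z := by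
  have hB := S.isBranching hM hc hcM hV
  have h1 : ∀ q : HierGroup M × ℕ, ∫⁻ ω, (if q.2 < S.theta q.1 ω then S.famAt Φ q ω else 0) ∂P =
      (∫⁻ ω, (if q.2 < S.theta q.1 ω then 1 else 0) ∂P) * pot (tkernel M c) Φ 0 q.1 := by
    intro q
    have hd : Disjoint ({.init q.1} : Set (Source M)) (subtree (q.1, q.2, [])) := by
      rw [disjoint_left]
      rintro s rfl ⟨v, h⟩
      simp at h
    have e : ∀ ω, (if q.2 < S.theta q.1 ω then S.famAt Φ q ω else 0) =
        (if q.2 < S.theta q.1 ω then 1 else 0) * S.famAt Φ q ω := by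
      intro ω; split_ifs <;> simp
    simp_rw [e]
    rw [lintegral_mul_eq_lintegral_mul_lintegral_of_independent_measurableSpace
      (S.sigmaOf_le _) (S.sigmaOf_le _) (S.indep_sigmaOf hd)
      (f := fun ω => if q.2 < S.theta q.1 ω then (1:ℝ≥0∞) else 0) ?_
      (S.measurable_famAt hM hc hcM hV hΦ q)]
    · congr 1
      exact hB.lintegral_fam hΦ hT hκ hΦκ _ _ _
    · refine ((measurable_of_countable fun n : ℕ => if q.2 < n then (1:ℝ≥0∞) else 0).comp
        (comap_measurable (S.theta q.1))).mono ?_ le_rfl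
      exact S.sigma_le_sigmaOf (s := .init q.1) rfl
  unfold total
  rw [lintegral_tsum fun q => ((Measurable.ite (measurableSet_lt measurable_const
    (S.measurable_theta _)) (S.measurable_famAt' hM hc hcM hV hΦ q) measurable_const)).aemeasurable]
  simp_rw [h1]
  -- Summing over labels at a site gives the intensity; summing the potential over sites gives the
  -- total mass of Φ, since counting measure is invariant.
  rw [tsum_prod']
  simp_rw [ENNReal.tsum_mul_right, S.tsum_measure_theta]
  rw [ENNReal.tsum_mul_left, tsum_pot_zero hB.semigroup hΦ]

end Prob

end PoissonBranchingSystem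

/-! ### Elementary estimates for characteristic functions -/

section ComplexBounds

/-- Taylor remainder for |x| ≤ 1 and the trivial bound otherwise; the constant is chosen only to
cover both cases. -/
lemma norm_cexp_I_mul_sub_le_sq (x : ℝ) : ‖cexp (I * x) - 1 - I * x‖ ≤ 4 * x ^ 2 := by
  have hn : ‖I * (x : ℂ)‖ = |x| := by simp
  rcases le_or_gt |x| 1 with h | h
  · have := exp_bound (x := I * x) (by rw [hn]; exact h) (n := 2) (by norm_num)
    simp only [Finset.sum_range_succ, range_one, sum_singleton, pow_zero, pow_one,
      Nat.factorial, hn, sq_abs] at this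
    norm_num at this
    rw [sub_sub]
    exact this.trans (by nlinarith [sq_nonneg x])
  · have h1 : ‖cexp (I * x)‖ = 1 := norm_exp_I_mul_ofReal x
    calc _ ≤ ‖cexp (I * x)‖ + ‖(1:ℂ)‖ + ‖I * (x:ℂ)‖ :=
          (norm_sub_le _ _).trans (add_le_add_left (norm_sub_le _ _) _)
      _ = 2 + |x| := by rw [h1, hn]; norm_num
      _ ≤ 4 * x ^ 2 := by rw [← sq_abs]; nlinarith

lemma norm_cexp_I_mul_sub_le_cube (x : ℝ) :
    ‖cexp (I * x) - 1 - I * x + (x : ℂ) ^ 2 / 2‖ ≤ 4 * |x| ^ 3 := by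
  have hn : ‖I * (x : ℂ)‖ = |x| := by simp
  rcases le_or_gt |x| 1 with h | h
  · have := exp_bound (x := I * x) (by rw [hn]; exact h) (n := 3) (by norm_num)
    simp only [Finset.sum_range_succ, range_one, sum_singleton, pow_zero, pow_one,
      Nat.factorial, hn, mul_pow, Complex.I_sq] at this
    norm_num at this
    have e : cexp (I * x) - 1 - I * x + (x : ℂ) ^ 2 / 2 =
        cexp (I * x) - (1 + I * x + -(x : ℂ) ^ 2 / 2) := by ring
    rw [e]
    exact this.trans (by nlinarith [pow_nonneg (abs_nonneg x) 3])
  · have h1 : ‖cexp (I * x)‖ = 1 := norm_exp_I_mul_ofReal x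
    have h2 : ‖(x : ℂ) ^ 2 / 2‖ = |x| ^ 2 / 2 := by simp
    calc _ ≤ ‖cexp (I * x)‖ + ‖(1:ℂ)‖ + ‖I * (x:ℂ)‖ + ‖(x : ℂ) ^ 2 / 2‖ :=
          (norm_add_le _ _).trans (add_le_add_left ((norm_sub_le _ _).trans
            (add_le_add_left (norm_sub_le _ _) _)) _)
      _ = 2 + |x| + |x| ^ 2 / 2 := by rw [h1, hn, h2]; norm_num
      _ ≤ 4 * |x| ^ 3 := by
        nlinarith [mul_pos (by linarith : 0 < |x|) (by linarith : 0 < |x|),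
          mul_pos (mul_pos (by linarith : 0 < |x|) (by linarith : 0 < |x|)) (sub_pos.2 h)]

/-- Mean value inequality: the derivative of the exponential has norm at most 1 on the convex left
half plane. -/
lemma norm_cexp_sub_cexp_le {a b : ℂ} (ha : a.re ≤ 0) (hb : b.re ≤ 0) :
    ‖cexp a - cexp b‖ ≤ ‖a - b‖ := by
  have := Convex.norm_image_sub_le_of_norm_deriv_le (𝕜 := ℂ) (f := cexp)
    (s := {z : ℂ | z.re ≤ 0}) (C := 1) (x := b) (y := a) (fun x _ => Complex.differentiableAt_exp)
    (fun x hx => by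
      rw [Complex.deriv_exp, norm_exp]; exact exp_le_one_iff.2 hx)
    (convex_halfSpace_re_le 0) hb ha
  simpa using this

/-- Replace the factors one at a time; all others have norm at most 1. -/
lemma norm_prod_sub_prod_le {ι : Type*} (A : Finset ι) (f g : ι → ℂ) (hf : ∀ i ∈ A, ‖f i‖ ≤ 1)
    (hg : ∀ i ∈ A, ‖g i‖ ≤ 1) : ‖∏ i ∈ A, f i - ∏ i ∈ A, g i‖ ≤ ∑ i ∈ A, ‖f i - g i‖ := by
  classical
  induction A using induction_on with
  | empty => simp
  | insert a A ha ih =>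
    rw [prod_insert ha, prod_insert ha, sum_insert ha]
    have e : f a * ∏ i ∈ A, f i - g a * ∏ i ∈ A, g i =
        (f a - g a) * ∏ i ∈ A, f i + g a * (∏ i ∈ A, f i - ∏ i ∈ A, g i) := by ring
    rw [e]
    have h1 : ‖∏ i ∈ A, f i‖ ≤ 1 := by
      rw [norm_prod]
      exact Finset.prod_le_one (fun i _ => norm_nonneg _) fun i hi => hf i (Finset.mem_insert_of_mem hi)
    have h2 := ih (fun i hi => hf i (Finset.mem_insert_of_mem hi))
      (fun i hi => hg i (Finset.mem_insert_of_mem hi))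
    refine (norm_add_le _ _).trans ?_
    rw [norm_mul, norm_mul]
    refine add_le_add (mul_le_of_le_one_right (norm_nonneg _) h1) ?_
    exact (mul_le_of_le_one_left (norm_nonneg _) (hg a (Finset.mem_insert_self _ _))).trans h2

/-- Comparison of a Poisson compound product with an exponential. -/
lemma norm_poisson_sum_sub_exp_le (lam : ℝ≥0) (φ : ℕ → ℂ) (hφ : ∀ i, ‖φ i‖ ≤ 1) {μ q δ : ℝ}
    (hq : 0 ≤ q) (h : ∀ i, ‖φ i - 1 - I * μ + q / 2‖ ≤ δ) :
    ‖(∑' k : ℕ, ((rexp (-lam) * lam ^ k / (k.factorial : ℝ) : ℝ) : ℂ) *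
        ∏ i ∈ range k, φ i) * cexp (-(I * (lam * μ))) -
      cexp (-(lam * q / 2 : ℝ))‖ ≤ 3 * lam * δ := by
  set w := φ 0 with hw
  have hp0 : ∀ k : ℕ, 0 ≤ rexp (-lam) * lam ^ k / (k.factorial : ℝ) := fun k => by positivity
  -- The families at one site need not be shown to have equal laws: all their characteristic
  -- functions lie within δ of the same number, hence within 2δ of the first one. Replacing k
  -- factors costs 2kδ, on average 2λδ.
  have hwk : ∀ i, ‖φ i - w‖ ≤ 2 * δ := by
    intro i
    have e : φ i - w = (φ i - 1 - I * μ + q / 2) - (w - 1 - I * μ + q / 2) := by ring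
    rw [e]
    exact (norm_sub_le _ _).trans (by linarith [h i, h 0])
  have hps := hasSum_one_poissonMeasure lam
  have hsum1 : Summable fun k : ℕ => ((rexp (-lam) * lam ^ k / (k.factorial : ℝ) : ℝ) : ℂ) *
      ∏ i ∈ range k, φ i := by
    refine Summable.of_norm_bounded hps.summable fun k => ?_
    rw [norm_mul, norm_real, norm_of_nonneg (hp0 k)]
    refine mul_le_of_le_one_right (hp0 k) ?_
    rw [norm_prod]
    exact Finset.prod_le_one (fun i _ => norm_nonneg _) fun i _ => hφ i
  have hsum2 : HasSum (fun k : ℕ => ((rexp (-lam) * lam ^ k / (k.factorial : ℝ) : ℝ) : ℂ) * w ^ k)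
      (cexp (lam * (w - 1))) := by
    have h1 := (NormedSpace.expSeries_div_hasSum_exp ((lam : ℂ) * w)).mul_left (cexp (-lam))
    rw [← Complex.exp_eq_exp_ℂ, ← Complex.exp_add] at h1
    have e1 : (fun k : ℕ => ((rexp (-lam) * lam ^ k / (k.factorial : ℝ) : ℝ) : ℂ) * w ^ k) =
        fun k : ℕ => cexp (-lam) * (((lam : ℂ) * w) ^ k / (k.factorial : ℂ)) := by
      ext k; push_cast; rw [mul_pow]; ring
    have e2 : (lam : ℂ) * (w - 1) = -lam + lam * w := by ring
    rw [e1, e2]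
    exact h1
  have hmean : HasSum (fun k : ℕ => rexp (-lam) * lam ^ k / (k.factorial : ℝ) * k) lam := by
    rw [← hasSum_nat_add_iff' 1]
    have h1 := hps.mul_left (lam : ℝ)
    simp only [mul_one] at h1
    simp only [range_one, sum_singleton, Nat.cast_zero, mul_zero, sub_zero]
    have e1 : (fun k : ℕ => rexp (-lam) * lam ^ (k + 1) / ((k + 1).factorial : ℝ) *
        ((k + 1 : ℕ) : ℝ)) = fun k : ℕ => lam * (rexp (-lam) * lam ^ k / (k.factorial : ℝ)) := by
      ext k
      rw [Nat.factorial_succ]; push_cast; rw [pow_succ]; field_simp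
    rw [e1]
    exact h1
  have hA : ‖(∑' k : ℕ, ((rexp (-lam) * lam ^ k / (k.factorial : ℝ) : ℝ) : ℂ) *
        ∏ i ∈ range k, φ i) - cexp (lam * (w - 1))‖ ≤ 2 * lam * δ := by
    rw [← hsum2.tsum_eq, ← hsum1.tsum_sub hsum2.summable]
    refine tsum_of_norm_bounded (g := fun k : ℕ =>
      rexp (-lam) * lam ^ k / (k.factorial : ℝ) * k * (2 * δ)) ?_ fun k => ?_
    · have := hmean.mul_right (2 * δ)
      rwa [show (lam : ℝ) * (2 * δ) = 2 * lam * δ by ring] at this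
    · rw [← mul_sub, norm_mul, norm_real, norm_of_nonneg (hp0 k), mul_assoc]
      refine mul_le_mul_of_nonneg_left ?_ (hp0 k)
      have := norm_prod_sub_prod_le (range k) φ (fun _ => w) (fun i _ => hφ i) (fun i _ => hφ 0)
      simp only [Finset.prod_const, Finset.card_range] at this
      refine this.trans ((sum_le_sum fun i _ => hwk i).trans ?_)
      simp
  -- The remaining λδ compares exp(λ(w - 1)), recentered by the mean, with the Gaussian value; both
  -- exponents have nonpositive real part.
  have hB : ‖cexp (lam * (w - 1)) * cexp (-(I * (lam * μ))) -
      cexp (-(lam * q / 2 : ℝ))‖ ≤ lam * δ := by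
    rw [← Complex.exp_add]
    have hre : w.re ≤ 1 := (Complex.re_le_norm w).trans (hφ 0)
    refine (norm_cexp_sub_cexp_le ?_ ?_).trans ?_
    · have : ((lam : ℂ) * (w - 1) + -(I * (lam * μ))).re = lam * (w.re - 1) := by
        simp
      rw [this]
      exact mul_nonpos_of_nonneg_of_nonpos lam.2 (by linarith)
    · rw [← ofReal_neg, ofReal_re]
      have : 0 ≤ lam * q / 2 := by positivity
      linarith
    · have e : (lam : ℂ) * (w - 1) + -(I * (lam * μ)) - -((lam * q / 2 : ℝ) : ℂ) =
          ((lam : ℝ) : ℂ) * (w - 1 - I * μ + q / 2) := by push_cast; ring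
      have e3 : ‖((lam : ℝ) : ℂ)‖ = lam := by
        rw [norm_real, norm_of_nonneg lam.coe_nonneg]
      rw [e, norm_mul, e3]
      exact mul_le_mul_of_nonneg_left (h 0) lam.2
  have e1 : ‖cexp (-(I * (lam * μ)))‖ = 1 := by
    rw [norm_exp]; simp
  calc _ = ‖((∑' k : ℕ, ((rexp (-lam) * lam ^ k / (k.factorial : ℝ) : ℝ) : ℂ) *
        ∏ i ∈ range k, φ i) - cexp (lam * (w - 1))) * cexp (-(I * (lam * μ))) +
        (cexp (lam * (w - 1)) * cexp (-(I * (lam * μ))) -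
      cexp (-(lam * q / 2 : ℝ)))‖ := by congr 1; ring
    _ ≤ 2 * lam * δ + lam * δ := by
        refine (norm_add_le _ _).trans (add_le_add ?_ hB)
        rw [norm_mul, e1, mul_one]; exact hA
    _ = _ := by ring

end ComplexBounds

lemma measurable_random_sum {Ω : Type*} {m : MeasurableSpace Ω} {θ : Ω → ℕ} (hθ : Measurable θ)
    {f : ℕ → Ω → ℝ} (hf : ∀ i, Measurable (f i)) :
    Measurable fun ω => ∑ i ∈ range (θ ω), f i ω := by
  have h : Measurable fun q : ℕ × Ω => ∑ i ∈ range q.1, f i q.2 :=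
    measurable_from_prod_countable_right fun n => by
      exact Finset.measurable_sum (range n) fun i _ => hf i
  exact h.comp (hθ.prodMk measurable_id)

/-! ### Characteristic function of a Poisson sum of families over all sites -/

namespace PoissonBranchingSystem

variable {M : ℕ} [NeZero M] {c V : ℝ} {lam : ℝ≥0} {Ω : Type*} [mΩ : MeasurableSpace Ω]
  {P : Measure Ω} [IsProbabilityMeasure P] (S : PoissonBranchingSystem M c V lam P)

lemma integral_mul_of_disjoint {A B : Set (Source M)} (h : Disjoint A B) {f g : Ω → ℂ}
    (hf : Measurable[S.sigmaOf A] f) (hg : Measurable[S.sigmaOf B] g) :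
    ∫ ω, f ω * g ω ∂P = (∫ ω, f ω ∂P) * ∫ ω, g ω ∂P := by
  have hi : IndepFun f g P := by
    rw [IndepFun_iff_Indep]
    exact indep_of_indep_of_le_left (indep_of_indep_of_le_right (S.indep_sigmaOf h) hg.comap_le)
      hf.comap_le
  exact hi.integral_fun_mul_eq_mul_integral
    (hf.mono (S.sigmaOf_le _) le_rfl).aestronglyMeasurable
    (hg.mono (S.sigmaOf_le _) le_rfl).aestronglyMeasurable

lemma integral_prod_of_disjoint {ι : Type*} (W : Finset ι) (A : ι → Set (Source M))
    (h : Pairwise (Function.onFun Disjoint A)) (f : ι → Ω → ℂ)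
    (hf : ∀ i, Measurable[S.sigmaOf (A i)] (f i)) :
    ∫ ω, ∏ i ∈ W, f i ω ∂P = ∏ i ∈ W, ∫ ω, f i ω ∂P := by
  classical
  induction W using induction_on with
  | empty => simp
  | insert a W ha ih =>
    simp_rw [prod_insert ha]
    rw [S.integral_mul_of_disjoint (A := A a) (B := ⋃ i ∈ W, A i) ?_ (hf a) ?_, ih]
    · rw [Set.disjoint_iUnion₂_right]
      intro i hi
      exact h (fun hai => ha (hai ▸ hi))
    · refine Finset.measurable_prod _ fun i hi => (hf i).mono (S.sigmaOf_mono ?_) le_rfl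
      exact Set.subset_biUnion_of_mem (u := A) hi

/-- All sources attached to the initial site `x`. -/
def siteSources (x : HierGroup M) : Set (Source M) :=
  {s | s = .init x ∨ ∃ i, s ∈ subtree (x, i, [])}

lemma subtree_root_disjoint {p q : HierGroup M × ℕ} (h : p ≠ q) :
    Disjoint (subtree (p.1, p.2, [])) (subtree (q.1, q.2, [])) := by
  rw [disjoint_left]
  rintro s ⟨v, hv⟩ ⟨w, hw⟩
  apply h
  rcases hv with rfl | rfl | rfl <;> simp at hw <;> exact Prod.ext hw.1 hw.2.1

lemma init_notMem_subtree (x : HierGroup M) (p : Particle M) : Source.init x ∉ subtree p := by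
  rintro ⟨v, h⟩; simp at h

lemma siteSources_disjoint : Pairwise (Function.onFun Disjoint (siteSources (M := M))) := by
  intro x y hxy
  rw [Function.onFun, disjoint_left]
  rintro s (rfl | ⟨i, hi⟩) (h | ⟨j, hj⟩)
  · simp at h; exact hxy h
  · exact init_notMem_subtree _ _ hj
  · subst h; exact init_notMem_subtree _ _ hi
  · exact disjoint_left.1 (subtree_root_disjoint (p := (x, i)) (q := (y, j))
      (fun h => hxy (Prod.ext_iff.1 h).1)) hi hj

variable {ξ : HierGroup M × ℕ → Ω → ℝ}

lemma measurable_siteSum (hξ : ∀ q, Measurable[S.sigmaOf (subtree (q.1, q.2, []))] (ξ q))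
    (x : HierGroup M) : Measurable[S.sigmaOf (siteSources x)]
      fun ω => ∑ i ∈ range (S.theta x ω), ξ (x, i) ω := by
  have h1 : Measurable[S.sigmaOf (siteSources x)] (S.theta x) :=
    (@measurable_iff_comap_le Ω ℕ _ _ _).2 (S.sigma_le_sigmaOf (s := .init x) (Or.inl rfl))
  have h2 : ∀ i, Measurable[S.sigmaOf (siteSources x)] (ξ (x, i)) := fun i =>
    (hξ (x, i)).mono (S.sigmaOf_mono fun s hs => Or.inr ⟨i, hs⟩) le_rfl
  exact measurable_random_sum h1 h2

/-- Condition on the number of initial particles; given k, the families with labels below k are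
independent of it and of each other. -/
lemma integral_cexp_siteSum (hξ : ∀ q, Measurable[S.sigmaOf (subtree (q.1, q.2, []))] (ξ q))
    (x : HierGroup M) :
    ∫ ω, cexp (I * ((∑ i ∈ range (S.theta x ω), ξ (x, i) ω : ℝ) : ℂ)) ∂P =
      ∑' k : ℕ, ((rexp (-lam) * lam ^ k / (k.factorial : ℝ) : ℝ) : ℂ) *
        ∏ i ∈ range k, ∫ ω, cexp (I * (ξ (x, i) ω : ℂ)) ∂P := by
  have hθ := S.measurable_theta x
  have hm : Measurable fun ω =>
      cexp (I * ((∑ i ∈ range (S.theta x ω), ξ (x, i) ω : ℝ) : ℂ)) := by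
    have := (S.measurable_siteSum hξ x).mono (S.sigmaOf_le _) le_rfl
    fun_prop
  have hint : Integrable (fun ω =>
      cexp (I * ((∑ i ∈ range (S.theta x ω), ξ (x, i) ω : ℝ) : ℂ))) P :=
    Integrable.of_bound hm.aestronglyMeasurable 1
      (Eventually.of_forall fun ω => (norm_exp_I_mul_ofReal _).le)
  have hU : ⋃ k : ℕ, S.theta x ⁻¹' {k} = Set.univ := by ext ω; simp
  have h1 := integral_iUnion (μ := P) (s := fun k : ℕ => S.theta x ⁻¹' {k})
    (fun k => hθ (measurableSet_singleton k))
    (fun a b hab => Disjoint.preimage _ (by simpa using hab)) (hint.integrableOn)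
  rw [hU, setIntegral_univ] at h1
  rw [h1]
  refine tsum_congr fun k => ?_
  have hA : Pairwise (Function.onFun Disjoint fun i : ℕ => subtree (M := M) (x, i, [])) := fun i j hij =>
    subtree_root_disjoint (p := (x, i)) (q := (x, j)) (by simpa using hij)
  have hme : ∀ i, Measurable[S.sigmaOf (subtree (x, i, []))]
      fun ω => cexp (I * (ξ (x, i) ω : ℂ)) := fun i =>
    (show Measurable fun r : ℝ => cexp (I * (r : ℂ)) by fun_prop).comp (hξ (x, i))
  have h2 := S.integral_prod_of_disjoint (range k) _ hA
    (fun i ω => cexp (I * (ξ (x, i) ω : ℂ))) hme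
  rw [← h2]
  have hd : Disjoint ({.init x} : Set (Source M)) (⋃ i, subtree (x, i, [])) := by
    rw [disjoint_left]
    rintro s rfl h
    obtain ⟨i, hi⟩ := mem_iUnion.1 h
    exact init_notMem_subtree _ _ hi
  have h3 := S.integral_mul_of_disjoint hd (f := fun ω => if S.theta x ω = k then 1 else 0)
    (g := fun ω => ∏ i ∈ range k, cexp (I * (ξ (x, i) ω : ℂ)))
    (((measurable_of_countable fun n : ℕ => if n = k then (1:ℂ) else 0).comp
      (comap_measurable (S.theta x))).mono (S.sigma_le_sigmaOf (s := .init x) rfl) le_rfl)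
    (Finset.measurable_prod _ fun i _ => (hme i).mono
      (S.sigmaOf_mono (Set.subset_iUnion (fun i => subtree (x, i, [])) i)) le_rfl)
  have h4 : ∫ ω, (if S.theta x ω = k then (1:ℂ) else 0) ∂P =
      ((rexp (-lam) * lam ^ k / (k.factorial : ℝ) : ℝ) : ℂ) := by
    have e : (fun ω => if S.theta x ω = k then (1:ℂ) else 0) =
        (S.theta x ⁻¹' {k}).indicator fun _ => 1 := by
      ext ω; simp [indicator]
    rw [e, integral_indicator_const _ (hθ (measurableSet_singleton k)), ← poissonMeasure_real_singleton,
      ← S.theta_law x, map_measureReal_apply hθ (measurableSet_singleton k)]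
    simp
  rw [h4] at h3
  rw [← h3, ← integral_indicator (hθ (measurableSet_singleton k))]
  refine integral_congr_ae (Eventually.of_forall fun ω => ?_)
  by_cases hk : S.theta x ω = k
  · simp only [indicator, Set.mem_preimage, Set.mem_singleton_iff, hk, if_true, one_mul]
    rw [← exp_sum, ← mul_sum]
    push_cast; rfl
  · simp [indicator, hk]

/-- Gaussian approximation of the characteristic function of a finite family of sites. -/
lemma norm_charFun_sites_sub_le (hξ : ∀ q, Measurable[S.sigmaOf (subtree (q.1, q.2, []))] (ξ q))
    {μ q δ : HierGroup M → ℝ} (hq : ∀ x, 0 ≤ q x)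
    (h : ∀ x i, ‖(∫ ω, cexp (I * (ξ (x, i) ω : ℂ)) ∂P) - 1 - I * μ x +
      q x / 2‖ ≤ δ x) (A : Finset (HierGroup M)) :
    ‖(∫ ω, cexp (I * ((∑ x ∈ A, (∑ i ∈ range (S.theta x ω), ξ (x, i) ω -
        lam * μ x) : ℝ) : ℂ)) ∂P) - cexp (-(lam * (∑ x ∈ A, q x) / 2 : ℝ))‖ ≤
      3 * lam * ∑ x ∈ A, δ x := by
  have hm : ∀ x, Measurable[S.sigmaOf (siteSources x)] fun ω => cexp (I *
      ((∑ i ∈ range (S.theta x ω), ξ (x, i) ω - lam * μ x : ℝ) : ℂ)) := fun x =>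
    (show Measurable fun r : ℝ => cexp (I * ((r - lam * μ x : ℝ) : ℂ)) by fun_prop).comp
      (S.measurable_siteSum hξ x)
  have h1 := S.integral_prod_of_disjoint A _ siteSources_disjoint _ hm
  have e1 : ∀ ω, cexp (I * ((∑ x ∈ A, (∑ i ∈ range (S.theta x ω), ξ (x, i) ω -
        lam * μ x) : ℝ) : ℂ)) = ∏ x ∈ A, cexp (I *
      ((∑ i ∈ range (S.theta x ω), ξ (x, i) ω - lam * μ x : ℝ) : ℂ)) := by
    intro ω
    rw [← exp_sum, ← mul_sum]; push_cast; rfl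
  have e2 : cexp (-(lam * (∑ x ∈ A, q x) / 2 : ℝ)) = ∏ x ∈ A, cexp (-(lam * q x / 2 : ℝ)) := by
    rw [← exp_sum, mul_sum, sum_div]; push_cast
    rw [Finset.sum_neg_distrib]
  simp_rw [e1]
  rw [h1, e2, mul_sum]
  refine (norm_prod_sub_prod_le A _ _ (fun x _ => ?_) (fun x _ => ?_)).trans
    (sum_le_sum fun x _ => ?_)
  · refine (norm_integral_le_integral_norm _).trans ?_
    simp only [norm_exp_I_mul_ofReal, integral_const, probReal_univ, smul_eq_mul, mul_one, le_refl]
  · rw [norm_exp, ← ofReal_neg, ofReal_re, exp_le_one_iff]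
    have := hq x
    have : 0 ≤ lam * q x / 2 := by positivity
    linarith
  · have h2 := norm_poisson_sum_sub_exp_le lam
      (fun i => ∫ ω, cexp (I * (ξ (x, i) ω : ℂ)) ∂P) (fun i => by
        refine (norm_integral_le_integral_norm _).trans ?_
        simp only [norm_exp_I_mul_ofReal, integral_const, probReal_univ, smul_eq_mul, mul_one,
          le_refl]) (hq x) (h x)
    rw [← S.integral_cexp_siteSum hξ x] at h2
    have e3 : ∫ ω, cexp (I * ((∑ i ∈ range (S.theta x ω), ξ (x, i) ω - lam * μ x : ℝ) : ℂ)) ∂P =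
        (∫ ω, cexp (I * ((∑ i ∈ range (S.theta x ω), ξ (x, i) ω : ℝ) : ℂ)) ∂P) *
          cexp (-(I * (lam * μ x))) := by
      rw [← integral_mul_const]
      congr 1; ext ω
      rw [← Complex.exp_add]; congr 1; push_cast; ring
    rw [e3]
    exact h2

/-- Gaussian approximation of the characteristic function of the total sum over all sites. -/
lemma norm_charFun_total_sub_le (hξ : ∀ q, Measurable[S.sigmaOf (subtree (q.1, q.2, []))] (ξ q))
    {μ q δ : HierGroup M → ℝ} (hq : ∀ x, 0 ≤ q x)
    (h : ∀ x i, ‖(∫ ω, cexp (I * (ξ (x, i) ω : ℂ)) ∂P) - 1 - I * μ x +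
      q x / 2‖ ≤ δ x) {m Q D : ℝ} (hμ : HasSum μ m) (hQ : HasSum q Q) (hδ : HasSum δ D)
    {J : Ω → ℝ} (hJ : ∀ᵐ ω ∂P, HasSum (fun x => ∑ i ∈ range (S.theta x ω), ξ (x, i) ω) (J ω)) :
    ‖(∫ ω, cexp (I * ((J ω - lam * m : ℝ) : ℂ)) ∂P) - cexp (-(lam * Q / 2 : ℝ))‖ ≤ 3 * lam * D := by
  -- Convergence is along all finite sets of sites; dominated convergence applies because the site
  -- set is countable, so this filter is countably generated.
  have hcg : (atTop : Filter (Finset (HierGroup M))).IsCountablyGenerated := inferInstance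
  have h1 : Tendsto (fun A : Finset (HierGroup M) => ∫ ω, cexp (I *
      ((∑ x ∈ A, (∑ i ∈ range (S.theta x ω), ξ (x, i) ω - lam * μ x) : ℝ) : ℂ)) ∂P) atTop
      (𝓝 (∫ ω, cexp (I * ((J ω - lam * m : ℝ) : ℂ)) ∂P)) := by
    refine tendsto_integral_filter_of_dominated_convergence (fun _ => 1) ?_ ?_ (integrable_const 1) ?_
    · refine Eventually.of_forall fun A => Measurable.aestronglyMeasurable ?_
      have : ∀ x, Measurable fun ω => ∑ i ∈ range (S.theta x ω), ξ (x, i) ω := fun x =>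
        (S.measurable_siteSum hξ x).mono (S.sigmaOf_le _) le_rfl
      fun_prop
    · exact Eventually.of_forall fun A => Eventually.of_forall fun ω =>
        (norm_exp_I_mul_ofReal _).le
    · filter_upwards [hJ] with ω hω
      have h2 : HasSum (fun x => ∑ i ∈ range (S.theta x ω), ξ (x, i) ω - lam * μ x)
          (J ω - lam * m) := hω.sub (hμ.mul_left _)
      exact ((show Continuous fun r : ℝ => cexp (I * (r : ℂ)) by fun_prop).tendsto _).comp h2
  have h2 : Tendsto (fun A : Finset (HierGroup M) => cexp (-(lam * (∑ x ∈ A, q x) / 2 : ℝ)))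
      atTop (𝓝 (cexp (-(lam * Q / 2 : ℝ)))) :=
    ((show Continuous fun r : ℝ => cexp (-((lam * r / 2 : ℝ) : ℂ)) by fun_prop).tendsto _).comp hQ
  exact le_of_tendsto_of_tendsto' (h1.sub h2).norm (hδ.mul_left (3 * (lam : ℝ)) |>.congr fun A => by
    rw [mul_sum]) fun A => S.norm_charFun_sites_sub_le hξ hq h A

end PoissonBranchingSystem

/-! ### Expansions of the characteristic function of one family -/

section Taylor

variable {Ω : Type*} [MeasurableSpace Ω] {P : Measure Ω} [IsProbabilityMeasure P]
  {F₁ F₂ : Ω → ℝ≥0∞}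

lemma integrable_pow_toReal (h₁ : Measurable F₁) (n : ℕ) (h : ∫⁻ ω, F₁ ω ^ n ∂P ≠ ⊤) :
    Integrable (fun ω => (F₁ ω).toReal ^ n) P := by
  have := integrable_toReal_of_lintegral_ne_top (h₁.pow_const n).aemeasurable h
  simpa [toReal_pow] using this

lemma integral_pow_toReal (h₁ : Measurable F₁) (n : ℕ) (h : ∫⁻ ω, F₁ ω ^ n ∂P ≠ ⊤) :
    ∫ ω, (F₁ ω).toReal ^ n ∂P = (∫⁻ ω, F₁ ω ^ n ∂P).toReal := by
  rw [← integral_toReal (h₁.pow_const n).aemeasurable (ae_lt_top (h₁.pow_const n) h)]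
  simp [toReal_pow]

lemma lintegral_pow_ne_top_of_le {G : Ω → ℝ≥0∞} (hle : ∀ ω, F₁ ω ≤ G ω) (n : ℕ)
    (h : ∫⁻ ω, G ω ^ n ∂P ≠ ⊤) : ∫⁻ ω, F₁ ω ^ n ∂P ≠ ⊤ :=
  ne_top_of_le_ne_top h (lintegral_mono fun ω => by have := hle ω; gcongr)

lemma lintegral_sq_ne_top (h : ∫⁻ ω, F₁ ω ^ 3 ∂P ≠ ⊤) : ∫⁻ ω, F₁ ω ^ 2 ∂P ≠ ⊤ := by
  have hle : ∀ x : ℝ≥0∞, x ^ 2 ≤ 1 + x ^ 3 := by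
    intro x
    rcases le_total x 1 with hx | hx
    · exact (pow_le_one₀ zero_le hx).trans le_self_add
    · exact (pow_le_pow_right₀ hx (by norm_num)).trans le_add_self
  refine ne_top_of_le_ne_top ?_ (lintegral_mono fun ω => hle (F₁ ω))
  rw [lintegral_add_left measurable_const]
  simp [h]

lemma lintegral_ne_top_of_sq (h : ∫⁻ ω, F₁ ω ^ 2 ∂P ≠ ⊤) : ∫⁻ ω, F₁ ω ∂P ≠ ⊤ := by
  have hle : ∀ x : ℝ≥0∞, x ≤ 1 + x ^ 2 := by
    intro x
    rcases le_total x 1 with hx | hx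
    · exact hx.trans le_self_add
    · exact (le_self_pow₀ hx (by norm_num)).trans le_add_self
  refine ne_top_of_le_ne_top ?_ (lintegral_mono fun ω => hle (F₁ ω))
  rw [lintegral_add_left measurable_const]
  simp [h]

lemma integrable_mul_toReal_sub (h₁ : Measurable F₁) (h₂ : Measurable F₂) (hf1 : ∫⁻ ω, F₁ ω ∂P ≠ ⊤)
    (hf2 : ∫⁻ ω, F₂ ω ∂P ≠ ⊤) (u : ℝ) :
    Integrable (fun ω => u * ((F₁ ω).toReal - (F₂ ω).toReal)) P ∧
      ((u * ((∫⁻ ω, F₁ ω ∂P).toReal - (∫⁻ ω, F₂ ω ∂P).toReal) : ℝ) : ℂ) =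
        ∫ ω, ((u * ((F₁ ω).toReal - (F₂ ω).toReal) : ℝ) : ℂ) ∂P := by
  have i1 := integrable_toReal_of_lintegral_ne_top h₁.aemeasurable hf1
  have i2 := integrable_toReal_of_lintegral_ne_top h₂.aemeasurable hf2
  refine ⟨(i1.sub i2).const_mul u, ?_⟩
  rw [integral_complex_ofReal, integral_const_mul, integral_sub i1 i2,
    integral_toReal h₁.aemeasurable (ae_lt_top h₁ hf1),
    integral_toReal h₂.aemeasurable (ae_lt_top h₂ hf2)]

lemma integrable_cexp {ξ : Ω → ℝ} (h : Measurable ξ) :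
    Integrable (fun ω => cexp (I * (ξ ω : ℂ))) P :=
  .of_bound (by fun_prop) 1 (Eventually.of_forall fun ω => (norm_exp_I_mul_ofReal _).le)

/-- First order expansion of a characteristic function. -/
lemma norm_charFun_sub_le_sq (h₁ : Measurable F₁) (h₂ : Measurable F₂) {s : ℝ≥0∞} (hs : s ≠ ⊤)
    (hle : ∫⁻ ω, (F₁ ω + F₂ ω) ^ 2 ∂P ≤ s) (u : ℝ) :
    ‖(∫ ω, cexp (I * ((u * ((F₁ ω).toReal - (F₂ ω).toReal) : ℝ) : ℂ)) ∂P) - 1 -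
      I * ((u * ((∫⁻ ω, F₁ ω ∂P).toReal - (∫⁻ ω, F₂ ω ∂P).toReal) : ℝ) : ℂ) + (0 : ℝ) / 2‖ ≤
    4 * (u ^ 2 * s.toReal) := by
  have h12 : Measurable fun ω => F₁ ω + F₂ ω := h₁.add h₂
  have hfin2 : ∫⁻ ω, (F₁ ω + F₂ ω) ^ 2 ∂P ≠ ⊤ := ne_top_of_le_ne_top hs hle
  have hf1 := lintegral_ne_top_of_sq (lintegral_pow_ne_top_of_le (fun _ => le_self_add) 2 hfin2)
  have hf2 := lintegral_ne_top_of_sq (lintegral_pow_ne_top_of_le (fun _ => le_add_self) 2 hfin2)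
  have hf12 := lintegral_ne_top_of_sq hfin2
  set ξ : Ω → ℝ := fun ω => u * ((F₁ ω).toReal - (F₂ ω).toReal) with hξ
  obtain ⟨iξ, eμ⟩ := integrable_mul_toReal_sub h₁ h₂ hf1 hf2 u
  have hξm : Measurable ξ := by fun_prop
  have ie := integrable_cexp (P := P) hξm
  have e1 : (∫ ω, cexp (I * (ξ ω : ℂ)) ∂P) - 1 - I * ∫ ω, (ξ ω : ℂ) ∂P =
      ∫ ω, (cexp (I * (ξ ω : ℂ)) - 1 - I * (ξ ω : ℂ)) ∂P := by
    have j1 : Integrable (fun ω => cexp (I * (ξ ω : ℂ)) - 1) P := ie.sub (integrable_const 1)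
    have j2 : Integrable (fun ω => I * (ξ ω : ℂ)) P := iξ.ofReal.const_mul _
    rw [integral_sub j1 j2, integral_sub ie (integrable_const 1), integral_const_mul]
    simp
  have e0 : (((0 : ℝ) : ℂ)) / 2 = 0 := by simp
  rw [eμ, e0, add_zero, e1]
  have isq := integrable_pow_toReal h12 2 hfin2
  calc _ ≤ ∫ ω, 4 * (u ^ 2 * (F₁ ω + F₂ ω).toReal ^ 2) ∂P := by
        refine norm_integral_le_of_norm_le ((isq.const_mul _).const_mul _) ?_
        filter_upwards [ae_lt_top h12 hf12] with ω hω
        refine (norm_cexp_I_mul_sub_le_sq _).trans ?_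
        have h1 : F₁ ω ≠ ⊤ := ne_top_of_le_ne_top hω.ne le_self_add
        have h2 : F₂ ω ≠ ⊤ := ne_top_of_le_ne_top hω.ne le_add_self
        rw [toReal_add h1 h2, hξ]
        simp only [mul_pow]
        gcongr 4 * (u ^ 2 * ?_)
        have p1 : 0 ≤ (F₁ ω).toReal := toReal_nonneg
        have p2 : 0 ≤ (F₂ ω).toReal := toReal_nonneg
        nlinarith [mul_nonneg p1 p2]
    _ = 4 * (u ^ 2 * (∫⁻ ω, (F₁ ω + F₂ ω) ^ 2 ∂P).toReal) := by
        rw [integral_const_mul, integral_const_mul, integral_pow_toReal h12 2 hfin2]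
    _ ≤ _ := by
        gcongr

/-- Second order expansion of a characteristic function. -/
lemma norm_charFun_sub_le_cube (h₁ : Measurable F₁) (h₂ : Measurable F₂) {t e L₁ L₂ L₁₂ : ℝ≥0∞}
    (ht : t ≠ ⊤) (he : e ≠ ⊤) (hle : ∫⁻ ω, (F₁ ω + F₂ ω) ^ 3 ∂P ≤ t)
    (hl₁ : L₁ ≤ ∫⁻ ω, F₁ ω ^ 2 ∂P) (hu₁ : ∫⁻ ω, F₁ ω ^ 2 ∂P ≤ e + L₁)
    (hl₂ : L₂ ≤ ∫⁻ ω, F₂ ω ^ 2 ∂P) (hu₂ : ∫⁻ ω, F₂ ω ^ 2 ∂P ≤ e + L₂)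
    (hl₁₂ : L₁₂ ≤ ∫⁻ ω, (F₁ ω + F₂ ω) ^ 2 ∂P) (hu₁₂ : ∫⁻ ω, (F₁ ω + F₂ ω) ^ 2 ∂P ≤ e + L₁₂) (u : ℝ) :
    ‖(∫ ω, cexp (I * ((u * ((F₁ ω).toReal - (F₂ ω).toReal) : ℝ) : ℂ)) ∂P) - 1 -
      I * ((u * ((∫⁻ ω, F₁ ω ∂P).toReal - (∫⁻ ω, F₂ ω ∂P).toReal) : ℝ) : ℂ) +
      ((u ^ 2 * (2 * L₁.toReal + 2 * L₂.toReal - L₁₂.toReal) : ℝ) : ℂ) / 2‖ ≤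
    4 * (|u| ^ 3 * t.toReal) + 5 / 2 * (u ^ 2 * e.toReal) := by
  have h12 : Measurable fun ω => F₁ ω + F₂ ω := h₁.add h₂
  have hfin3 : ∫⁻ ω, (F₁ ω + F₂ ω) ^ 3 ∂P ≠ ⊤ := ne_top_of_le_ne_top ht hle
  have hfin2 := lintegral_sq_ne_top hfin3
  have hs1 := lintegral_pow_ne_top_of_le (F₁ := F₁) (fun _ => le_self_add) 2 hfin2
  have hs2 := lintegral_pow_ne_top_of_le (F₁ := F₂) (fun _ => le_add_self) 2 hfin2
  have hf1 := lintegral_ne_top_of_sq hs1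
  have hf2 := lintegral_ne_top_of_sq hs2
  have hbound : ∀ {L U : ℝ≥0∞}, U ≠ ⊤ → L ≤ U → U ≤ e + L →
      L.toReal ≤ U.toReal ∧ U.toReal ≤ e.toReal + L.toReal := by
    intro L U hU h1 h2
    have hL := ne_top_of_le_ne_top hU h1
    refine ⟨toReal_mono hU h1, ?_⟩
    rw [← toReal_add he hL]
    exact toReal_mono (add_ne_top.2 ⟨he, hL⟩) h2
  obtain ⟨a1, b1⟩ := hbound hs1 hl₁ hu₁
  obtain ⟨a2, b2⟩ := hbound hs2 hl₂ hu₂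
  obtain ⟨a3, b3⟩ := hbound hfin2 hl₁₂ hu₁₂
  set ξ : Ω → ℝ := fun ω => u * ((F₁ ω).toReal - (F₂ ω).toReal) with hξ
  obtain ⟨iξ, eμ⟩ := integrable_mul_toReal_sub h₁ h₂ hf1 hf2 u
  have hfinite : ∀ᵐ ω ∂P, F₁ ω ≠ ⊤ ∧ F₂ ω ≠ ⊤ := by
    filter_upwards [ae_lt_top h₁ hf1, ae_lt_top h₂ hf2] with ω h h' using ⟨h.ne, h'.ne⟩
  have q1 := integrable_pow_toReal h₁ 2 hs1
  have q2 := integrable_pow_toReal h₂ 2 hs2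
  have q12 := integrable_pow_toReal h12 2 hfin2
  -- Moments are available only for nonnegative functionals, so the square of the difference is
  -- written as 2x² + 2y² - (x + y)².
  have esq : ∀ᵐ ω ∂P, ξ ω ^ 2 = u ^ 2 * (2 * (F₁ ω).toReal ^ 2 + 2 * (F₂ ω).toReal ^ 2 -
      (F₁ ω + F₂ ω).toReal ^ 2) := by
    filter_upwards [hfinite] with ω hω
    rw [toReal_add hω.1 hω.2, hξ]; ring
  have iall := ((((q1.const_mul 2).add (q2.const_mul 2)).sub q12).const_mul (u ^ 2))
  have iξ2 : Integrable (fun ω => ξ ω ^ 2) P := iall.congr (by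
    filter_upwards [esq] with ω hω using hω.symm)
  have eξ2 : ∫ ω, ξ ω ^ 2 ∂P = u ^ 2 * (2 * (∫⁻ ω, F₁ ω ^ 2 ∂P).toReal +
      2 * (∫⁻ ω, F₂ ω ^ 2 ∂P).toReal - (∫⁻ ω, (F₁ ω + F₂ ω) ^ 2 ∂P).toReal) := by
    have j1 : Integrable (fun ω => 2 * (F₁ ω).toReal ^ 2 + 2 * (F₂ ω).toReal ^ 2) P :=
      (q1.const_mul 2).add (q2.const_mul 2)
    rw [integral_congr_ae esq, integral_const_mul, integral_sub j1 q12,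
      integral_add (q1.const_mul 2) (q2.const_mul 2), integral_const_mul, integral_const_mul,
      integral_pow_toReal h₁ 2 hs1, integral_pow_toReal h₂ 2 hs2,
      integral_pow_toReal h12 2 hfin2]
  have hξm : Measurable ξ := by fun_prop
  have ie := integrable_cexp (P := P) hξm
  have iξ2c : Integrable (fun ω => (ξ ω : ℂ) ^ 2) P := by
    have := iξ2.ofReal (𝕜 := ℂ)
    simpa using this
  set q := u ^ 2 * (2 * L₁.toReal + 2 * L₂.toReal - L₁₂.toReal) with hq
  have e1 : (∫ ω, cexp (I * (ξ ω : ℂ)) ∂P) - 1 - I * (∫ ω, (ξ ω : ℂ) ∂P) + (q : ℂ) / 2 =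
      (∫ ω, (cexp (I * (ξ ω : ℂ)) - 1 - I * (ξ ω : ℂ) + (ξ ω : ℂ) ^ 2 / 2) ∂P) +
      (((q - ∫ ω, ξ ω ^ 2 ∂P) / 2 : ℝ) : ℂ) := by
    have j1 : Integrable (fun ω => cexp (I * (ξ ω : ℂ)) - 1) P := ie.sub (integrable_const 1)
    have j2 : Integrable (fun ω => I * (ξ ω : ℂ)) P := iξ.ofReal.const_mul _
    have j3 : Integrable (fun ω => cexp (I * (ξ ω : ℂ)) - 1 - I * (ξ ω : ℂ)) P :=
      j1.sub j2
    rw [integral_add j3 (iξ2c.div_const 2), integral_sub j1 j2,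
      integral_sub ie (integrable_const 1), integral_const_mul, integral_div]
    have : ∫ ω, (ξ ω : ℂ) ^ 2 ∂P = ((∫ ω, ξ ω ^ 2 ∂P : ℝ) : ℂ) := by
      rw [← integral_complex_ofReal]; simp
    rw [this]
    push_cast
    simp only [integral_const, probReal_univ, one_smul]
    ring
  rw [eμ, e1]
  have i3 := integrable_pow_toReal h12 3 hfin3
  refine (norm_add_le _ _).trans (add_le_add ?_ ?_)
  · calc _ ≤ ∫ ω, 4 * (|u| ^ 3 * (F₁ ω + F₂ ω).toReal ^ 3) ∂P := by
          refine norm_integral_le_of_norm_le ((i3.const_mul _).const_mul _) ?_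
          filter_upwards [hfinite] with ω hω
          refine (norm_cexp_I_mul_sub_le_cube _).trans ?_
          rw [toReal_add hω.1 hω.2, hξ]
          simp only [abs_mul, mul_pow]
          gcongr
          have p1 : 0 ≤ (F₁ ω).toReal := toReal_nonneg
          have p2 : 0 ≤ (F₂ ω).toReal := toReal_nonneg
          rw [abs_le]; constructor <;> linarith
      _ = 4 * (|u| ^ 3 * (∫⁻ ω, (F₁ ω + F₂ ω) ^ 3 ∂P).toReal) := by
          rw [integral_const_mul, integral_const_mul, integral_pow_toReal h12 3 hfin3]
      _ ≤ _ := by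
          have := toReal_mono ht hle
          gcongr
  · rw [norm_real, eξ2, hq, Real.norm_eq_abs, ← mul_sub, mul_div_assoc, abs_mul, abs_of_nonneg (sq_nonneg u)]
    -- Each second moment is known up to e, and the coefficients 2, 2 and -1 are halved: (2 + 2 +
    -- 1)/2 = 5/2.
    rw [mul_left_comm (5 / 2 : ℝ)]
    refine mul_le_mul_of_nonneg_left ?_ (sq_nonneg u)
    rw [abs_le]
    constructor <;> linarith

end Taylor

lemma hasSum_toReal_of_ne_top {α : Type*} {f : α → ℝ≥0∞} (h : ∑' x, f x ≠ ⊤) :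
    HasSum (fun x => (f x).toReal) (∑' x, f x).toReal := by
  rw [ENNReal.tsum_toReal_eq fun x => ne_top_of_tsum_ne_top h x]
  exact ENNReal.hasSum_toReal h

/-! ### Additivity and monotonicity in the test function -/

section Additivity

variable {H : Type*} [AddCommGroup H] [Countable H] [MeasurableSpace H] [DiscreteMeasurableSpace H]
  {ι Ω : Type*} {Φ₁ Φ₂ : ℝ → H → ℝ≥0∞} {ch : Bool → ι → ι} {life : ι → Ω → ℝ} {split : ι → Ω → Bool}
  {walk : ι → ℝ≥0 → Ω → H} {ω : Ω}

lemma occ_add (h₁ : ∀ y, Measurable fun s => Φ₁ s y) {L : Ω → ℝ} {w : ℝ≥0 → Ω → H}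
    (hw : Measurable fun r => w r ω) (s : ℝ) (y : H) :
    occ (fun s y => Φ₁ s y + Φ₂ s y) L w s y ω = occ Φ₁ L w s y ω + occ Φ₂ L w s y ω := by
  unfold occ
  rw [← lintegral_add_left]
  · refine lintegral_congr fun r => ?_
    split_ifs <;> simp
  · refine Measurable.ite (measurableSet_lt measurable_id measurable_const) ?_ measurable_const
    refine (measurable_uncurry_field h₁).comp (Measurable.prodMk (by fun_prop) ?_)
    exact measurable_add_countable measurable_const (hw.comp measurable_real_toNNReal)

lemma pathOcc_add (h₁ : ∀ y, Measurable fun s => Φ₁ s y) (hw : ∀ p, Measurable fun r => walk p r ω)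
    (w : List Bool) (p : ι) (s : ℝ) (y : H) :
    pathOcc (fun s y => Φ₁ s y + Φ₂ s y) ch life split walk ω w p s y =
      pathOcc Φ₁ ch life split walk ω w p s y + pathOcc Φ₂ ch life split walk ω w p s y := by
  induction w generalizing p s y with
  | nil => exact occ_add h₁ (hw p) s y
  | cons b w ih =>
    unfold pathOcc
    split_ifs
    · exact ih _ _ _
    · simp

lemma fam_add (h₁ : ∀ y, Measurable fun s => Φ₁ s y) (hw : ∀ p, Measurable fun r => walk p r ω)
    (p : ι) (s : ℝ) (y : H) :
    fam (fun s y => Φ₁ s y + Φ₂ s y) ch life split walk p s y ω =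
      fam Φ₁ ch life split walk p s y ω + fam Φ₂ ch life split walk p s y ω := by
  simp_rw [fam_eq_tsum, pathOcc_add h₁ hw, tsum_add]

end Additivity

section Monotone

variable {H : Type*} [AddCommGroup H] [Countable H] {k : ℝ → H → ℝ≥0∞} {V : ℝ}
  {Φ Ψ : ℝ → H → ℝ≥0∞}

lemma renewal_lifeOcc_mono (h : ∀ s y, Φ s y ≤ Ψ s y) (s : ℝ) (y : H) :
    renewal k V (lifeOcc k V Φ) s y ≤ renewal k V (lifeOcc k V Ψ) s y := by
  have h1 : ∀ s y, lifeOcc k V Φ s y ≤ lifeOcc k V Ψ s y := fun s y =>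
    resW_mono (fun _ _ => le_rfl) h s y
  exact add_le_add (h1 s y) (mul_le_mul' le_rfl (resW_mono (fun _ _ => le_rfl) h1 s y))

lemma pot_mono (h : ∀ s y, Φ s y ≤ Ψ s y) (s : ℝ) (y : H) : pot k Φ s y ≤ pot k Ψ s y :=
  resW_mono (fun _ _ => le_rfl) h s y

end Monotone

/-- A bounded space-time test function vanishing after time `T`, with potential bounded by `a` and
occupation of any path up to time `l` bounded by `a (1 + l)`. -/
structure IsOccTest {H : Type*} [AddCommGroup H] (k : ℝ → H → ℝ≥0∞) (Φ : ℝ → H → ℝ≥0∞) (T : ℝ)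
    (a : ℝ≥0∞) : Prop where
  meas : ∀ y, Measurable fun s => Φ s y
  zero : ∀ s y, T < s → Φ s y = 0
  ne_top : a ≠ ⊤
  bdd : ∃ κ : ℝ≥0∞, κ ≠ ⊤ ∧ ∀ s y, Φ s y ≤ κ
  occ_le : ∀ (l s : ℝ) (f : ℝ → H), ∫⁻ r in Ioi (0:ℝ), (if r < l then Φ (s + r) (f r) else 0) ≤
    a * ofReal (1 + l)
  pot_le : ∀ s y, pot k Φ s y ≤ a

lemma IsOccTest.mono {H : Type*} [AddCommGroup H] [Countable H] {k : ℝ → H → ℝ≥0∞}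
    {Φ Ψ : ℝ → H → ℝ≥0∞}
    {T : ℝ} {a : ℝ≥0∞} (h : IsOccTest k Ψ T a) (hm : ∀ y, Measurable fun s => Φ s y)
    (hle : ∀ s y, Φ s y ≤ Ψ s y) : IsOccTest k Φ T a where
  meas := hm
  zero s y hs := le_antisymm ((hle s y).trans (h.zero s y hs).le) zero_le
  ne_top := h.ne_top
  bdd := let ⟨κ, h1, h2⟩ := h.bdd; ⟨κ, h1, fun s y => (hle s y).trans (h2 s y)⟩
  occ_le l s f := (lintegral_mono fun r => by split_ifs <;> simp [hle]).trans (h.occ_le l s f)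
  pot_le s y := (pot_mono hle s y).trans (h.pot_le s y)

/-- The quadratic form `V ∫ ∑ (G Φ)²`. -/
def qform {H : Type*} [AddCommGroup H] (k : ℝ → H → ℝ≥0∞) (V : ℝ) (Φ : ℝ → H → ℝ≥0∞) : ℝ≥0∞ :=
  ofReal V * ∫⁻ s in Ioi (0:ℝ), ∑' y, pot k Φ s y ^ 2

lemma tsum_qform {H : Type*} [AddCommGroup H] [Countable H] {k : ℝ → H → ℝ≥0∞}
    {Φ : ℝ → H → ℝ≥0∞} (hk : SymmSemigroup k) (V : ℝ) (hΦ : ∀ y, Measurable fun s => Φ s y) :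
    ∑' y, ofReal V * pot k (fun s y => pot k Φ s y ^ 2) 0 y = qform k V Φ := by
  rw [qform, ENNReal.tsum_mul_left, tsum_pot_zero hk fun y => (measurable_pot hk hΦ y).pow_const 2]

/-- The inequality (x + y)² ≤ 2x² + 2y² under the potentials. It makes the polarized variance
nonnegative site by site, as the comparison with a Gaussian requires. -/
lemma add_sq_qform_le {H : Type*} [AddCommGroup H] [Countable H] {k : ℝ → H → ℝ≥0∞}
    {Φ₁ Φ₂ : ℝ → H → ℝ≥0∞} (hk : SymmSemigroup k) (V : ℝ)
    (h₁ : ∀ y, Measurable fun s => Φ₁ s y) (h₂ : ∀ y, Measurable fun s => Φ₂ s y) (x : H) :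
    ofReal V * pot k (fun s y => pot k (fun s y => Φ₁ s y + Φ₂ s y) s y ^ 2) 0 x ≤
      2 * (ofReal V * pot k (fun s y => pot k Φ₁ s y ^ 2) 0 x) +
      2 * (ofReal V * pot k (fun s y => pot k Φ₂ s y ^ 2) 0 x) := by
  have hp1 : ∀ y, Measurable fun s => pot k Φ₁ s y ^ 2 := fun y => (measurable_pot hk h₁ y).pow_const 2
  have hp2 : ∀ y, Measurable fun s => pot k Φ₂ s y ^ 2 := fun y => (measurable_pot hk h₂ y).pow_const 2
  have e1 : ∀ s y, pot k (fun s y => Φ₁ s y + Φ₂ s y) s y ^ 2 ≤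
      2 * pot k Φ₁ s y ^ 2 + 2 * pot k Φ₂ s y ^ 2 := by
    intro s y
    rw [pot, resW_add hk measurable_const h₁]
    have : ∀ a b : ℝ≥0∞, (a + b) ^ 2 ≤ 2 * a ^ 2 + 2 * b ^ 2 := by
      intro a b
      rcases eq_or_ne a ⊤ with rfl | ha
      · simp
      rcases eq_or_ne b ⊤ with rfl | hb
      · simp
      lift a to ℝ≥0 using ha
      lift b to ℝ≥0 using hb
      norm_cast
      rw [← coe_le_coe]
      push_cast
      nlinarith [sq_nonneg ((a : ℝ) - b)]
    exact this _ _
  have e2 := pot_mono (k := k) e1 0 x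
  rw [pot, show pot k (fun s y => 2 * pot k Φ₁ s y ^ 2 + 2 * pot k Φ₂ s y ^ 2) 0 x = resW k (fun _ => 1)
    (fun s y => 2 * pot k Φ₁ s y ^ 2 + 2 * pot k Φ₂ s y ^ 2) 0 x from rfl,
    resW_add hk measurable_const fun y => (hp1 y).const_mul 2,
    resW_const_mul hk measurable_const hp1, resW_const_mul hk measurable_const hp2] at e2
  refine (mul_le_mul' le_rfl e2).trans_eq ?_
  rw [mul_add, mul_left_comm, mul_left_comm _ (2 : ℝ≥0∞)]
  rfl

/-- The total mass of `Φ`. -/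
def mass {H : Type*} (Φ : ℝ → H → ℝ≥0∞) : ℝ≥0∞ := ∫⁻ s in Ioi (0:ℝ), ∑' y, Φ s y

/-! ### Gaussian approximation and variance bound for centered occupations -/

namespace PoissonBranchingSystem

variable {M : ℕ} {c V : ℝ} {lam : ℝ≥0} {Ω : Type*} [mΩ : MeasurableSpace Ω] {P : Measure Ω}
  [IsProbabilityMeasure P] (S : PoissonBranchingSystem M c V lam P) [NeZero M]
  {Φ Φ₁ Φ₂ : ℝ → HierGroup M → ℝ≥0∞}

lemma famAt_add (h₁ : ∀ y, Measurable fun s => Φ₁ s y) (q : HierGroup M × ℕ) (ω : Ω) :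
    S.famAt (fun s y => Φ₁ s y + Φ₂ s y) q ω = S.famAt Φ₁ q ω + S.famAt Φ₂ q ω :=
  fam_add h₁ (ω := ω) (walk := S.walk) (fun p => (S.measurable_walk_joint p).comp
    (measurable_prodMk_right (y := ω))) _ _ _

lemma total_eq_tsum_sum (Φ : ℝ → HierGroup M → ℝ≥0∞) (ω : Ω) :
    S.total Φ ω = ∑' x, ∑ i ∈ range (S.theta x ω), S.famAt Φ (x, i) ω := by
  rw [total, tsum_prod']
  refine tsum_congr fun x => ?_
  rw [tsum_eq_sum (s := range (S.theta x ω))]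
  · refine sum_congr rfl fun i hi => ?_
    rw [if_pos (mem_range.1 hi)]
  · intro i hi
    rw [if_neg (by simpa using hi)]

lemma hasSum_total {ω : Ω} (h : S.total Φ ω ≠ ⊤) :
    HasSum (fun x => ∑ i ∈ range (S.theta x ω), (S.famAt Φ (x, i) ω).toReal)
      (S.total Φ ω).toReal := by
  rw [total_eq_tsum_sum] at h ⊢
  have h1 := hasSum_toReal_of_ne_top h
  have e : (fun x => (∑ i ∈ range (S.theta x ω), S.famAt Φ (x, i) ω).toReal) =
      fun x => ∑ i ∈ range (S.theta x ω), (S.famAt Φ (x, i) ω).toReal := by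
    funext x
    have h2 := ne_top_of_tsum_ne_top h x
    rw [toReal_sum]
    exact fun i hi => (ENNReal.sum_lt_top.1 (lt_top_iff_ne_top.2 h2) i hi).ne
  rwa [e] at h1

lemma ae_total_ne_top (hM : 1 < M) (hc : 1 ≤ c) (hcM : c < M) (hV : 0 < V) {T : ℝ} {a : ℝ≥0∞}
    (hΦ : IsOccTest (tkernel M c) Φ T a) (hI : mass Φ ≠ ⊤) : ∀ᵐ ω ∂P, S.total Φ ω ≠ ⊤ := by
  refine (ae_lt_top (S.measurable_total hM hc hcM hV hΦ.meas) ?_).mono fun _ h => h.ne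
  obtain ⟨κ, hκ, hle⟩ := hΦ.bdd
  rw [S.lintegral_total hM hc hcM hV hΦ.meas hΦ.zero hκ hle]
  exact mul_ne_top (by simp) hI

/-- The centered difference of the total occupations of `Φ₁` and `Φ₂`. -/
def centered (Φ₁ Φ₂ : ℝ → HierGroup M → ℝ≥0∞) (ω : Ω) : ℝ :=
  (S.total Φ₁ ω).toReal - (S.total Φ₂ ω).toReal - lam * ((mass Φ₁).toReal - (mass Φ₂).toReal)

lemma measurable_centered (hM : 1 < M) (hc : 1 ≤ c) (hcM : c < M) (hV : 0 < V)
    (h₁ : ∀ y, Measurable fun s => Φ₁ s y) (h₂ : ∀ y, Measurable fun s => Φ₂ s y) :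
    Measurable (S.centered Φ₁ Φ₂) := by
  have := S.measurable_total hM hc hcM hV h₁
  have := S.measurable_total hM hc hcM hV h₂
  unfold centered
  fun_prop

lemma lintegral_famAt (hM : 1 < M) (hc : 1 ≤ c) (hcM : c < M) (hV : 0 < V) {T : ℝ} {a : ℝ≥0∞}
    (hΦ : IsOccTest (tkernel M c) Φ T a) (q : HierGroup M × ℕ) :
    ∫⁻ ω, S.famAt Φ q ω ∂P = pot (tkernel M c) Φ 0 q.1 := by
  obtain ⟨κ, hκ, hle⟩ := hΦ.bdd
  exact (S.isBranching hM hc hcM hV).lintegral_fam hΦ.meas hΦ.zero hκ hle _ _ _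

lemma lintegral_famAt_sq_le (hM : 1 < M) (hc : 1 ≤ c) (hcM : c < M) (hV : 0 < V) {T : ℝ} {a : ℝ≥0∞}
    (hΦ : IsOccTest (tkernel M c) Φ T a) (q : HierGroup M × ℕ) :
    ∫⁻ ω, S.famAt Φ q ω ^ 2 ∂P ≤ secondBd (tkernel M c) V Φ a 0 q.1 := by
  have hB := S.isBranching hM hc hcM hV
  exact hB.lintegral_fam_sq_le hΦ.meas (fun p s y ω => hΦ.occ_le _ _ _) hΦ.pot_le _ _ _

lemma le_lintegral_famAt_sq (hM : 1 < M) (hc : 1 ≤ c) (hcM : c < M) (hV : 0 < V) {T : ℝ} {a : ℝ≥0∞}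
    (hΦ : IsOccTest (tkernel M c) Φ T a) (q : HierGroup M × ℕ) :
    ofReal V * pot (tkernel M c) (fun s y => pot (tkernel M c) Φ s y ^ 2) 0 q.1 ≤
      ∫⁻ ω, S.famAt Φ q ω ^ 2 ∂P := by
  obtain ⟨κ, hκ, hle⟩ := hΦ.bdd
  exact (S.isBranching hM hc hcM hV).le_lintegral_fam_sq hΦ.meas hΦ.zero hκ hle hΦ.ne_top
    hΦ.pot_le _ _ _

lemma lintegral_famAt_cube_le (hM : 1 < M) (hc : 1 ≤ c) (hcM : c < M) (hV : 0 < V) {T : ℝ} {a c₂ : ℝ≥0∞}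
    (hΦ : IsOccTest (tkernel M c) Φ T a)
    (hc₂ : ∀ s y, 0 ≤ s → secondBd (tkernel M c) V Φ a s y ≤ c₂) (q : HierGroup M × ℕ) :
    ∫⁻ ω, S.famAt Φ q ω ^ 3 ∂P ≤ thirdBd (tkernel M c) V Φ a c₂ 0 q.1 := by
  have hB := S.isBranching hM hc hcM hV
  exact hB.lintegral_fam_cube_le hΦ.meas (fun p s y ω => hΦ.occ_le _ _ _) hΦ.pot_le
    hc₂ _ _ le_rfl _

/-- Transfers any expansion for a single family, of first order (q = 0) or of second order, to the
whole centered system. -/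
lemma norm_charFun_centered_sub_le_of (hM : 1 < M) (hc : 1 ≤ c) (hcM : c < M) (hV : 0 < V) {T : ℝ}
    {a : ℝ≥0∞} (h₁ : ∀ y, Measurable fun s => Φ₁ s y) (h₂ : ∀ y, Measurable fun s => Φ₂ s y)
    (hG : IsOccTest (tkernel M c) (fun s y => Φ₁ s y + Φ₂ s y) T a)
    (hI : mass (fun s y => Φ₁ s y + Φ₂ s y) ≠ ⊤) {u : ℝ} {q δ : HierGroup M → ℝ} {Q D : ℝ}
    (hq : ∀ x, 0 ≤ q x) (hQ : HasSum q Q) (hD : HasSum δ D)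
    (h : ∀ x i, ‖(∫ ω, cexp (I * ((u * ((S.famAt Φ₁ (x, i) ω).toReal -
      (S.famAt Φ₂ (x, i) ω).toReal) : ℝ) : ℂ)) ∂P) - 1 - I * ((u * ((∫⁻ ω, S.famAt Φ₁ (x, i) ω ∂P).toReal -
      (∫⁻ ω, S.famAt Φ₂ (x, i) ω ∂P).toReal) : ℝ) : ℂ) + (q x : ℂ) / 2‖ ≤ δ x) :
    ‖(∫ ω, cexp (I * ((u * S.centered Φ₁ Φ₂ ω : ℝ) : ℂ)) ∂P) -
      cexp (-(lam * Q / 2 : ℝ))‖ ≤ 3 * lam * D := by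
  have hk := (S.isBranching hM hc hcM hV).semigroup
  have t₁ : IsOccTest (tkernel M c) Φ₁ T a := hG.mono h₁ fun s y => le_self_add
  have t₂ : IsOccTest (tkernel M c) Φ₂ T a := hG.mono h₂ fun s y => le_add_self
  have hI1 : mass Φ₁ ≠ ⊤ := ne_top_of_le_ne_top hI (lintegral_mono fun s => tsum_le_tsum fun y => le_self_add)
  have hI2 : mass Φ₂ ≠ ⊤ := ne_top_of_le_ne_top hI (lintegral_mono fun s => tsum_le_tsum fun y => le_add_self)
  have sm : ∀ {Ψ : ℝ → HierGroup M → ℝ≥0∞}, (∀ y, Measurable fun s => Ψ s y) →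
      mass Ψ ≠ ⊤ → HasSum (fun y => (pot (tkernel M c) Ψ 0 y).toReal) (mass Ψ).toReal := by
    intro Ψ hm h
    have h3 := tsum_pot_zero hk hm
    have := hasSum_toReal_of_ne_top (f := pot (tkernel M c) Ψ 0) (by rw [h3]; exact h)
    rwa [h3] at this
  have hξ : ∀ q : HierGroup M × ℕ, Measurable[S.sigmaOf (subtree (q.1, q.2, []))]
      (fun ω => u * ((S.famAt Φ₁ q ω).toReal - (S.famAt Φ₂ q ω).toReal)) := fun q =>
    ((S.measurable_famAt hM hc hcM hV h₁ q).ennreal_toReal.sub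
      (S.measurable_famAt hM hc hcM hV h₂ q).ennreal_toReal).const_mul u
  have key := S.norm_charFun_total_sub_le hξ hq (by
      intro x i
      have := h x i
      rw [S.lintegral_famAt hM hc hcM hV t₁, S.lintegral_famAt hM hc hcM hV t₂] at this
      exact this) (((sm h₁ hI1).sub (sm h₂ hI2)).mul_left u) hQ hD
      (J := fun ω => u * ((S.total Φ₁ ω).toReal - (S.total Φ₂ ω).toReal)) (by
        filter_upwards [S.ae_total_ne_top hM hc hcM hV t₁ hI1, S.ae_total_ne_top hM hc hcM hV t₂ hI2]
          with ω w1 w2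
        have := ((S.hasSum_total w1).sub (S.hasSum_total w2)).mul_left u
        simpa only [← mul_sum, sum_sub_distrib] using this)
  have ecen : ∀ ω, u * ((S.total Φ₁ ω).toReal - (S.total Φ₂ ω).toReal) -
      lam * (u * ((mass Φ₁).toReal - (mass Φ₂).toReal)) = u * S.centered Φ₁ Φ₂ ω := by
    intro ω; rw [centered]; ring
  simpa only [ecen] using key

/-- Gaussian approximation of the characteristic function of a centered occupation. -/
lemma norm_charFun_centered_sub_le (hM : 1 < M) (hc : 1 ≤ c) (hcM : c < M) (hV : 0 < V) {T : ℝ}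
    {a c₂ e t : ℝ≥0∞} (h₁ : ∀ y, Measurable fun s => Φ₁ s y) (h₂ : ∀ y, Measurable fun s => Φ₂ s y)
    (hG : IsOccTest (tkernel M c) (fun s y => Φ₁ s y + Φ₂ s y) T a)
    (hI : mass (fun s y => Φ₁ s y + Φ₂ s y) ≠ ⊤)
    (hQ : qform (tkernel M c) V (fun s y => Φ₁ s y + Φ₂ s y) ≠ ⊤)
    (hc₂ : ∀ s y, 0 ≤ s → secondBd (tkernel M c) V (fun s y => Φ₁ s y + Φ₂ s y) a s y ≤ c₂)
    (he : e ≠ ⊤) (ht : t ≠ ⊤)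
    (hle : 3 * a * ∑' y, renewal (tkernel M c) V (lifeOcc (tkernel M c) V fun s y => Φ₁ s y + Φ₂ s y) 0 y ≤ e)
    (hlt : ∑' y, thirdBd (tkernel M c) V (fun s y => Φ₁ s y + Φ₂ s y) a c₂ 0 y ≤ t) (u : ℝ) :
    ‖(∫ ω, cexp (I * ((u * S.centered Φ₁ Φ₂ ω : ℝ) : ℂ)) ∂P) -
      cexp (-(lam * (u ^ 2 * (2 * (qform (tkernel M c) V Φ₁).toReal +
        2 * (qform (tkernel M c) V Φ₂).toReal -
        (qform (tkernel M c) V fun s y => Φ₁ s y + Φ₂ s y).toReal)) / 2 : ℝ))‖ ≤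
    3 * lam * (4 * (|u| ^ 3 * t.toReal) + 5 / 2 * (u ^ 2 * e.toReal)) := by
  set G : ℝ → HierGroup M → ℝ≥0∞ := fun s y => Φ₁ s y + Φ₂ s y with hGdef
  have hk := (S.isBranching hM hc hcM hV).semigroup
  have t₁ : IsOccTest (tkernel M c) Φ₁ T a := hG.mono h₁ fun s y => le_self_add
  have t₂ : IsOccTest (tkernel M c) Φ₂ T a := hG.mono h₂ fun s y => le_add_self
  have hqm : ∀ {Ψ : ℝ → HierGroup M → ℝ≥0∞}, (∀ s y, Ψ s y ≤ G s y) → qform (tkernel M c) V Ψ ≠ ⊤ := by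
    intro Ψ h
    refine ne_top_of_le_ne_top hQ (mul_le_mul' le_rfl (lintegral_mono fun s => tsum_le_tsum fun y => ?_))
    have := pot_mono (k := tkernel M c) h s y
    gcongr
  have hQ1 := hqm (Ψ := Φ₁) fun s y => le_self_add
  have hQ2 := hqm (Ψ := Φ₂) fun s y => le_add_self
  set E : HierGroup M → ℝ≥0∞ := fun y => 3 * a * renewal (tkernel M c) V (lifeOcc (tkernel M c) V G) 0 y with hE
  set L : (ℝ → HierGroup M → ℝ≥0∞) → HierGroup M → ℝ≥0∞ := fun Ψ y =>
    ofReal V * pot (tkernel M c) (fun s y => pot (tkernel M c) Ψ s y ^ 2) 0 y with hL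
  -- One error term, computed for Φ₁ + Φ₂, serves for Φ₁, Φ₂ and their sum; only the main term L
  -- depends on the function.
  have hup : ∀ {Ψ : ℝ → HierGroup M → ℝ≥0∞}, (∀ s y, Ψ s y ≤ G s y) → ∀ y,
      secondBd (tkernel M c) V Ψ a 0 y ≤ E y + L Ψ y := by
    intro Ψ h y
    rw [secondBd, one_mul]
    exact add_le_add (mul_le_mul' le_rfl (renewal_lifeOcc_mono h 0 y)) le_rfl
  have hEs : ∑' y, E y ≠ ⊤ := by
    rw [hE, ENNReal.tsum_mul_left]; exact ne_top_of_le_ne_top he hle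
  have hts : ∑' y, thirdBd (tkernel M c) V G a c₂ 0 y ≠ ⊤ := ne_top_of_le_ne_top ht hlt
  have sL : ∀ {Ψ : ℝ → HierGroup M → ℝ≥0∞}, (∀ y, Measurable fun s => Ψ s y) →
      qform (tkernel M c) V Ψ ≠ ⊤ → HasSum (fun y => (L Ψ y).toReal) (qform (tkernel M c) V Ψ).toReal := by
    intro Ψ hm h
    have h3 := tsum_qform hk V hm
    have := hasSum_toReal_of_ne_top (f := L Ψ) (by rw [hL]; dsimp only; rw [h3]; exact h)
    rwa [show ∑' y, L Ψ y = qform (tkernel M c) V Ψ from h3] at this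
  have hmG : ∀ y, Measurable fun s => G s y := hG.meas
  have hm1 := fun q => S.measurable_famAt' hM hc hcM hV h₁ q
  have hm2 := fun q => S.measurable_famAt' hM hc hcM hV h₂ q
  have hadd : ∀ q ω, S.famAt Φ₁ q ω + S.famAt Φ₂ q ω = S.famAt G q ω := fun q ω => (S.famAt_add h₁ q ω).symm
  have hest := fun (x : HierGroup M) (i : ℕ) => norm_charFun_sub_le_cube (P := P) (hm1 (x, i)) (hm2 (x, i))
    (t := thirdBd (tkernel M c) V G a c₂ 0 x) (e := E x) (L₁ := L Φ₁ x) (L₂ := L Φ₂ x) (L₁₂ := L G x)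
    (ne_top_of_tsum_ne_top hts x) (ne_top_of_tsum_ne_top hEs x)
    (by simp_rw [hadd]; exact S.lintegral_famAt_cube_le hM hc hcM hV hG hc₂ (x, i))
    (S.le_lintegral_famAt_sq hM hc hcM hV t₁ (x, i))
    ((S.lintegral_famAt_sq_le hM hc hcM hV t₁ (x, i)).trans (hup (fun s y => le_self_add) x))
    (S.le_lintegral_famAt_sq hM hc hcM hV t₂ (x, i))
    ((S.lintegral_famAt_sq_le hM hc hcM hV t₂ (x, i)).trans (hup (fun s y => le_add_self) x))
    (by simp_rw [hadd]; exact S.le_lintegral_famAt_sq hM hc hcM hV hG (x, i))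
    (by simp_rw [hadd]
        exact (S.lintegral_famAt_sq_le hM hc hcM hV hG (x, i)).trans (hup (fun s y => le_rfl) x)) u
  have hnn : ∀ x, 0 ≤ u ^ 2 * (2 * (L Φ₁ x).toReal + 2 * (L Φ₂ x).toReal - (L G x).toReal) := by
    intro x
    have h3 : L G x ≤ 2 * L Φ₁ x + 2 * L Φ₂ x := add_sq_qform_le hk V h₁ h₂ x
    have f1 : L Φ₁ x ≠ ⊤ := ne_top_of_tsum_ne_top (by rw [hL]; dsimp only; rwa [tsum_qform hk V h₁]) x
    have f2 : L Φ₂ x ≠ ⊤ := ne_top_of_tsum_ne_top (by rw [hL]; dsimp only; rwa [tsum_qform hk V h₂]) x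
    have f3 : 2 * L Φ₁ x ≠ ⊤ := mul_ne_top (by simp) f1
    have f4 : 2 * L Φ₂ x ≠ ⊤ := mul_ne_top (by simp) f2
    have h4 := toReal_mono (add_ne_top.2 ⟨f3, f4⟩) h3
    rw [toReal_add f3 f4, toReal_mul (a := 2) (b := L Φ₁ x),
      toReal_mul (a := 2) (b := L Φ₂ x), ENNReal.toReal_ofNat] at h4
    exact mul_nonneg (sq_nonneg u) (sub_nonneg.2 h4)
  have key := S.norm_charFun_centered_sub_le_of hM hc hcM hV h₁ h₂ hG hI hnn
    (((((sL h₁ hQ1).mul_left 2).add ((sL h₂ hQ2).mul_left 2)).sub (sL hmG hQ)).mul_left (u ^ 2))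
    ((((hasSum_toReal_of_ne_top hts).mul_left (|u| ^ 3)).mul_left 4).add
      (((hasSum_toReal_of_ne_top hEs).mul_left (u ^ 2)).mul_left (5 / 2))) hest
  refine key.trans ?_
  have e2 : (∑' y, E y).toReal ≤ e.toReal := toReal_mono he (by rw [hE, ENNReal.tsum_mul_left]; exact hle)
  gcongr

/-- The first order expansion uses second moments only; it is used to recover the variance bound for
the total. -/
lemma norm_charFun_centered_sub_one_le (hM : 1 < M) (hc : 1 ≤ c) (hcM : c < M) (hV : 0 < V) {T : ℝ}
    {a s : ℝ≥0∞} (h₁ : ∀ y, Measurable fun s => Φ₁ s y) (h₂ : ∀ y, Measurable fun s => Φ₂ s y)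
    (hG : IsOccTest (tkernel M c) (fun s y => Φ₁ s y + Φ₂ s y) T a)
    (hI : mass (fun s y => Φ₁ s y + Φ₂ s y) ≠ ⊤) (hs : s ≠ ⊤)
    (hle : ∑' y, secondBd (tkernel M c) V (fun s y => Φ₁ s y + Φ₂ s y) a 0 y ≤ s) (u : ℝ) :
    ‖(∫ ω, cexp (I * ((u * S.centered Φ₁ Φ₂ ω : ℝ) : ℂ)) ∂P) - 1‖ ≤
      3 * lam * (4 * (u ^ 2 * s.toReal)) := by
  set G : ℝ → HierGroup M → ℝ≥0∞ := fun s y => Φ₁ s y + Φ₂ s y with hGdef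
  have hss : ∑' y, secondBd (tkernel M c) V G a 0 y ≠ ⊤ := ne_top_of_le_ne_top hs hle
  have hadd : ∀ q ω, S.famAt Φ₁ q ω + S.famAt Φ₂ q ω = S.famAt G q ω := fun q ω => (S.famAt_add h₁ q ω).symm
  have key := S.norm_charFun_centered_sub_le_of hM hc hcM hV h₁ h₂ hG hI (u := u) (q := fun _ => 0)
    (fun _ => le_rfl) hasSum_zero (((hasSum_toReal_of_ne_top hss).mul_left (u ^ 2)).mul_left 4) fun x i =>
      norm_charFun_sub_le_sq (P := P) (S.measurable_famAt' hM hc hcM hV h₁ (x, i))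
        (S.measurable_famAt' hM hc hcM hV h₂ (x, i)) (ne_top_of_tsum_ne_top hss x)
        (by simp_rw [hadd]; exact S.lintegral_famAt_sq_le hM hc hcM hV hG (x, i)) u
  simp only [mul_zero, zero_div, Complex.ofReal_zero, neg_zero, Complex.exp_zero] at key
  refine key.trans ?_
  have := lam.coe_nonneg
  gcongr

/-- Second moment bound for a centered occupation. -/
lemma lintegral_centered_sq_le (hM : 1 < M) (hc : 1 ≤ c) (hcM : c < M) (hV : 0 < V) {T : ℝ}
    {a s : ℝ≥0∞} (h₁ : ∀ y, Measurable fun s => Φ₁ s y) (h₂ : ∀ y, Measurable fun s => Φ₂ s y)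
    (hG : IsOccTest (tkernel M c) (fun s y => Φ₁ s y + Φ₂ s y) T a)
    (hI : mass (fun s y => Φ₁ s y + Φ₂ s y) ≠ ⊤) (hs : s ≠ ⊤)
    (hle : ∑' y, secondBd (tkernel M c) V (fun s y => Φ₁ s y + Φ₂ s y) a 0 y ≤ s) :
    ∫⁻ ω, ofReal (S.centered Φ₁ Φ₂ ω ^ 2) ∂P ≤ ofReal (24 * lam * s.toReal) := by
  set J := S.centered Φ₁ Φ₂ with hJ
  have hJm : Measurable J := S.measurable_centered hM hc hcM hV h₁ h₂
  -- As sin²(hJ) = (1 - Re e^{2ihJ})/2, the bound near frequency zero controls this integral; 24 =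
  -- (1/2)·3·4·2².
  have hJc : ∀ h : ℝ, ∫ ω, sin (h * J ω) ^ 2 ∂P ≤ h ^ 2 * (24 * lam * s.toReal) := by
    intro h
    have h3 := S.norm_charFun_centered_sub_one_le hM hc hcM hV h₁ h₂ hG hI hs hle (2 * h)
    have ie := integrable_cexp (P := P) (hJm.const_mul (2 * h))
    have e1 : ∀ ω, sin (h * J ω) ^ 2 =
        1 / 2 - (1 / 2) * (cexp (I * ((2 * h * J ω : ℝ) : ℂ))).re := by
      intro ω
      rw [mul_comm I, Complex.exp_ofReal_mul_I_re, mul_assoc 2 h, Real.cos_two_mul, Real.cos_sq']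
      ring
    have i2 : Integrable (fun ω => (1 / 2 : ℝ) * (cexp (I * ((2 * h * J ω : ℝ) : ℂ))).re) P :=
      ie.re.const_mul _
    simp_rw [e1]
    rw [integral_sub (integrable_const _) i2, integral_const_mul]
    have e2 : ∫ ω, (cexp (I * ((2 * h * J ω : ℝ) : ℂ))).re ∂P =
      (∫ ω, cexp (I * ((2 * h * J ω : ℝ) : ℂ)) ∂P).re := integral_re ie
    rw [e2]
    have h4 := (Complex.abs_re_le_norm _).trans h3
    rw [Complex.sub_re, Complex.one_re, abs_le] at h4
    simp only [integral_const, probReal_univ, one_smul]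
    nlinarith [h4.1]
  -- sin(hJ)/h tends to J as h → 0, so Fatou's lemma bounds the second moment without integrability
  -- of J² being known in advance.
  have hlim : ∀ ω, Tendsto (fun n : ℕ => ofReal (((1 / ((n : ℝ) + 1))⁻¹ *
      sin (1 / ((n : ℝ) + 1) * J ω)) ^ 2)) atTop (𝓝 (ofReal (J ω ^ 2))) := by
    intro ω
    have hd : HasDerivAt (fun h : ℝ => sin (h * J ω)) (J ω) 0 := by
      have := (((hasDerivAt_id (0:ℝ)).mul_const (J ω))).sin
      simpa using this
    have ht : Tendsto (fun n : ℕ => 1 / ((n : ℝ) + 1)) atTop (𝓝[≠] 0) :=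
      tendsto_nhdsWithin_iff.2 ⟨tendsto_one_div_add_atTop_nhds_zero_nat,
        Eventually.of_forall fun n => by
          have : (0:ℝ) < 1 / ((n : ℝ) + 1) := by positivity
          exact this.ne'⟩
    have h5 := hd.tendsto_slope_zero.comp ht
    simp only [zero_add, zero_mul, Real.sin_zero, sub_zero, smul_eq_mul, Function.comp_def] at h5
    exact (ENNReal.continuous_ofReal.tendsto _).comp (h5.pow 2)
  calc _ = ∫⁻ ω, liminf (fun n : ℕ => ofReal (((1 / ((n : ℝ) + 1))⁻¹ *
      sin (1 / ((n : ℝ) + 1) * J ω)) ^ 2)) atTop ∂P := by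
        refine lintegral_congr fun ω => ?_
        rw [(hlim ω).liminf_eq]
    _ ≤ liminf (fun n : ℕ => ∫⁻ ω, ofReal (((1 / ((n : ℝ) + 1))⁻¹ *
      sin (1 / ((n : ℝ) + 1) * J ω)) ^ 2) ∂P) atTop :=
        lintegral_liminf_le fun n => by fun_prop
    _ ≤ _ := by
      refine liminf_le_of_le (by isBoundedDefault) fun b hb => ?_
      obtain ⟨n, hn⟩ := hb.exists
      refine hn.trans ?_
      have hpos : (0:ℝ) < 1 / ((n : ℝ) + 1) := by positivity
      set h := 1 / ((n : ℝ) + 1)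
      have i : Integrable (fun ω => (h⁻¹ * sin (h * J ω)) ^ 2) P := by
        refine Integrable.of_bound (by fun_prop) (h⁻¹ ^ 2) (Eventually.of_forall fun ω => ?_)
        rw [Real.norm_eq_abs, abs_of_nonneg (sq_nonneg _), mul_pow]
        exact mul_le_of_le_one_right (sq_nonneg _) (Real.sin_sq_le_one _)
      rw [← ofReal_integral_eq_lintegral_ofReal i (Eventually.of_forall fun ω => sq_nonneg _)]
      refine ofReal_le_ofReal ?_
      simp_rw [mul_pow]
      rw [integral_const_mul]
      calc _ ≤ h⁻¹ ^ 2 * (h ^ 2 * (24 * lam * s.toReal)) := by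
            gcongr
            exact hJc h
        _ = _ := by field_simp

end PoissonBranchingSystem

open Classical in
/-- The space-time function `f(s) 1[y = x]`. -/
def siteFn {H : Type*} (f : ℝ → ℝ≥0∞) (x : H) (s : ℝ) (y : H) : ℝ≥0∞ := if y = x then f s else 0

lemma measurable_siteFn {H : Type*} {f : ℝ → ℝ≥0∞} (hf : Measurable f) (x y : H) :
    Measurable fun s => siteFn f x s y := by
  unfold siteFn
  split_ifs
  · exact hf
  · exact measurable_const

lemma tsum_siteFn_mul {H : Type*} (f : ℝ → ℝ≥0∞) (x : H) (s : ℝ) (g : H → ℝ≥0∞) :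
    ∑' y, siteFn f x s y * g y = f s * g x := by
  rw [tsum_eq_single x]
  · simp [siteFn]
  · intro y hy; simp [siteFn, hy]

lemma mass_siteFn {H : Type*} (f : ℝ → ℝ≥0∞) (x : H) :
    mass (siteFn f x) = ∫⁻ s in Ioi (0:ℝ), f s := by
  unfold mass
  refine lintegral_congr fun s => ?_
  simpa using tsum_siteFn_mul f x s fun _ => 1

lemma HasBoundedSupport.exists_finset {M : ℕ} [NeZero M] {φ : HierGroup M → ℝ}
    (h : HasBoundedSupport φ) : ∃ B : Finset (HierGroup M), ∀ x ∉ B, φ x = 0 := by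
  obtain ⟨R, hR⟩ := h
  refine ⟨hball M R, fun x hx => ?_⟩
  by_contra h
  exact hx (mem_hball.2 ((hdist_zero_right x) ▸ hR x h))

/-! ### Particle counts and occupation times of sites -/

namespace PoissonBranchingSystem

variable {M : ℕ} {c V : ℝ} {lam : ℝ≥0} {Ω : Type*} [mΩ : MeasurableSpace Ω] {P : Measure Ω}
  [IsProbabilityMeasure P] (S : PoissonBranchingSystem M c V lam P) [NeZero M]

lemma total_siteFn {f : ℝ → ℝ≥0∞} (hf : Measurable f) (x : HierGroup M) {ω : Ω}
    (h : ∀ p, 0 ≤ S.life p ω) :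
    S.total (siteFn f x) ω = ∫⁻ t in Ioi (0:ℝ), f t * S.count t x ω := by
  rw [S.total_eq_lintegral (measurable_siteFn hf x) h]
  exact lintegral_congr fun s => tsum_siteFn_mul f x s _

lemma lintegral_mul_count (hM : 1 < M) (hc : 1 ≤ c) (hcM : c < M) (hV : 0 < V) {f : ℝ → ℝ≥0∞}
    (hf : Measurable f) {T : ℝ} (hT : ∀ s, T < s → f s = 0) (hf1 : ∀ s, f s ≤ 1) (x : HierGroup M) :
    ∫⁻ t in Ioi (0:ℝ), f t * ∫⁻ ω, S.count t x ω ∂P = lam * ∫⁻ t in Ioi (0:ℝ), f t := by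
  have h1 := S.lintegral_total hM hc hcM hV (measurable_siteFn hf x) (T := T) (κ := 1)
    (fun s y hs => by simp [siteFn, hT s hs]) (by simp)
    (fun s y => by unfold siteFn; split_ifs <;> simp [hf1])
  have h2 : ∫⁻ ω, S.total (siteFn f x) ω ∂P =
      ∫⁻ ω, (∫⁻ t in Ioi (0:ℝ), f t * S.count t x ω) ∂P := by
    refine lintegral_congr_ae ?_
    filter_upwards [S.ae_life_nonneg hM hc hcM hV] with ω hω using S.total_siteFn hf x hω
  have hm : Measurable fun q : Ω × ℝ => f q.2 * S.count q.2 x q.1 :=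
    (hf.comp measurable_snd).mul ((S.measurable_count x).comp measurable_swap)
  rw [h2, lintegral_lintegral_swap (f := fun ω t => f t * S.count t x ω) hm.aemeasurable] at h1
  rw [← mass_siteFn f x]
  refine Eq.trans ?_ h1
  refine lintegral_congr fun t => ?_
  rw [lintegral_const_mul _ (S.measurable_count_right x t)]

/-- The mean formula is integrated over time. Testing it against indicators of measurable time sets
identifies the mean count for almost every time only. -/
lemma ae_lintegral_count (hM : 1 < M) (hc : 1 ≤ c) (hcM : c < M) (hV : 0 < V) (x : HierGroup M) :
    ∀ᵐ t : ℝ, 0 < t → ∫⁻ ω, S.count t x ω ∂P = lam := by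
  have hg : Measurable fun t => ∫⁻ ω, S.count t x ω ∂P := (S.measurable_count x).lintegral_prod_right'
  have h1 : ∀ n : ℕ, ∀ᵐ t ∂(volume.restrict (Ioc (0:ℝ) n)), ∫⁻ ω, S.count t x ω ∂P = lam := by
    intro n
    refine ae_eq_of_forall_setLIntegral_eq_of_sigmaFinite hg measurable_const fun A hA _ => ?_
    have hB : MeasurableSet (A ∩ Ioc (0:ℝ) n) := hA.inter measurableSet_Ioc
    have h2 := S.lintegral_mul_count hM hc hcM hV (f := (A ∩ Ioc (0:ℝ) n).indicator 1)
      (measurable_one.indicator hB) (T := n)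
      (fun s hs => Set.indicator_of_notMem (fun h => absurd h.2.2 (not_le.2 hs)) _)
      (fun s => Set.indicator_le_self _ _ _) x
    have e : ∀ t, (A ∩ Ioc (0:ℝ) n).indicator 1 t * ∫⁻ ω, S.count t x ω ∂P =
        (A ∩ Ioc (0:ℝ) n).indicator (fun t => ∫⁻ ω, S.count t x ω ∂P) t := by
      intro t
      by_cases ht : t ∈ A ∩ Ioc (0:ℝ) n <;> simp [ht]
    simp_rw [e] at h2
    have hsub : (A ∩ Ioc (0:ℝ) n) ∩ Ioi 0 = A ∩ Ioc (0:ℝ) n :=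
      Set.inter_eq_left.2 fun t ht => ht.2.1
    rw [lintegral_indicator hB, lintegral_indicator hB, Measure.restrict_restrict hB, hsub] at h2
    rw [Measure.restrict_restrict hA, h2]
    simp
  have h2 := ae_all_iff.2 fun n : ℕ => (ae_restrict_iff' measurableSet_Ioc).1 (h1 n)
  filter_upwards [h2] with t ht h0
  obtain ⟨n, hn⟩ := exists_nat_ge t
  exact ht n ⟨h0, hn⟩

open Classical in
-- Lifetimes are half-open on the right and paths are right-continuous, so a particle seen at x at
-- time t is still there shortly afterwards.
lemma eventually_alive_le (ω : Ω) (x : HierGroup M) (t : ℝ) (p : Particle M) :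
    ∀ᶠ r in 𝓝[>] t, (if S.Alive ω t p ∧ S.position ω t p = x then (1:ℝ≥0∞) else 0) ≤
      if S.Alive ω r p ∧ S.position ω r p = x then 1 else 0 := by
  by_cases h : S.Alive ω t p ∧ S.position ω t p = x
  · obtain ⟨⟨h1, h2, h3⟩, h4⟩ := h
    have e1 : ∀ᶠ r in 𝓝[>] t, r < S.birthTime ω p.1 p.2.1 p.2.2 + S.life p ω :=
      nhdsWithin_le_nhds (eventually_lt_nhds h3)
    have ht : Tendsto (fun r : ℝ => (r - S.birthTime ω p.1 p.2.1 p.2.2).toNNReal) (𝓝[>] t)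
        (𝓝[>] (t - S.birthTime ω p.1 p.2.1 p.2.2).toNNReal) := by
      refine tendsto_nhdsWithin_iff.2 ⟨?_, ?_⟩
      · exact tendsto_nhdsWithin_of_tendsto_nhds
          ((show Continuous fun r : ℝ => (r - S.birthTime ω p.1 p.2.1 p.2.2).toNNReal by fun_prop).tendsto t)
      · filter_upwards [self_mem_nhdsWithin] with r hr
        have hr' : t < r := hr
        exact (Real.toNNReal_lt_toNNReal_iff (by linarith)).2 (by linarith)
    filter_upwards [e1, ht.eventually ((S.walk_law p).right_cont ω _), self_mem_nhdsWithin]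
      with r r1 r2 r3
    have r3' : t < r := r3
    have : S.Alive ω r p ∧ S.position ω r p = x := by
      refine ⟨⟨h1, by linarith, r1⟩, ?_⟩
      rw [← h4, position, position, r2]
    rw [if_pos this]
    split_ifs <;> simp
  · simp [h]

lemma count_le_liminf (ω : Ω) (x : HierGroup M) {t : ℝ} {r : ℕ → ℝ} (hr : Tendsto r atTop (𝓝[>] t)) :
    S.count t x ω ≤ liminf (fun n => S.count (r n) x ω) atTop := by
  classical
  conv_lhs => rw [count, ENNReal.tsum_eq_iSup_sum]
  refine iSup_le fun A => ?_
  refine le_liminf_of_le (by isBoundedDefault) ?_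
  have h1 : ∀ᶠ s in 𝓝[>] t, ∀ p ∈ A, (if S.Alive ω t p ∧ S.position ω t p = x then (1:ℝ≥0∞) else 0) ≤
      if S.Alive ω s p ∧ S.position ω s p = x then 1 else 0 :=
    (Finset.eventually_all A).2 fun p _ => S.eventually_alive_le ω x t p
  filter_upwards [hr.eventually h1] with n hn
  exact (sum_le_sum hn).trans (sum_le_tsum A)

/-- Fatou's lemma along times decreasing to t, taken from the dense set where the mean is known. An
upper bound at every time suffices for integrability. -/
lemma lintegral_count_le (hM : 1 < M) (hc : 1 ≤ c) (hcM : c < M) (hV : 0 < V) (x : HierGroup M)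
    {t : ℝ} (ht : 0 ≤ t) : ∫⁻ ω, S.count t x ω ∂P ≤ lam := by
  have hd := Measure.dense_of_ae (S.ae_lintegral_count hM hc hcM hV x)
  have : ∀ n : ℕ, ∃ r, (0 < r → ∫⁻ ω, S.count r x ω ∂P = lam) ∧ t < r ∧ r < t + 1 / ((n : ℝ) + 1) := by
    intro n
    obtain ⟨r, h1, h2⟩ := hd.exists_between (show t < t + 1 / ((n : ℝ) + 1) by
      have : (0:ℝ) < 1 / ((n : ℝ) + 1) := by positivity
      linarith)
    exact ⟨r, h1, h2.1, h2.2⟩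
  choose r h1 h2 h3 using this
  have hr : Tendsto r atTop (𝓝[>] t) := by
    refine tendsto_nhdsWithin_iff.2 ⟨?_, Eventually.of_forall h2⟩
    refine tendsto_of_tendsto_of_tendsto_of_le_of_le tendsto_const_nhds ?_ (fun n => (h2 n).le)
      (fun n => (h3 n).le)
    simpa using tendsto_const_nhds.add (tendsto_one_div_add_atTop_nhds_zero_nat (𝕜 := ℝ))
  calc _ ≤ ∫⁻ ω, liminf (fun n => S.count (r n) x ω) atTop ∂P :=
        lintegral_mono fun ω => S.count_le_liminf ω x hr
    _ ≤ liminf (fun n => ∫⁻ ω, S.count (r n) x ω ∂P) atTop :=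
        lintegral_liminf_le fun n => S.measurable_count_right x (r n)
    _ = lam := by
        simp_rw [fun n => h1 n (ht.trans_lt (h2 n))]
        simp

lemma ae_N_ne_top (hM : 1 < M) (hc : 1 ≤ c) (hcM : c < M) (hV : 0 < V) {t : ℝ} (ht : 0 ≤ t) :
    ∀ᵐ ω ∂P, ∀ x, S.N t ω {x} ≠ ⊤ := by
  refine ae_all_iff.2 fun x => ?_
  have h1 := ae_lt_top (S.measurable_count_right x t)
    (ne_top_of_le_ne_top coe_ne_top (S.lintegral_count_le hM hc hcM hV x ht))
  filter_upwards [h1] with ω hω h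
  rw [S.count_eq, h] at hω
  simp at hω

lemma toReal_count (t : ℝ) (x : HierGroup M) (ω : Ω) :
    (S.count t x ω).toReal = ((S.N t ω {x}).toNat : ℝ) := by
  rw [S.count_eq]
  cases h : S.N t ω {x} <;> simp

lemma pairing_eq {φ : HierGroup M → ℝ} {B : Finset (HierGroup M)} (hB : ∀ x ∉ B, φ x = 0) (t : ℝ)
    (ω : Ω) : S.pairing φ t ω = ∑ x ∈ B, φ x * (S.count t x ω).toReal := by
  rw [pairing, tsum_eq_sum (s := B) fun x hx => by simp [hB x hx]]
  simp_rw [S.toReal_count]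

lemma integrable_count (hM : 1 < M) (hc : 1 ≤ c) (hcM : c < M) (hV : 0 < V) (x : HierGroup M)
    {t : ℝ} (ht : 0 ≤ t) : Integrable (fun ω => (S.count t x ω).toReal) P :=
  integrable_toReal_of_lintegral_ne_top (S.measurable_count_right x t).aemeasurable
    (ne_top_of_le_ne_top coe_ne_top (S.lintegral_count_le hM hc hcM hV x ht))

lemma integrable_pairing (hM : 1 < M) (hc : 1 ≤ c) (hcM : c < M) (hV : 0 < V) {φ : HierGroup M → ℝ}
    {B : Finset (HierGroup M)} (hB : ∀ x ∉ B, φ x = 0) {t : ℝ} (ht : 0 ≤ t) :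
    Integrable (S.pairing φ t) P := by
  have : S.pairing φ t = fun ω => ∑ x ∈ B, φ x * (S.count t x ω).toReal :=
    funext fun ω => S.pairing_eq hB t ω
  rw [this]
  exact integrable_finsetSum _ fun x _ => (S.integrable_count hM hc hcM hV x ht).const_mul _

lemma ae_integral_pairing (hM : 1 < M) (hc : 1 ≤ c) (hcM : c < M) (hV : 0 < V) {φ : HierGroup M → ℝ}
    {B : Finset (HierGroup M)} (hB : ∀ x ∉ B, φ x = 0) :
    ∀ᵐ t : ℝ, 0 < t → ∫ ω, S.pairing φ t ω ∂P = ∑ x ∈ B, φ x * lam := by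
  filter_upwards [ae_all_iff.2 fun x => S.ae_lintegral_count hM hc hcM hV x] with t ht h0
  simp_rw [S.pairing_eq hB]
  rw [integral_finsetSum _ fun x _ => (S.integrable_count hM hc hcM hV x h0.le).const_mul _]
  refine sum_congr rfl fun x _ => ?_
  rw [integral_const_mul, integral_toReal (S.measurable_count_right x t).aemeasurable
    (ae_lt_top (S.measurable_count_right x t) (by rw [ht x h0]; simp)), ht x h0]
  simp

/-- The occupation time of the site `x` up to time `u`. -/
def occTime (u : ℝ) (x : HierGroup M) (ω : Ω) : ℝ≥0∞ := ∫⁻ r in Ioc 0 u, S.count r x ω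

lemma ae_occTime_ne_top (hM : 1 < M) (hc : 1 ≤ c) (hcM : c < M) (hV : 0 < V) :
    ∀ᵐ ω ∂P, ∀ u x, S.occTime u x ω ≠ ⊤ := by
  have h1 : ∀ (x : HierGroup M) (n : ℕ), ∀ᵐ ω ∂P, S.occTime n x ω < ⊤ := by
    intro x n
    have hm : Measurable fun q : Ω × ℝ => S.count q.2 x q.1 :=
      (S.measurable_count x).comp measurable_swap
    refine ae_lt_top hm.lintegral_prod_right' ?_
    unfold occTime
    rw [lintegral_lintegral_swap (f := fun ω t => S.count t x ω) hm.aemeasurable]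
    refine ne_top_of_le_ne_top (b := ∫⁻ t in Ioc (0:ℝ) n, (lam : ℝ≥0∞)) ?_ ?_
    · rw [setLIntegral_const]
      exact mul_ne_top coe_ne_top (by simp)
    · exact setLIntegral_mono' measurableSet_Ioc fun t ht =>
        S.lintegral_count_le hM hc hcM hV x ht.1.le
  filter_upwards [ae_all_iff.2 fun x => ae_all_iff.2 (h1 x)] with ω hω u x
  obtain ⟨n, hn⟩ := exists_nat_ge u
  exact ne_top_of_le_ne_top (hω x n).ne (lintegral_mono_set (Set.Ioc_subset_Ioc_right hn))

lemma intervalIntegrable_count {ω : Ω} {x : HierGroup M} (h : ∀ u, S.occTime u x ω ≠ ⊤) {u : ℝ}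
    (hu : 0 ≤ u) : IntervalIntegrable (fun r => (S.count r x ω).toReal) volume 0 u :=
  (intervalIntegrable_iff_integrableOn_Ioc_of_le hu).2
    (integrable_toReal_of_lintegral_ne_top (S.measurable_count_left x ω).aemeasurable (h u))

lemma toReal_occTime {ω : Ω} {x : HierGroup M} (h : ∀ u, S.occTime u x ω ≠ ⊤) {u : ℝ}
    (hu : 0 ≤ u) : ∫ r in (0:ℝ)..u, (S.count r x ω).toReal = (S.occTime u x ω).toReal := by
  rw [intervalIntegral.integral_of_le hu, integral_toReal (S.measurable_count_left x ω).aemeasurable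
    (ae_lt_top (S.measurable_count_left x ω) (h u))]
  rfl

lemma intervalIntegrable_pairing (hM : 1 < M) (hc : 1 ≤ c) (hcM : c < M) (hV : 0 < V)
    {φ : HierGroup M → ℝ} {B : Finset (HierGroup M)} (hB : ∀ x ∉ B, φ x = 0) {ω : Ω}
    (h : ∀ u x, S.occTime u x ω ≠ ⊤) {t : ℝ} (ht : 0 ≤ t) :
    IntervalIntegrable (fun r => S.pairing φ r ω - ∫ ω', S.pairing φ r ω' ∂P) volume 0 t ∧
    ∫ r in (0:ℝ)..t, (S.pairing φ r ω - ∫ ω', S.pairing φ r ω' ∂P) =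
      ∑ x ∈ B, φ x * ((S.occTime t x ω).toReal - lam * t) := by
  have i1 : IntervalIntegrable (fun r => ∑ x ∈ B, φ x * (S.count r x ω).toReal) volume 0 t := by
    have := IntervalIntegrable.sum (μ := volume) (a := 0) (b := t) B
      (f := fun x r => φ x * (S.count r x ω).toReal)
      fun x _ => (S.intervalIntegrable_count (fun u => h u x) ht).const_mul (φ x)
    have e : (fun r => ∑ x ∈ B, φ x * (S.count r x ω).toReal) =
        ∑ x ∈ B, fun r => φ x * (S.count r x ω).toReal := by
      funext r; simp
    rwa [e]
  have i2 : IntervalIntegrable (fun _ : ℝ => ∑ x ∈ B, φ x * (lam : ℝ)) volume 0 t :=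
    intervalIntegrable_const
  -- The expected pairing is identified for almost every r only, which is enough inside the time
  -- integral.
  have hae : ∀ᵐ r : ℝ, r ∈ Set.uIoc 0 t → (∑ x ∈ B, φ x * (S.count r x ω).toReal - ∑ x ∈ B, φ x * (lam : ℝ)) =
      S.pairing φ r ω - ∫ ω', S.pairing φ r ω' ∂P := by
    filter_upwards [S.ae_integral_pairing hM hc hcM hV hB] with r hr hr'
    rw [Set.uIoc_of_le ht] at hr'
    rw [hr hr'.1, S.pairing_eq hB]
  have hae' : (fun r => ∑ x ∈ B, φ x * (S.count r x ω).toReal - ∑ x ∈ B, φ x * (lam : ℝ))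
      =ᵐ[volume.restrict (Set.uIoc 0 t)] fun r => S.pairing φ r ω - ∫ ω', S.pairing φ r ω' ∂P :=
    (ae_restrict_iff' measurableSet_uIoc).2 hae
  refine ⟨(i1.sub i2).congr_ae hae', ?_⟩
  rw [← intervalIntegral.integral_congr_ae hae, intervalIntegral.integral_sub i1 i2,
    intervalIntegral.integral_finsetSum fun x _ =>
      (S.intervalIntegrable_count (fun u => h u x) ht).const_mul (φ x)]
  simp_rw [intervalIntegral.integral_const_mul, S.toReal_occTime (fun u => h u _) ht, mul_sub,
    sum_sub_distrib]
  simp only [intervalIntegral.integral_const, sub_zero, smul_eq_mul, mul_sum]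
  congr 1
  exact sum_congr rfl fun x _ => by ring

lemma fluctuation_eq (hM : 1 < M) (hc : 1 ≤ c) (hcM : c < M) (hV : 0 < V)
    {φ : HierGroup M → ℝ} {B : Finset (HierGroup M)} (hB : ∀ x ∉ B, φ x = 0) {ω : Ω}
    (h : ∀ u x, S.occTime u x ω ≠ ⊤) (F : ℝ) {T t : ℝ} (hT : 0 ≤ T) (ht : 0 ≤ t) :
    S.fluctuation F T φ t ω = ∑ x ∈ B, (φ x / F) * ((S.occTime (T * t) x ω).toReal - lam * (T * t)) := by
  rw [fluctuation, (S.intervalIntegrable_pairing hM hc hcM hV hB h (mul_nonneg hT ht)).2, mul_sum]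
  exact sum_congr rfl fun x _ => by ring

lemma continuous_occTime {ω : Ω} {x : HierGroup M} (h : ∀ u, S.occTime u x ω ≠ ⊤) :
    ContinuousOn (fun u => (S.occTime u x ω).toReal) (Ici 0) := by
  intro u hu
  have hu' : (0:ℝ) ≤ u := hu
  have h1 : ContinuousOn (fun v => ∫ r in (0:ℝ)..v, (S.count r x ω).toReal) (Set.uIcc 0 (u + 1)) :=
    intervalIntegral.continuousOn_primitive_interval
      ((intervalIntegrable_iff' (by simp)).1 (S.intervalIntegrable_count h (by linarith)))
  rw [Set.uIcc_of_le (by linarith)] at h1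
  have h2 : ContinuousOn (fun u => (S.occTime u x ω).toReal) (Icc 0 (u + 1)) :=
    h1.congr fun v hv => (S.toReal_occTime h hv.1).symm
  refine (h2 u ⟨hu', by linarith⟩).mono_of_mem_nhdsWithin ?_
  have : Icc 0 (u + 1) = Ici 0 ∩ Iic (u + 1) := Set.Ici_inter_Iic.symm
  rw [this]
  exact inter_mem self_mem_nhdsWithin (nhdsWithin_le_nhds (Iic_mem_nhds (by linarith)))

lemma measurable_occTime (u : ℝ) (x : HierGroup M) : Measurable (S.occTime u x) := by
  have hm : Measurable fun q : Ω × ℝ => S.count q.2 x q.1 :=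
    (S.measurable_count x).comp measurable_swap
  exact hm.lintegral_prod_right'

end PoissonBranchingSystem

/-! ### The covariance form and admissible test functions -/

section Bilinear

variable {H : Type*} [AddCommGroup H] [Countable H] {k : ℝ → H → ℝ≥0∞} {f g : ℝ → ℝ≥0∞}

lemma avg_siteFn (r : ℝ) (x : H) (s : ℝ) (y : H) :
    avg k r (siteFn f x s) y = k r (x - y) * f s := by
  rw [avg, tsum_eq_single (x - y)]
  · simp [siteFn]
  · intro z hz
    have : y + z ≠ x := fun h => hz (eq_sub_of_add_eq' h)
    simp [siteFn, this]

lemma pot_siteFn (x : H) (s : ℝ) (y : H) :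
    pot k (siteFn f x) s y = ∫⁻ r in Ioi (0:ℝ), k r (x - y) * f (s + r) := by
  unfold pot resW
  simp_rw [one_mul]
  exact lintegral_congr fun r => avg_siteFn r x (s + r) y

/-- A test function bounded by 1 and the maximum of the kernel at the origin leave the tail of the
Green function from time v on. -/
lemma avg_pot_siteFn_le (hk : SymmSemigroup k) (hf : Measurable f) (hf1 : ∀ s, f s ≤ 1) (x : H)
    {v : ℝ} (hv : 0 ≤ v) (s : ℝ) (y : H) :
    avg k v (pot k (siteFn f x) s) y ≤ ∫⁻ r in Ioi (0:ℝ), k (v + r) 0 := by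
  rw [pot, avg_resW hk measurable_const (measurable_siteFn hf x) hv]
  refine setLIntegral_mono' measurableSet_Ioi fun r hr => ?_
  have hr' : (0:ℝ) < r := hr
  rw [avg_siteFn, one_mul]
  calc _ ≤ k (v + r) 0 * 1 := mul_le_mul' (hk.le_zero _ (by linarith) _) (hf1 _)
    _ = _ := mul_one _

/-- Symmetry turns the sum over the starting point of two kernels into a convolution, so
Chapman–Kolmogorov gives a kernel at the total time. -/
lemma tsum_mul_shift (hk : SymmSemigroup k) {r r' : ℝ} (hr : 0 ≤ r) (hr' : 0 ≤ r') (x x' : H) :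
    ∑' y, k r (x - y) * k r' (x' - y) = k (r + r') (x - x') := by
  rw [← hk.conv r r' hr hr', ← (Equiv.subLeft x).tsum_eq]
  refine tsum_congr fun y => ?_
  rw [Equiv.subLeft_apply, sub_sub_cancel, ← hk.neg r' (x - x' - y)]
  congr 2
  abel

/-- The bilinear form `∫ ∑ G(f 1_x) G(g 1_{x'})` as a function of `z = x - x'`. -/
def bil (k : ℝ → H → ℝ≥0∞) (f g : ℝ → ℝ≥0∞) (z : H) : ℝ≥0∞ :=
  ∫⁻ s in Ioi (0:ℝ), ∫⁻ r in Ioi (0:ℝ), ∫⁻ r' in Ioi (0:ℝ), k (r + r') z * (f (s + r) * g (s + r'))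

lemma tsum_pot_mul_pot (hk : SymmSemigroup k) (hf : Measurable f) (hg : Measurable g) (x x' : H)
    (s : ℝ) : ∑' y, pot k (siteFn f x) s y * pot k (siteFn g x') s y =
      ∫⁻ r in Ioi (0:ℝ), ∫⁻ r' in Ioi (0:ℝ), k (r + r') (x - x') * (f (s + r) * g (s + r')) := by
  have m1 : ∀ (h : ℝ → ℝ≥0∞), Measurable h → ∀ z, Measurable fun r => k r z * h (s + r) := fun h hh z =>
    (hk.measurable z).mul (hh.comp (measurable_const_add s))
  have e1 : ∀ y, pot k (siteFn f x) s y * pot k (siteFn g x') s y =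
      ∫⁻ r in Ioi (0:ℝ), ∫⁻ r' in Ioi (0:ℝ),
        (k r (x - y) * f (s + r)) * (k r' (x' - y) * g (s + r')) := by
    intro y
    rw [pot_siteFn, pot_siteFn, ← lintegral_mul_const _ (m1 f hf _)]
    refine lintegral_congr fun r => ?_
    rw [lintegral_const_mul _ (m1 g hg _)]
  have m2 : ∀ y, Measurable fun q : ℝ × ℝ =>
      (k q.1 (x - y) * f (s + q.1)) * (k q.2 (x' - y) * g (s + q.2)) := fun y =>
    ((m1 f hf _).comp measurable_fst).mul ((m1 g hg _).comp measurable_snd)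
  simp_rw [e1]
  rw [← lintegral_tsum fun y => (Measurable.lintegral_prod_right' (m2 y)).aemeasurable]
  refine setLIntegral_congr_fun measurableSet_Ioi fun r hr => ?_
  dsimp only
  rw [← lintegral_tsum (f := fun y r' => (k r (x - y) * f (s + r)) * (k r' (x' - y) * g (s + r')))
    fun y => ((m2 y).comp measurable_prodMk_left).aemeasurable]
  refine setLIntegral_congr_fun measurableSet_Ioi fun r' hr' => ?_
  rw [← tsum_mul_shift hk (le_of_lt hr) (le_of_lt hr'), ← ENNReal.tsum_mul_right]
  exact tsum_congr fun y => by ring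

/-- A finite combination of functions `f(s) 1[y = x]`. -/
def comb {ι : Type*} (W : Finset ι) (A : ι → ℝ≥0∞) (f : ι → ℝ → ℝ≥0∞) (x : ι → H) (s : ℝ) (y : H) :
    ℝ≥0∞ := ∑ i ∈ W, A i * siteFn (f i) (x i) s y

variable {ι : Type*} {W : Finset ι} {A : ι → ℝ≥0∞} {F : ι → ℝ → ℝ≥0∞} {x : ι → H}

lemma measurable_comb (hF : ∀ i, Measurable (F i)) (y : H) : Measurable fun s => comb W A F x s y :=
  Finset.measurable_fun_sum _ fun i _ => (measurable_siteFn (hF i) (x i) y).const_mul _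

lemma pot_comb (hk : SymmSemigroup k) (hF : ∀ i, Measurable (F i)) (s : ℝ) (y : H) :
    pot k (comb W A F x) s y = ∑ i ∈ W, A i * pot k (siteFn (F i) (x i)) s y := by
  classical
  induction W using induction_on generalizing s y with
  | empty =>
    have : comb ∅ A F x = fun _ _ => 0 := by funext s y; simp [comb]
    simp [this, pot, resW, avg]
  | insert i W hi ih =>
    have : comb (insert i W) A F x = fun s y => A i * siteFn (F i) (x i) s y + comb W A F x s y := by
      funext s y; simp [comb, sum_insert hi]
    rw [this, sum_insert hi, ← ih, pot, resW_add hk measurable_const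
      (fun y => (measurable_siteFn (hF i) (x i) y).const_mul _),
      resW_const_mul hk measurable_const (measurable_siteFn (hF i) (x i))]
    rfl

lemma qform_comb (hk : SymmSemigroup k) (hF : ∀ i, Measurable (F i)) (V : ℝ) :
    qform k V (comb W A F x) =
      ofReal V * ∑ i ∈ W, ∑ j ∈ W, A i * A j * bil k (F i) (F j) (x i - x j) := by
  unfold qform
  congr 1
  have mp : ∀ i y, Measurable fun s => pot k (siteFn (F i) (x i)) s y := fun i =>
    measurable_pot hk (measurable_siteFn (hF i) (x i))
  have mt : ∀ i j, Measurable fun s => ∑' y, pot k (siteFn (F i) (x i)) s y *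
      pot k (siteFn (F j) (x j)) s y := fun i j =>
    Measurable.tsum fun y => (mp i y).mul (mp j y)
  have e1 : ∀ s, ∑' y, pot k (comb W A F x) s y ^ 2 = ∑ i ∈ W, ∑ j ∈ W, A i * A j *
      ∑' y, pot k (siteFn (F i) (x i)) s y * pot k (siteFn (F j) (x j)) s y := by
    intro s
    simp_rw [pot_comb hk hF, sq, sum_mul_sum, ← ENNReal.tsum_mul_left]
    rw [Summable.tsum_finsetSum fun _ _ => summable]
    refine sum_congr rfl fun i _ => ?_
    rw [Summable.tsum_finsetSum fun _ _ => summable]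
    exact sum_congr rfl fun j _ => tsum_congr fun y => by ring
  simp_rw [e1]
  rw [lintegral_finsetSum _ fun i _ => Finset.measurable_fun_sum _ fun j _ => (mt i j).const_mul _]
  refine sum_congr rfl fun i _ => ?_
  rw [lintegral_finsetSum _ fun j _ => (mt i j).const_mul _]
  refine sum_congr rfl fun j _ => ?_
  rw [lintegral_const_mul _ (mt i j)]
  congr 1
  unfold bil
  exact lintegral_congr fun s => tsum_pot_mul_pot hk (hF i) (hF j) (x i) (x j) s

lemma mass_comb (hF : ∀ i, Measurable (F i)) :
    mass (comb W A F x) = ∑ i ∈ W, A i * ∫⁻ s in Ioi (0:ℝ), F i s := by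
  unfold mass
  have e : ∀ s, ∑' y, comb W A F x s y = ∑ i ∈ W, A i * F i s := by
    intro s
    unfold comb
    rw [Summable.tsum_finsetSum fun _ _ => summable]
    refine sum_congr rfl fun i _ => ?_
    rw [ENNReal.tsum_mul_left]
    congr 1
    simpa using tsum_siteFn_mul (F i) (x i) s fun _ => 1
  simp_rw [e]
  rw [lintegral_finsetSum _ fun i _ => (hF i).const_mul _]
  exact sum_congr rfl fun i _ => lintegral_const_mul _ (hF i)

/-- The Green function at the origin. -/
def green (k : ℝ → H → ℝ≥0∞) : ℝ≥0∞ := ∫⁻ r in Ioi (0:ℝ), k r 0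

/-- The indicator function of `(u, v]`. -/
def box (u v : ℝ) : ℝ → ℝ≥0∞ := (Ioc u v).indicator 1

lemma measurable_box (u v : ℝ) : Measurable (box u v) := measurable_one.indicator measurableSet_Ioc

lemma box_le_one (u v s : ℝ) : box u v s ≤ 1 := Set.indicator_le_self _ _ _

lemma box_eq_zero {u v s : ℝ} (h : v < s) : box u v s = 0 :=
  Set.indicator_of_notMem (fun hs => absurd hs.2 (not_le.2 h)) _

lemma lintegral_box_add_le (u v s : ℝ) : ∫⁻ r in Ioi (0:ℝ), box u v (s + r) ≤ ofReal (v - u) := by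
  rw [lintegral_Ioi_shift (box u v) s]
  refine (setLIntegral_le_lintegral _ _).trans ?_
  rw [box, lintegral_indicator measurableSet_Ioc]
  simp

lemma lintegral_box {u v : ℝ} (hu : 0 ≤ u) : ∫⁻ s in Ioi (0:ℝ), box u v s = ofReal (v - u) := by
  rw [box, lintegral_indicator measurableSet_Ioc, Measure.restrict_restrict measurableSet_Ioc]
  have : Ioc u v ∩ Ioi 0 = Ioc u v := Set.inter_eq_left.2 fun t ht => lt_of_le_of_lt hu ht.1
  rw [this]; simp

/-- Combines the bound by the interval length with a uniform bound. The factor min(1, w) for short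
intervals is what later gives an exponent above 1 in the increment estimate. -/
lemma min_le_min_mul {w L : ℝ≥0∞} {y : ℝ≥0∞} (h1 : y ≤ w) (h2 : y ≤ L) : y ≤ min 1 w * (1 + L) := by
  rcases le_total w 1 with h | h
  · rw [min_eq_right h]
    exact h1.trans (le_mul_of_one_le_right zero_le le_self_add)
  · rw [min_eq_left h, one_mul]
    exact h2.trans le_add_self

/-- Combinations of indicators of intervals of length at most `w` are admissible test functions. -/
lemma isOccTest_comb (hk : SymmSemigroup k) (hgreen : green k ≠ ⊤) (hA : ∀ i, A i ≠ ⊤) {u v : ι → ℝ}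
    {T w : ℝ} (hT : ∀ i, v i ≤ T) (hw : ∀ i, v i - u i ≤ w) :
    IsOccTest k (comb W A (fun i => box (u i) (v i)) x) T
      ((∑ i ∈ W, A i) * (min 1 (ofReal w) * (1 + green k))) where
  meas y := measurable_comb (fun i => measurable_box _ _) y
  zero s y hs := Finset.sum_eq_zero fun i _ => by
    simp [siteFn, box_eq_zero ((hT i).trans_lt hs)]
  ne_top := by
    refine mul_ne_top (sum_ne_top.2 fun i _ => hA i) (mul_ne_top ?_ ?_)
    · exact ne_top_of_le_ne_top one_ne_top (min_le_left _ _)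
    · exact add_ne_top.2 ⟨one_ne_top, hgreen⟩
  bdd := by
    refine ⟨∑ i ∈ W, A i, sum_ne_top.2 fun i _ => hA i, fun s y => ?_⟩
    refine sum_le_sum fun i _ => ?_
    refine mul_le_of_le_one_right zero_le ?_
    unfold siteFn
    split_ifs
    · exact box_le_one _ _ _
    · simp
  occ_le l s f := by
    have h1 : ∫⁻ r in Ioi (0:ℝ), (if r < l then comb W A (fun i => box (u i) (v i)) x (s + r) (f r) else 0) ≤
        ∫⁻ r in Ioi (0:ℝ), ∑ i ∈ W, A i * ((Iio l).indicator 1 r * box (u i) (v i) (s + r)) := by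
      refine lintegral_mono fun r => ?_
      split_ifs with h
      · unfold comb
        refine sum_le_sum fun i _ => mul_le_mul' le_rfl ?_
        rw [indicator_of_mem (Set.mem_Iio.2 h), Pi.one_apply, one_mul, siteFn]
        split_ifs <;> simp
      · simp
    have mb : ∀ i, Measurable fun r => (Iio l).indicator 1 r * box (u i) (v i) (s + r) := fun i =>
      (measurable_one.indicator measurableSet_Iio).mul
        ((measurable_box _ _).comp (measurable_const_add s))
    refine h1.trans ?_
    rw [lintegral_finsetSum _ fun i _ => (mb i).const_mul _, sum_mul, sum_mul]
    refine sum_le_sum fun i _ => ?_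
    rw [lintegral_const_mul _ (mb i), mul_assoc]
    refine mul_le_mul' le_rfl ?_
    have b1 : ∫⁻ r in Ioi (0:ℝ), (Iio l).indicator 1 r * box (u i) (v i) (s + r) ≤ ofReal w := by
      refine le_trans (lintegral_mono fun r => ?_) ((lintegral_box_add_le (u i) (v i) s).trans
        (ofReal_le_ofReal (hw i)))
      exact mul_le_of_le_one_left zero_le (Set.indicator_le_self _ _ _)
    have b2 : ∫⁻ r in Ioi (0:ℝ), (Iio l).indicator 1 r * box (u i) (v i) (s + r) ≤ ofReal l := by
      refine le_trans (lintegral_mono fun r => mul_le_of_le_one_right zero_le (box_le_one _ _ _)) ?_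
      rw [lintegral_indicator measurableSet_Iio, Measure.restrict_restrict measurableSet_Iio,
        inter_comm, Set.Ioi_inter_Iio]
      simp
    rcases le_total 0 l with hl | hl
    · refine (min_le_min_mul b1 b2).trans ?_
      rw [ofReal_add zero_le_one hl, ofReal_one, mul_assoc]
      refine mul_le_mul' le_rfl ?_
      exact le_mul_of_one_le_left zero_le le_self_add
    · exact (b2.trans_eq (ofReal_of_nonpos hl)).trans zero_le
  pot_le s y := by
    rw [pot_comb hk fun i => measurable_box _ _, sum_mul]
    refine sum_le_sum fun i _ => mul_le_mul' le_rfl ?_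
    rw [pot_siteFn]
    refine min_le_min_mul ?_ ?_
    · refine le_trans (setLIntegral_mono' measurableSet_Ioi fun r hr => ?_)
        ((lintegral_box_add_le (u i) (v i) s).trans (ofReal_le_ofReal (hw i)))
      refine mul_le_of_le_one_left zero_le ?_
      rw [← hk.tsum_eq_one r (le_of_lt hr)]
      exact ENNReal.le_tsum _
    · refine setLIntegral_mono' measurableSet_Ioi fun r hr => ?_
      exact (mul_le_of_le_one_right zero_le (box_le_one _ _ _)).trans (hk.le_zero r (le_of_lt hr) _)

end Bilinear

/-! ### Signed combinations of occupation times -/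

namespace PoissonBranchingSystem

variable {M : ℕ} {c V : ℝ} {lam : ℝ≥0} {Ω : Type*} [mΩ : MeasurableSpace Ω] {P : Measure Ω}
  [IsProbabilityMeasure P] (S : PoissonBranchingSystem M c V lam P) [NeZero M]

lemma total_comb {ι : Type*} {W : Finset ι} {A : ι → ℝ≥0∞} {u v : ι → ℝ} (hu : ∀ i, 0 ≤ u i)
    {x : ι → HierGroup M} {ω : Ω} (h : ∀ p, 0 ≤ S.life p ω) :
    S.total (comb W A (fun i => box (u i) (v i)) x) ω =
      ∑ i ∈ W, A i * ∫⁻ r in Ioc (u i) (v i), S.count r (x i) ω := by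
  rw [S.total_eq_lintegral (fun y => measurable_comb (fun i => measurable_box _ _) y) h]
  have e : ∀ t, ∑' z, comb W A (fun i => box (u i) (v i)) x t z * S.count t z ω =
      ∑ i ∈ W, A i * (Ioc (u i) (v i)).indicator (fun r => S.count r (x i) ω) t := by
    intro t
    unfold comb
    simp_rw [sum_mul]
    rw [Summable.tsum_finsetSum fun _ _ => summable]
    refine sum_congr rfl fun i _ => ?_
    simp_rw [mul_assoc]
    rw [ENNReal.tsum_mul_left, tsum_siteFn_mul]
    by_cases ht : t ∈ Ioc (u i) (v i) <;> simp [box, ht]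
  have m : ∀ i, Measurable ((Ioc (u i) (v i)).indicator fun r => S.count r (x i) ω) := fun i =>
    (S.measurable_count_left (x i) ω).indicator measurableSet_Ioc
  simp_rw [e]
  rw [lintegral_finsetSum _ fun i _ => (m i).const_mul _]
  refine sum_congr rfl fun i _ => ?_
  rw [lintegral_const_mul _ (m i), lintegral_indicator measurableSet_Ioc,
    Measure.restrict_restrict measurableSet_Ioc]
  have : Ioc (u i) (v i) ∩ Ioi 0 = Ioc (u i) (v i) :=
    Set.inter_eq_left.2 fun t ht => lt_of_le_of_lt (hu i) ht.1
  rw [this]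

lemma toReal_lintegral_count {ω : Ω} {x : HierGroup M} (h : ∀ u, S.occTime u x ω ≠ ⊤) {u v : ℝ}
    (hu : 0 ≤ u) (huv : u ≤ v) : (∫⁻ r in Ioc u v, S.count r x ω).toReal =
      (S.occTime v x ω).toReal - (S.occTime u x ω).toReal := by
  have e : S.occTime v x ω = S.occTime u x ω + ∫⁻ r in Ioc u v, S.count r x ω := by
    rw [occTime, occTime, ← Set.Ioc_union_Ioc_eq_Ioc hu huv,
      lintegral_union measurableSet_Ioc (Set.Ioc_disjoint_Ioc_of_le le_rfl)]
  have h1 := h v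
  rw [e] at h1 ⊢
  rw [toReal_add (h u) (ne_top_of_le_ne_top h1 le_add_self)]
  ring

/-- The positive part of the combination with real coefficients `C`. -/
def posComb {ι : Type*} (W : Finset ι) (C : ι → ℝ) (u v : ι → ℝ) (x : ι → HierGroup M) :
    ℝ → HierGroup M → ℝ≥0∞ :=
  comb W (fun i => ofReal (C i)) (fun i => box (u i) (v i)) x

lemma posComb_add {ι : Type*} (W : Finset ι) (C : ι → ℝ) (u v : ι → ℝ) (x : ι → HierGroup M) :
    (fun s y => posComb W C u v x s y + posComb W (fun i => -C i) u v x s y) =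
      posComb W (fun i => |C i|) u v x := by
  funext s y
  simp only [posComb, comb]
  rw [← sum_add_distrib]
  refine sum_congr rfl fun i _ => ?_
  rw [← add_mul]
  congr 1
  rcases le_total 0 (C i) with h | h
  · rw [abs_of_nonneg h, ofReal_of_nonpos (neg_nonpos.2 h), add_zero]
  · rw [abs_of_nonpos h, ofReal_of_nonpos h, zero_add]

/-- Signed combinations of centered occupation times are centered occupations. -/
lemma centered_posComb {ι : Type*} (W : Finset ι) (C : ι → ℝ) {u v : ι → ℝ} (hu : ∀ i, 0 ≤ u i)
    (huv : ∀ i, u i ≤ v i) (x : ι → HierGroup M) {ω : Ω} (h : ∀ p, 0 ≤ S.life p ω)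
    (ho : ∀ u x, S.occTime u x ω ≠ ⊤) :
    S.centered (posComb W C u v x) (posComb W (fun i => -C i) u v x) ω =
      ∑ i ∈ W, C i * ((S.occTime (v i) (x i) ω).toReal - (S.occTime (u i) (x i) ω).toReal -
        lam * (v i - u i)) := by
  have e1 : ∀ C : ι → ℝ, (S.total (posComb W C u v x) ω).toReal =
      ∑ i ∈ W, max (C i) 0 * ((S.occTime (v i) (x i) ω).toReal - (S.occTime (u i) (x i) ω).toReal) := by
    intro C
    rw [posComb, S.total_comb hu h, toReal_sum]
    · refine sum_congr rfl fun i _ => ?_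
      rw [toReal_mul, S.toReal_lintegral_count (fun u => ho u _) (hu i) (huv i), toReal_ofReal']
    · intro i _
      exact mul_ne_top ofReal_ne_top (ne_top_of_le_ne_top (ho (v i) (x i))
        (lintegral_mono_set (Set.Ioc_subset_Ioc_left (hu i))))
  have e2 : ∀ C : ι → ℝ, (mass (posComb W C u v x)).toReal = ∑ i ∈ W, max (C i) 0 * (v i - u i) := by
    intro C
    rw [posComb, mass_comb fun i => measurable_box _ _, toReal_sum]
    · refine sum_congr rfl fun i _ => ?_
      rw [toReal_mul, lintegral_box (hu i), toReal_ofReal (sub_nonneg.2 (huv i)), toReal_ofReal']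
    · intro i _
      rw [lintegral_box (hu i)]
      exact mul_ne_top ofReal_ne_top ofReal_ne_top
  rw [centered, e1, e1, e2, e2, ← sum_sub_distrib, ← sum_sub_distrib, mul_sum, ← sum_sub_distrib]
  refine sum_congr rfl fun i _ => ?_
  have : max (C i) 0 - max (-C i) 0 = C i := by
    rcases le_total 0 (C i) with h | h
    · rw [max_eq_left h, max_eq_right (neg_nonpos.2 h), sub_zero]
    · rw [max_eq_right h, max_eq_left (neg_nonneg.2 h)]; ring
  calc _ = (max (C i) 0 - max (-C i) 0) * ((S.occTime (v i) (x i) ω).toReal -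
        (S.occTime (u i) (x i) ω).toReal - lam * (v i - u i)) := by ring
    _ = _ := by rw [this]

/-- The variance form of a signed combination. -/
lemma qform_posComb (hk : SymmSemigroup (tkernel M c)) {ι : Type*} (W : Finset ι) (C : ι → ℝ) (u v : ι → ℝ)
    (x : ι → HierGroup M) (V : ℝ) (hV : 0 ≤ V)
    (hfin : ∀ i j, bil (tkernel M c) (box (u i) (v i)) (box (u j) (v j)) (x i - x j) ≠ ⊤) :
    2 * (qform (tkernel M c) V (posComb W C u v x)).toReal +
      2 * (qform (tkernel M c) V (posComb W (fun i => -C i) u v x)).toReal -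
      (qform (tkernel M c) V (posComb W (fun i => |C i|) u v x)).toReal =
    V * ∑ i ∈ W, ∑ j ∈ W, C i * C j *
      (bil (tkernel M c) (box (u i) (v i)) (box (u j) (v j)) (x i - x j)).toReal := by
  have e1 : ∀ C : ι → ℝ, (qform (tkernel M c) V (posComb W C u v x)).toReal =
      V * ∑ i ∈ W, ∑ j ∈ W, max (C i) 0 * max (C j) 0 *
      (bil (tkernel M c) (box (u i) (v i)) (box (u j) (v j)) (x i - x j)).toReal := by
    intro C
    rw [posComb, qform_comb hk fun i => measurable_box _ _, toReal_mul,
      toReal_ofReal hV, toReal_sum]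
    · congr 1
      refine sum_congr rfl fun i _ => ?_
      rw [toReal_sum]
      · refine sum_congr rfl fun j _ => ?_
        rw [toReal_mul, toReal_mul, toReal_ofReal', toReal_ofReal']
      · exact fun j _ => mul_ne_top (mul_ne_top ofReal_ne_top
          ofReal_ne_top) (hfin i j)
    · exact fun i _ => sum_ne_top.2 fun j _ => mul_ne_top
        (mul_ne_top ofReal_ne_top ofReal_ne_top) (hfin i j)
  rw [e1, e1, e1, mul_left_comm, mul_left_comm 2 V, ← mul_add, ← mul_sub, mul_sum,
    mul_sum, ← sum_add_distrib, ← sum_sub_distrib]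
  congr 1
  refine sum_congr rfl fun i _ => ?_
  rw [mul_sum, mul_sum, ← sum_add_distrib, ← sum_sub_distrib]
  refine sum_congr rfl fun j _ => ?_
  -- With C = p - n and |C| = p + n, the polarization is 2pp' + 2nn' - (p + n)(p' + n') = (p - n)(p'
  -- - n').
  have h1 : ∀ r : ℝ, r = max r 0 - max (-r) 0 ∧ max |r| 0 = max r 0 + max (-r) 0 := by
    intro r
    rcases le_total 0 r with h | h
    · simp [abs_of_nonneg h, max_eq_left h, max_eq_right (neg_nonpos.2 h)]
    · simp [abs_of_nonpos h, max_eq_right h, max_eq_left (neg_nonneg.2 h)]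
  rw [(h1 (C i)).2, (h1 (C j)).2]
  conv_rhs => rw [(h1 (C i)).1, (h1 (C j)).1]
  ring

end PoissonBranchingSystem

/-! ### Relations between a, b, c, M and γ -/

section Parameters

variable {M : ℕ} {c : ℝ}

lemma lt_of_lt_sqrt (hM : 1 < M) (hcM : c < sqrt M) : c < M := by
  refine hcM.trans_le ?_
  have : (1:ℝ) ≤ M := by exact_mod_cast hM.le
  exact (Real.sqrt_le_left (by linarith)).2 (by nlinarith)

lemma sq_lt_of_lt_sqrt (hc : 1 < c) (hcM : c < sqrt M) : c ^ 2 < M := by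
  have := (Real.lt_sqrt (by linarith)).1 hcM
  exact this

/-- M a² = c²/M. Its n-th power is T_n/F², the order of the normalized single-particle and
off-diagonal errors. -/
lemma mul_aConst_sq_lt_one (hM : 1 < M) (hc : 1 < c) (hcM : c < sqrt M) :
    M * aConst M c ^ 2 < 1 := by
  have hM0 : (0:ℝ) < M := by exact_mod_cast (by omega : 0 < M)
  rw [aConst, div_pow, sq (M:ℝ), ← mul_div_assoc, mul_div_mul_left _ _ hM0.ne', div_lt_one hM0]
  exact sq_lt_of_lt_sqrt hc hcM

lemma log_div_pos (hM : 1 < M) (hc : 1 < c) (hcM : c < sqrt M) : 0 < log (M / c) :=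
  Real.log_pos ((one_lt_div (by linarith)).2 (lt_of_lt_sqrt hM hcM))

lemma degree_pos (hM : 1 < M) (hc : 1 < c) (hcM : c < sqrt M) : 0 < degree M c :=
  div_pos (Real.log_pos hc) (log_div_pos hM hc hcM)

lemma degree_lt_one (hM : 1 < M) (hc : 1 < c) (hcM : c < sqrt M) : degree M c < 1 := by
  rw [degree, div_lt_one (log_div_pos hM hc hcM)]
  refine Real.log_lt_log (by linarith) ?_
  rw [lt_div_iff₀ (by linarith), ← sq]
  exact sq_lt_of_lt_sqrt hc hcM

/-- This identity is the meaning of γ: it converts volume growth M^j into powers of the relaxation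
rates. -/
lemma aConst_rpow (hM : 1 < M) (hc : 1 < c) (hcM : c < sqrt M) :
    aConst M c ^ (1 + degree M c) = (M:ℝ)⁻¹ := by
  have hM0 : (0:ℝ) < M := by exact_mod_cast (by omega : 0 < M)
  have hc0 : 0 < c := by linarith
  have hL := log_div_pos hM hc hcM
  have ha : 0 < aConst M c := by rw [aConst]; positivity
  have e : log (aConst M c) = -log (M / c) := by
    rw [← Real.log_inv, inv_div, aConst]
  rw [Real.rpow_def_of_pos ha, e, degree]
  have : -log (M / c) * (1 + log c / log (M / c)) = -log M := by
    field_simp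
    rw [Real.log_div hM0.ne' hc0.ne']; ring
  rw [this, Real.exp_neg, Real.exp_log hM0]

end Parameters

/-! ### The form of a single exponential relaxation rate -/

section Decay

/-- `∫ e^{-β r} f(s + r) dr`. -/
def expPot (β : ℝ) (f : ℝ → ℝ≥0∞) (s : ℝ) : ℝ≥0∞ := ∫⁻ r in Ioi (0:ℝ), expW β r * f (s + r)

/-- The bilinear form of the exponential kernel. -/
def decay (β : ℝ) (f g : ℝ → ℝ≥0∞) : ℝ≥0∞ := ∫⁻ s in Ioi (0:ℝ), expPot β f s * expPot β g s

lemma measurable_expPot (β : ℝ) {f : ℝ → ℝ≥0∞} (hf : Measurable f) : Measurable (expPot β f) := by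
  have : Measurable fun q : ℝ × ℝ => expW β q.2 * f (q.1 + q.2) :=
    ((measurable_expW β).comp measurable_snd).mul (hf.comp (measurable_fst.add measurable_snd))
  exact this.lintegral_prod_right'

lemma expPot_mono (β : ℝ) {f g : ℝ → ℝ≥0∞} (h : ∀ s, f s ≤ g s) (s : ℝ) : expPot β f s ≤ expPot β g s :=
  lintegral_mono fun _ => mul_le_mul' le_rfl (h _)

lemma decay_mono (β : ℝ) {f g f' g' : ℝ → ℝ≥0∞} (hf : ∀ s, f s ≤ f' s) (hg : ∀ s, g s ≤ g' s) :
    decay β f g ≤ decay β f' g' :=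
  lintegral_mono fun s => mul_le_mul' (expPot_mono β hf s) (expPot_mono β hg s)

lemma decay_comm (β : ℝ) (f g : ℝ → ℝ≥0∞) : decay β f g = decay β g f :=
  lintegral_congr fun _ => mul_comm _ _

lemma lintegral_expW_Ioc {β : ℝ} (hβ : 0 < β) {p q : ℝ} (hpq : p ≤ q) :
    ∫⁻ r in Ioc p q, expW β r = ofReal ((rexp (-(β * p)) - rexp (-(β * q))) / β) := by
  unfold expW
  have hc : Continuous fun r => rexp (-(β * r)) := by fun_prop
  rw [← ofReal_integral_eq_lintegral_ofReal
    ((hc.integrableOn_Icc (a := p) (b := q)).mono_set Set.Ioc_subset_Icc_self)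
    (Eventually.of_forall fun r => (exp_pos _).le)]
  congr 1
  rw [← intervalIntegral.integral_of_le hpq,
    intervalIntegral.integral_eq_sub_of_hasDerivAt (f := fun r => -rexp (-(β * r)) / β)
      (f' := fun r => rexp (-(β * r)))]
  · ring
  · intro r _
    have h1 : HasDerivAt (fun r : ℝ => -(β * r)) (-(β * 1)) r := ((hasDerivAt_id r).const_mul β).neg
    have h2 := (h1.exp.neg).div_const β
    have e : -(rexp (-(β * r)) * -(β * 1)) / β = rexp (-(β * r)) := by field_simp
    rwa [e] at h2
  · exact hc.intervalIntegrable _ _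

lemma expPot_box (β : ℝ) (u v s : ℝ) :
    expPot β (box u v) s = ∫⁻ r in Ioc (max 0 (u - s)) (v - s), expW β r := by
  have e : ∀ r, expW β r * box u v (s + r) = (Ioc (u - s) (v - s)).indicator (expW β) r := by
    intro r
    have : s + r ∈ Ioc u v ↔ r ∈ Ioc (u - s) (v - s) := by
      simp only [Set.mem_Ioc, sub_lt_iff_lt_add', le_sub_iff_add_le']
    by_cases h : r ∈ Ioc (u - s) (v - s)
    · simp [box, this.2 h, h]
    · rw [box, Set.indicator_of_notMem (fun hh => h (this.1 hh)), Set.indicator_of_notMem h, mul_zero]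
  unfold expPot
  simp_rw [e]
  rw [lintegral_indicator measurableSet_Ioc, Measure.restrict_restrict measurableSet_Ioc]
  congr 2
  ext r
  simp only [Set.mem_inter_iff, Set.mem_Ioc, mem_Ioi, max_lt_iff]
  tauto

lemma expPot_box_zero {β : ℝ} (hβ : 0 < β) {τ s : ℝ} (hs : 0 < s) (hsτ : s ≤ τ) :
    expPot β (box 0 τ) s = ofReal ((1 - rexp (-(β * (τ - s)))) / β) := by
  rw [expPot_box, max_eq_left (by linarith), lintegral_expW_Ioc hβ (by linarith)]
  simp

lemma expPot_box_of_lt (β : ℝ) {u v s : ℝ} (h : v ≤ s) : expPot β (box u v) s = 0 := by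
  rw [expPot_box, Set.Ioc_eq_empty (by rw [not_lt]; exact le_trans (by linarith) (le_max_left _ _))]
  simp

lemma expPot_box_le {β : ℝ} (hβ : 0 < β) {u v s w : ℝ} (hw : v - u ≤ w) (hw0 : 0 ≤ w) :
    expPot β (box u v) s ≤ ofReal ((1 - rexp (-(β * w))) / β) := by
  rcases le_total v s with h | h
  · rw [expPot_box_of_lt β h]; exact zero_le
  rw [expPot_box]
  rcases le_total (max 0 (u - s)) (v - s) with h1 | h1
  · rw [lintegral_expW_Ioc hβ h1]
    refine ofReal_le_ofReal ?_
    gcongr ?_ / β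
    set p := max 0 (u - s) with hp
    have hp0 : 0 ≤ p := le_max_left _ _
    have hq : v - s ≤ p + w := by
      have := le_max_right 0 (u - s)
      linarith
    have e1 : rexp (-(β * (p + w))) ≤ rexp (-(β * (v - s))) := by gcongr
    have e2 : rexp (-(β * (p + w))) = rexp (-(β * p)) * rexp (-(β * w)) := by
      rw [← exp_add]; ring_nf
    have e3 : rexp (-(β * p)) ≤ 1 := exp_le_one_iff.2 (by nlinarith)
    have e4 : rexp (-(β * w)) ≤ 1 := exp_le_one_iff.2 (by nlinarith)
    nlinarith
  · rw [Set.Ioc_eq_empty (not_lt.2 h1)]; simp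

lemma expPot_box_le_of_le {β : ℝ} (hβ : 0 < β) {u v s w : ℝ} (huv : u ≤ v) (hw : v - u ≤ w) (hs : s ≤ u) :
    expPot β (box u v) s ≤ ofReal (rexp (-(β * (u - s))) * ((1 - rexp (-(β * w))) / β)) := by
  rw [expPot_box, max_eq_right (by linarith), lintegral_expW_Ioc hβ (by linarith)]
  refine ofReal_le_ofReal ?_
  rw [← mul_div_assoc]
  gcongr ?_ / β
  rw [mul_sub (rexp _), mul_one, ← exp_add]
  have : rexp (-(β * (u - s)) + -(β * w)) ≤ rexp (-(β * (v - s))) :=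
    Real.exp_le_exp.2 (by nlinarith)
  linarith

/-- The left side is at most min(1, x), which x^θ dominates for every θ in [0, 1]. -/
lemma one_sub_exp_le_rpow {x θ : ℝ} (hx : 0 ≤ x) (h0 : 0 ≤ θ) (h1 : θ ≤ 1) :
    1 - rexp (-x) ≤ x ^ θ := by
  rcases le_total x 1 with h | h
  · have e1 : 1 - rexp (-x) ≤ x := by linarith [add_one_le_exp (-x)]
    rcases hx.eq_or_lt with rfl | hx
    · simp; positivity
    · calc _ ≤ x := e1
        _ = x ^ (1:ℝ) := (rpow_one x).symm
        _ ≤ x ^ θ := Real.rpow_le_rpow_of_exponent_ge hx h h1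
  · calc 1 - rexp (-x) ≤ 1 := by linarith [exp_pos (-x)]
      _ ≤ x ^ θ := Real.one_le_rpow h h0

/-- Bound for the form of an interval of length at most `w`. -/
lemma decay_box_le {β : ℝ} (hβ : 0 < β) {u v w θ : ℝ} (hu : 0 ≤ u) (huv : u ≤ v) (hw : v - u ≤ w)
    (h1 : 1 ≤ θ) (h2 : θ ≤ 2) :
    decay β (box u v) (box u v) ≤ ofReal (3 / 2 * ((β ^ 3)⁻¹ * (β * w) ^ θ)) := by
  have hw0 : 0 ≤ w := by linarith
  set D := (1 - rexp (-(β * w))) / β with hD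
  have hexp : rexp (-(β * w)) ≤ 1 := exp_le_one_iff.2 (by nlinarith)
  have hD0 : 0 ≤ D := div_nonneg (by linarith) hβ.le
  -- Up to time u the potential is at most D e^{-β(u-s)}, whose square integrates to at most
  -- D²/(2β). On (u, v] it is at most D over a length at most w, and from v on it vanishes.
  have s1 : ∫⁻ s in Ioc 0 u, expPot β (box u v) s * expPot β (box u v) s ≤
      ofReal (D ^ 2 / (2 * β)) := by
    calc _ ≤ ∫⁻ s in Ioc 0 u, ofReal (D ^ 2 * rexp (-(2 * β * u))) * expW (-(2 * β)) s := by
          refine setLIntegral_mono' measurableSet_Ioc fun s hs => ?_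
          have := expPot_box_le_of_le hβ huv hw hs.2
          refine (mul_le_mul' this this).trans_eq ?_
          rw [← ofReal_mul (by positivity), expW, ← ofReal_mul (by positivity)]
          congr 1
          have e : rexp (-(2 * β * u)) * rexp (-(-(2 * β) * s)) =
              rexp (-(β * (u - s))) * rexp (-(β * (u - s))) := by
            rw [← exp_add, ← exp_add]; ring_nf
          rw [mul_assoc (D ^ 2), e, hD]; ring
      _ ≤ _ := by
          unfold expW
          have hc : Continuous fun r => rexp (-(-(2 * β) * r)) := by fun_prop
          rw [lintegral_const_mul _ (by fun_prop), ← ofReal_integral_eq_lintegral_ofReal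
            ((hc.integrableOn_Icc (a := 0) (b := u)).mono_set Set.Ioc_subset_Icc_self)
            (Eventually.of_forall fun r => (exp_pos _).le), ← ofReal_mul (by positivity)]
          refine ofReal_le_ofReal ?_
          rw [← intervalIntegral.integral_of_le hu,
            intervalIntegral.integral_eq_sub_of_hasDerivAt (f := fun r => rexp (-(-(2 * β) * r)) / (2 * β))
              (f' := fun r => rexp (-(-(2 * β) * r)))]
          · have e : rexp (-(2 * β * u)) * rexp (-(-(2 * β) * u)) = 1 := by
              rw [← exp_add]; simp
            calc _ = D ^ 2 / (2 * β) * (rexp (-(2 * β * u)) * rexp (-(-(2 * β) * u))) -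
                  D ^ 2 / (2 * β) * rexp (-(2 * β * u)) * rexp (-(-(2 * β) * 0)) := by ring
              _ ≤ D ^ 2 / (2 * β) := by
                  rw [e, mul_one]
                  exact sub_le_self _ (by positivity)
          · intro r _
            have g1 : HasDerivAt (fun r : ℝ => -(-(2 * β) * r)) (-(-(2 * β) * 1)) r :=
              ((hasDerivAt_id r).const_mul (-(2 * β))).neg
            have g2 := g1.exp.div_const (2 * β)
            have e : rexp (-(-(2 * β) * r)) * -(-(2 * β) * 1) / (2 * β) = rexp (-(-(2 * β) * r)) := by
              field_simp
            rwa [e] at g2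
          · exact hc.intervalIntegrable _ _
  have s2 : ∫⁻ s in Ioc u v, expPot β (box u v) s * expPot β (box u v) s ≤ ofReal (D ^ 2 * w) := by
    calc _ ≤ ∫⁻ s in Ioc u v, ofReal (D ^ 2) := by
          refine lintegral_mono fun s => ?_
          have := expPot_box_le hβ (s := s) hw hw0
          refine (mul_le_mul' this this).trans_eq ?_
          rw [← ofReal_mul hD0, sq]
      _ ≤ _ := by
          rw [setLIntegral_const, Real.volume_Ioc, ← ofReal_mul (by positivity)]
          gcongr
  have s3 : ∫⁻ s in Ioi v, expPot β (box u v) s * expPot β (box u v) s = 0 := by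
    rw [setLIntegral_congr_fun (g := fun _ => 0) measurableSet_Ioi fun s hs => by
      simp [expPot_box_of_lt β (le_of_lt (mem_Ioi.1 hs))]]
    simp
  have hsplit : decay β (box u v) (box u v) ≤ ofReal (D ^ 2 / (2 * β) + D ^ 2 * w) := by
    rw [decay, ← Set.Ioc_union_Ioi_eq_Ioi (hu.trans huv), ← Set.Ioc_union_Ioc_eq_Ioc hu huv]
    refine (lintegral_union_le _ _ _).trans ?_
    rw [s3, add_zero]
    refine (lintegral_union_le _ _ _).trans ?_
    rw [ofReal_add (by positivity) (by positivity)]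
    exact add_le_add s1 s2
  refine hsplit.trans (ofReal_le_ofReal ?_)
  have hx : 0 ≤ β * w := by positivity
  set x := β * w with hxdef
  set m := 1 - rexp (-x) with hm
  have hm1 : m ≤ 1 := by linarith [exp_pos (-x)]
  have b1 : m ^ 2 ≤ x ^ θ := by
    have := one_sub_exp_le_rpow hx (θ := θ / 2) (by linarith) (by linarith)
    calc m ^ 2 ≤ (x ^ (θ / 2)) ^ 2 := by gcongr
      _ = x ^ θ := by rw [← rpow_natCast, ← rpow_mul hx]; congr 1; push_cast; ring
  have b2 : x * m ^ 2 ≤ x ^ θ := by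
    rcases hx.eq_or_lt with h | h
    · rw [← h]; simp; positivity
    have := one_sub_exp_le_rpow hx (θ := θ - 1) (by linarith) (by linarith)
    calc x * m ^ 2 ≤ x * m := by
          gcongr
          nlinarith
      _ ≤ x * x ^ (θ - 1) := by gcongr
      _ = x ^ θ := by
          rw [rpow_sub h, rpow_one]; field_simp
  -- Both m² and x m² are at most x^θ for 1 ≤ θ ≤ 2, which gives 1/2 + 1 = 3/2.
  have e1 : D ^ 2 / (2 * β) + D ^ 2 * w = (β ^ 3)⁻¹ * (m ^ 2 / 2 + x * m ^ 2) := by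
    rw [hD, hxdef]; field_simp
  rw [e1, mul_left_comm]
  gcongr
  linarith

/-- `e^{-x} - 1 + x`. -/
def gfun (x : ℝ) : ℝ := rexp (-x) - 1 + x

/-- The covariance profile of a single relaxation rate. -/
def psi (x y : ℝ) : ℝ := gfun x + gfun y - 1 / 2 * (gfun (x + y) + gfun |x - y|)

lemma psi_comm (x y : ℝ) : psi x y = psi y x := by
  unfold psi; rw [add_comm y x, abs_sub_comm y x]; ring

/-- The potential of the shorter interval vanishes after s, so the form is the integral over (0, s]
of an explicit product of two terms 1 - e^{-β(·)}, divided by β². The sign of `psi` is read off from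
this integral. -/
lemma decay_box_zero_aux {β : ℝ} (hβ : 0 < β) {s t : ℝ} (hs : 0 ≤ s) (hst : s ≤ t) :
    decay β (box 0 s) (box 0 t) = ofReal ((β ^ 3)⁻¹ * psi (β * s) (β * t)) ∧
      0 ≤ psi (β * s) (β * t) := by
  have hc : Continuous fun σ => (1 - rexp (-(β * (s - σ)))) / β * ((1 - rexp (-(β * (t - σ)))) / β) := by
    fun_prop
  have hnn : ∀ σ ∈ Ioc 0 s, 0 ≤ (1 - rexp (-(β * (s - σ)))) / β ∧ 0 ≤ (1 - rexp (-(β * (t - σ)))) / β := by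
    intro σ hσ
    constructor
    · refine div_nonneg (sub_nonneg.2 (exp_le_one_iff.2 ?_)) hβ.le
      have := hσ.2
      nlinarith
    · refine div_nonneg (sub_nonneg.2 (exp_le_one_iff.2 ?_)) hβ.le
      have := hσ.2
      nlinarith
  have e1 : decay β (box 0 s) (box 0 t) = ∫⁻ σ in Ioc 0 s,
      ofReal ((1 - rexp (-(β * (s - σ)))) / β * ((1 - rexp (-(β * (t - σ)))) / β)) := by
    rw [decay, ← Set.Ioc_union_Ioi_eq_Ioi hs, lintegral_union measurableSet_Ioi
      (disjoint_left.2 fun x hx hx' => absurd hx.2 (not_le.2 hx'))]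
    have s3 : ∫⁻ σ in Ioi s, expPot β (box 0 s) σ * expPot β (box 0 t) σ = 0 := by
      rw [setLIntegral_congr_fun (g := fun _ => 0) measurableSet_Ioi fun σ hσ => by
        simp [expPot_box_of_lt β (le_of_lt (mem_Ioi.1 hσ))]]
      simp
    rw [s3, add_zero]
    refine setLIntegral_congr_fun measurableSet_Ioc fun σ hσ => ?_
    rw [expPot_box_zero hβ hσ.1 hσ.2, expPot_box_zero hβ hσ.1 (hσ.2.trans hst),
      ← ofReal_mul (hnn σ hσ).1]
  have hae : ∀ᵐ σ ∂(volume.restrict (Ioc 0 s)), 0 ≤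
      (1 - rexp (-(β * (s - σ)))) / β * ((1 - rexp (-(β * (t - σ)))) / β) :=
    (ae_restrict_iff' measurableSet_Ioc).2 (Eventually.of_forall fun σ hσ =>
      mul_nonneg (hnn σ hσ).1 (hnn σ hσ).2)
  have e2 : ∫ σ in Ioc 0 s, (1 - rexp (-(β * (s - σ)))) / β * ((1 - rexp (-(β * (t - σ)))) / β) =
      (β ^ 3)⁻¹ * psi (β * s) (β * t) := by
    rw [← intervalIntegral.integral_of_le hs, intervalIntegral.integral_eq_sub_of_hasDerivAt
      (f := fun σ => (σ - rexp (-(β * (s - σ))) / β - rexp (-(β * (t - σ))) / β +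
        rexp (-(β * (s + t - 2 * σ))) / (2 * β)) / β ^ 2)]
    · have h1 : |β * s - β * t| = β * (t - s) := by
        rw [abs_of_nonpos (by nlinarith)]; ring
      unfold psi gfun
      rw [h1, sub_self, mul_zero, neg_zero, exp_zero]
      have a1 : -(β * (s + t - 2 * s)) = -(β * (t - s)) := by ring
      have a2 : -(β * (s + t - 2 * 0)) = -(β * s + β * t) := by ring
      rw [a1, a2]
      simp only [sub_zero]
      field_simp
      ring
    · intro σ _
      have g : ∀ p q : ℝ, HasDerivAt (fun σ : ℝ => rexp (-(β * (p - q * σ))))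
          (rexp (-(β * (p - q * σ))) * (β * q)) σ := by
        intro p q
        have h1 : HasDerivAt (fun σ : ℝ => -(β * (p - q * σ))) (-(β * (0 - q * 1))) σ :=
          (((hasDerivAt_const σ p).sub ((hasDerivAt_id σ).const_mul q)).const_mul β).neg
        have h2 := h1.exp
        rwa [show -(β * (0 - q * 1)) = β * q by ring] at h2
      have g1 := g s 1
      have g2 := g t 1
      have g3 := g (s + t) 2
      simp only [one_mul] at g1 g2
      have g4 := ((((hasDerivAt_id σ).sub (g1.div_const β)).sub (g2.div_const β)).add
        (g3.div_const (2 * β))).div_const (β ^ 2)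
      have e : (1 - rexp (-(β * (s - σ)))) / β * ((1 - rexp (-(β * (t - σ)))) / β) =
          (1 - rexp (-(β * (s - σ))) * (β * 1) / β - rexp (-(β * (t - σ))) * (β * 1) / β +
            rexp (-(β * (s + t - 2 * σ))) * (β * 2) / (2 * β)) / β ^ 2 := by
        have : rexp (-(β * (s + t - 2 * σ))) = rexp (-(β * (s - σ))) * rexp (-(β * (t - σ))) := by
          rw [← exp_add]; ring_nf
        rw [this]
        field_simp
        ring
      rw [e]
      exact g4
    · exact hc.intervalIntegrable _ _
  have hint : IntegrableOn (fun σ => (1 - rexp (-(β * (s - σ)))) / β * ((1 - rexp (-(β * (t - σ)))) / β))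
      (Ioc 0 s) := (hc.integrableOn_Icc (a := 0) (b := s)).mono_set Set.Ioc_subset_Icc_self
  constructor
  · rw [e1, ← ofReal_integral_eq_lintegral_ofReal hint hae, e2]
  · have h0 := integral_nonneg_of_ae hae
    rw [e2] at h0
    exact (mul_nonneg_iff_of_pos_left (by positivity)).1 h0

lemma decay_box_zero {β : ℝ} (hβ : 0 < β) {s t : ℝ} (hs : 0 ≤ s) (ht : 0 ≤ t) :
    decay β (box 0 s) (box 0 t) = ofReal ((β ^ 3)⁻¹ * psi (β * s) (β * t)) ∧
      0 ≤ psi (β * s) (β * t) := by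
  rcases le_total s t with h | h
  · exact decay_box_zero_aux hβ hs h
  · rw [decay_comm, psi_comm]
    exact decay_box_zero_aux hβ ht h

/-- Enlarge both intervals to (0, m] and apply the bound for a single interval. -/
lemma psi_le {β : ℝ} (hβ : 0 < β) {s t m θ : ℝ} (hs : 0 ≤ s) (ht : 0 ≤ t) (hsm : s ≤ m) (htm : t ≤ m)
    (h1 : 1 ≤ θ) (h2 : θ ≤ 2) :
    (β ^ 3)⁻¹ * psi (β * s) (β * t) ≤ 3 / 2 * ((β ^ 3)⁻¹ * (β * m) ^ θ) := by
  have hm : 0 ≤ m := hs.trans hsm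
  have hmono : ∀ {p : ℝ}, p ≤ m → ∀ σ, box 0 p σ ≤ box 0 m σ := by
    intro p hp σ
    exact Set.indicator_le_indicator_of_subset (Set.Ioc_subset_Ioc_right hp) (fun _ => zero_le) σ
  have h3 := (decay_mono β (hmono hsm) (hmono htm)).trans
    (decay_box_le hβ le_rfl hm (w := m) (by linarith) h1 h2)
  rw [(decay_box_zero hβ hs ht).1] at h3
  exact (ENNReal.ofReal_le_ofReal_iff (by positivity)).1 h3

end Decay

/-! ### Spectral series for the covariance form and the Green function -/

section Spectral

variable {M : ℕ} [NeZero M] {c : ℝ}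

/-- The spectral weight of level `j`. -/
def wt (M : ℕ) (j : ℕ) : ℝ≥0∞ := ofReal ((1 - (M:ℝ)⁻¹) * ((M:ℝ)⁻¹) ^ j)

lemma one_sub_inv_pos (hM : 1 < M) : 0 < 1 - (M:ℝ)⁻¹ :=
  sub_pos.2 (inv_lt_one_of_one_lt₀ (by exact_mod_cast hM))

lemma rate_pos (hM : 1 < M) (hc : 1 ≤ c) (hcM : c < M) (j : ℕ) : 0 < bConst M c * aConst M c ^ j :=
  mul_pos (bConst_pos hM hcM) (pow_pos (aConst_pos (M := M) (by linarith)) _)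

lemma expW_add (β r s : ℝ) : expW β (r + s) = expW β r * expW β s := by
  rw [expW, expW, expW, ← ofReal_mul (exp_pos _).le, ← exp_add]
  congr 2; ring

lemma tkernel_zero (hM : 1 < M) (hc : 1 ≤ c) (hcM : c < M) {t : ℝ} (ht : 0 ≤ t) :
    tkernel M c t 0 = ∑' j, wt M j * expW (bConst M c * aConst M c ^ j) t := by
  have h1 := (one_sub_inv_pos hM).le
  have hs : Summable fun j => rexp (-(bConst M c * aConst M c ^ j * t)) * ((M:ℝ)⁻¹) ^ j := by
    refine Summable.of_nonneg_of_le (fun j => by positivity) (fun j => ?_) (summable_inv_pow hM)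
    refine mul_le_of_le_one_left (by positivity) (exp_le_one_iff.2 ?_)
    have := rate_pos hM hc hcM j
    rw [neg_nonpos]; positivity
  rw [tkernel, transProb_zero_eq hM hc hcM, ← tsum_mul_left,
    ofReal_tsum_of_nonneg (fun j => by positivity) (hs.mul_left _)]
  refine tsum_congr fun j => ?_
  rw [wt, expW, ← ofReal_mul (by positivity)]
  congr 1; ring

/-- At each spectral level the exponential of r + r' factorizes, so the double time integral becomes
a product of two one-dimensional potentials. -/
lemma bil_zero (hM : 1 < M) (hc : 1 ≤ c) (hcM : c < M) {f g : ℝ → ℝ≥0∞} (hf : Measurable f)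
    (hg : Measurable g) : bil (tkernel M c) f g 0 =
      ∑' j, wt M j * decay (bConst M c * aConst M c ^ j) f g := by
  have mE : ∀ (β s : ℝ) (h : ℝ → ℝ≥0∞), Measurable h → Measurable fun r => expW β r * h (s + r) :=
    fun β s h hh => (measurable_expW β).mul (hh.comp (measurable_const_add s))
  have e1 : ∀ s, ∀ r ∈ Ioi (0:ℝ), ∫⁻ r' in Ioi (0:ℝ), tkernel M c (r + r') 0 * (f (s + r) * g (s + r')) =
      ∑' j, wt M j * ((expW (bConst M c * aConst M c ^ j) r * f (s + r)) *
        expPot (bConst M c * aConst M c ^ j) g s) := by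
    intro s r hr
    have e2 : ∀ r' ∈ Ioi (0:ℝ), tkernel M c (r + r') 0 * (f (s + r) * g (s + r')) =
        ∑' j, (wt M j * (expW (bConst M c * aConst M c ^ j) r * f (s + r))) *
          (expW (bConst M c * aConst M c ^ j) r' * g (s + r')) := by
      intro r' hr'
      rw [tkernel_zero hM hc hcM (add_nonneg (le_of_lt hr) (le_of_lt hr')), ← ENNReal.tsum_mul_right]
      refine tsum_congr fun j => ?_
      rw [expW_add]; ring
    rw [setLIntegral_congr_fun measurableSet_Ioi e2,
      lintegral_tsum fun j => ((mE _ s g hg).const_mul _).aemeasurable]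
    refine tsum_congr fun j => ?_
    rw [lintegral_const_mul _ (mE _ s g hg), mul_assoc]; rfl
  have e3 : ∀ s, ∫⁻ r in Ioi (0:ℝ), ∫⁻ r' in Ioi (0:ℝ), tkernel M c (r + r') 0 * (f (s + r) * g (s + r')) =
      ∑' j, wt M j * (expPot (bConst M c * aConst M c ^ j) f s * expPot (bConst M c * aConst M c ^ j) g s) := by
    intro s
    rw [setLIntegral_congr_fun measurableSet_Ioi (e1 s),
      lintegral_tsum fun j => (((mE _ s f hf).mul_const _).const_mul _).aemeasurable]
    refine tsum_congr fun j => ?_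
    rw [lintegral_const_mul _ ((mE _ s f hf).mul_const _), lintegral_mul_const _ (mE _ s f hf)]; rfl
  have mp : ∀ β, Measurable fun s => expPot β f s * expPot β g s := fun β =>
    (measurable_expPot β hf).mul (measurable_expPot β hg)
  unfold bil
  simp_rw [e3]
  rw [lintegral_tsum fun j => ((mp _).const_mul _).aemeasurable]
  refine tsum_congr fun j => ?_
  rw [lintegral_const_mul _ (mp _)]; rfl

lemma bil_le_zero (hk : SymmSemigroup (tkernel M c)) (f g : ℝ → ℝ≥0∞) (z : HierGroup M) :
    bil (tkernel M c) f g z ≤ bil (tkernel M c) f g 0 := by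
  refine lintegral_mono fun s => setLIntegral_mono' measurableSet_Ioi fun r hr =>
    setLIntegral_mono' measurableSet_Ioi fun r' hr' => mul_le_mul' ?_ le_rfl
  exact hk.le_zero _ (add_nonneg (le_of_lt hr) (le_of_lt hr')) z

/-- Only levels below |z| distinguish z from the origin. Each has a fixed positive rate, so on time
intervals (0, T] its contribution grows only linearly in T. -/
lemma bil_zero_le (hM : 1 < M) (hc : 1 ≤ c) (hcM : c < M)
    {f g : ℝ → ℝ≥0∞} (hf : Measurable f) (hg : Measurable g) (z : HierGroup M) :
    bil (tkernel M c) f g 0 ≤ bil (tkernel M c) f g z +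
      ∑ j ∈ range (hdist 0 z), 2 * decay (bConst M c * aConst M c ^ j) f g := by
  have mE : ∀ (β s : ℝ) (h : ℝ → ℝ≥0∞), Measurable h → Measurable fun r => expW β r * h (s + r) :=
    fun β s h hh => (measurable_expW β).mul (hh.comp (measurable_const_add s))
  have hle : ∀ t, 0 ≤ t → tkernel M c t 0 ≤ tkernel M c t z +
      ∑ j ∈ range (hdist 0 z), 2 * expW (bConst M c * aConst M c ^ j) t := by
    intro t ht
    rw [tkernel]
    refine (ofReal_le_ofReal (transProb_zero_sub_le hM hc hcM ht z)).trans ?_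
    refine ENNReal.ofReal_add_le.trans (add_le_add le_rfl ?_)
    rw [ENNReal.ofReal_sum_of_nonneg fun j _ => by positivity]
    refine sum_le_sum fun j _ => ?_
    rw [ofReal_mul zero_le_two]
    simp [expW]
  have e1 : ∀ s, ∀ r ∈ Ioi (0:ℝ), ∫⁻ r' in Ioi (0:ℝ), tkernel M c (r + r') 0 * (f (s + r) * g (s + r')) ≤
      (∫⁻ r' in Ioi (0:ℝ), tkernel M c (r + r') z * (f (s + r) * g (s + r'))) +
      ∑ j ∈ range (hdist 0 z), (2 * (expW (bConst M c * aConst M c ^ j) r * f (s + r))) *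
        expPot (bConst M c * aConst M c ^ j) g s := by
    intro s r hr
    calc _ ≤ ∫⁻ r' in Ioi (0:ℝ), (tkernel M c (r + r') z * (f (s + r) * g (s + r')) +
          ∑ j ∈ range (hdist 0 z), (2 * (expW (bConst M c * aConst M c ^ j) r * f (s + r))) *
            (expW (bConst M c * aConst M c ^ j) r' * g (s + r'))) := by
          refine setLIntegral_mono' measurableSet_Ioi fun r' hr' => ?_
          refine (mul_le_mul' (hle (r + r') (add_nonneg (le_of_lt hr) (le_of_lt hr'))) le_rfl).trans_eq ?_
          rw [add_mul, sum_mul]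
          congr 1
          refine sum_congr rfl fun j _ => ?_
          rw [expW_add]; ring
      _ = _ := by
          rw [lintegral_add_right _ (Finset.measurable_fun_sum _ fun j _ => (mE _ s g hg).const_mul _),
            lintegral_finsetSum _ fun j _ => (mE _ s g hg).const_mul _]
          congr 1
          refine sum_congr rfl fun j _ => ?_
          rw [lintegral_const_mul _ (mE _ s g hg)]; rfl
  have e2 : ∀ s, ∫⁻ r in Ioi (0:ℝ), ∫⁻ r' in Ioi (0:ℝ), tkernel M c (r + r') 0 * (f (s + r) * g (s + r')) ≤
      (∫⁻ r in Ioi (0:ℝ), ∫⁻ r' in Ioi (0:ℝ), tkernel M c (r + r') z * (f (s + r) * g (s + r'))) +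
      ∑ j ∈ range (hdist 0 z), 2 * (expPot (bConst M c * aConst M c ^ j) f s *
        expPot (bConst M c * aConst M c ^ j) g s) := by
    intro s
    refine (setLIntegral_mono' measurableSet_Ioi (e1 s)).trans_eq ?_
    rw [lintegral_add_right _ (Finset.measurable_fun_sum _ fun j _ => ((mE _ s f hf).const_mul _).mul_const _),
      lintegral_finsetSum _ fun j _ => ((mE _ s f hf).const_mul _).mul_const _]
    congr 1
    refine sum_congr rfl fun j _ => ?_
    rw [lintegral_mul_const _ ((mE _ s f hf).const_mul _), lintegral_const_mul _ (mE _ s f hf), mul_assoc]; rfl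
  have mp : ∀ β, Measurable fun s => expPot β f s * expPot β g s := fun β =>
    (measurable_expPot β hf).mul (measurable_expPot β hg)
  refine (lintegral_mono e2).trans_eq ?_
  rw [lintegral_add_right _ (Finset.measurable_fun_sum _ fun j _ => (mp _).const_mul _),
    lintegral_finsetSum _ fun j _ => (mp _).const_mul _]
  congr 1
  refine sum_congr rfl fun j _ => ?_
  rw [lintegral_const_mul _ (mp _)]; rfl

lemma lintegral_expW_eq {β : ℝ} (hβ : 0 < β) : ∫⁻ r in Ioi (0:ℝ), expW β r = ofReal β⁻¹ := by
  have h := lintegral_expW hβ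
  rw [ENNReal.ofReal_inv_of_pos hβ]
  exact ENNReal.eq_inv_of_mul_eq_one_left (by rwa [mul_comm] at h)

/-- `∫_v^∞ p_r(0) dr`. -/
def tailGreen (M : ℕ) (c v : ℝ) : ℝ≥0∞ := ∫⁻ r in Ioi (0:ℝ), tkernel M c (v + r) 0

lemma tailGreen_eq (hM : 1 < M) (hc : 1 ≤ c) (hcM : c < M) {v : ℝ} (hv : 0 ≤ v) :
    tailGreen M c v = ∑' j, wt M j * ofReal (bConst M c * aConst M c ^ j)⁻¹ *
      expW (bConst M c * aConst M c ^ j) v := by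
  have e : ∀ r ∈ Ioi (0:ℝ), tkernel M c (v + r) 0 = ∑' j, wt M j *
      expW (bConst M c * aConst M c ^ j) v * expW (bConst M c * aConst M c ^ j) r := by
    intro r hr
    rw [tkernel_zero hM hc hcM (add_nonneg hv (le_of_lt hr))]
    exact tsum_congr fun j => by rw [expW_add, mul_assoc]
  rw [tailGreen, setLIntegral_congr_fun measurableSet_Ioi e,
    lintegral_tsum fun j => ((measurable_expW _).const_mul _).aemeasurable]
  refine tsum_congr fun j => ?_
  rw [lintegral_const_mul _ (measurable_expW _), lintegral_expW_eq (rate_pos hM hc hcM j)]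
  ring

lemma measurable_tailGreen (hk : SymmSemigroup (tkernel M c)) : Measurable (tailGreen M c) := by
  have : Measurable fun q : ℝ × ℝ => tkernel M c (q.1 + q.2) 0 :=
    (hk.measurable 0).comp (measurable_fst.add measurable_snd)
  exact this.lintegral_prod_right'

lemma mul_aConst (hM : 1 < M) : (M:ℝ) * aConst M c = c := by
  rw [aConst]; field_simp

/-- Level j contributes a multiple of (M a)^{-j} = c^{-j}, summable exactly because c > 1: the walk
is transient. -/
lemma green_ne_top (hM : 1 < M) (hc : 1 < c) (hcM : c < M) : green (tkernel M c) ≠ ⊤ := by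
  have h0 := tailGreen_eq hM hc.le hcM le_rfl
  have e0 : tailGreen M c 0 = green (tkernel M c) := by simp [tailGreen, green]
  have h1 := one_sub_inv_pos hM
  have hcinv : c⁻¹ = (M:ℝ)⁻¹ * (aConst M c)⁻¹ := by rw [← mul_inv, mul_aConst hM]
  rw [e0] at h0
  rw [h0]
  have e : ∀ j, wt M j * ofReal (bConst M c * aConst M c ^ j)⁻¹ *
      expW (bConst M c * aConst M c ^ j) 0 = ofReal ((1 - (M:ℝ)⁻¹) * (bConst M c)⁻¹ * (c⁻¹) ^ j) := by
    intro j
    rw [wt, ← ofReal_mul (by positivity), expW, mul_zero, neg_zero, exp_zero, ofReal_one, mul_one]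
    congr 1
    rw [mul_inv, ← inv_pow (aConst M c), hcinv, mul_pow]; ring
  simp_rw [e]
  exact ((summable_geometric_of_lt_one (by positivity) (inv_lt_one_of_one_lt₀ hc)).mul_left _).tsum_ofReal_ne_top

/-- The integrated tail of the Green function grows slower than linearly. -/
lemma exists_lintegral_tailGreen_le (hM : 1 < M) (hc : 1 < c) (hcM : c < sqrt M) :
    ∃ C : ℝ, 0 ≤ C ∧ ∀ T : ℝ, 0 ≤ T → ∫⁻ v in Ioc 0 T, tailGreen M c v ≤
      ofReal (C * T ^ (1 - 3 * degree M c / 4)) := by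
  have hcM' := lt_of_lt_sqrt hM hcM
  have hγ := degree_pos hM hc hcM
  have hγ1 := degree_lt_one hM hc hcM
  set γ := degree M c with hγdef
  have ha := aConst_pos (M := M) (c := c) (by linarith)
  have ha1 := aConst_lt_one (M := M) hcM'
  have hb := bConst_pos hM hcM'
  have h1 := one_sub_inv_pos hM
  -- With T to the power κ extracted, level j leaves a^{j(1+γ+κ-2)} = a^{jγ/4}, which is summable; κ
  -- is still below the exponent 1 - γ/2 of the norming.
  set κ := 1 - 3 * γ / 4 with hκ
  set a := aConst M c with hadef
  set b := bConst M c with hbdef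
  have hθ : a ^ (γ / 4) < 1 := Real.rpow_lt_one ha.le ha1 (by positivity)
  have hs : Summable fun j : ℕ => (1 - (M:ℝ)⁻¹) * b ^ (κ - 2) * (a ^ (γ / 4)) ^ j :=
    (summable_geometric_of_lt_one (by positivity) hθ).mul_left _
  refine ⟨∑' j : ℕ, (1 - (M:ℝ)⁻¹) * b ^ (κ - 2) * (a ^ (γ / 4)) ^ j, tsum_nonneg fun j => by positivity,
    fun T hT => ?_⟩
  have hterm : ∀ j : ℕ, wt M j * ofReal (b * a ^ j)⁻¹ * ∫⁻ v in Ioc 0 T, expW (b * a ^ j) v ≤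
      ofReal ((1 - (M:ℝ)⁻¹) * b ^ (κ - 2) * (a ^ (γ / 4)) ^ j * T ^ κ) := by
    intro j
    have hβ : 0 < b * a ^ j := rate_pos hM hc.le hcM' j
    rw [lintegral_expW_Ioc hβ hT, wt, ← ofReal_mul (by positivity), ← ofReal_mul (by positivity)]
    refine ofReal_le_ofReal ?_
    have h2 := one_sub_exp_le_rpow (x := b * a ^ j * T) (θ := κ) (by positivity) (by linarith) (by linarith)
    rw [mul_zero, neg_zero, exp_zero]
    calc _ ≤ (1 - (M:ℝ)⁻¹) * (M:ℝ)⁻¹ ^ j * (b * a ^ j)⁻¹ * ((b * a ^ j * T) ^ κ / (b * a ^ j)) := by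
          gcongr
      _ = _ := by
          rw [mul_rpow hβ.le hT, ← aConst_rpow hM hc hcM]
          have e1 : (b * a ^ j)⁻¹ * ((b * a ^ j) ^ κ / (b * a ^ j)) = (b * a ^ j) ^ (κ - 2) := by
            have e0 := rpow_sub hβ κ 2
            rw [e0, rpow_two]; field_simp
          have e2 : (b * a ^ j) ^ (κ - 2) = b ^ (κ - 2) * (a ^ (κ - 2)) ^ j := by
            rw [mul_rpow hb.le (by positivity), ← rpow_natCast a j, ← rpow_mul ha.le,
              mul_comm (j:ℝ), rpow_mul ha.le, rpow_natCast]
          have e3 : a ^ (1 + γ) * a ^ (κ - 2) = a ^ (γ / 4) := by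
            rw [← rpow_add ha]; congr 1; rw [hκ]; ring
          rw [← e3, mul_pow]
          calc _ = (1 - a ^ (1 + γ)) * (a ^ (1 + γ)) ^ j *
                ((b * a ^ j)⁻¹ * ((b * a ^ j) ^ κ / (b * a ^ j))) * T ^ κ := by ring
            _ = _ := by rw [e1, e2]; ring
  have e0 : ∫⁻ v in Ioc 0 T, tailGreen M c v = ∑' j : ℕ, wt M j * ofReal (b * a ^ j)⁻¹ *
      ∫⁻ v in Ioc 0 T, expW (b * a ^ j) v := by
    rw [setLIntegral_congr_fun measurableSet_Ioc fun v hv => tailGreen_eq hM hc.le hcM' hv.1.le,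
      lintegral_tsum fun j => ((measurable_expW _).const_mul _).aemeasurable]
    exact tsum_congr fun j => lintegral_const_mul _ (measurable_expW _)
  rw [e0, ← tsum_mul_right, ofReal_tsum_of_nonneg (fun j => by positivity) (hs.mul_right _)]
  exact tsum_le_tsum hterm

end Spectral

/-! ### Exact scaling under T_n = a^{-n} -/

section Scaling

variable {M : ℕ} [NeZero M] {c : ℝ}

/-- The weight of the relaxation rate `b a^i` in the limiting variance. -/
def kap (M : ℕ) (c : ℝ) (i : ℤ) : ℝ :=
  (1 - (M:ℝ)⁻¹) * ((M:ℝ)⁻¹) ^ i * ((bConst M c * aConst M c ^ i) ^ 3)⁻¹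

/-- The terms of the limiting covariance. -/
def covTerm (M : ℕ) (c s t : ℝ) (i : ℤ) : ℝ :=
  kap M c i * psi (bConst M c * aConst M c ^ i * s) (bConst M c * aConst M c ^ i * t)

/-- M a³ = a^{2-γ} by the identity for a^{1+γ}. -/
lemma norming_sq (hM : 1 < M) (hc : 1 < c) (hcM : c < sqrt M) (n : ℕ) :
    norming M c (timeSeq M c n) ^ 2 = ((M * aConst M c ^ 3) ^ n)⁻¹ := by
  have ha := aConst_pos (M := M) (c := c) (by linarith)
  have e : (M:ℝ) * aConst M c ^ 3 = aConst M c ^ (2 - degree M c) := by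
    have h := aConst_rpow hM hc hcM
    have : aConst M c ^ (2 - degree M c) = aConst M c ^ (3:ℝ) / aConst M c ^ (1 + degree M c) := by
      rw [← rpow_sub ha]; congr 1; ring
    rw [this, h, show (3:ℝ) = ((3:ℕ):ℝ) by norm_num, rpow_natCast]
    field_simp
  rw [norming, timeSeq, e, ← rpow_natCast, ← rpow_mul (by positivity), Real.inv_rpow (by positivity),
    ← rpow_natCast, ← rpow_natCast, ← rpow_mul ha.le, ← rpow_mul ha.le]
  congr 2
  push_cast; ring

lemma kap_pos (hM : 1 < M) (hc : 1 ≤ c) (hcM : c < M) (i : ℤ) : 0 < kap M c i := by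
  have ha := aConst_pos (M := M) (c := c) (by linarith)
  have hb := bConst_pos hM hcM
  have h1 := one_sub_inv_pos hM
  unfold kap; positivity

lemma rate_shift (hc : 0 < c) (n : ℕ) (j : ℕ) (t : ℝ) :
    bConst M c * aConst M c ^ j * (timeSeq M c n * t) =
      bConst M c * aConst M c ^ ((j:ℤ) - n) * t := by
  have ha := aConst_pos (M := M) hc
  rw [timeSeq, zpow_sub₀ ha.ne', zpow_natCast, zpow_natCast]
  field_simp

/-- Rescaling time by T_n moves every rate by n levels, and the squared norming absorbs exactly the
resulting change of the weights. This is the discrete scale invariance behind the limit. -/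
lemma kap_shift (hM : 1 < M) (hc : 1 < c) (hcM : c < sqrt M) (n j : ℕ) :
    (1 - (M:ℝ)⁻¹) * ((M:ℝ)⁻¹) ^ j * ((bConst M c * aConst M c ^ j) ^ 3)⁻¹ =
      norming M c (timeSeq M c n) ^ 2 * kap M c ((j:ℤ) - n) := by
  have hcM' := lt_of_lt_sqrt hM hcM
  have ha := aConst_pos (M := M) (c := c) (by linarith)
  rw [norming_sq hM hc hcM, kap, zpow_sub₀ ha.ne', zpow_sub₀ (by positivity), zpow_natCast, zpow_natCast,
    zpow_natCast, zpow_natCast, mul_pow, inv_pow, inv_pow]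
  field_simp
  ring

/-- The exponent gained by Kolmogorov's criterion. -/
def epsExp (M : ℕ) (c : ℝ) : ℝ := (1 - degree M c) / 2

/-- The exponent used at level `i`. -/
def thetaExp (M : ℕ) (c : ℝ) (i : ℤ) : ℝ := if 0 ≤ i then 2 else 1 + epsExp M c

/-- Summable majorant of the covariance terms. -/
def majorant (M : ℕ) (c : ℝ) (i : ℤ) : ℝ :=
  3 / 2 * (kap M c i * (bConst M c * aConst M c ^ i) ^ thetaExp M c i)

lemma eps_pos (hM : 1 < M) (hc : 1 < c) (hcM : c < sqrt M) : 0 < epsExp M c ∧ epsExp M c < 1 / 2 := by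
  have h1 := degree_pos hM hc hcM
  have h2 := degree_lt_one hM hc hcM
  unfold epsExp
  constructor <;> linarith

lemma theta_mem (hM : 1 < M) (hc : 1 < c) (hcM : c < sqrt M) (i : ℤ) :
    1 ≤ thetaExp M c i ∧ thetaExp M c i ≤ 2 := by
  have := eps_pos hM hc hcM
  unfold thetaExp
  split_ifs <;> constructor <;> linarith

lemma majorant_nonneg (hM : 1 < M) (hc : 1 ≤ c) (hcM : c < M) (i : ℤ) : 0 ≤ majorant M c i := by
  have ha := aConst_pos (M := M) (c := c) (by linarith)
  have hb := bConst_pos hM hcM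
  have := kap_pos hM hc hcM i
  unfold majorant; positivity

/-- For i ≥ 0 (slow rates) the exponent 2 leaves c^{-i}. For i < 0 (fast rates) the exponent 1 + ε
leaves a^{(1-γ-ε)|i|} = a^{ε|i|}, since ε is half of 1 - γ. -/
lemma summable_majorant (hM : 1 < M) (hc : 1 < c) (hcM : c < sqrt M) : Summable (majorant M c) := by
  have hcM' := lt_of_lt_sqrt hM hcM
  have ha := aConst_pos (M := M) (c := c) (by linarith)
  have ha1 := aConst_lt_one (M := M) hcM'
  have hb := bConst_pos hM hcM'
  have hε := eps_pos hM hc hcM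
  have hcinv : c⁻¹ = (M:ℝ)⁻¹ * (aConst M c)⁻¹ := by rw [← mul_inv, mul_aConst hM]
  refine Summable.of_nat_of_neg_add_one ?_ ?_
  · have e : ∀ n : ℕ, majorant M c n = 3 / 2 * (1 - (M:ℝ)⁻¹) * (bConst M c)⁻¹ * (c⁻¹) ^ n := by
      intro n
      rw [majorant, thetaExp, if_pos (Int.natCast_nonneg n), kap, rpow_two, zpow_natCast, zpow_natCast,
        hcinv, mul_pow (M:ℝ)⁻¹, inv_pow, inv_pow]
      field_simp
    simp_rw [e]
    exact (summable_geometric_of_lt_one (by positivity) (inv_lt_one_of_one_lt₀ hc)).mul_left _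
  · have hr : aConst M c ^ epsExp M c < 1 := Real.rpow_lt_one ha.le ha1 hε.1
    have e : ∀ n : ℕ, majorant M c (-((n:ℤ) + 1)) = 3 / 2 * (1 - (M:ℝ)⁻¹) * bConst M c ^ (epsExp M c - 2) *
        (aConst M c ^ epsExp M c) * (aConst M c ^ epsExp M c) ^ n := by
      intro n
      have hneg : ¬ (0 ≤ -((n:ℤ) + 1)) := by omega
      have hq : 0 < bConst M c * aConst M c ^ (-((n:ℤ) + 1)) := by positivity
      have e1 : ((bConst M c * aConst M c ^ (-((n:ℤ) + 1))) ^ 3)⁻¹ *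
          (bConst M c * aConst M c ^ (-((n:ℤ) + 1))) ^ (1 + epsExp M c) =
          (bConst M c * aConst M c ^ (-((n:ℤ) + 1))) ^ (epsExp M c - 2) := by
        rw [show epsExp M c - 2 = 1 + epsExp M c - (3:ℕ) by push_cast; ring, rpow_sub hq, rpow_natCast]
        field_simp
      have e2 : (bConst M c * aConst M c ^ (-((n:ℤ) + 1))) ^ (epsExp M c - 2) =
          bConst M c ^ (epsExp M c - 2) * (aConst M c ^ (2 - epsExp M c)) ^ (n + 1) := by
        rw [mul_rpow hb.le (by positivity), ← Real.rpow_intCast, ← rpow_mul ha.le,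
          ← rpow_natCast, ← rpow_mul ha.le]
        congr 2; push_cast; ring
      have e3 : ((M:ℝ)⁻¹) ^ (-((n:ℤ) + 1)) = ((aConst M c ^ (1 + degree M c))⁻¹) ^ (n + 1) := by
        rw [aConst_rpow hM hc hcM, inv_inv, zpow_neg, inv_zpow, inv_inv]
        exact_mod_cast rfl
      have e4 : (aConst M c ^ (1 + degree M c))⁻¹ * aConst M c ^ (2 - epsExp M c) = aConst M c ^ epsExp M c := by
        rw [← rpow_neg ha.le, ← rpow_add ha]; congr 1; unfold epsExp; ring
      rw [majorant, thetaExp, if_neg hneg, kap]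
      calc _ = 3 / 2 * (1 - (M:ℝ)⁻¹) * ((M:ℝ)⁻¹) ^ (-((n:ℤ) + 1)) *
            (((bConst M c * aConst M c ^ (-((n:ℤ) + 1))) ^ 3)⁻¹ *
            (bConst M c * aConst M c ^ (-((n:ℤ) + 1))) ^ (1 + epsExp M c)) := by ring
        _ = 3 / 2 * (1 - (M:ℝ)⁻¹) * bConst M c ^ (epsExp M c - 2) *
            ((aConst M c ^ (1 + degree M c))⁻¹ * aConst M c ^ (2 - epsExp M c)) ^ (n + 1) := by
              rw [e1, e2, e3, mul_pow]; ring
        _ = _ := by rw [e4, pow_succ]; ring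
    simp_rw [e]
    exact (summable_geometric_of_lt_one (by positivity) hr).mul_left _

/-- One increment exponent 1 + ε serves all levels; the price 1 + h is harmless on bounded time
intervals. -/
lemma rpow_theta_le (hM : 1 < M) (hc : 1 < c) (hcM : c < sqrt M) (i : ℤ) {h : ℝ} (hh : 0 ≤ h) :
    h ^ thetaExp M c i ≤ (1 + h) * h ^ (1 + epsExp M c) := by
  have hε := eps_pos hM hc hcM
  unfold thetaExp
  split_ifs
  · rcases hh.eq_or_lt with rfl | hpos
    · rw [Real.zero_rpow (by norm_num), Real.zero_rpow (by linarith)]; simp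
    have : h ^ (2:ℝ) = h ^ (1 - epsExp M c) * h ^ (1 + epsExp M c) := by
      rw [← rpow_add hpos]; congr 1; ring
    rw [this]
    gcongr
    calc h ^ (1 - epsExp M c) ≤ (1 + h) ^ (1 - epsExp M c) := by
          gcongr <;> linarith
      _ ≤ (1 + h) ^ (1:ℝ) := Real.rpow_le_rpow_of_exponent_le (by linarith) (by linarith)
      _ = 1 + h := rpow_one _
  · exact le_mul_of_one_le_left (by positivity) (by linarith)

lemma covTerm_bounds (hM : 1 < M) (hc : 1 < c) (hcM : c < sqrt M) {s t m : ℝ} (hs : 0 ≤ s)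
    (ht : 0 ≤ t) (hsm : s ≤ m) (htm : t ≤ m) (i : ℤ) :
    0 ≤ covTerm M c s t i ∧ covTerm M c s t i ≤ majorant M c i * ((1 + m) * m ^ (1 + epsExp M c)) := by
  have hcM' := lt_of_lt_sqrt hM hcM
  have ha := aConst_pos (M := M) (c := c) (by linarith)
  have hb := bConst_pos hM hcM'
  have hβ : 0 < bConst M c * aConst M c ^ i := by positivity
  have hk := kap_pos hM hc.le hcM' i
  have hθ := theta_mem hM hc hcM i
  have hm : 0 ≤ m := hs.trans hsm
  refine ⟨mul_nonneg hk.le (decay_box_zero hβ hs ht).2, ?_⟩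
  have h1 := psi_le hβ hs ht hsm htm hθ.1 hθ.2
  rw [mul_rpow hβ.le hm, mul_left_comm, mul_le_mul_iff_of_pos_left (by positivity)] at h1
  have h2 := rpow_theta_le hM hc hcM i hm
  rw [covTerm, majorant]
  calc _ ≤ kap M c i * (3 / 2 * ((bConst M c * aConst M c ^ i) ^ thetaExp M c i * m ^ thetaExp M c i)) := by
        gcongr
    _ ≤ kap M c i * (3 / 2 * ((bConst M c * aConst M c ^ i) ^ thetaExp M c i *
        ((1 + m) * m ^ (1 + epsExp M c)))) := by gcongr
    _ = _ := by ring

/-- Increment bound for the variance form. -/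
lemma bil_box_le (hM : 1 < M) (hc : 1 < c) (hcM : c < sqrt M) (hk : SymmSemigroup (tkernel M c))
    (n : ℕ) {s t : ℝ} (hs : 0 ≤ s) (hst : s ≤ t) (z : HierGroup M) :
    bil (tkernel M c) (box (timeSeq M c n * s) (timeSeq M c n * t))
      (box (timeSeq M c n * s) (timeSeq M c n * t)) z ≤
    ofReal (norming M c (timeSeq M c n) ^ 2 *
      ((∑' i, majorant M c i) * ((1 + (t - s)) * (t - s) ^ (1 + epsExp M c)))) := by
  have hcM' := lt_of_lt_sqrt hM hcM
  have ha := aConst_pos (M := M) (c := c) (by linarith)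
  have hb := bConst_pos hM hcM'
  have h1 := one_sub_inv_pos hM
  have hM0 : (0:ℝ) < M := by exact_mod_cast (by omega : 0 < M)
  have hT : 0 < timeSeq M c n := by rw [timeSeq]; positivity
  have hts : 0 ≤ t - s := sub_nonneg.2 hst
  refine (bil_le_zero hk _ _ z).trans ?_
  rw [bil_zero hM hc.le hcM' (measurable_box _ _) (measurable_box _ _)]
  set D := (1 + (t - s)) * (t - s) ^ (1 + epsExp M c) with hD
  have hD0 : 0 ≤ D := by positivity
  set N := norming M c (timeSeq M c n) ^ 2 with hN
  have hterm : ∀ j : ℕ, wt M j * decay (bConst M c * aConst M c ^ j)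
      (box (timeSeq M c n * s) (timeSeq M c n * t)) (box (timeSeq M c n * s) (timeSeq M c n * t)) ≤
      ofReal (N * (majorant M c ((j:ℤ) - n) * D)) := by
    intro j
    have hβ := rate_pos hM hc.le hcM' j
    -- The exponent is chosen according to the shifted level j - n, so that after rescaling the
    -- terms belong to one majorant independent of n.
    have hθ := theta_mem hM hc hcM ((j:ℤ) - n)
    have h2 := decay_box_le hβ (u := timeSeq M c n * s) (v := timeSeq M c n * t) (w := timeSeq M c n * (t - s))
      (by positivity) (by gcongr) (by rw [mul_sub]) hθ.1 hθ.2
    refine (mul_le_mul' le_rfl h2).trans ?_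
    rw [wt, ← ofReal_mul (by positivity)]
    refine ofReal_le_ofReal ?_
    have hβ' : 0 < bConst M c * aConst M c ^ ((j:ℤ) - n) := by positivity
    rw [rate_shift (by linarith), mul_rpow hβ'.le hts]
    have h3 := rpow_theta_le hM hc hcM ((j:ℤ) - n) hts
    have e := kap_shift hM hc hcM n j
    calc _ = ((1 - (M:ℝ)⁻¹) * ((M:ℝ)⁻¹) ^ j * ((bConst M c * aConst M c ^ j) ^ 3)⁻¹) *
          (3 / 2 * ((bConst M c * aConst M c ^ ((j:ℤ) - n)) ^ thetaExp M c ((j:ℤ) - n) *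
            (t - s) ^ thetaExp M c ((j:ℤ) - n))) := by ring
      _ ≤ ((1 - (M:ℝ)⁻¹) * ((M:ℝ)⁻¹) ^ j * ((bConst M c * aConst M c ^ j) ^ 3)⁻¹) *
          (3 / 2 * ((bConst M c * aConst M c ^ ((j:ℤ) - n)) ^ thetaExp M c ((j:ℤ) - n) * D)) := by gcongr
      _ = _ := by rw [e, majorant]; ring
  have hsum := summable_majorant hM hc hcM
  have hinj : Function.Injective fun j : ℕ => (j:ℤ) - n := fun i j h => by simpa using h
  have hsub : Summable fun j : ℕ => majorant M c ((j:ℤ) - n) := hsum.comp_injective hinj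
  refine (tsum_le_tsum hterm).trans ?_
  rw [← ofReal_tsum_of_nonneg (fun j => mul_nonneg (sq_nonneg _)
    (mul_nonneg (majorant_nonneg hM hc.le hcM' _) hD0)) ((hsub.mul_right D).mul_left N)]
  refine ofReal_le_ofReal ?_
  rw [tsum_mul_left, tsum_mul_right]
  gcongr
  exact hsub.tsum_le_tsum_of_inj _ hinj (fun _ _ => majorant_nonneg hM hc.le hcM' _) (fun _ => le_rfl) hsum

end Scaling

/-! ### Limit of the variance and identification with osfBm -/

section Limits

variable {M : ℕ} [NeZero M] {c : ℝ}

lemma timeSeq_pos (hc : 0 < c) (n : ℕ) : 0 < timeSeq M c n := by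
  have := aConst_pos (M := M) hc
  rw [timeSeq]; positivity

lemma norming_pos (hc : 0 < c) (n : ℕ) : 0 < norming M c (timeSeq M c n) :=
  Real.rpow_pos_of_pos (timeSeq_pos hc n) _

lemma summable_covTerm (hM : 1 < M) (hc : 1 < c) (hcM : c < sqrt M) {s t : ℝ} (hs : 0 ≤ s) (ht : 0 ≤ t) :
    Summable (covTerm M c s t) :=
  Summable.of_nonneg_of_le (fun i => (covTerm_bounds hM hc hcM hs ht (le_max_left s t) (le_max_right s t) i).1)
    (fun i => (covTerm_bounds hM hc hcM hs ht (le_max_left s t) (le_max_right s t) i).2)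
    ((summable_majorant hM hc hcM).mul_right _)

lemma bil_box_zero (hM : 1 < M) (hc : 1 < c) (hcM : c < sqrt M) (n : ℕ) {s t : ℝ} (hs : 0 ≤ s) (ht : 0 ≤ t) :
    bil (tkernel M c) (box 0 (timeSeq M c n * s)) (box 0 (timeSeq M c n * t)) 0 =
      ofReal (norming M c (timeSeq M c n) ^ 2 * ∑' j : ℕ, covTerm M c s t ((j:ℤ) - n)) := by
  have hcM' := lt_of_lt_sqrt hM hcM
  have hT := timeSeq_pos (M := M) (c := c) (by linarith) n
  have h1 := one_sub_inv_pos hM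
  have hinj : Function.Injective fun j : ℕ => (j:ℤ) - n := fun i j h => by simpa using h
  rw [bil_zero hM hc.le hcM' (measurable_box _ _) (measurable_box _ _), ← tsum_mul_left,
    ofReal_tsum_of_nonneg (fun j => mul_nonneg (sq_nonneg _)
      (covTerm_bounds hM hc hcM hs ht (le_max_left s t) (le_max_right s t) _).1)
      (((summable_covTerm hM hc hcM hs ht).comp_injective hinj).mul_left _)]
  refine tsum_congr fun j => ?_
  rw [(decay_box_zero (rate_pos hM hc.le hcM' j) (by positivity) (by positivity)).1, wt,
    ← ofReal_mul (by positivity), rate_shift (by linarith), rate_shift (by linarith), covTerm,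
    ← mul_assoc, ← mul_assoc, kap_shift hM hc hcM n j]

/-- The shifted sum is the sum over ℤ restricted to indices ≥ -n, and the restriction disappears in
the limit. -/
lemma tendsto_tsum_shift {f : ℤ → ℝ} (hf : Summable f) (h0 : ∀ i, 0 ≤ f i) :
    Tendsto (fun n : ℕ => ∑' j : ℕ, f ((j:ℤ) - n)) atTop (𝓝 (∑' i, f i)) := by
  have e : ∀ n : ℕ, ∑' j : ℕ, f ((j:ℤ) - n) = ∑' i : ℤ, indicator {i | -(n:ℤ) ≤ i} f i := by
    intro n
    have hinj : Function.Injective fun j : ℕ => (j:ℤ) - n := fun i j h => by simpa using h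
    rw [← hinj.tsum_eq (f := indicator {i | -(n:ℤ) ≤ i} f)]
    · refine tsum_congr fun j => ?_
      exact (indicator_of_mem (s := {i | -(n:ℤ) ≤ i}) (show -(n:ℤ) ≤ (j:ℤ) - n by omega) f).symm
    · intro i hi
      have : -(n:ℤ) ≤ i := Set.mem_of_indicator_ne_zero (s := {i | -(n:ℤ) ≤ i}) hi
      exact ⟨(i + n).toNat, by dsimp only; omega⟩
  simp_rw [e]
  refine tendsto_tsum_of_dominated_convergence hf (fun i => ?_) (Eventually.of_forall fun n i => ?_)
  · refine tendsto_const_nhds.congr' ?_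
    filter_upwards [eventually_ge_atTop (-i).toNat] with n hn
    exact (indicator_of_mem (s := {i | -(n:ℤ) ≤ i}) (show -(n:ℤ) ≤ i by omega) f).symm
  · rw [norm_of_nonneg (Set.indicator_nonneg (fun i _ => h0 i) i)]
    exact Set.indicator_le_self' (fun i _ => h0 i) i

/-- Scaling limit of the variance form. -/
lemma tendsto_bil (hM : 1 < M) (hc : 1 < c) (hcM : c < sqrt M) (hk : SymmSemigroup (tkernel M c))
    {s t : ℝ} (hs : 0 ≤ s) (ht : 0 ≤ t) (z : HierGroup M) :
    Tendsto (fun n => (bil (tkernel M c) (box 0 (timeSeq M c n * s)) (box 0 (timeSeq M c n * t)) z).toReal /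
      norming M c (timeSeq M c n) ^ 2) atTop (𝓝 (∑' i, covTerm M c s t i)) := by
  have hcM' := lt_of_lt_sqrt hM hcM
  have ha := aConst_pos (M := M) (c := c) (by linarith)
  have hT := timeSeq_pos (M := M) (c := c) (by linarith)
  have hN : ∀ n, 0 < norming M c (timeSeq M c n) ^ 2 := fun n => pow_pos (norming_pos (by linarith) n) 2
  set m := max s t with hm
  have hlim := tendsto_tsum_shift (summable_covTerm hM hc hcM hs ht)
    (fun i => (covTerm_bounds hM hc hcM hs ht (le_max_left s t) (le_max_right s t) i).1)
  have hnn : ∀ n : ℕ, 0 ≤ ∑' j : ℕ, covTerm M c s t ((j:ℤ) - n) := fun n => tsum_nonneg fun j =>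
    (covTerm_bounds hM hc hcM hs ht (le_max_left s t) (le_max_right s t) _).1
  have hzero := fun n => bil_box_zero hM hc hcM n hs ht
  -- The constant comes from `psi_le` with θ = 1, hence linear growth in T_n, and 3 = 2 · 3/2.
  set D := ∑ j ∈ range (hdist 0 z), 3 * ((bConst M c * aConst M c ^ j) ^ 3)⁻¹ * (bConst M c * aConst M c ^ j) * m
    with hD
  have hβ := rate_pos hM hc.le hcM'
  have hD0 : 0 ≤ D := sum_nonneg fun j _ => by have := hβ j; positivity
  have hup : ∀ n : ℕ, (bil (tkernel M c) (box 0 (timeSeq M c n * s)) (box 0 (timeSeq M c n * t)) z).toReal /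
      norming M c (timeSeq M c n) ^ 2 ≤ ∑' j : ℕ, covTerm M c s t ((j:ℤ) - n) := by
    intro n
    have h := toReal_mono (hzero n ▸ ofReal_ne_top) (bil_le_zero hk (box 0 (timeSeq M c n * s)) (box 0 (timeSeq M c n * t)) z)
    rw [hzero n, toReal_ofReal (mul_nonneg (hN n).le (hnn n))] at h
    rwa [div_le_iff₀' (hN n)]
  have hlow : ∀ n : ℕ, ∑' j : ℕ, covTerm M c s t ((j:ℤ) - n) - D * (M * aConst M c ^ 2) ^ n ≤
      (bil (tkernel M c) (box 0 (timeSeq M c n * s)) (box 0 (timeSeq M c n * t)) z).toReal /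
      norming M c (timeSeq M c n) ^ 2 := by
    intro n
    have hfin : bil (tkernel M c) (box 0 (timeSeq M c n * s)) (box 0 (timeSeq M c n * t)) z ≠ ⊤ :=
      ne_top_of_le_ne_top (hzero n ▸ ofReal_ne_top) (bil_le_zero hk _ _ z)
    have h := bil_zero_le hM hc.le hcM' (measurable_box 0 (timeSeq M c n * s)) (measurable_box 0 (timeSeq M c n * t)) z
    have h2 : ∑ j ∈ range (hdist 0 z), 2 * decay (bConst M c * aConst M c ^ j)
        (box 0 (timeSeq M c n * s)) (box 0 (timeSeq M c n * t)) ≤ ofReal (D * timeSeq M c n) := by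
      rw [hD, sum_mul, ENNReal.ofReal_sum_of_nonneg fun j _ => by
        have := hβ j; have := hT n; positivity]
      refine sum_le_sum fun j _ => ?_
      have hTn := hT n
      have hbj := hβ j
      rw [(decay_box_zero hbj (by positivity) (by positivity)).1, ← ENNReal.ofReal_ofNat 2,
        ← ofReal_mul (by norm_num)]
      refine ofReal_le_ofReal ?_
      have h3 := psi_le hbj (s := timeSeq M c n * s) (t := timeSeq M c n * t) (m := timeSeq M c n * m)
        (by positivity) (by positivity) (mul_le_mul_of_nonneg_left (le_max_left s t) hTn.le)
        (mul_le_mul_of_nonneg_left (le_max_right s t) hTn.le) le_rfl (by norm_num : (1:ℝ) ≤ 2)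
      rw [rpow_one] at h3
      linarith
    have h3 := h.trans (add_le_add le_rfl h2)
    rw [hzero n, ← ENNReal.ofReal_toReal hfin, ← ofReal_add toReal_nonneg
      (mul_nonneg hD0 (hT n).le), ENNReal.ofReal_le_ofReal_iff (add_nonneg toReal_nonneg
      (mul_nonneg hD0 (hT n).le))] at h3
    rw [le_div_iff₀ (hN n), sub_mul]
    -- This is T_n/F² = (M a²)^n, so the off-diagonal correction disappears after normalization.
    have e : D * (M * aConst M c ^ 2) ^ n * norming M c (timeSeq M c n) ^ 2 = D * timeSeq M c n := by
      rw [norming_sq hM hc hcM, timeSeq, mul_pow, mul_pow]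
      field_simp
      ring
    rw [e]; linarith
  have hr := mul_aConst_sq_lt_one hM hc hcM
  refine tendsto_of_tendsto_of_tendsto_of_le_of_le ?_ hlim hlow hup
  have := (tendsto_pow_atTop_nhds_zero_of_lt_one (by positivity) hr).const_mul D
  simpa using hlim.sub this

lemma gfun_nonneg (x : ℝ) : 0 ≤ gfun x := by
  have := add_one_le_exp (-x)
  unfold gfun; linarith

lemma gfun_le_rpow {x θ : ℝ} (hx : 0 ≤ x) (h1 : 1 ≤ θ) (h2 : θ ≤ 2) : gfun x ≤ x ^ θ := by
  rcases le_total x 1 with h | h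
  · have h3 := le_of_abs_le (Real.abs_exp_sub_one_sub_id_le (x := -x) (by rwa [abs_neg, abs_of_nonneg hx]))
    have h4 : x ^ (2:ℝ) ≤ x ^ θ := Real.rpow_le_rpow_of_exponent_ge_of_imp hx h h2 (by intros; linarith)
    rw [rpow_two] at h4
    unfold gfun; nlinarith
  · have h3 : rexp (-x) ≤ 1 := exp_le_one_iff.2 (by linarith)
    have h4 : x ^ (1:ℝ) ≤ x ^ θ := Real.rpow_le_rpow_of_exponent_le h h1
    rw [rpow_one] at h4
    unfold gfun; linarith

lemma summable_kap_gfun (hM : 1 < M) (hc : 1 < c) (hcM : c < sqrt M) {u : ℝ} (hu : 0 ≤ u) :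
    Summable fun i : ℤ => kap M c i * gfun (bConst M c * aConst M c ^ i * u) := by
  have hcM' := lt_of_lt_sqrt hM hcM
  have ha := aConst_pos (M := M) (c := c) (by linarith)
  have hb := bConst_pos hM hcM'
  refine Summable.of_nonneg_of_le (fun i => mul_nonneg (kap_pos hM hc.le hcM' i).le (gfun_nonneg _)) (fun i => ?_)
    ((summable_majorant hM hc hcM).mul_right ((1 + u) * u ^ (1 + epsExp M c)))
  have hk := kap_pos hM hc.le hcM' i
  have hθ := theta_mem hM hc hcM i
  have hβ : 0 < bConst M c * aConst M c ^ i := by positivity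
  have h1 := gfun_le_rpow (x := bConst M c * aConst M c ^ i * u) (by positivity) hθ.1 hθ.2
  rw [mul_rpow hβ.le hu] at h1
  have h2 := rpow_theta_le hM hc hcM i hu
  calc _ ≤ kap M c i * ((bConst M c * aConst M c ^ i) ^ thetaExp M c i * ((1 + u) * u ^ (1 + epsExp M c))) := by
        gcongr
        exact h1.trans (by gcongr)
    _ = 2 / 3 * (majorant M c i * ((1 + u) * u ^ (1 + epsExp M c))) := by rw [majorant]; ring
    _ ≤ _ := by
        have := mul_nonneg (majorant_nonneg hM hc.le hcM' i) (show 0 ≤ (1 + u) * u ^ (1 + epsExp M c) by positivity)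
        linarith

lemma KConst_sq (hM : 1 < M) (hcM : c < M) {V : ℝ} (hV : 0 < V) (lam : ℝ≥0) :
    KConst M c V lam ^ 2 = lam * V * ((1 - (M:ℝ)⁻¹) * (bConst M c ^ (1 + degree M c))⁻¹) := by
  have hM1 : (1:ℝ) < M := by exact_mod_cast hM
  have hb := bConst_pos hM hcM
  rw [KConst, Real.sq_sqrt (div_nonneg (mul_nonneg (mul_nonneg lam.coe_nonneg hV.le) (by linarith)) (by positivity))]
  field_simp

/-- With β = b a^i one has β^{1+γ} = b^{1+γ} M^{-i} and 2H = 3 - (1 + γ). The powers of β in h thus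
turn into the spectral weight, and b^{1+γ} is the factor compensated by K. -/
lemma KConst_sq_mul_hOsc (hM : 1 < M) (hc : 1 < c) (hcM : c < sqrt M) {V : ℝ} (hV : 0 < V) (lam : ℝ≥0)
    {u : ℝ} (hu : 0 ≤ u) : KConst M c V lam ^ 2 * (u ^ (2 * hurst M c) *
      hOsc (aConst M c) (bConst M c) (hurst M c) u) =
      lam * V * ∑' i : ℤ, kap M c i * gfun (bConst M c * aConst M c ^ i * u) := by
  have hcM' := lt_of_lt_sqrt hM hcM
  have ha := aConst_pos (M := M) (c := c) (by linarith)
  have hb := bConst_pos hM hcM'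
  rw [KConst_sq hM hcM' hV, mul_assoc]
  congr 1
  rcases hu.eq_or_lt with rfl | hu
  · simp [hOsc, gfun]
  rw [hOsc, if_pos hu, ← tsum_mul_left, ← tsum_mul_left]
  refine tsum_congr fun i => ?_
  have hβ : 0 < bConst M c * aConst M c ^ i := by positivity
  set β := bConst M c * aConst M c ^ i with hβd
  have e1 : u ^ (2 * hurst M c) * (β * u) ^ (-(2 * hurst M c)) = β ^ (1 + degree M c) * (β ^ 3)⁻¹ := by
    rw [mul_rpow hβ.le hu.le, rpow_neg hu.le, mul_left_comm, mul_inv_cancel₀ (by positivity), mul_one,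
      ← rpow_natCast, ← rpow_neg hβ.le, ← rpow_add hβ, hurst]
    congr 1; push_cast; ring
  have e2 : β ^ (1 + degree M c) = bConst M c ^ (1 + degree M c) * ((M:ℝ)⁻¹) ^ i := by
    rw [hβd, mul_rpow hb.le (by positivity), ← aConst_rpow hM hc hcM, ← Real.rpow_intCast,
      ← Real.rpow_intCast, ← rpow_mul ha.le, ← rpow_mul ha.le, mul_comm (i:ℝ)]
  calc _ = (1 - (M:ℝ)⁻¹) * (bConst M c ^ (1 + degree M c))⁻¹ *
        (u ^ (2 * hurst M c) * (β * u) ^ (-(2 * hurst M c))) * gfun (β * u) := by rw [gfun]; ring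
    _ = _ := by
        rw [e1, e2, kap, ← hβd]
        field_simp

/-- The limiting covariance is that of a multiple of osfBm. -/
lemma KConst_sq_mul_osfBmCov (hM : 1 < M) (hc : 1 < c) (hcM : c < sqrt M) {V : ℝ} (hV : 0 < V) (lam : ℝ≥0)
    {s t : ℝ} (hs : 0 ≤ s) (ht : 0 ≤ t) : KConst M c V lam ^ 2 *
      osfBmCov (aConst M c) (bConst M c) (hurst M c) s t = lam * V * ∑' i : ℤ, covTerm M c s t i := by
  have hcM' := lt_of_lt_sqrt hM hcM
  have ha := aConst_pos (M := M) (c := c) (by linarith)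
  have hb := bConst_pos hM hcM'
  have h := fun {u : ℝ} (hu : 0 ≤ u) => KConst_sq_mul_hOsc hM hc hcM hV lam hu
  have hS := fun {u : ℝ} (hu : 0 ≤ u) => (summable_kap_gfun hM hc hcM hu).hasSum
  have hsum := ((hS hs).add (hS ht)).sub (((hS (add_nonneg hs ht)).add (hS (abs_nonneg (s - t)))).mul_left (1/2))
  have e : ∀ i, covTerm M c s t i = kap M c i * gfun (bConst M c * aConst M c ^ i * s) +
      kap M c i * gfun (bConst M c * aConst M c ^ i * t) -
      1 / 2 * (kap M c i * gfun (bConst M c * aConst M c ^ i * (s + t)) +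
        kap M c i * gfun (bConst M c * aConst M c ^ i * |s - t|)) := by
    intro i
    have hβ : 0 < bConst M c * aConst M c ^ i := by positivity
    rw [covTerm, psi, ← mul_sub, abs_mul, abs_of_pos hβ, ← mul_add]; ring
  rw [tsum_congr e, hsum.tsum_eq, osfBmCov, mul_sub, mul_add, h hs, h ht,
    show ∀ k a b : ℝ, k * (1 / 2 * (a + b)) = 1 / 2 * (k * a + k * b) by intros; ring,
    h (add_nonneg hs ht), h (abs_nonneg _)]
  ring

end Limits

/-! ### Convergence of finite-dimensional characteristic functions and increment bounds -/

section Bounds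

lemma bil_mono {H : Type*} [AddCommGroup H] (k : ℝ → H → ℝ≥0∞) {f f' g g' : ℝ → ℝ≥0∞} (hf : ∀ s, f s ≤ f' s)
    (hg : ∀ s, g s ≤ g' s) (z : H) : bil k f g z ≤ bil k f' g' z :=
  lintegral_mono fun _ => lintegral_mono fun _ => lintegral_mono fun _ =>
    mul_le_mul' le_rfl (mul_le_mul' (hf _) (hg _))

lemma box_mono {u v v' : ℝ} (h : v ≤ v') (s : ℝ) : box u v s ≤ box u v' s :=
  Set.indicator_le_indicator_of_subset (Set.Ioc_subset_Ioc_right h) (fun _ => zero_le) s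

lemma qform_comb_le {H : Type*} [AddCommGroup H] [Countable H] {k : ℝ → H → ℝ≥0∞} (hk : SymmSemigroup k)
    {ι : Type*} {W : Finset ι} {A : ι → ℝ≥0∞} {F : ι → ℝ → ℝ≥0∞} {x : ι → H} (hF : ∀ i, Measurable (F i)) (V : ℝ)
    {K : ℝ≥0∞} (hK : ∀ i j z, bil k (F i) (F j) z ≤ K) :
    qform k V (comb W A F x) ≤ ofReal V * ((∑ i ∈ W, A i) ^ 2 * K) := by
  rw [qform_comb hk hF, sq, sum_mul_sum, sum_mul]
  refine mul_le_mul' le_rfl (sum_le_sum fun i _ => ?_)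
  rw [sum_mul]
  exact sum_le_sum fun j _ => mul_le_mul' le_rfl (hK i j _)

lemma avg_pot_comb_le {H : Type*} [AddCommGroup H] [Countable H] {k : ℝ → H → ℝ≥0∞} (hk : SymmSemigroup k)
    {ι : Type*} (W : Finset ι) (A : ι → ℝ≥0∞) (u v : ι → ℝ) (x : ι → H) {r : ℝ} (hr : 0 ≤ r) (s : ℝ) (y : H) :
    avg k r (pot k (comb W A (fun i => box (u i) (v i)) x) s) y ≤
      (∑ i ∈ W, A i) * ∫⁻ r' in Ioi (0:ℝ), k (r + r') 0 := by
  have hb : ∀ i, Measurable (box (u i) (v i)) := fun i => measurable_box _ _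
  have e : avg k r (pot k (comb W A (fun i => box (u i) (v i)) x) s) y =
      ∑ i ∈ W, A i * avg k r (pot k (siteFn (box (u i) (v i)) (x i)) s) y := by
    unfold avg
    simp_rw [pot_comb hk hb, mul_sum]
    rw [Summable.tsum_finsetSum fun _ _ => summable]
    refine sum_congr rfl fun i _ => ?_
    rw [← ENNReal.tsum_mul_left]
    exact tsum_congr fun z => by ring
  rw [e, sum_mul]
  refine sum_le_sum fun i _ => mul_le_mul' le_rfl
    (avg_pot_siteFn_le hk (hb i) (fun s => ?_) _ hr s y)
  exact Set.indicator_le_self' (fun _ _ => zero_le) s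

lemma tendsto_mul_zero {f g : ℕ → ℝ≥0∞} (hf : Tendsto f atTop (𝓝 0)) (hg : Tendsto g atTop (𝓝 0)) :
    Tendsto (fun n => f n * g n) atTop (𝓝 0) := by
  simpa using ENNReal.Tendsto.mul hf (Or.inr zero_ne_top) hg (Or.inr zero_ne_top)

lemma tendsto_const_mul_zero {f : ℕ → ℝ≥0∞} (hf : Tendsto f atTop (𝓝 0)) {K : ℝ≥0∞} (hK : K ≠ ⊤) :
    Tendsto (fun n => K * f n) atTop (𝓝 0) := by
  simpa using ENNReal.Tendsto.const_mul hf (Or.inr hK)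

/-- After expansion every term contains a small factor: a, B, or the product of a or B with a times
the mass. -/
lemma tendsto_third_bound {a W Q B : ℕ → ℝ≥0∞} {q L l v : ℝ≥0∞} (ha : Tendsto a atTop (𝓝 0))
    (hB : Tendsto B atTop (𝓝 0)) (haI : Tendsto (fun n => a n * W n) atTop (𝓝 0)) (hQ : ∀ n, Q n ≤ q)
    (hq : q ≠ ⊤) (hL : L ≠ ⊤) (hl : l ≠ ⊤) (hv : v ≠ ⊤) :
    Tendsto (fun n => (7 * a n ^ 2 + 3 * (3 * a n ^ 2 * L + a n * (v * B n))) * (L * W n) +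
      3 * (v * (3 * a n * (a n * (l * W n) + v * (l * Q n)) + v * (B n * Q n)))) atTop (𝓝 0) := by
  have h1 := tendsto_mul_zero ha haI
  have h2 := tendsto_mul_zero hB haI
  have h := (tendsto_const_mul_zero h1 (K := 7 * L + 9 * L * L + 9 * v * l) (by finiteness)).add
    ((tendsto_const_mul_zero h2 (K := 3 * v * L) (by finiteness)).add
      ((tendsto_const_mul_zero ha (K := 9 * v * v * l * q) (by finiteness)).add
      (tendsto_const_mul_zero hB (K := 3 * v * v * q) (by finiteness))))
  simp only [add_zero] at h
  refine tendsto_of_tendsto_of_tendsto_of_le_of_le tendsto_const_nhds h (fun _ => zero_le) fun n => ?_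
  calc _ = (7 * L + 9 * L * L + 9 * v * l) * (a n * (a n * W n)) + (3 * v * L * (B n * (a n * W n)) +
        (9 * v * v * l * Q n * a n + 3 * v * v * Q n * B n)) := by ring
    _ ≤ _ := by
        gcongr <;> exact hQ n

end Bounds

namespace PoissonBranchingSystem

variable {M : ℕ} [NeZero M] {c V : ℝ} {lam : ℝ≥0} {Ω : Type*} [mΩ : MeasurableSpace Ω] {P : Measure Ω}
  [IsProbabilityMeasure P] (S : PoissonBranchingSystem M c V lam P)

lemma sum_ofReal_abs_div {ι : Type*} (W : Finset ι) (D : ι → ℝ) {F : ℝ} (hF : 0 < F) :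
    ∑ i ∈ W, ofReal |D i / F| = ofReal ((∑ i ∈ W, |D i|) / F) := by
  rw [sum_div, ENNReal.ofReal_sum_of_nonneg fun i _ => by positivity]
  exact sum_congr rfl fun i _ => by rw [abs_div, abs_of_pos hF]

/-- Convergence of the characteristic functions of linear combinations of rescaled occupation times. -/
lemma tendsto_charFun (hM : 1 < M) (hc : 1 < c) (hcM : c < sqrt M) (hV : 0 < V) {ι : Type*} [Fintype ι]
    (D : ι → ℝ) (x : ι → HierGroup M) {t : ι → ℝ} (ht : ∀ i, 0 ≤ t i) :
    Tendsto (fun n => ∫ ω, cexp (I * ((∑ i, D i / norming M c (timeSeq M c n) *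
        ((S.occTime (timeSeq M c n * t i) (x i) ω).toReal - lam * (timeSeq M c n * t i)) : ℝ) : ℂ)) ∂P) atTop
      (𝓝 (cexp (-(lam * V * ∑ i, ∑ j, D i * D j * ∑' l, covTerm M c (t i) (t j) l) / 2 : ℝ))) := by
  have hcM' := lt_of_lt_sqrt hM hcM
  have hk : SymmSemigroup (tkernel M c) := (S.isBranching hM hc.le hcM' hV).semigroup
  have ha0 := aConst_pos (M := M) (c := c) (by linarith)
  have ha1 := aConst_lt_one (M := M) hcM'
  set F := fun n => norming M c (timeSeq M c n) with hFd
  set T := fun n => timeSeq M c n with hTd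
  have hT : ∀ n, 0 < T n := timeSeq_pos (M := M) (c := c) (by linarith)
  have hF : ∀ n, 0 < F n := norming_pos (M := M) (c := c) (by linarith)
  have hg := green_ne_top hM hc hcM'
  set A := ∑ i, |D i| with hA
  have hA0 : 0 ≤ A := sum_nonneg fun i _ => abs_nonneg _
  set τ := ∑ i, t i with hτ
  have hτ0 : 0 ≤ τ := sum_nonneg fun i _ => ht i
  have htτ : ∀ i, t i ≤ τ := fun i => Finset.single_le_sum (fun i _ => ht i) (Finset.mem_univ i)
  set C := fun n i => D i / F n with hC
  set G := fun n => posComb (M := M) univ (fun i => |C n i|) (fun _ => 0) (fun i => T n * t i) x with hG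
  have hGadd := fun n => posComb_add (M := M) univ (C n) (fun _ => 0) (fun i => T n * t i) x
  have hb : ∀ n i, Measurable (box 0 (T n * t i)) := fun n i => measurable_box _ _
  have hAn : ∀ n, ∑ i, ofReal |C n i| = ofReal (A / F n) := fun n =>
    sum_ofReal_abs_div _ _ (hF n)
  -- the four sequences controlling the error
  set a : ℕ → ℝ≥0∞ := fun n => ofReal (A / F n) *
    (min 1 (ofReal (T n * τ)) * (1 + green (tkernel M c))) with had
  set B : ℕ → ℝ≥0∞ := fun n => ∫⁻ r in Ioc 0 (T n * τ), ofReal (A / F n) * tailGreen M c r with hBd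
  have hcomb := fun n (C' : ι → ℝ) => isOccTest_comb (W := univ) (x := x)
    (A := fun i => ofReal (C' i)) (u := fun _ => 0) (v := fun i => T n * t i) (T := T n * τ)
    (w := T n * τ) hk hg (fun i => ofReal_ne_top)
    (fun i => mul_le_mul_of_nonneg_left (htτ i) (hT n).le)
    (fun i => by rw [sub_zero]; exact mul_le_mul_of_nonneg_left (htτ i) (hT n).le)
  have hocc : ∀ n, IsOccTest (tkernel M c) (G n) (T n * τ) (a n) := fun n => by
    have h := hcomb n fun i => |C n i|
    rwa [hAn n] at h
  have hmass : ∀ n, mass (G n) ≤ ofReal (A / F n) * ofReal (T n * τ) := by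
    intro n
    rw [hG]
    dsimp only [posComb]
    rw [mass_comb (hb n), ← hAn n, sum_mul]
    refine sum_le_sum fun i _ => mul_le_mul' le_rfl ?_
    rw [lintegral_box le_rfl, sub_zero]
    exact ofReal_le_ofReal (mul_le_mul_of_nonneg_left (htτ i) (hT n).le)
  set Λ := (∑' i, majorant M c i) * ((1 + (τ - 0)) * (τ - 0) ^ (1 + epsExp M c)) with hΛ
  have hbil : ∀ n i j z, bil (tkernel M c) (box 0 (T n * t i)) (box 0 (T n * t j)) z ≤
      ofReal (F n ^ 2 * Λ) := by
    intro n i j z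
    have h := bil_box_le hM hc hcM hk n le_rfl hτ0 z
    rw [mul_zero] at h
    exact (bil_mono _ (box_mono (mul_le_mul_of_nonneg_left (htτ i) (hT n).le))
      (box_mono (mul_le_mul_of_nonneg_left (htτ j) (hT n).le)) z).trans h
  have hq : ∀ n, qform (tkernel M c) V (G n) ≤ ofReal V * ofReal (A ^ 2 * Λ) := by
    intro n
    refine (qform_comb_le hk (hb n) V (fun i j z => hbil n i j z)).trans ?_
    rw [hAn n, ← ofReal_pow (div_nonneg hA0 (hF n).le), ← ofReal_mul (by positivity)]
    refine mul_le_mul' le_rfl (ofReal_le_ofReal (le_of_eq ?_))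
    have := (hF n).ne'
    field_simp
  have havg : ∀ n s r y, 0 ≤ s → 0 ≤ r → avg (tkernel M c) r (pot (tkernel M c) (G n) s) y ≤
      ofReal (A / F n) * tailGreen M c r := by
    intro n s r y _ hr
    rw [← hAn n]
    exact avg_pot_comb_le hk _ _ _ _ _ hr s y
  -- their limits
  obtain ⟨Cg, hCg, hCg'⟩ := exists_lintegral_tailGreen_le hM hc hcM
  have hTinf : Tendsto T atTop atTop := by
    rw [hTd]
    simp only [timeSeq, ← inv_pow]
    exact tendsto_pow_atTop_atTop_of_one_lt (one_lt_inv₀ ha0 |>.2 ha1)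
  have hFinf : Tendsto F atTop atTop := by
    refine (tendsto_rpow_atTop ?_).comp ?_
    · have := degree_lt_one hM hc hcM; linarith
    · exact hTinf
  have hale : ∀ n, a n ≤ (1 + green (tkernel M c)) * ofReal (A / F n) := fun n => by
    rw [had, mul_comm (1 + _)]
    refine mul_le_mul' le_rfl ?_
    calc _ ≤ 1 * (1 + green (tkernel M c)) := mul_le_mul' (min_le_left _ _) le_rfl
      _ = _ := one_mul _
  have hgt : 1 + green (tkernel M c) ≠ ⊤ := by finiteness
  have hzero : ∀ {f : ℕ → ℝ}, Tendsto f atTop (𝓝 0) → Tendsto (fun n => ofReal (f n)) atTop (𝓝 0) :=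
    fun h => by simpa using ENNReal.tendsto_ofReal h
  have hAF : Tendsto (fun n => A / F n) atTop (𝓝 0) := hFinf.const_div_atTop A
  have ha : Tendsto a atTop (𝓝 0) := tendsto_of_tendsto_of_tendsto_of_le_of_le tendsto_const_nhds
    (tendsto_const_mul_zero (hzero hAF) hgt) (fun _ => zero_le) hale
  -- F grows like T^{1-γ/2} and the integrated Green tail at most like T^{1-3γ/4}, so the quotient
  -- is of order T^{-γ/4}.
  have hB : Tendsto B atTop (𝓝 0) := by
    have hle : ∀ n, B n ≤ ofReal (A * (Cg * τ ^ (1 - 3 * degree M c / 4)) *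
        T n ^ (-(degree M c / 4))) := by
      intro n
      rw [hBd]
      dsimp only
      rw [lintegral_const_mul _ (measurable_tailGreen hk)]
      refine (mul_le_mul' le_rfl (hCg' _ (mul_nonneg (hT n).le hτ0))).trans ?_
      rw [← ofReal_mul (div_nonneg hA0 (hF n).le), mul_rpow (hT n).le hτ0]
      refine ofReal_le_ofReal (le_of_eq ?_)
      have e : F n * T n ^ (-(degree M c / 4)) = T n ^ (1 - 3 * degree M c / 4) := by
        rw [hFd]; dsimp only
        rw [norming, ← rpow_add (hT n)]
        congr 1; ring
      rw [← e]
      have := (hF n).ne'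
      have e2 : A / F n * (Cg * (F n * T n ^ (-(degree M c / 4)) * τ ^ (1 - 3 * degree M c / 4))) =
        (F n / F n) * (A * (Cg * τ ^ (1 - 3 * degree M c / 4)) * T n ^ (-(degree M c / 4))) := by ring
      rw [e2, div_self this, one_mul]
    refine tendsto_of_tendsto_of_tendsto_of_le_of_le tendsto_const_nhds (hzero ?_) (fun _ => zero_le) hle
    have h := ((tendsto_rpow_neg_atTop (y := degree M c / 4) (by have := degree_pos hM hc hcM; linarith)).comp
      hTinf).const_mul (A * (Cg * τ ^ (1 - 3 * degree M c / 4)))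
    simpa using h
  -- a is O(1/F) and the mass is O(T/F), so the product is of order T/F² = (M a²)^n.
  have haI : Tendsto (fun n => a n * mass (G n)) atTop (𝓝 0) := by
    have hr := mul_aConst_sq_lt_one hM hc hcM
    have hle : ∀ n, a n * mass (G n) ≤ (1 + green (tkernel M c)) *
        ofReal (A ^ 2 * τ * (M * aConst M c ^ 2) ^ n) := by
      intro n
      refine (mul_le_mul' (hale n) (hmass n)).trans ?_
      rw [mul_assoc, ← ofReal_mul (div_nonneg hA0 (hF n).le), ← ofReal_mul (div_nonneg hA0 (hF n).le)]
      refine mul_le_mul' le_rfl (ofReal_le_ofReal (le_of_eq ?_))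
      have e : T n * (F n ^ 2)⁻¹ = (M * aConst M c ^ 2) ^ n := by
        rw [hFd, hTd]; dsimp only
        rw [norming_sq hM hc hcM, inv_inv, timeSeq, mul_pow, mul_pow]
        field_simp
        ring
      rw [← e]
      field_simp
    refine tendsto_of_tendsto_of_tendsto_of_le_of_le tendsto_const_nhds
      (tendsto_const_mul_zero (hzero ?_) hgt) (fun _ => zero_le) hle
    simpa using (tendsto_pow_atTop_nhds_zero_of_lt_one (by positivity) hr).const_mul (A ^ 2 * τ)
  have hane : ∀ n, a n ≠ ⊤ := fun n => (hocc n).ne_top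
  have hIne : ∀ n, mass (G n) ≠ ⊤ := fun n => ne_top_of_le_ne_top (by finiteness) (hmass n)
  have hqne : ∀ n, qform (tkernel M c) V (G n) ≠ ⊤ := fun n => ne_top_of_le_ne_top (by finiteness) (hq n)
  have hBne : ∀ n, B n ≠ ⊤ := by
    intro n
    rw [hBd]; dsimp only
    rw [lintegral_const_mul _ (measurable_tailGreen hk)]
    have := ne_top_of_le_ne_top ofReal_ne_top (hCg' _ (mul_nonneg (hT n).le hτ0))
    finiteness
  have hl := lifeConst_ne_top hV
  set L := lifeConst V * (1 + ofReal V) with hLd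
  have hL : L ≠ ⊤ := by finiteness
  set Qp : ℕ → ℝ≥0∞ := fun n => ∫⁻ s in Ioi (0:ℝ), ∑' y, pot (tkernel M c) (G n) s y ^ 2 with hQp
  have hVQ : ∀ n, qform (tkernel M c) V (G n) = ofReal V * Qp n := fun n => rfl
  have hV0 : ofReal V ≠ 0 := (ofReal_pos.2 hV).ne'
  have hQle : ∀ n, Qp n ≤ ofReal (A ^ 2 * Λ) := fun n => by
    have := hq n
    rwa [hVQ, ENNReal.mul_le_mul_iff_right hV0 ofReal_ne_top] at this
  have hQpne : ∀ n, Qp n ≠ ⊤ := fun n => ne_top_of_le_ne_top ofReal_ne_top (hQle n)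
  -- These three are the right-hand sides of `secondBd_le`, of the single-particle error and of
  -- `tsum_thirdBd_le` for the rescaled test function.
  set c₂ : ℕ → ℝ≥0∞ := fun n => 3 * a n ^ 2 * L + a n * (ofReal V * B n) with hc₂d
  set e : ℕ → ℝ≥0∞ := fun n => 3 * L * (a n * mass (G n)) with hed
  set θ : ℕ → ℝ≥0∞ := fun n => (7 * a n ^ 2 + 3 * c₂ n) * (L * mass (G n)) +
    3 * (ofReal V * (3 * a n * (a n * (lifeConst V * mass (G n)) + ofReal V * (lifeConst V * Qp n)) +
      ofReal V * (B n * Qp n))) with hθd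
  have he0 : Tendsto e atTop (𝓝 0) := tendsto_const_mul_zero haI (by finiteness)
  have hθ0 : Tendsto θ atTop (𝓝 0) := tendsto_third_bound ha hB haI hQle ofReal_ne_top hL hl
    ofReal_ne_top
  have hene : ∀ n, e n ≠ ⊤ := fun n => by have := hane n; have := hIne n; finiteness
  have hθne : ∀ n, θ n ≠ ⊤ := fun n => by
    have := hane n; have := hIne n; have := hBne n; have := hQpne n
    simp only [hθd, hc₂d]; finiteness
  set X : ℕ → Ω → ℝ := fun n => S.centered (posComb univ (C n) (fun _ => 0) (fun i => T n * t i) x)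
    (posComb univ (fun i => -C n i) (fun _ => 0) (fun i => T n * t i) x) with hX
  set σ : ℕ → ℝ := fun n => V * ∑ i, ∑ j, C n i * C n j *
    (bil (tkernel M c) (box 0 (T n * t i)) (box 0 (T n * t j)) (x i - x j)).toReal with hσ
  have hmeas : ∀ n (C' : ι → ℝ) y, Measurable fun s => posComb univ C' (fun _ => 0) (fun i => T n * t i) x s y :=
    fun n C' y => (hcomb n C').meas y
  have hmain : ∀ n, ‖(∫ ω, cexp (I * ((X n ω : ℝ) : ℂ)) ∂P) - cexp (-(lam * σ n) / 2 : ℝ)‖ ≤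
      3 * lam * (4 * (θ n).toReal + 5 / 2 * (e n).toReal) := by
    intro n
    have h := S.norm_charFun_centered_sub_le hM hc.le hcM' hV (T := T n * τ) (a := a n) (c₂ := c₂ n) (e := e n)
      (t := θ n) (hmeas n (C n)) (hmeas n fun i => -C n i)
      (by rw [hGadd n]; exact hocc n) (by rw [hGadd n]; exact hIne n) (by rw [hGadd n]; exact hqne n)
      (by rw [hGadd n]
          exact fun s y hs => secondBd_le hk hV (hocc n).meas (hocc n).zero (hocc n).pot_le (havg n) s y hs)
      (hene n) (hθne n)
      (by rw [hGadd n]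
          refine (mul_le_mul' le_rfl (tsum_renewal_lifeOcc_le hk hV (hocc n).meas)).trans_eq ?_
          rw [hed]; dsimp only; rw [mass, hLd]; ring)
      (by rw [hGadd n]
          exact tsum_thirdBd_le hk hV (hocc n).meas (hocc n).zero (hocc n).pot_le (c₂ n)
            ((measurable_tailGreen hk).const_mul _) (havg n)) 1
    rw [hGadd n, qform_posComb hk univ (C n) (fun _ => 0) (fun i => T n * t i) x V hV.le
      (fun i j => ne_top_of_le_ne_top ofReal_ne_top (hbil n i j _))] at h
    simpa [hX, hσ, neg_div] using h
  have hlife := S.ae_life_nonneg hM hc.le hcM' hV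
  have hoc := S.ae_occTime_ne_top hM hc.le hcM' hV
  have hXeq : ∀ n, (∫ ω, cexp (I * ((∑ i, D i / F n *
        ((S.occTime (T n * t i) (x i) ω).toReal - lam * (T n * t i)) : ℝ) : ℂ)) ∂P) =
      ∫ ω, cexp (I * ((X n ω : ℝ) : ℂ)) ∂P := by
    intro n
    refine integral_congr_ae ?_
    filter_upwards [hlife, hoc] with ω h1 h2
    have h3 := S.centered_posComb univ (C n) (u := fun _ => 0) (v := fun i => T n * t i) (fun _ => le_rfl)
      (fun i => mul_nonneg (hT n).le (ht i)) x h1 h2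
    have h4 : ∀ y, S.occTime 0 y ω = 0 := fun y => by simp [occTime]
    simp only [h4, ENNReal.toReal_zero, sub_zero] at h3
    simp only [hX]
    rw [h3]
  have hσlim : Tendsto σ atTop (𝓝 (V * ∑ i, ∑ j, D i * D j * ∑' l, covTerm M c (t i) (t j) l)) := by
    have h : σ = fun n => V * ∑ i, ∑ j, D i * D j *
        ((bil (tkernel M c) (box 0 (T n * t i)) (box 0 (T n * t j)) (x i - x j)).toReal / F n ^ 2) := by
      funext n
      simp only [hσ, hC]
      congr 1
      refine sum_congr rfl fun i _ => sum_congr rfl fun j _ => ?_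
      ring
    rw [h]
    exact (tendsto_finsetSum _ fun i _ => tendsto_finsetSum _ fun j _ =>
      (tendsto_bil hM hc hcM hk (ht i) (ht j) (x i - x j)).const_mul _).const_mul _
  have hcf : Tendsto (fun n => cexp (-(lam * σ n) / 2 : ℝ)) atTop
      (𝓝 (cexp (-(lam * V * ∑ i, ∑ j, D i * D j * ∑' l, covTerm M c (t i) (t j) l) / 2 : ℝ))) := by
    refine (Complex.continuous_exp.tendsto _).comp ((Complex.continuous_ofReal.tendsto _).comp ?_)
    have := ((hσlim.const_mul (lam:ℝ)).neg).div_const 2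
    simpa only [mul_assoc] using this
  refine Tendsto.congr (fun n => (hXeq n).symm) ?_
  have hdiff : Tendsto (fun n => (∫ ω, cexp (I * ((X n ω : ℝ) : ℂ)) ∂P) -
      cexp (-(lam * σ n) / 2 : ℝ)) atTop (𝓝 0) := by
    refine squeeze_zero_norm hmain ?_
    have h1 := (ENNReal.tendsto_toReal zero_ne_top).comp hθ0
    have h2 := (ENNReal.tendsto_toReal zero_ne_top).comp he0
    have := ((h1.const_mul 4).add (h2.const_mul (5/2))).const_mul (3 * (lam:ℝ))
    simpa using this
  simpa using hdiff.add hcf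

/-- The rescaled occupation time fluctuations at stage `n`. -/
def occFluct (B : Finset (HierGroup M)) (φ : HierGroup M → ℝ) (n : ℕ) (t : ℝ) (ω : Ω) : ℝ :=
  ∑ x ∈ B, φ x / norming M c (timeSeq M c n) *
    ((S.occTime (timeSeq M c n * t) x ω).toReal - lam * (timeSeq M c n * t))

/-- Uniform second moment bound for the increments. -/
lemma exists_lintegral_increment_le (hM : 1 < M) (hc : 1 < c) (hcM : c < sqrt M) (hV : 0 < V)
    (B : Finset (HierGroup M)) (φ : HierGroup M → ℝ) {τ : ℝ} (hτ : 0 ≤ τ) : ∃ K : ℝ, 0 ≤ K ∧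
    ∀ n s t, 0 ≤ s → s ≤ t → t ≤ τ → ∫⁻ ω, ofReal ((S.occFluct B φ n t ω - S.occFluct B φ n s ω) ^ 2) ∂P ≤
      ofReal (K * (t - s) ^ (1 + epsExp M c)) := by
  have hcM' := lt_of_lt_sqrt hM hcM
  have hk : SymmSemigroup (tkernel M c) := (S.isBranching hM hc.le hcM' hV).semigroup
  have ha0 := aConst_pos (M := M) (c := c) (by linarith)
  have ha1 := aConst_lt_one (M := M) hcM'
  have hg := green_ne_top hM hc hcM'
  have hε := eps_pos hM hc hcM
  have hl := lifeConst_ne_top hV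
  set A := ∑ x ∈ B, |φ x| with hA
  have hA0 : 0 ≤ A := sum_nonneg fun i _ => abs_nonneg _
  set L := lifeConst V * (1 + ofReal V) with hLd
  have hL : L ≠ ⊤ := by finiteness
  have hmaj : 0 ≤ ∑' i, majorant M c i := tsum_nonneg fun i => majorant_nonneg hM hc.le hcM' i
  set Λ := (∑' i, majorant M c i) * (1 + τ) with hΛ
  have hΛ0 : 0 ≤ Λ := by positivity
  set K : ℝ≥0∞ := 3 * (1 + green (tkernel M c)) * L * ofReal (A ^ 2) +
    ofReal V * ofReal (A ^ 2 * Λ) with hK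
  have hKt : K ≠ ⊤ := by finiteness
  refine ⟨24 * lam * K.toReal, by positivity, fun n s t hs hst htτ => ?_⟩
  set F := norming M c (timeSeq M c n) with hFd
  set T := timeSeq M c n with hTd
  have hT : 0 < T := timeSeq_pos (by linarith) n
  have hF : 0 < F := norming_pos (by linarith) n
  have hT1 : 1 ≤ T := (one_le_inv₀ (by positivity)).2 (pow_le_one₀ ha0.le ha1.le)
  have hts : 0 ≤ t - s := sub_nonneg.2 hst
  set D := (t - s) ^ (1 + epsExp M c) with hD
  have hD0 : 0 ≤ D := by positivity
  set C := fun x => φ x / F with hC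
  have hAn : ∑ x ∈ B, ofReal |C x| = ofReal (A / F) := sum_ofReal_abs_div _ _ hF
  have hw : ∀ _ : HierGroup M, T * t - T * s ≤ T * (t - s) := fun _ => (mul_sub T t s).ge
  have hGadd := posComb_add (M := M) B C (fun _ => T * s) (fun _ => T * t) id
  set G := posComb B (fun i => |C i|) (fun _ => T * s) (fun _ => T * t) id with hG
  have hb : ∀ _ : HierGroup M, Measurable (box (T * s) (T * t)) := fun _ => measurable_box _ _
  have hocc := fun C' : HierGroup M → ℝ => isOccTest_comb (W := B) (x := id) (A := fun i => ofReal (C' i))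
      (u := fun _ => T * s) (v := fun _ => T * t) (T := T * t) (w := T * (t - s)) hk hg
      (fun i => ofReal_ne_top) (fun i => le_rfl) hw
  set a := ofReal (A / F) * (min 1 (ofReal (T * (t - s))) * (1 + green (tkernel M c))) with ha
  have hoccG : IsOccTest (tkernel M c) G (T * t) a := by
    have := hocc fun i => |C i|
    rwa [hAn] at this
  have hmass : mass G = ofReal (A / F) * ofReal (T * (t - s)) := by
    rw [hG, posComb, mass_comb hb, ← hAn, sum_mul]
    refine sum_congr rfl fun i _ => ?_
    rw [lintegral_box (by positivity), mul_sub]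
  -- F² = T^{2-γ} and 2 - γ ≥ 1 + ε, while T ≥ 1.
  have hF2 : T ^ (1 + epsExp M c) ≤ F ^ 2 := by
    rw [hFd, norming, ← rpow_natCast, ← rpow_mul hT.le]
    refine Real.rpow_le_rpow_of_exponent_le hT1 ?_
    have := degree_lt_one hM hc hcM
    unfold epsExp; push_cast; linarith
  have h1 : a * mass G ≤ (1 + green (tkernel M c)) * ofReal (A ^ 2) * ofReal D := by
    -- The single-particle error is linear in the interval length through its mass; the factor
    -- min(1, w) ≤ w^ε supplies the missing power ε.
    have hmin : min 1 (ofReal (T * (t - s))) ≤ ofReal ((T * (t - s)) ^ epsExp M c) := by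
      rcases le_total 1 (T * (t - s)) with h | h
      · exact (min_le_left _ _).trans (one_le_ofReal.2 (Real.one_le_rpow h hε.1.le))
      · refine (min_le_right _ _).trans (ofReal_le_ofReal ?_)
        calc T * (t - s) = (T * (t - s)) ^ (1:ℝ) := (rpow_one _).symm
          _ ≤ _ := Real.rpow_le_rpow_of_exponent_ge_of_imp (by positivity) h (by linarith) (by intro _ h'; linarith)
    have h2 : (T * (t - s)) ^ epsExp M c * (T * (t - s)) ≤ F ^ 2 * D := by
      have : (T * (t - s)) ^ epsExp M c * (T * (t - s)) = (T * (t - s)) ^ (1 + epsExp M c) := by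
        rw [Real.rpow_one_add' (by positivity) (by linarith), mul_comm]
      rw [this, mul_rpow hT.le hts]
      gcongr
    calc a * mass G ≤ ofReal (A / F) * (ofReal ((T * (t - s)) ^ epsExp M c) *
          (1 + green (tkernel M c))) * (ofReal (A / F) * ofReal (T * (t - s))) := by
          rw [hmass, ha]; gcongr
      _ = (1 + green (tkernel M c)) * ofReal ((A / F) ^ 2 *
          ((T * (t - s)) ^ epsExp M c * (T * (t - s)))) := by
          have hTt : 0 ≤ T * (t - s) := by positivity
          generalize T * (t - s) = w at hTt
          rw [ofReal_mul (by positivity), ofReal_mul (by positivity), ofReal_pow (by positivity)]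
          ring
      _ ≤ (1 + green (tkernel M c)) * ofReal ((A / F) ^ 2 * (F ^ 2 * D)) := by gcongr
      _ = _ := by
          rw [mul_assoc, ← ofReal_mul (by positivity)]
          congr 2
          field_simp
  have h2 : qform (tkernel M c) V G ≤ ofReal V * ofReal (A ^ 2 * Λ) * ofReal D := by
    refine (qform_comb_le hk hb V (fun _ _ z => bil_box_le hM hc hcM hk n hs hst z)).trans ?_
    rw [hAn, ← ofReal_pow (by positivity), mul_assoc, ← ofReal_mul (p := (A / F) ^ 2) (by positivity),
      ← ofReal_mul (p := A ^ 2 * Λ) (by positivity)]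
    refine mul_le_mul' le_rfl (ofReal_le_ofReal ?_)
    calc _ ≤ (A / F) ^ 2 * (F ^ 2 * ((∑' i, majorant M c i) * ((1 + τ) * D))) := by gcongr; linarith
      _ = _ := by rw [hΛ]; field_simp
  have hsec : ∑' y, secondBd (tkernel M c) V G a 0 y ≤ K * ofReal D := by
    refine (tsum_secondBd_le hk hV hoccG.meas a).trans ?_
    calc _ = 3 * L * (a * mass G) + qform (tkernel M c) V G := by rw [mass, qform, hLd]; ring
      _ ≤ 3 * L * ((1 + green (tkernel M c)) * ofReal (A ^ 2) * ofReal D) +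
          ofReal V * ofReal (A ^ 2 * Λ) * ofReal D := by gcongr
      _ = _ := by rw [hK]; ring
  have h3 := S.lintegral_centered_sq_le hM hc.le hcM' hV (T := T * t) (a := a) (s := K * ofReal D)
    (hocc C).meas (hocc fun i => -C i).meas
    (by change IsOccTest _ (fun s y => posComb B C _ _ id s y + posComb B (fun i => -C i) _ _ id s y) _ _
        rw [hGadd]; exact hoccG)
    (by change mass (fun s y => posComb B C _ _ id s y + posComb B (fun i => -C i) _ _ id s y) ≠ _
        rw [hGadd, hmass]; finiteness)
    (by finiteness)
    (by change ∑' y, secondBd _ _ (fun s y => posComb B C _ _ id s y + posComb B (fun i => -C i) _ _ id s y) _ _ _ ≤ _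
        rw [hGadd]; exact hsec)
  refine (lintegral_congr_ae ?_).trans_le (h3.trans_eq ?_)
  · filter_upwards [S.ae_life_nonneg hM hc.le hcM' hV, S.ae_occTime_ne_top hM hc.le hcM' hV] with ω h4 h5
    have h6 := S.centered_posComb B C (u := fun _ => T * s) (v := fun _ => T * t) (fun _ => by positivity)
      (fun _ => by gcongr) id h4 h5
    change _ = ofReal (S.centered (posComb B C _ _ id) (posComb B (fun i => -C i) _ _ id) ω ^ 2)
    rw [h6, occFluct, occFluct, ← sum_sub_distrib]
    congr 2
    refine sum_congr rfl fun x _ => ?_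
    simp only [hC, id]; ring
  · rw [toReal_mul, toReal_ofReal hD0]; congr 1; ring

end PoissonBranchingSystem

/-! ### Random continuous paths: measurability, tightness, weak convergence -/

section PathSpace

instance instMeasurableSpaceHalfLinePath : MeasurableSpace C(ℝ≥0, ℝ) := borel _

instance instBorelSpaceHalfLinePath : BorelSpace C(ℝ≥0, ℝ) := ⟨rfl⟩

/-- A random continuous path is measurable if all its evaluations are. -/
lemma measurable_path {Ω : Type*} [MeasurableSpace Ω] {f : Ω → C(ℝ≥0, ℝ)} (hf : ∀ t, Measurable fun ω => f ω t) :
    Measurable f := by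
  have hb : instMeasurableSpaceHalfLinePath = _ :=
    borel_eq_generateFrom_of_subbasis (ContinuousMap.compactOpen_eq (X := ℝ≥0) (Y := ℝ))
  rw [hb]
  refine measurable_generateFrom ?_
  rintro _ ⟨K, hK, U, hU, rfl⟩
  have hU : IsOpen U := hU
  obtain ⟨D, hDK, hDc, hKD⟩ := (TopologicalSpace.IsSeparable.of_separableSpace K).exists_countable_dense_subset
  have hcl : ∀ n : ℕ, IsClosed {y : ℝ | ((n:ℝ≥0∞))⁻¹ ≤ Metric.infEDist y Uᶜ} := fun n =>
    isClosed_le continuous_const Metric.continuous_infEDist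
  -- On the compact K the distance to the complement of U attains its minimum, so a path maps K into
  -- U exactly when this distance stays above some 1/n on a countable dense subset of K.
  have e : f ⁻¹' {g | Set.MapsTo g K U} =
      ⋃ n : ℕ, ⋂ q ∈ D, (fun ω => f ω q) ⁻¹' {y | ((n:ℝ≥0∞))⁻¹ ≤ Metric.infEDist y Uᶜ} := by
    ext ω
    simp only [Set.mem_preimage, Set.mem_ofPred_eq, mem_iUnion, Set.mem_iInter]
    constructor
    · intro h
      rcases K.eq_empty_or_nonempty with rfl | hne
      · exact ⟨0, fun q hq => absurd (hDK hq) (Set.notMem_empty q)⟩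
      obtain ⟨x, hx, hmin⟩ := hK.exists_isMinOn hne
        ((Metric.continuous_infEDist (s := Uᶜ)).comp (f ω).continuous).continuousOn
      have hpos : Metric.infEDist (f ω x) Uᶜ ≠ 0 := by
        intro h0
        have := Metric.mem_closure_iff_infEDist_zero.2 h0
        rw [hU.isClosed_compl.closure_eq] at this
        exact this (h hx)
      obtain ⟨n, hn⟩ := ENNReal.exists_inv_nat_lt hpos
      exact ⟨n, fun q hq => hn.le.trans (hmin (hDK hq))⟩
    · rintro ⟨n, hn⟩ x hx
      have hmem : x ∈ closure D := hKD hx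
      have h1 : f ω x ∈ {y : ℝ | ((n:ℝ≥0∞))⁻¹ ≤ Metric.infEDist y Uᶜ} :=
        (closure_minimal (t := (f ω) ⁻¹' {y : ℝ | ((n:ℝ≥0∞))⁻¹ ≤ Metric.infEDist y Uᶜ})
          (fun q hq => hn q hq) ((hcl n).preimage (f ω).continuous)) hmem
      by_contra hxU
      have h2 : Metric.infEDist (f ω x) Uᶜ = 0 := Metric.infEDist_zero_of_mem hxU
      have h3 : ((n:ℝ≥0∞))⁻¹ ≤ 0 := h2 ▸ h1
      simp at h3
  rw [e]
  exact MeasurableSet.iUnion fun n => MeasurableSet.biInter hDc fun q _ => (hcl n).measurableSet.preimage (hf q)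

lemma aemeasurable_path {Ω : Type*} [MeasurableSpace Ω] {P : Measure Ω} {f : Ω → C(ℝ≥0, ℝ)}
    (hf : ∀ t, AEMeasurable (fun ω => f ω t) P) : AEMeasurable f P := by
  -- The measurable version is applied to the completed σ-algebra, in which almost everywhere
  -- measurable evaluations are measurable.
  have h : NullMeasurable f P := measurable_path (Ω := NullMeasurableSpace Ω P) fun t => (hf t).nullMeasurable
  exact h.aemeasurable

/-- Dyadic modulus of continuity implies a modulus of continuity. -/
lemma abs_sub_le_of_dyadic {g : ℝ → ℝ} (hg : Continuous g) {R θ : ℝ} (hR : 0 ≤ R) (h0 : 0 < θ) (h1 : θ < 1) {m : ℕ}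
    (h : ∀ k j : ℕ, j < m * 2 ^ k → |g ((j + 1) / 2 ^ k) - g (j / 2 ^ k)| ≤ R * θ ^ k) {t : ℝ} (ht : 0 ≤ t)
    (htm : t < m) (k : ℕ) : |g (⌊t * 2 ^ k⌋₊ / 2 ^ k) - g t| ≤ R * θ ^ k / (1 - θ) := by
  have hlim : Tendsto (fun i : ℕ => g (⌊t * 2 ^ i⌋₊ / 2 ^ i)) atTop (𝓝 (g t)) :=
    (hg.tendsto t).comp ((tendsto_nat_floor_mul_div_atTop ht).comp (tendsto_pow_atTop_atTop_of_one_lt one_lt_two))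
  refine dist_le_of_le_geometric_of_tendsto θ R h1 (fun i => ?_) hlim k
  have hlt : ⌊t * 2 ^ i⌋₊ < m * 2 ^ i := by
    rw [Nat.floor_lt (by positivity)]; push_cast; gcongr
  have e1 := floor_le (show 0 ≤ t * 2 ^ i by positivity)
  have e2 := Nat.lt_floor_add_one (t * 2 ^ i)
  have e3 := floor_le (show 0 ≤ t * 2 ^ (i + 1) by positivity)
  have e4 := Nat.lt_floor_add_one (t * 2 ^ (i + 1))
  set p := ⌊t * 2 ^ i⌋₊
  set q := ⌊t * 2 ^ (i + 1)⌋₊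
  have h2 : t * 2 ^ (i + 1) = 2 * (t * 2 ^ i) := by ring
  rw [h2] at e3 e4
  have h3 : (q : ℝ) < 2 * p + 2 := by linarith
  have h4 : (2 * p : ℝ) < q + 1 := by linarith
  norm_cast at h3 h4
  have h5 : (p : ℝ) / 2 ^ i = ((2 * p : ℕ) : ℝ) / 2 ^ (i + 1) := by push_cast; rw [pow_succ]; field_simp
  rw [h5]
  -- Refining the dyadic grid moves the left grid point by zero or one fine step, so a single
  -- increment of level i + 1 is involved.
  rcases (by omega : q = 2 * p ∨ q = 2 * p + 1) with hq | hq
  · rw [hq, dist_self]; positivity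
  · rw [hq, dist_comm, Real.dist_eq]
    have := h (i + 1) (2 * p) (by rw [pow_succ, ← mul_assoc]; omega)
    push_cast at this ⊢
    refine this.trans (mul_le_mul_of_nonneg_left ?_ hR)
    exact pow_le_pow_of_le_one h0.le h1.le (le_succ i)

/-- If t - s ≤ 2^{-k}, the level k grid points below s and t coincide or are neighbours; join s and
t through them. -/
lemma osc_le_of_dyadic {g : ℝ → ℝ} (hg : Continuous g) {R θ : ℝ} (hR : 0 ≤ R) (h0 : 0 < θ) (h1 : θ < 1) {m : ℕ}
    (h : ∀ k j : ℕ, j < m * 2 ^ k → |g ((j + 1) / 2 ^ k) - g (j / 2 ^ k)| ≤ R * θ ^ k) {s t : ℝ} (hs : 0 ≤ s)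
    (hst : s ≤ t) (htm : t < m) (k : ℕ) (hk : (t - s) * 2 ^ k ≤ 1) :
    |g t - g s| ≤ R * θ ^ k + 2 * (R * θ ^ k / (1 - θ)) := by
  have ht := hs.trans hst
  have a1 := abs_sub_le_of_dyadic hg hR h0 h1 h hs (hst.trans_lt htm) k
  have a2 := abs_sub_le_of_dyadic hg hR h0 h1 h ht htm k
  have hlt : ⌊t * 2 ^ k⌋₊ < m * 2 ^ k := by
    rw [Nat.floor_lt (by positivity)]; push_cast; gcongr
  have hle : ⌊s * 2 ^ k⌋₊ ≤ ⌊t * 2 ^ k⌋₊ := Nat.floor_mono (by gcongr)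
  have e2 := Nat.lt_floor_add_one (s * 2 ^ k)
  have e3 := floor_le (show 0 ≤ t * 2 ^ k by positivity)
  set p := ⌊s * 2 ^ k⌋₊
  set q := ⌊t * 2 ^ k⌋₊
  have h3 : (q : ℝ) < p + 2 := by nlinarith
  norm_cast at h3
  have a3 : |g (q / 2 ^ k) - g (p / 2 ^ k)| ≤ R * θ ^ k := by
    rcases (by omega : q = p ∨ q = p + 1) with hq | hq
    · rw [hq, sub_self, abs_zero]; positivity
    · rw [hq]; push_cast; exact h k p (by omega)
  rw [abs_le] at *
  constructor <;> linarith [a1.1, a1.2, a2.1, a2.2, a3.1, a3.2]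

/-- Paths whose dyadic increments on `[0, m]` at level `k` are at most `R m * θ ^ k`. -/
def dyadicSet (θ R : ℝ) (m : ℕ) : Set C(ℝ≥0, ℝ) :=
  {f | ∀ k j : ℕ, j < m * 2 ^ k →
    |f (toNNReal ((j + 1) / 2 ^ k)) - f (toNNReal (j / 2 ^ k))| ≤ R * θ ^ k}

/-- Arzelà–Ascoli on compact sets: the dyadic bounds give equicontinuity, and starting from 0 the
unit steps at level 0 give pointwise boundedness. -/
lemma isCompact_closure_dyadicSet {θ : ℝ} (h0 : 0 < θ) (h1 : θ < 1) {R : ℕ → ℝ} (hR : ∀ m, 0 ≤ R m) :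
    IsCompact (closure {f : C(ℝ≥0, ℝ) | f 0 = 0 ∧ ∀ m, f ∈ dyadicSet θ (R m) m}) := by
  have : T2Space (UniformOnFun ℝ≥0 ℝ {K | IsCompact K}) := UniformOnFun.t2Space_of_covering <|
    Set.eq_univ_of_forall fun x => Set.mem_sUnion.2 ⟨{x}, isCompact_singleton, rfl⟩
  refine ArzelaAscoli.isCompact_closure_of_isClosedEmbedding (ι := C(ℝ≥0, ℝ)) (F := fun f => (f : ℝ≥0 → ℝ))
    (𝔖 := {K | IsCompact K}) (fun K hK => hK)
    ContinuousMap.isUniformEmbedding_toUniformOnFunIsCompact.isClosedEmbedding ?_ ?_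
  · intro K _ x _
    refine EquicontinuousAt.equicontinuousWithinAt ?_ K
    rw [Metric.equicontinuousAt_iff]
    intro η hη
    obtain ⟨m, hm⟩ := exists_nat_gt ((x:ℝ) + 1)
    have hlim : Tendsto (fun k : ℕ => R m * θ ^ k + 2 * (R m * θ ^ k / (1 - θ))) atTop (𝓝 0) := by
      have h := (tendsto_pow_atTop_nhds_zero_of_lt_one h0.le h1).const_mul (R m)
      simpa using h.add ((h.div_const (1 - θ)).const_mul 2)
    obtain ⟨k, hk⟩ := (hlim.eventually (gt_mem_nhds hη)).exists
    refine ⟨((2:ℝ) ^ k)⁻¹, by positivity, fun y hy f => ?_⟩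
    obtain ⟨f, -, hf⟩ := f
    have hg : Continuous fun r : ℝ => f r.toNNReal := f.continuous.comp continuous_real_toNNReal
    have hd : |(y:ℝ) - x| < ((2:ℝ) ^ k)⁻¹ := hy
    have hinv : ((2:ℝ) ^ k)⁻¹ ≤ 1 := inv_le_one_of_one_le₀ (one_le_pow₀ one_le_two)
    have hp : ((2:ℝ) ^ k)⁻¹ * 2 ^ k = 1 := inv_mul_cancel₀ (by positivity)
    rw [abs_lt] at hd
    have key := fun {s t : ℝ} => osc_le_of_dyadic hg (s := s) (t := t) (hR m) h0 h1 (hf m)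
    refine lt_of_le_of_lt ?_ hk
    rcases le_total x y with hxy | hxy
    · have := key (s := (x:ℝ)) (t := (y:ℝ)) x.coe_nonneg (coe_le_coe.2 hxy) (by linarith) k
        (hp ▸ mul_le_mul_of_nonneg_right hd.2.le (by positivity))
      simp only [Real.toNNReal_coe] at this
      rwa [dist_comm]
    · have := key (s := (y:ℝ)) (t := (x:ℝ)) y.coe_nonneg (coe_le_coe.2 hxy) (by linarith) k
        (hp ▸ mul_le_mul_of_nonneg_right (by linarith) (by positivity))
      simp only [Real.toNNReal_coe] at this
      exact this
  · intro K _ x _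
    obtain ⟨m, hm⟩ := exists_nat_gt (x:ℝ)
    refine ⟨Metric.closedBall 0 (m * R m + R m / (1 - θ)), isCompact_closedBall _ _, fun f hf => ?_⟩
    have hg : Continuous fun r : ℝ => f r.toNNReal := f.continuous.comp continuous_real_toNNReal
    have hstep : ∀ j : ℕ, j ≤ m → |f (toNNReal j)| ≤ j * R m := by
      intro j
      induction j with
      | zero => intro _; simp [hf.1]
      | succ j ih =>
        intro hj
        have a1 := hf.2 m 0 j (by simpa using hj)
        simp only [pow_zero, div_one, mul_one] at a1
        have a2 := ih (by omega)
        push_cast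
        rw [abs_le] at *
        constructor <;> linarith [a1.1, a1.2, a2.1, a2.2]
    have a1 := abs_sub_le_of_dyadic hg (hR m) h0 h1 (hf.2 m) (t := (x:ℝ)) x.coe_nonneg hm 0
    simp only [pow_zero, div_one, mul_one, Real.toNNReal_coe] at a1
    have hfl : ⌊(x:ℝ)⌋₊ ≤ m := (Nat.floor_lt x.coe_nonneg).2 hm |>.le
    have a2 := hstep _ hfl
    have a3 : (⌊(x:ℝ)⌋₊ : ℝ) * R m ≤ m * R m := mul_le_mul_of_nonneg_right (by exact_mod_cast hfl) (hR m)
    rw [Metric.mem_closedBall, Real.dist_eq, sub_zero]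
    rw [abs_le] at *
    constructor <;> linarith [a1.1, a1.2, a2.1, a2.2]

/-- Chebyshev's inequality for each of the m 2^k increments of level k. Allowing increments of size
R 2^{-kε/4} costs 2^{kε/2}, so the union bound over level k is of order 2^{-kε/2} and can be summed.
-/
lemma measure_dyadicSet_compl_le {Ω : Type*} [MeasurableSpace Ω] {P : Measure Ω} {Y : Ω → C(ℝ≥0, ℝ)}
    (hY : ∀ t, AEMeasurable (fun ω => Y ω t) P) {ε K R : ℝ} (hε : 0 < ε) (hK : 0 ≤ K) (hR : 0 < R) {m : ℕ}
    (hinc : ∀ s t : ℝ≥0, s ≤ t → t ≤ m →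
      ∫⁻ ω, ofReal ((Y ω t - Y ω s) ^ 2) ∂P ≤ ofReal (K * ((t:ℝ) - s) ^ (1 + ε))) :
    P {ω | Y ω ∉ dyadicSet (2 ^ (-(ε / 4))) R m} ≤ ofReal (m * K * (1 - (2:ℝ) ^ (-(ε / 2)))⁻¹ / R ^ 2) := by
  set θ : ℝ := 2 ^ (-(ε / 4)) with hθ
  set ρ : ℝ := 2 ^ (-(ε / 2)) with hρ
  have hθ0 : 0 < θ := by positivity
  have hρ0 : 0 < ρ := by positivity
  have hρ1 : ρ < 1 := Real.rpow_lt_one_of_one_lt_of_neg one_lt_two (by linarith)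
  have hsub : {ω | Y ω ∉ dyadicSet θ R m} ⊆ ⋃ k : ℕ, ⋃ j ∈ range (m * 2 ^ k),
      {ω | ofReal ((R * θ ^ k) ^ 2) ≤ ofReal
        ((Y ω (toNNReal ((j + 1) / 2 ^ k)) - Y ω (toNNReal (j / 2 ^ k))) ^ 2)} := by
    intro ω hω
    simp only [dyadicSet, Set.mem_ofPred_eq, not_forall, not_le] at hω
    obtain ⟨k, j, hj, hlt⟩ := hω
    simp only [mem_iUnion, mem_range]
    refine ⟨k, j, hj, ofReal_le_ofReal ?_⟩
    rw [← sq_abs (Y ω _ - _)]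
    gcongr
  have hterm : ∀ k : ℕ, ∀ j ∈ range (m * 2 ^ k), P {ω | ofReal ((R * θ ^ k) ^ 2) ≤ ofReal
        ((Y ω (toNNReal ((j + 1) / 2 ^ k)) - Y ω (toNNReal (j / 2 ^ k))) ^ 2)} ≤
      ofReal (K / R ^ 2 * (((2:ℝ) ^ k)⁻¹ * ρ ^ k)) := by
    intro k j hj
    have hpos : 0 < (R * θ ^ k) ^ 2 := by positivity
    refine (meas_ge_le_lintegral_div (((hY _).sub (hY _)).pow_const 2).ennreal_ofReal
      (ofReal_pos.2 hpos).ne' ofReal_ne_top).trans ?_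
    have hj' : j + 1 ≤ m * 2 ^ k := mem_range.1 hj
    have h1 := hinc (toNNReal (j / 2 ^ k)) (toNNReal ((j + 1) / 2 ^ k))
      (Real.toNNReal_le_toNNReal (by gcongr; linarith)) (by
        rw [Real.toNNReal_le_iff_le_coe, NNReal.coe_natCast, div_le_iff₀ (by positivity)]
        exact_mod_cast hj')
    rw [coe_toNNReal _ (by positivity), coe_toNNReal _ (by positivity)] at h1
    refine (ENNReal.div_le_div_right h1 _).trans_eq ?_
    rw [← ENNReal.ofReal_div_of_pos hpos]
    congr 1
    have e1 : ((j:ℝ) + 1) / 2 ^ k - j / 2 ^ k = ((2:ℝ) ^ k)⁻¹ := by field_simp; ring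
    have e2 : (((2:ℝ) ^ k)⁻¹) ^ (1 + ε) = ((2:ℝ) ^ k)⁻¹ * ρ ^ k * (θ ^ k) ^ 2 := by
      rw [hρ, hθ, ← rpow_natCast 2 k, ← rpow_natCast, ← rpow_natCast, ← rpow_natCast,
        ← rpow_neg zero_le_two, ← rpow_mul zero_le_two, ← rpow_mul zero_le_two,
        ← rpow_mul zero_le_two, ← rpow_mul zero_le_two, ← rpow_add two_pos, ← rpow_add two_pos]
      congr 1; push_cast; ring
    rw [e1, e2]
    field_simp
  have hsum : HasSum (fun k : ℕ => m * K / R ^ 2 * ρ ^ k) (m * K / R ^ 2 * (1 - ρ)⁻¹) :=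
    (hasSum_geometric_of_lt_one hρ0.le hρ1).mul_left _
  calc P {ω | Y ω ∉ dyadicSet θ R m} ≤ ∑' k : ℕ, ∑ j ∈ range (m * 2 ^ k),
        ofReal (K / R ^ 2 * (((2:ℝ) ^ k)⁻¹ * ρ ^ k)) :=
        (measure_mono hsub).trans ((measure_iUnion_le _).trans (tsum_le_tsum fun k =>
          (measure_biUnion_finset_le _ _).trans (sum_le_sum (hterm k))))
    _ = ∑' k : ℕ, ofReal (m * K / R ^ 2 * ρ ^ k) := by
        refine tsum_congr fun k => ?_
        rw [sum_const, Finset.card_range, nsmul_eq_mul, ← ENNReal.ofReal_natCast,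
          ← ofReal_mul (by positivity)]
        congr 1; push_cast; field_simp
    _ = ofReal (m * K / R ^ 2 * (1 - ρ)⁻¹) := by
        rw [← ofReal_tsum_of_nonneg (fun k => by positivity) hsum.summable, hsum.tsum_eq]
    _ = _ := by congr 1; ring

/-- Kolmogorov's tightness criterion. -/
lemma isTightMeasureSet_of_increments {Ω : Type*} [MeasurableSpace Ω] {P : Measure Ω} {Y : ℕ → Ω → C(ℝ≥0, ℝ)}
    (hY : ∀ n t, AEMeasurable (fun ω => Y n ω t) P) (h0 : ∀ n ω, Y n ω 0 = 0) {ε : ℝ} (hε : 0 < ε)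
    (hinc : ∀ m : ℕ, ∃ K : ℝ, 0 ≤ K ∧ ∀ n, ∀ s t : ℝ≥0, s ≤ t → t ≤ m →
      ∫⁻ ω, ofReal ((Y n ω t - Y n ω s) ^ 2) ∂P ≤ ofReal (K * ((t:ℝ) - s) ^ (1 + ε))) :
    IsTightMeasureSet (Set.range fun n => P.map (Y n)) := by
  rw [isTightMeasureSet_iff_exists_isCompact_measure_compl_le]
  intro η hη
  choose K hK hKinc using hinc
  obtain ⟨η', hη', hsum⟩ := ENNReal.exists_pos_sum_of_countable' hη.ne' ℕ
  have hRex : ∀ m : ℕ, ∃ R : ℝ, 0 < R ∧ ofReal (m * K m * (1 - (2:ℝ) ^ (-(ε / 2)))⁻¹ / R ^ 2) ≤ η' m := by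
    intro m
    have h : Tendsto (fun R : ℝ => ofReal (m * K m * (1 - (2:ℝ) ^ (-(ε / 2)))⁻¹ / R ^ 2)) atTop (𝓝 0) := by
      simpa using ENNReal.tendsto_ofReal ((tendsto_pow_atTop two_ne_zero).const_div_atTop
        (m * K m * (1 - (2:ℝ) ^ (-(ε / 2)))⁻¹))
    obtain ⟨R, h1, h2⟩ := ((h.eventually (ge_mem_nhds (hη' m))).and (eventually_gt_atTop 0)).exists
    exact ⟨R, h2, h1⟩
  choose R hR hRle using hRex
  have hθ1 : (2:ℝ) ^ (-(ε / 4)) < 1 := Real.rpow_lt_one_of_one_lt_of_neg one_lt_two (by linarith)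
  refine ⟨_, isCompact_closure_dyadicSet (θ := 2 ^ (-(ε / 4))) (by positivity) hθ1 fun m => (hR m).le, ?_⟩
  rintro _ ⟨n, rfl⟩
  dsimp only
  rw [Measure.map_apply_of_aemeasurable (aemeasurable_path (hY n)) isClosed_closure.isOpen_compl.measurableSet]
  have hsub : Y n ⁻¹' (closure {f : C(ℝ≥0, ℝ) | f 0 = 0 ∧ ∀ m, f ∈ dyadicSet (2 ^ (-(ε / 4))) (R m) m})ᶜ ⊆
      ⋃ m, {ω | Y n ω ∉ dyadicSet (2 ^ (-(ε / 4))) (R m) m} := by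
    intro ω hω
    by_contra h
    simp only [mem_iUnion, Set.mem_ofPred_eq, not_exists, not_not] at h
    exact hω (subset_closure ⟨h0 n ω, h⟩)
  refine (measure_mono hsub).trans ((measure_iUnion_le _).trans (le_trans (tsum_le_tsum fun m => ?_) hsum.le))
  exact (measure_dyadicSet_compl_le (hY n) hε (hK m) (hR m) (hKinc m n)).trans (hRle m)

/-- On the path space, tightness and convergence of the finite dimensional characteristic functions imply weak
convergence. -/
lemma tendsto_of_tight_of_charFun {ι : Type*} {l : Filter ι} {μ : ι → ProbabilityMeasure C(ℝ≥0, ℝ)}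
    {μ₀ : ProbabilityMeasure C(ℝ≥0, ℝ)} (ht : IsTightMeasureSet {(μ n : Measure C(ℝ≥0, ℝ)) | n})
    (h : ∀ (W : Finset ℝ≥0) (α : ℝ≥0 → ℝ),
      Tendsto (fun n => ∫ f, cexp (I * ((∑ t ∈ W, α t * f t : ℝ) : ℂ)) ∂(μ n : Measure C(ℝ≥0, ℝ))) l
        (𝓝 (∫ f, cexp (I * ((∑ t ∈ W, α t * f t : ℝ) : ℂ)) ∂(μ₀ : Measure C(ℝ≥0, ℝ))))) :
    Tendsto μ l (𝓝 μ₀) := by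
  -- Functionals of a path are finite combinations of evaluations. With the discrete topology on the
  -- coefficients, joint continuity of the pairing reduces to continuity in the path.
  let : TopologicalSpace (ℝ≥0 →₀ ℝ) := ⊥
  have : DiscreteTopology (ℝ≥0 →₀ ℝ) := ⟨rfl⟩
  let L : C(ℝ≥0, ℝ) →ₗ[ℝ] (ℝ≥0 →₀ ℝ) →ₗ[ℝ] ℝ :=
    LinearMap.mk₂ ℝ (fun f w => Finsupp.linearCombination ℝ (f : ℝ≥0 → ℝ) w)
      (fun f g w => by simp [Finsupp.linearCombination_apply, Finsupp.sum, mul_add, sum_add_distrib])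
      (fun r f w => by
        simp only [Finsupp.linearCombination_apply, Finsupp.sum, Finset.smul_sum]
        exact sum_congr rfl fun t _ => by simp; ring)
      (fun f v w => map_add _ _ _) (fun r f w => map_smul _ _ _)
  have hLapp : ∀ f w, L f w = ∑ t ∈ w.support, w t * f t := fun f w => by
    simp [L, Finsupp.linearCombination_apply, Finsupp.sum]
  have hL : Continuous fun p : C(ℝ≥0, ℝ) × (ℝ≥0 →₀ ℝ) => L p.1 p.2 := by
    rw [continuous_prod_of_discrete_right]
    intro w
    simp only [hLapp]
    fun_prop
  refine ProbabilityMeasure.tendsto_of_tight_of_separatesPoints ht (𝕜 := ℂ)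
    (A := BoundedContinuousFunction.charPoly Real.continuous_probChar hL) ?_ ?_
  · refine BoundedContinuousFunction.separatesPoints_charPoly _ Real.probChar_ne_one _ ?_
    intro f hf hLf
    refine hf (ContinuousMap.ext fun t => ?_)
    have : L f (Finsupp.single t 1) = 0 := by rw [hLf]; rfl
    simpa [L] using this
  · intro g hg
    rw [BoundedContinuousFunction.mem_charPoly] at hg
    obtain ⟨w, hw⟩ := hg
    have h_eq (ν : ProbabilityMeasure C(ℝ≥0, ℝ)) : ∫ x, g x ∂(ν : Measure C(ℝ≥0, ℝ)) = w.coeff.sum (fun a z =>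
        z * ∫ f, cexp (I * ((∑ t ∈ a.support, a t * f t : ℝ) : ℂ)) ∂(ν : Measure C(ℝ≥0, ℝ))) := by
      simp_rw [hw, Finsupp.sum]
      rw [integral_finsetSum]
      · refine sum_congr rfl fun a _ => ?_
        rw [integral_const_mul]
        congr 2
        funext f
        rw [hLapp, Real.probChar_apply, mul_comm]
      · refine fun a _ => Integrable.const_mul ?_ _
        exact BoundedContinuousFunction.integrable ν
          (BoundedContinuousFunction.char Real.continuous_probChar hL a)
    simp_rw [h_eq]
    exact tendsto_finsetSum _ fun a _ => (h a.support a).const_mul _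

end PathSpace

/-! ### Characterization of osfBm by its characteristic functions -/

section Gaussian

variable {Ω' : Type*} [MeasurableSpace Ω'] {P' : Measure Ω'} [IsProbabilityMeasure P'] {a b H : ℝ}
  {ζ : ℝ≥0 → Ω' → ℝ}

lemma osfBmCov_comm (s t : ℝ) : osfBmCov a b H s t = osfBmCov a b H t s := by
  rw [osfBmCov, osfBmCov, abs_sub_comm, add_comm s t]; ring

lemma IsOsfBm.integral_exp (h : IsOsfBm a b H ζ P') (W : Finset ℝ≥0) (α : ℝ≥0 → ℝ) :
    ∫ ω, cexp (I * ((∑ t ∈ W, α t * ζ t ω : ℝ) : ℂ)) ∂P' =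
      cexp (-(∑ s ∈ W, ∑ t ∈ W, α s * α t * osfBmCov a b H s t) / 2 : ℝ) := by
  have hX : HasGaussianLaw (fun ω => ∑ t ∈ W, α t * ζ t ω) P' := (h.gaussian.smul α).hasGaussianLaw_fun_sum
  have hL2 : ∀ t, MemLp (ζ t) 2 P' := fun t => (h.gaussian.hasGaussianLaw_eval t).memLp_two
  have hmean : ∫ ω, ∑ t ∈ W, α t * ζ t ω ∂P' = 0 := by
    rw [integral_finsetSum _ fun t _ => ((hL2 t).integrable one_le_two).const_mul _]
    exact Finset.sum_eq_zero fun t _ => by rw [integral_const_mul, h.centered, mul_zero]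
  have hvar : Var[fun ω => ∑ t ∈ W, α t * ζ t ω; P'] = ∑ s ∈ W, ∑ t ∈ W, α s * α t * osfBmCov a b H s t := by
    rw [variance_fun_sum' fun t _ => (hL2 t).const_mul (α t)]
    refine sum_congr rfl fun s _ => sum_congr rfl fun t _ => ?_
    rw [covariance_const_mul_left, covariance_const_mul_right, h.covariance]; ring
  have h1 := hX.charFun_map_eq (1:ℝ)
  rw [charFun_apply_real, integral_map hX.aemeasurable (by fun_prop)] at h1
  simp only [Complex.ofReal_one, one_mul, RCLike.inner_apply, mul_one, map_one] at h1
  rw [hmean, hvar] at h1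
  simp_rw [mul_comm I, h1]
  congr 1
  push_cast; ring

/-- Every linear combination of values has a Gaussian characteristic function, hence a Gaussian law;
covariances are recovered from variances by polarization. -/
lemma isOsfBm_of_integral_exp (hm : ∀ t, AEMeasurable (ζ t) P') (h : ∀ (W : Finset ℝ≥0) (α : ℝ≥0 → ℝ),
    ∫ ω, cexp (I * ((∑ t ∈ W, α t * ζ t ω : ℝ) : ℂ)) ∂P' =
      cexp (-(∑ s ∈ W, ∑ t ∈ W, α s * α t * osfBmCov a b H s t) / 2 : ℝ)) : IsOsfBm a b H ζ P' := by
  set Q : Finset ℝ≥0 → (ℝ≥0 → ℝ) → ℝ := fun W α => ∑ s ∈ W, ∑ t ∈ W, α s * α t * osfBmCov a b H s t with hQ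
  have hX : ∀ (W : Finset ℝ≥0) (α : ℝ≥0 → ℝ), AEMeasurable (fun ω => ∑ t ∈ W, α t * ζ t ω) P' := fun W α =>
    Finset.aemeasurable_fun_sum _ fun t _ => (hm t).const_mul _
  -- Positivity of the covariance form is not assumed: it follows because a characteristic function
  -- has modulus at most 1.
  have hQ0 : ∀ W α, 0 ≤ Q W α := by
    intro W α
    have h1 : ‖∫ ω, cexp (I * ((∑ t ∈ W, α t * ζ t ω : ℝ) : ℂ)) ∂P'‖ ≤ 1 := by
      refine (norm_integral_le_of_norm_le_const (C := 1) (Eventually.of_forall fun ω => ?_)).trans (by simp)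
      rw [norm_exp_I_mul_ofReal]
    rw [h W α, Complex.norm_exp_ofReal, exp_le_one_iff] at h1
    simp only [hQ]; linarith
  have hlaw : ∀ W α, P'.map (fun ω => ∑ t ∈ W, α t * ζ t ω) = gaussianReal 0 (Q W α).toNNReal := by
    intro W α
    refine Measure.ext_of_charFun (funext fun u => ?_)
    rw [charFun_apply_real, integral_map (hX W α) (by fun_prop), charFun_gaussianReal,
      coe_toNNReal _ (hQ0 W α)]
    have h1 := h W (fun t => u * α t)
    have e : ∀ ω, ((∑ t ∈ W, u * α t * ζ t ω : ℝ) : ℂ) = u * ((∑ t ∈ W, α t * ζ t ω : ℝ) : ℂ) := fun ω => by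
      rw [← Complex.ofReal_mul, mul_sum]; simp_rw [mul_assoc]
    simp_rw [e, mul_comm I] at h1
    rw [h1]
    congr 1
    have e2 : ∑ s ∈ W, ∑ t ∈ W, u * α s * (u * α t) * osfBmCov a b H s t = u ^ 2 * Q W α := by
      rw [hQ, mul_sum]
      refine sum_congr rfl fun s _ => ?_
      rw [mul_sum]
      exact sum_congr rfl fun t _ => by ring
    rw [e2]; push_cast; ring
  have hG : IsGaussianProcess ζ P' := by
    refine ⟨fun W => ⟨isGaussian_of_map_eq_gaussianReal fun L => ?_⟩⟩
    set α : ℝ≥0 → ℝ := fun t => L fun j => if t = j then 1 else 0 with hα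
    refine ⟨0, (Q W α).toNNReal, ?_⟩
    have hrm : AEMeasurable (fun ω => W.restrict (ζ · ω)) P' := aemeasurable_pi_lambda _ fun i => hm i
    rw [AEMeasurable.map_map_of_aemeasurable L.continuous.measurable.aemeasurable hrm, ← hlaw]
    congr 1
    funext ω
    have h1 := LinearMap.pi_apply_eq_sum_univ (L : (W → ℝ) →ₗ[ℝ] ℝ) (W.restrict (ζ · ω))
    rw [← sum_coe_sort]
    refine h1.trans (sum_congr rfl fun i _ => ?_)
    simp only [hα, smul_eq_mul, Finset.restrict, Subtype.ext_iff]
    exact mul_comm _ _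
  have hL2 : ∀ t, MemLp (ζ t) 2 P' := fun t => (hG.hasGaussianLaw_eval t).memLp_two
  have hvar : ∀ W α, Var[fun ω => ∑ t ∈ W, α t * ζ t ω; P'] = Q W α := by
    intro W α
    have h1 := variance_map (X := id) (Y := fun ω => ∑ t ∈ W, α t * ζ t ω) (μ := P') aemeasurable_id (hX W α)
    rw [hlaw, variance_id_gaussianReal, coe_toNNReal _ (hQ0 W α)] at h1
    exact h1.symm
  refine ⟨hG, fun t => ?_, fun s t => ?_⟩
  · have h1 := hlaw {t} fun _ => 1
    simp only [sum_singleton, one_mul] at h1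
    have h2 := integral_map (μ := P') (hm t) (f := id) aestronglyMeasurable_id
    rw [h1] at h2
    simpa using h2.symm
  · rcases eq_or_ne s t with rfl | hst
    · have h1 := hvar {s} fun _ => 1
      simp only [hQ, sum_singleton, one_mul] at h1
      rw [covariance_self (hm s), ← h1]
    · have h1 := hvar {s} fun _ => 1
      have h2 := hvar {t} fun _ => 1
      have h3 := hvar {s, t} fun _ => 1
      simp only [hQ, sum_singleton, Finset.sum_pair hst, one_mul] at h1 h2 h3
      have h4 := variance_add (hL2 s) (hL2 t)
      rw [show (ζ s + ζ t) = fun ω => ζ s ω + ζ t ω from rfl, h3] at h4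
      rw [osfBmCov_comm (t:ℝ) s] at h3 h4
      linarith

end Gaussian

/-! ### The functional limit theorem on the half line and the existence of osfBm -/

namespace PoissonBranchingSystem

variable {M : ℕ} [NeZero M] {c V : ℝ} {lam : ℝ≥0} {Ω : Type*} [mΩ : MeasurableSpace Ω] {P : Measure Ω}
  [IsProbabilityMeasure P] (S : PoissonBranchingSystem M c V lam P)

lemma occFluct_zero (B : Finset (HierGroup M)) (φ : HierGroup M → ℝ) (n : ℕ) (ω : Ω) : S.occFluct B φ n 0 ω = 0 := by
  simp [occFluct, occTime]

lemma measurable_occFluct (B : Finset (HierGroup M)) (φ : HierGroup M → ℝ) (n : ℕ) (t : ℝ) :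
    Measurable (S.occFluct B φ n t) :=
  Finset.measurable_fun_sum _ fun x _ => ((S.measurable_occTime _ x).ennreal_toReal.sub_const _).const_mul _

lemma continuous_occFluct (hc : 0 < c) (B : Finset (HierGroup M)) (φ : HierGroup M → ℝ) (n : ℕ) {ω : Ω}
    (h : ∀ u x, S.occTime u x ω ≠ ⊤) : Continuous fun t : ℝ≥0 => S.occFluct B φ n t ω := by
  unfold occFluct
  refine continuous_finsetSum _ fun x _ => ?_
  have hT := timeSeq_pos (M := M) hc n
  have h1 : Continuous fun t : ℝ≥0 => (S.occTime (timeSeq M c n * t) x ω).toReal :=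
    (S.continuous_occTime fun u => h u x).comp_continuous (by fun_prop) fun t => by
      rw [Set.mem_Ici]; exact mul_nonneg hT.le t.coe_nonneg
  fun_prop

open Classical in
/-- The path of the rescaled occupation time fluctuations. -/
def occPath (B : Finset (HierGroup M)) (φ : HierGroup M → ℝ) (n : ℕ) (ω : Ω) : C(ℝ≥0, ℝ) :=
  if h : 0 < c ∧ ∀ u x, S.occTime u x ω ≠ ⊤ then
    ⟨fun t => S.occFluct B φ n t ω, S.continuous_occFluct h.1 B φ n h.2⟩ else 0

lemma occPath_apply (hc : 0 < c) (B : Finset (HierGroup M)) (φ : HierGroup M → ℝ) (n : ℕ) {ω : Ω}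
    (h : ∀ u x, S.occTime u x ω ≠ ⊤) (t : ℝ≥0) : S.occPath B φ n ω t = S.occFluct B φ n t ω := by
  rw [occPath, dif_pos ⟨hc, h⟩]; rfl

lemma occPath_zero (B : Finset (HierGroup M)) (φ : HierGroup M → ℝ) (n : ℕ) (ω : Ω) : S.occPath B φ n ω 0 = 0 := by
  unfold occPath
  split_ifs
  · exact S.occFluct_zero B φ n ω
  · rfl

lemma aemeasurable_occPath_apply (hM : 1 < M) (hc : 1 ≤ c) (hcM : c < M) (hV : 0 < V) (B : Finset (HierGroup M))
    (φ : HierGroup M → ℝ) (n : ℕ) (t : ℝ≥0) : AEMeasurable (fun ω => S.occPath B φ n ω t) P := by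
  refine (S.measurable_occFluct B φ n t).aemeasurable.congr ?_
  filter_upwards [S.ae_occTime_ne_top hM hc hcM hV] with ω h
  exact (S.occPath_apply (by linarith) B φ n h t).symm

lemma isTightMeasureSet_occPath (hM : 1 < M) (hc : 1 < c) (hcM : c < sqrt M) (hV : 0 < V)
    (B : Finset (HierGroup M)) (φ : HierGroup M → ℝ) :
    IsTightMeasureSet (Set.range fun n => P.map (S.occPath B φ n)) := by
  have hcM' := lt_of_lt_sqrt hM hcM
  refine isTightMeasureSet_of_increments (S.aemeasurable_occPath_apply hM hc.le hcM' hV B φ) (S.occPath_zero B φ)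
    (eps_pos hM hc hcM).1 fun m => ?_
  obtain ⟨K, hK, h⟩ := S.exists_lintegral_increment_le hM hc hcM hV B φ (Nat.cast_nonneg m)
  refine ⟨K, hK, fun n s t hst htm => ?_⟩
  refine (lintegral_congr_ae ?_).trans_le (h n s t s.coe_nonneg (by exact_mod_cast hst) (by exact_mod_cast htm))
  filter_upwards [S.ae_occTime_ne_top hM hc.le hcM' hV] with ω h
  rw [S.occPath_apply (by linarith) B φ n h, S.occPath_apply (by linarith) B φ n h]

lemma sum_prod_mul {κ ι : Type*} (W : Finset κ) (B : Finset ι) (g : κ → ℝ) (φ : ι → ℝ) :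
    ∑ i : W × B, φ i.2 * g i.1 = (∑ x ∈ B, φ x) * ∑ t ∈ W, g t := by
  rw [← sum_coe_sort B, ← sum_coe_sort W, sum_mul_sum, Fintype.sum_prod_type_right]

lemma sum_prod_mul_mul {κ ι : Type*} (W : Finset κ) (B : Finset ι) (g : κ → κ → ℝ) (φ : ι → ℝ) :
    ∑ i : W × B, ∑ j : W × B, φ i.2 * (φ j.2 * g i.1 j.1) =
      (∑ x ∈ B, φ x) * ((∑ x ∈ B, φ x) * ∑ s ∈ W, ∑ t ∈ W, g s t) := by
  rw [mul_sum (s := W), ← sum_prod_mul W B (fun s => (∑ x ∈ B, φ x) * ∑ t ∈ W, g s t) φ]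
  exact sum_congr rfl fun i _ => by rw [← mul_sum, sum_prod_mul W B (g i.1) φ]

/-- The limiting covariance of two site occupation times does not depend on the sites, so the double
sum over times and sites factors and leaves the square of Σφ. -/
lemma tendsto_integral_exp_occPath (hM : 1 < M) (hc : 1 < c) (hcM : c < sqrt M) (hV : 0 < V)
    (B : Finset (HierGroup M)) (φ : HierGroup M → ℝ) (W : Finset ℝ≥0) (α : ℝ≥0 → ℝ) :
    Tendsto (fun n => ∫ ω, cexp (I * ((∑ t ∈ W, α t * S.occPath B φ n ω t : ℝ) : ℂ)) ∂P) atTop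
      (𝓝 (cexp (-((KConst M c V lam * ∑ x ∈ B, φ x) ^ 2 *
        ∑ s ∈ W, ∑ t ∈ W, α s * α t * osfBmCov (aConst M c) (bConst M c) (hurst M c) s t) / 2 : ℝ))) := by
  have hcM' := lt_of_lt_sqrt hM hcM
  have h := S.tendsto_charFun hM hc hcM hV (ι := W × B) (fun i => α i.1 * φ i.2) (fun i => i.2)
    (t := fun i => ((i.1 : ℝ≥0) : ℝ)) fun i => NNReal.coe_nonneg _
  have e1 : lam * V * ∑ i : W × B, ∑ j : W × B, α i.1 * φ i.2 * (α j.1 * φ j.2) *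
      ∑' l, covTerm M c ((i.1 : ℝ≥0) : ℝ) ((j.1 : ℝ≥0) : ℝ) l = (KConst M c V lam * ∑ x ∈ B, φ x) ^ 2 *
        ∑ s ∈ W, ∑ t ∈ W, α s * α t * osfBmCov (aConst M c) (bConst M c) (hurst M c) s t := by
    have e2 : ∀ s t : ℝ≥0, lam * V * ∑' l, covTerm M c s t l = KConst M c V lam ^ 2 *
        osfBmCov (aConst M c) (bConst M c) (hurst M c) s t := fun s t =>
      (KConst_sq_mul_osfBmCov hM hc hcM hV lam s.coe_nonneg t.coe_nonneg).symm
    calc _ = ∑ i : W × B, ∑ j : W × B, φ i.2 * (φ j.2 * (KConst M c V lam ^ 2 * (α i.1 * α j.1 *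
          osfBmCov (aConst M c) (bConst M c) (hurst M c) ((i.1 : ℝ≥0) : ℝ) ((j.1 : ℝ≥0) : ℝ)))) := by
          rw [mul_sum]
          refine sum_congr rfl fun i _ => ?_
          rw [mul_sum]
          refine sum_congr rfl fun j _ => ?_
          linear_combination (α i.1 * φ i.2 * (α j.1 * φ j.2)) * e2 i.1 j.1
      _ = (∑ x ∈ B, φ x) * ((∑ x ∈ B, φ x) * (KConst M c V lam ^ 2 *
          ∑ s ∈ W, ∑ t ∈ W, α s * α t * osfBmCov (aConst M c) (bConst M c) (hurst M c) s t)) := by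
          rw [sum_prod_mul_mul W B (fun s t => KConst M c V lam ^ 2 * (α s * α t *
            osfBmCov (aConst M c) (bConst M c) (hurst M c) s t)) φ]
          simp_rw [← mul_sum]
      _ = _ := by ring
  rw [e1] at h
  refine h.congr fun n => integral_congr_ae ?_
  filter_upwards [S.ae_occTime_ne_top hM hc.le hcM' hV] with ω hω
  congr 3
  rw [Fintype.sum_prod_type, sum_coe_sort W fun t => ∑ x : B, α t * φ x / norming M c (timeSeq M c n) *
    ((S.occTime (timeSeq M c n * (t:ℝ)) x ω).toReal - lam * (timeSeq M c n * (t:ℝ)))]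
  refine sum_congr rfl fun t _ => ?_
  rw [S.occPath_apply (by linarith) B φ n hω, occFluct, mul_sum, ← sum_coe_sort B]
  exact sum_congr rfl fun x _ => by ring

/-- The integrand of a finite dimensional characteristic function. -/
def expEval (W : Finset ℝ≥0) (α : ℝ≥0 → ℝ) : BoundedContinuousFunction C(ℝ≥0, ℝ) ℂ :=
  BoundedContinuousFunction.ofNormedAddCommGroup
    (fun f => cexp (I * ((∑ t ∈ W, α t * f t : ℝ) : ℂ))) (by fun_prop) 1
    fun f => by rw [norm_exp_I_mul_ofReal]

/-- OsfBm exists: it is a limit of occupation time fluctuations. -/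
lemma exists_isOsfBm (S : PoissonBranchingSystem M c V lam P) (hM : 1 < M) (hc : 1 < c) (hcM : c < sqrt M) (hV : 0 < V)
    (hK : 0 < KConst M c V lam) : ∃ (Ω' : Type) (_ : MeasurableSpace Ω') (P' : Measure Ω') (_ : IsProbabilityMeasure P')
      (ζ : ℝ≥0 → Ω' → ℝ), IsOsfBm (aConst M c) (bConst M c) (hurst M c) ζ P' ∧ ∀ ω, Continuous (fun t => ζ t ω) := by
  have hcM' := lt_of_lt_sqrt hM hcM
  set Y := S.occPath {0} fun _ => 1 with hY
  have hYm : ∀ n, AEMeasurable (Y n) P := fun n =>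
    aemeasurable_path (S.aemeasurable_occPath_apply hM hc.le hcM' hV {0} _ n)
  set μ : ℕ → ProbabilityMeasure C(ℝ≥0, ℝ) := fun n =>
    ⟨P.map (Y n), Measure.isProbabilityMeasure_map (hYm n)⟩ with hμ
  have hc1 : IsCompact (closure (Set.range μ)) := by
    refine isCompact_closure_of_isTightMeasureSet ?_
    convert S.isTightMeasureSet_occPath hM hc hcM hV {0} fun _ => 1 using 1
    ext ν
    constructor
    · rintro ⟨_, ⟨n, rfl⟩, rfl⟩
      exact ⟨n, rfl⟩
    · rintro ⟨n, rfl⟩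
      exact ⟨_, ⟨n, rfl⟩, rfl⟩
  -- By tightness the laws have compact closure; an ultrafilter finer than `atTop` selects a cluster
  -- point without extracting a subsequence. The finite-dimensional limits identify its
  -- characteristic functions.
  set U : Ultrafilter ℕ := Ultrafilter.of atTop
  obtain ⟨ν, -, hν⟩ := hc1.ultrafilter_le_nhds (U.map μ)
    (le_trans (by simp) (monotone_principal subset_closure))
  have hν' : Tendsto μ U (𝓝 ν) := hν
  rw [ProbabilityMeasure.tendsto_iff_forall_integral_rclike_tendsto ℂ] at hν'
  have hcf : ∀ (W : Finset ℝ≥0) (α : ℝ≥0 → ℝ), ∫ f : C(ℝ≥0, ℝ), cexp (I * ((∑ t ∈ W, α t * f t : ℝ) : ℂ)) ∂(ν : Measure C(ℝ≥0, ℝ)) =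
      cexp (-((KConst M c V lam) ^ 2 *
        ∑ s ∈ W, ∑ t ∈ W, α s * α t * osfBmCov (aConst M c) (bConst M c) (hurst M c) s t) / 2 : ℝ) := by
    intro W α
    have h1 := hν' (expEval W α)
    have h2 := (S.tendsto_integral_exp_occPath hM hc hcM hV {0} (fun _ => 1) W α).mono_left (Ultrafilter.of_le atTop)
    simp only [sum_singleton, mul_one] at h2
    refine tendsto_nhds_unique h1 (h2.congr fun n => ?_)
    exact (integral_map (hYm n) (expEval W α).continuous.aestronglyMeasurable).symm
  refine ⟨C(ℝ≥0, ℝ), inferInstance, ν, inferInstance, fun t f => f t / KConst M c V lam, ?_, fun f => by fun_prop⟩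
  refine isOsfBm_of_integral_exp (fun t => by
    have : Continuous fun f : C(ℝ≥0, ℝ) => f t / KConst M c V lam := by fun_prop
    exact this.measurable.aemeasurable) fun W α => ?_
  have h1 := hcf W fun t => α t / KConst M c V lam
  have e : ∀ f : C(ℝ≥0, ℝ), ∑ t ∈ W, α t * (f t / KConst M c V lam) = ∑ t ∈ W, α t / KConst M c V lam * f t := fun f =>
    sum_congr rfl fun t _ => by ring
  simp_rw [e]
  rw [h1, mul_sum]
  have e2 : ∀ s ∈ W, KConst M c V lam ^ 2 * ∑ t ∈ W, α s / KConst M c V lam * (α t / KConst M c V lam) *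
      osfBmCov (aConst M c) (bConst M c) (hurst M c) s t =
      ∑ t ∈ W, α s * α t * osfBmCov (aConst M c) (bConst M c) (hurst M c) s t := fun s _ => by
    rw [mul_sum]
    exact sum_congr rfl fun t _ => by field_simp
  rw [sum_congr rfl e2]

/-- Functional central limit theorem on the half line. -/
lemma tendstoInDistribution_occPath (hM : 1 < M) (hc : 1 < c) (hcM : c < sqrt M) (hV : 0 < V)
    (B : Finset (HierGroup M)) (φ : HierGroup M → ℝ) {Ω' : Type*} [MeasurableSpace Ω'] {P' : Measure Ω'}
    [IsProbabilityMeasure P'] {ζ : ℝ≥0 → Ω' → ℝ} (hζ : ∀ ω, Continuous fun t => ζ t ω)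
    (h : IsOsfBm (aConst M c) (bConst M c) (hurst M c) ζ P') :
    TendstoInDistribution (S.occPath B φ) atTop
      (fun ω => (KConst M c V lam * ∑ x ∈ B, φ x) • (⟨fun t => ζ t ω, hζ ω⟩ : C(ℝ≥0, ℝ))) (fun _ => P) P' := by
  have hcM' := lt_of_lt_sqrt hM hcM
  have hYm : ∀ n, AEMeasurable (S.occPath B φ n) P := fun n =>
    aemeasurable_path (S.aemeasurable_occPath_apply hM hc.le hcM' hV B φ n)
  have hZm : AEMeasurable (fun ω => (KConst M c V lam * ∑ x ∈ B, φ x) • (⟨fun t => ζ t ω, hζ ω⟩ : C(ℝ≥0, ℝ))) P' :=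
    aemeasurable_path fun t => (h.gaussian.aemeasurable t).const_mul _
  refine ⟨hYm, hZm, tendsto_of_tight_of_charFun (S.isTightMeasureSet_occPath hM hc hcM hV B φ) fun W α => ?_⟩
  have h1 := S.tendsto_integral_exp_occPath hM hc hcM hV B φ W α
  have h2 := h.integral_exp W fun t => KConst M c V lam * (∑ x ∈ B, φ x) * α t
  have e : ∑ s ∈ W, ∑ t ∈ W, KConst M c V lam * (∑ x ∈ B, φ x) * α s * (KConst M c V lam * (∑ x ∈ B, φ x) * α t) *
      osfBmCov (aConst M c) (bConst M c) (hurst M c) s t = (KConst M c V lam * ∑ x ∈ B, φ x) ^ 2 *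
      ∑ s ∈ W, ∑ t ∈ W, α s * α t * osfBmCov (aConst M c) (bConst M c) (hurst M c) s t := by
    simp_rw [mul_sum]
    exact sum_congr rfl fun s _ => sum_congr rfl fun t _ => by ring
  rw [e] at h2
  rw [← h2] at h1
  have h3 : ∫ f : C(ℝ≥0, ℝ), expEval W α f ∂(P'.map fun ω => (KConst M c V lam * ∑ x ∈ B, φ x) •
      (⟨fun t => ζ t ω, hζ ω⟩ : C(ℝ≥0, ℝ))) = ∫ ω, cexp (I *
        ((∑ t ∈ W, KConst M c V lam * (∑ x ∈ B, φ x) * α t * ζ t ω : ℝ) : ℂ)) ∂P' := by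
    rw [integral_map hZm (expEval W α).continuous.aestronglyMeasurable]
    refine integral_congr_ae (Eventually.of_forall fun ω => ?_)
    change cexp _ = _
    congr 3
    refine sum_congr rfl fun t _ => ?_
    change α t * (KConst M c V lam * (∑ x ∈ B, φ x) * ζ t ω) = _
    ring
  rw [← h3] at h1
  refine h1.congr fun n => ?_
  exact (integral_map (hYm n) (expEval W α).continuous.aestronglyMeasurable).symm

end PoissonBranchingSystem

end HierBranching

end

/-! ### Assembly: restriction to bounded time intervals -/

theorem theorem2p4 (M : ℕ) (hM : 1 < M) (c : ℝ) (hc : 1 < c) (hcM : c < Real.sqrt M)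
    (V : ℝ) (hV : 0 < V) (lam : ℝ≥0) (hlam : 0 < lam)
    {Ω : Type*} [MeasurableSpace Ω] (P : Measure Ω) [IsProbabilityMeasure P]
    (S : HierBranching.PoissonBranchingSystem M c V lam P) :
    -- the range of the parameters
    (0 < HierBranching.degree M c ∧ HierBranching.degree M c < 1 ∧
      1 / 2 < HierBranching.hurst M c ∧ HierBranching.hurst M c < 1 ∧
      0 < HierBranching.KConst M c V lam) ∧
    -- osfBm with continuous paths exists
    (∃ (Ω' : Type) (_ : MeasurableSpace Ω') (P' : Measure Ω') (_ : IsProbabilityMeasure P')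
      (ζ : ℝ≥0 → Ω' → ℝ), HierBranching.IsOsfBm (HierBranching.aConst M c) (HierBranching.bConst M c)
          (HierBranching.hurst M c) ζ P' ∧
        ∀ ω, Continuous (fun t => ζ t ω)) ∧
    -- at each time there are a.s. finitely many particles at each site
    (∀ t : ℝ, 0 ≤ t → ∀ᵐ ω ∂P, ∀ x, S.N t ω {x} ≠ ⊤) ∧
    ∀ φ : HierBranching.HierGroup M → ℝ, HierBranching.HasBoundedSupport φ →
      -- the expectations and the time integrals in the definition of the fluctuations exist
      (∀ t : ℝ, 0 ≤ t → Integrable (S.pairing φ t) P) ∧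
      (∀ᵐ ω ∂P, ∀ t : ℝ, 0 ≤ t →
        IntervalIntegrable (fun r => S.pairing φ r ω - ∫ ω', S.pairing φ r ω' ∂P) volume 0 t) ∧
      -- weak convergence in `C([0, τ])` for each `τ > 0`
      ∀ τ : ℝ, 0 < τ →
        ∃ Y : ℕ → Ω → C(Set.Icc (0 : ℝ) τ, ℝ),
          (∀ n, ∀ᵐ ω ∂P, ∀ t : Set.Icc (0 : ℝ) τ,
            Y n ω t = S.fluctuation (HierBranching.norming M c (HierBranching.timeSeq M c n))
              (HierBranching.timeSeq M c n) φ t ω) ∧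
          ∀ (Ω' : Type*) [MeasurableSpace Ω'] (P' : Measure Ω') [IsProbabilityMeasure P']
            (ζ : ℝ≥0 → Ω' → ℝ) (hζ : ∀ ω, Continuous (fun t => ζ t ω)),
            HierBranching.IsOsfBm (HierBranching.aConst M c) (HierBranching.bConst M c)
              (HierBranching.hurst M c) ζ P' →
            TendstoInDistribution Y atTop
              (fun ω => (HierBranching.KConst M c V lam * ∑' x, φ x) •
                HierBranching.restrictPath (fun t => ζ t ω) (hζ ω) τ)
              (fun _ => P) P' := by
  have : NeZero M := ⟨by omega⟩
  have hcM' := HierBranching.lt_of_lt_sqrt hM hcM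
  have hγ := HierBranching.degree_pos hM hc hcM
  have hγ1 := HierBranching.degree_lt_one hM hc hcM
  have hK : 0 < HierBranching.KConst M c V lam := by
    have hM1 : (1:ℝ) < M := by exact_mod_cast hM
    have hb := HierBranching.bConst_pos hM hcM'
    have hlam' : (0:ℝ) < lam := hlam
    rw [HierBranching.KConst, Real.sqrt_pos]
    have : 0 < (M:ℝ) - 1 := by linarith
    positivity
  refine ⟨⟨hγ, hγ1, by unfold HierBranching.hurst; linarith, by unfold HierBranching.hurst; linarith, hK⟩,
    S.exists_isOsfBm hM hc hcM hV hK, fun t ht => S.ae_N_ne_top hM hc.le hcM' hV ht, fun φ hφ => ?_⟩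
  obtain ⟨B, hB⟩ := hφ.exists_finset
  have hocc := S.ae_occTime_ne_top hM hc.le hcM' hV
  refine ⟨fun t ht => S.integrable_pairing hM hc.le hcM' hV hB ht, ?_, fun τ hτ => ?_⟩
  · filter_upwards [hocc] with ω h t ht
    exact (S.intervalIntegrable_pairing hM hc.le hcM' hV hB h ht).1
  -- Restriction to [0, τ] is composition with this inclusion, a continuous map of path spaces, so
  -- convergence on the half line passes to C([0, τ]).
  let ι : C(Set.Icc (0 : ℝ) τ, ℝ≥0) := ⟨fun t => ⟨(t : ℝ), t.2.1⟩, by fun_prop⟩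
  have hι : Continuous fun f : C(ℝ≥0, ℝ) => f.comp ι := ContinuousMap.continuous_precomp ι
  refine ⟨fun n ω => (S.occPath B φ n ω).comp ι, fun n => ?_, fun Ω' _ P' _ ζ hζ h => ?_⟩
  · filter_upwards [hocc] with ω h t
    rw [S.fluctuation_eq hM hc.le hcM' hV hB h _ (HierBranching.timeSeq_pos (by linarith) n).le t.2.1]
    exact S.occPath_apply (by linarith) B φ n h (ι t)
  · rw [tsum_eq_sum (s := B) hB]
    exact (S.tendstoInDistribution_occPath hM hc hcM hV B φ hζ h).continuous_comp hι
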